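/- Consider the equations $$u_t-u_{xx}+f^1(u)\,u_y=f^2(u),\qquad u=u(t,x,y),\qquad(\ast)$$ where $f^1,f^2$ are smooth functions on a nonempty open interval $I\subseteq\mathbb R$ and $f^1$ is not constant on $I$. For a connected nonempty open set $B\subseteq\mathbb R^3$ of points $(t,x,y)$, let $A^{\max}$ be the space of all smooth vector fields $\xi^0\partial_t+\xi^1\partial_x+\xi^2\partial_y+\eta\partial_u$ on $B\times I$ that satisfy Lie's infinitesimal invariance criterion for $(\ast)$, and let $A^{\ker}=\langle\partial_t,\partial_x,\partial_y\rangle$. Let $G^{\rm equiv}$ be the group of the transformations $$\bar t=a_1^2t+a_2,\quad \bar x=a_1x+a_3,\quad \bar y=a_4y+a_5t+a_6,\quad \bar u=a_7u+a_8,\qquad a_1a_4a_7\neq0,$$ under which $\bar f^1(\bar u)=\frac{a_4}{a_1^2}f^1(u)+\frac{a_5}{a_1^2}$ and $\bar f^2(\bar u)=\frac{a_7}{a_1^2}f^2(u)$. Below $\varepsilon=\pm1$ and $\delta\in\{-1,0,1\}$; $m,n$ are real; $\ln u$ is considered for $u>0$, and the powers $u^m$, $u^n$ occurring in an equation are considered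 for $u>0$, or on any interval if their exponents are natural numbers. The additional equivalence transformations are the following (with $\bar t=t$, $\bar x=x$ in 1)–5)); each takes the equation with the first pair $(f^1,f^2)$ to the equation with the second pair: 1) $(e^u,\ \varepsilon e^u+\delta)\to(e^u,\ \delta)$: $\bar y=-\varepsilon e^{-\varepsilon y}$, $\bar u=u-\varepsilon y$; 2) $(\ln u,\ \varepsilon u)\to(\ln u,\ 0)$: $\bar y=y-\frac{\varepsilon}{2}t^2$, $\bar u=e^{-\varepsilon t}u$; 3) $(u^m,\ \varepsilon u^{m+1}+\delta u)\to(u^m,\ \delta u)$, $m\ne0,1$: $\bar y=-\frac{\varepsilon}{m}e^{-\varepsilon my}$, $\bar u=e^{-\varepsilon y}u$; 4) $(u,\ \varepsilon)\to(u,\ 0)$: $\bar y=y-\frac{\varepsilon}{2}t^2$, $\bar u=u-\varepsilon t$; 5) $(u,\ u^2)\to(u,\ 0)$: $\bar y=-e^{-y}$, $\bar u=e^{-y}u$; 6) $(u,\ u^2-1)\to(u,\ u)$: $\bar t=2t$, $\bar x=\sqrt2\,x$, $\bar y=-2e^{t-y}$, $\bar u=e^{t-y}u-e^{t-y}$. The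 14 canonical forms, each with generators supplementing $\partial_t,\partial_x,\partial_y$, are, with $D=t\partial_t+\frac12x\partial_x+y\partial_y$: 1. $f^1$ not equivalent under $G^{\rm equiv}$ to any of $e^u$, $\ln u$, $u^k$ $(k\neq0)$, and $f^2=0$: $D$; 2. $e^u,\ \varepsilon e^{mu}$, $m\ne0,1$: $t\partial_t+\frac12x\partial_x+\frac{m-1}{m}y\partial_y-\frac1m\partial_u$; 3. $e^u,\ \varepsilon$: $y\partial_y+\partial_u$; 4. $e^u,\ 0$: $D$, $\ y\partial_y+\partial_u$; 5. $\ln u,\ \varepsilon u^m$, $m\ne1$: $t\partial_t+\frac12x\partial_x+\bigl(y-\frac{t}{m-1}\bigr)\partial_y-\frac{u}{m-1}\partial_u$; 6. $\ln u,\ \varepsilon u\ln u$: $e^{\varepsilon t}(\partial_y+\varepsilon u\partial_u)$; 7. $\ln u,\ 0$: $D$, $\ t\partial_y+u\partial_u$; 8. $u^m,\ \varepsilon u^n$, $m\ne0,1$, $n\ne m+1$: $(n-1)t\partial_t+\frac12(n-1)x\partial_x+(n-m-1)y\partial_y-u\partial_u$; 9. $u^m,\ 0$, $m\ne0,1$: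 $D$, $\ y\partial_y+\frac1mu\partial_u$; 10. $u,\ \varepsilon e^u$: $t\partial_t+\frac12x\partial_x+(y-t)\partial_y-\partial_u$; 11. $u,\ \varepsilon u^m$, $m\ne0,1,2$: $t\partial_t+\frac12x\partial_x+\frac{m-2}{m-1}y\partial_y-\frac{u}{m-1}\partial_u$; 12. $u,\ u^2+1$: $e^y(\sin t\,\partial_y+(\cos t+u\sin t)\partial_u)$, $\ e^y(\cos t\,\partial_y-(\sin t-u\cos t)\partial_u)$; 13. $u,\ \varepsilon u$: $y\partial_y+u\partial_u$, $\ e^{\varepsilon t}(\partial_y+\varepsilon\partial_u)$; 14. $u,\ 0$: $D$, $\ t\partial_y+\partial_u$, $\ y\partial_y+u\partial_u$. Then: (a) Every equation $(\ast)$ for which $A^{\max}$, over some connected nonempty open $B$, is strictly larger than $A^{\ker}$ is transformed by an element of $G^{\rm equiv}$, followed if necessary by one of the additional equivalence transformations 1)–6), into an equation of one of the 14 canonical forms. (b) For every equation of a canonical form, and over every connected nonempty open $B$, the algebra $A^{\max}$ is spanned by $\partial_t,\partial_x,\partial_y$ and the generators listed with that form. (c) Equations of two different canonical forms $i<j$ are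 not equivalent: for no nonempty open $B\subseteq\mathbb R^3$ is there a point transformation (a diffeomorphism in the variables $t,x,y,u$) defined on $B\times I$, $I$ being the interval of the first equation, that transforms the equation of form $i$ into that of form $j$. In particular $f^1=u$, $f^2=u^2+1$ is not equivalent to $f^1=u$, $f^2=\pm u$. (The intervals of the two equations are arbitrary, so for forms 2–14 this excludes local equivalence.) -/

import Mathlib

open Set Filter Topology
open scoped ContDiff

namespace Kolmogorov

/-- The space of independent variables `(t, x, y)`. -/
abbrev Base : Type := ℝ × ℝ × ℝ

/-- The space of all variables, with points `((t, x, y), u)`. -/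
abbrev Total : Type := Base × ℝ

/-- A map of the total space given by its four components as functions of `t, x, y, u`. -/
def ofCoords (a b c d : ℝ → ℝ → ℝ → ℝ → ℝ) : Total → Total := fun q =>
  ((a q.1.1 q.1.2.1 q.1.2.2 q.2, b q.1.1 q.1.2.1 q.1.2.2 q.2, c q.1.1 q.1.2.1 q.1.2.2 q.2),
    d q.1.1 q.1.2.1 q.1.2.2 q.2)

/-- An equation `u_t - u_xx + f₁(u) u_y = f₂(u)` of the class: `f₁` and `f₂` are smooth on a nonempty
open interval `dom` (the range of values of `u` that is considered), and `f₁` is not constant there.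
The values of `f₁` and `f₂` outside `dom` play no role. -/
structure Equation where
  dom : Set ℝ
  f₁ : ℝ → ℝ
  f₂ : ℝ → ℝ
  isOpen_dom : IsOpen dom
  ordConnected_dom : dom.OrdConnected
  nonempty_dom : dom.Nonempty
  smooth_f₁ : ContDiffOn ℝ ∞ f₁ dom
  smooth_f₂ : ContDiffOn ℝ ∞ f₂ dom
  nonconst_f₁ : ∃ a ∈ dom, ∃ b ∈ dom, f₁ a ≠ f₁ b

/-! ### Partial derivatives and the equation -/

/-- `∂w/∂t`. -/
noncomputable def Dt (w : Base → ℝ) (p : Base) : ℝ := fderiv ℝ w p (1, 0, 0)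

/-- `∂w/∂x`. -/
noncomputable def Dx (w : Base → ℝ) (p : Base) : ℝ := fderiv ℝ w p (0, 1, 0)

/-- `∂w/∂y`. -/
noncomputable def Dy (w : Base → ℝ) (p : Base) : ℝ := fderiv ℝ w p (0, 0, 1)

/-- The function `u` satisfies the equation at the point `p = (t, x, y)`. -/
def Equation.HoldsAt (E : Equation) (u : Base → ℝ) (p : Base) : Prop :=
  Dt u p - Dx (Dx u) p + E.f₁ (u p) * Dy u p = E.f₂ (u p)

/-! ### Infinitesimal symmetries

A vector field `ξ⁰∂_t + ξ¹∂_x + ξ²∂_y + η∂_u` is a map `v : Total → Total` with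
`v = ((ξ⁰, ξ¹, ξ²), η)`. The total derivatives that occur in the prolongation formulas are computed as
ordinary derivatives along the graph of a function `φ`. -/

/-- `ξ⁰` along the graph of `φ`. -/
def xi0 (v : Total → Total) (φ : Base → ℝ) (q : Base) : ℝ := (v (q, φ q)).1.1

/-- `ξ¹` along the graph of `φ`. -/
def xi1 (v : Total → Total) (φ : Base → ℝ) (q : Base) : ℝ := (v (q, φ q)).1.2.1

/-- `ξ²` along the graph of `φ`. -/
def xi2 (v : Total → Total) (φ : Base → ℝ) (q : Base) : ℝ := (v (q, φ q)).1.2.2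

/-- `η` along the graph of `φ`. -/
def eta (v : Total → Total) (φ : Base → ℝ) (q : Base) : ℝ := (v (q, φ q)).2

/-- The coefficient `ζ^t` of `∂/∂u_t` in the prolonged field. -/
noncomputable def zetaT (v : Total → Total) (φ : Base → ℝ) (q : Base) : ℝ :=
  Dt (eta v φ) q - Dt φ q * Dt (xi0 v φ) q - Dx φ q * Dt (xi1 v φ) q - Dy φ q * Dt (xi2 v φ) q

/-- The coefficient `ζ^x` of `∂/∂u_x` in the prolonged field. -/
noncomputable def zetaX (v : Total → Total) (φ : Base → ℝ) (q : Base) : ℝ :=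
  Dx (eta v φ) q - Dt φ q * Dx (xi0 v φ) q - Dx φ q * Dx (xi1 v φ) q - Dy φ q * Dx (xi2 v φ) q

/-- The coefficient `ζ^y` of `∂/∂u_y` in the prolonged field. -/
noncomputable def zetaY (v : Total → Total) (φ : Base → ℝ) (q : Base) : ℝ :=
  Dy (eta v φ) q - Dt φ q * Dy (xi0 v φ) q - Dx φ q * Dy (xi1 v φ) q - Dy φ q * Dy (xi2 v φ) q

/-- The coefficient `ζ^xx` of `∂/∂u_xx` in the prolonged field. -/
noncomputable def zetaXX (v : Total → Total) (φ : Base → ℝ) (q : Base) : ℝ :=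
  Dx (zetaX v φ) q - Dt (Dx φ) q * Dx (xi0 v φ) q - Dx (Dx φ) q * Dx (xi1 v φ) q
    - Dy (Dx φ) q * Dx (xi2 v φ) q

/-- The second prolongation of `v`, applied to `u_t - u_xx + f₁(u) u_y - f₂(u)` and evaluated at the
2-jet of `φ` at `p`. -/
noncomputable def Equation.prolonged (E : Equation) (v : Total → Total) (φ : Base → ℝ) (p : Base) :
    ℝ :=
  zetaT v φ p - zetaXX v φ p + E.f₁ (φ p) * zetaY v φ p
    + eta v φ p * (deriv E.f₁ (φ p) * Dy φ p - deriv E.f₂ (φ p))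

/-- Lie's criterion: `v` is smooth on `B × dom`, and its second prolongation annihilates the equation
at every 2-jet over `B × dom` that satisfies the equation. The fields with this property form the
maximal invariance algebra `A^max` of the equation over `B`. -/
def Equation.IsSymmetry (E : Equation) (B : Set Base) (v : Total → Total) : Prop :=
  ContDiffOn ℝ ∞ v (B ×ˢ E.dom) ∧
    ∀ φ : Base → ℝ, ContDiff ℝ ∞ φ → ∀ p ∈ B, φ p ∈ E.dom → E.HoldsAt φ p → E.prolonged v φ p = 0

/-- On the set `D`, the field `v` coincides with a linear combination, with constant coefficients, of
the fields in `S`. -/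
def SpannedOn (S : Set (Total → Total)) (D : Set Total) (v : Total → Total) : Prop :=
  ∃ w ∈ Submodule.span ℝ S, EqOn v w D

/-- The generators `∂_t, ∂_x, ∂_y` of the kernel algebra `A^ker`. -/
def kernelFields : Set (Total → Total) :=
  {ofCoords (fun _ _ _ _ => 1) (fun _ _ _ _ => 0) (fun _ _ _ _ => 0) (fun _ _ _ _ => 0),
    ofCoords (fun _ _ _ _ => 0) (fun _ _ _ _ => 1) (fun _ _ _ _ => 0) (fun _ _ _ _ => 0),
    ofCoords (fun _ _ _ _ => 0) (fun _ _ _ _ => 0) (fun _ _ _ _ => 1) (fun _ _ _ _ => 0)}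

/-- The equation admits, over `B`, an invariance algebra larger than `A^ker`. -/
def Equation.HasExtension (E : Equation) (B : Set Base) : Prop :=
  ∃ v, E.IsSymmetry B v ∧ ¬ SpannedOn kernelFields (B ×ˢ E.dom) v

/-! ### Point transformations -/

/-- The point transformation `Φ`, defined on `B × E.dom`, transforms `E` into `E'`: it is a
diffeomorphism of `B × E.dom` onto its image, the image lies over `E'.dom`, and whenever `Φ` takes the
graph of a function `u` near a point to the graph of a function `w`, then `u` satisfies `E` at this
point if and only if `w` satisfies `E'` at the corresponding point. -/
def Transforms (Φ : Total → Total) (B : Set Base) (E E' : Equation) : Prop :=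
  ContDiffOn ℝ ∞ Φ (B ×ˢ E.dom) ∧ InjOn Φ (B ×ˢ E.dom) ∧
    (∀ q ∈ B ×ˢ E.dom, (fderiv ℝ Φ q).det ≠ 0) ∧ (∀ q ∈ B ×ˢ E.dom, (Φ q).2 ∈ E'.dom) ∧
    ∀ (u w : Base → ℝ) (p : Base), p ∈ B → u p ∈ E.dom → ContDiffAt ℝ ∞ u p →
      ContDiffAt ℝ ∞ w (Φ (p, u p)).1 → (∀ᶠ q in 𝓝 p, w (Φ (q, u q)).1 = (Φ (q, u q)).2) →
      (E.HoldsAt u p ↔ E'.HoldsAt w (Φ (p, u p)).1)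

/-- An element of the group `G^equiv`. -/
structure EquivTransf where
  (a₁ a₂ a₃ a₄ a₅ a₆ a₇ a₈ : ℝ)
  a₁_ne : a₁ ≠ 0
  a₄_ne : a₄ ≠ 0
  a₇_ne : a₇ ≠ 0

/-- The action on the variables. -/
def EquivTransf.map (g : EquivTransf) : Total → Total :=
  ofCoords (fun t _ _ _ => g.a₁ ^ 2 * t + g.a₂) (fun _ x _ _ => g.a₁ * x + g.a₃)
    (fun t _ y _ => g.a₄ * y + g.a₅ * t + g.a₆) (fun _ _ _ u => g.a₇ * u + g.a₈)

/-- The action on the arbitrary elements: `g` takes the pair `(f₁, f₂)` of `E` to that of `E'`. -/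
def EquivTransf.Takes (g : EquivTransf) (E E' : Equation) : Prop :=
  E'.dom = (fun u => g.a₇ * u + g.a₈) '' E.dom ∧
    ∀ u ∈ E.dom, E'.f₁ (g.a₇ * u + g.a₈) = g.a₄ / g.a₁ ^ 2 * E.f₁ u + g.a₅ / g.a₁ ^ 2 ∧
      E'.f₂ (g.a₇ * u + g.a₈) = g.a₇ / g.a₁ ^ 2 * E.f₂ u

/-- The power `u ^ m` is used for `u > 0`, or on any interval if `m` is a natural number. -/
def PowerDomain (I : Set ℝ) (m : ℝ) : Prop := I ⊆ Ioi 0 ∨ ∃ k : ℕ, m = k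

/-- `ε = ±1`. -/
def IsSign (ε : ℝ) : Prop := ε = 1 ∨ ε = -1

/-- `ε ∈ {-1, 0, 1}`. -/
def IsSignOrZero (ε : ℝ) : Prop := ε = 1 ∨ ε = -1 ∨ ε = 0

/-- The function `f₁` of the equation is `e^u`, `ln u`, or `u ^ m` with `m ≠ 0`. -/
def Equation.IsSpecial (E : Equation) : Prop :=
  EqOn E.f₁ Real.exp E.dom ∨ (E.dom ⊆ Ioi 0 ∧ EqOn E.f₁ Real.log E.dom) ∨
    ∃ m : ℝ, m ≠ 0 ∧ PowerDomain E.dom m ∧ EqOn E.f₁ (fun u => u ^ m) E.dom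

/-- The function `f₁` is not equivalent under `G^equiv` to any of `e^u`, `ln u`, `u ^ m`. -/
def Equation.IsGeneric (E : Equation) : Prop :=
  ¬ ∃ (g : EquivTransf) (E' : Equation), g.Takes E E' ∧ E'.IsSpecial

/-! ### The additional equivalence transformations -/

/-- `Additional Ψ E E'`: the point transformation `Ψ` is one of the six additional equivalence
transformations, listed for the source equation `E` and the target equation `E'`. -/
inductive Additional : (Total → Total) → Equation → Equation → Prop
  | exp (ε δ : ℝ) (E E' : Equation) (hε : IsSign ε) (hδ : IsSignOrZero δ)
      (h₁ : EqOn E.f₁ Real.exp E.dom) (h₂ : EqOn E.f₂ (fun u => ε * Real.exp u + δ) E.dom)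
      (h₁' : EqOn E'.f₁ Real.exp E'.dom) (h₂' : EqOn E'.f₂ (fun _ => δ) E'.dom) :
      Additional (ofCoords (fun t _ _ _ => t) (fun _ x _ _ => x)
        (fun _ _ y _ => -ε * Real.exp (-ε * y)) (fun _ _ y u => u - ε * y)) E E'
  | log (ε : ℝ) (E E' : Equation) (hε : IsSign ε) (hd : E.dom ⊆ Ioi 0) (hd' : E'.dom ⊆ Ioi 0)
      (h₁ : EqOn E.f₁ Real.log E.dom) (h₂ : EqOn E.f₂ (fun u => ε * u) E.dom)
      (h₁' : EqOn E'.f₁ Real.log E'.dom) (h₂' : EqOn E'.f₂ (fun _ => 0) E'.dom) :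
      Additional (ofCoords (fun t _ _ _ => t) (fun _ x _ _ => x)
        (fun t _ y _ => y - ε / 2 * t ^ 2) (fun t _ _ u => Real.exp (-ε * t) * u)) E E'
  | pow (m ε δ : ℝ) (E E' : Equation) (hm₀ : m ≠ 0) (hm₁ : m ≠ 1) (hε : IsSign ε)
      (hδ : IsSignOrZero δ) (hd : PowerDomain E.dom m) (hd' : PowerDomain E'.dom m)
      (h₁ : EqOn E.f₁ (fun u => u ^ m) E.dom)
      (h₂ : EqOn E.f₂ (fun u => ε * u ^ (m + 1) + δ * u) E.dom)
      (h₁' : EqOn E'.f₁ (fun u => u ^ m) E'.dom) (h₂' : EqOn E'.f₂ (fun u => δ * u) E'.dom) :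
      Additional (ofCoords (fun t _ _ _ => t) (fun _ x _ _ => x)
        (fun _ _ y _ => -(ε / m) * Real.exp (-ε * m * y)) (fun _ _ y u => Real.exp (-ε * y) * u)) E E'
  | const (ε : ℝ) (E E' : Equation) (hε : IsSign ε)
      (h₁ : EqOn E.f₁ (fun u => u) E.dom) (h₂ : EqOn E.f₂ (fun _ => ε) E.dom)
      (h₁' : EqOn E'.f₁ (fun u => u) E'.dom) (h₂' : EqOn E'.f₂ (fun _ => 0) E'.dom) :
      Additional (ofCoords (fun t _ _ _ => t) (fun _ x _ _ => x)
        (fun t _ y _ => y - ε / 2 * t ^ 2) (fun t _ _ u => u - ε * t)) E E'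
  | sq (E E' : Equation)
      (h₁ : EqOn E.f₁ (fun u => u) E.dom) (h₂ : EqOn E.f₂ (fun u => u ^ 2) E.dom)
      (h₁' : EqOn E'.f₁ (fun u => u) E'.dom) (h₂' : EqOn E'.f₂ (fun _ => 0) E'.dom) :
      Additional (ofCoords (fun t _ _ _ => t) (fun _ x _ _ => x)
        (fun _ _ y _ => -Real.exp (-y)) (fun _ _ y u => Real.exp (-y) * u)) E E'
  | sqSubOne (E E' : Equation)
      (h₁ : EqOn E.f₁ (fun u => u) E.dom) (h₂ : EqOn E.f₂ (fun u => u ^ 2 - 1) E.dom)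
      (h₁' : EqOn E'.f₁ (fun u => u) E'.dom) (h₂' : EqOn E'.f₂ (fun u => u) E'.dom) :
      Additional (ofCoords (fun t _ _ _ => 2 * t) (fun _ x _ _ => Real.sqrt 2 * x)
        (fun t _ y _ => -2 * Real.exp (t - y))
        (fun t _ y u => Real.exp (t - y) * u - Real.exp (t - y))) E E'

/-! ### The canonical equations -/

/-- The field `t∂_t + ½x∂_x + y∂_y`. -/
noncomputable def dilation : Total → Total :=
  ofCoords (fun t _ _ _ => t) (fun _ x _ _ => x / 2) (fun _ _ y _ => y) (fun _ _ _ _ => 0)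

/-- `Canonical i E S`: the equation `E` is of the `i`-th canonical form (`1 ≤ i ≤ 14`), and `S` is the
list of the generators of its maximal invariance algebra that supplement `∂_t, ∂_x, ∂_y`. -/
inductive Canonical : ℕ → Equation → Set (Total → Total) → Prop
  | row1 (E : Equation) (h₁ : E.IsGeneric) (h₂ : EqOn E.f₂ (fun _ => 0) E.dom) :
      Canonical 1 E {dilation}
  | row2 (m ε : ℝ) (E : Equation) (hm₀ : m ≠ 0) (hm₁ : m ≠ 1) (hε : IsSign ε)
      (h₁ : EqOn E.f₁ Real.exp E.dom) (h₂ : EqOn E.f₂ (fun u => ε * Real.exp (m * u)) E.dom) :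
      Canonical 2 E {ofCoords (fun t _ _ _ => t) (fun _ x _ _ => x / 2)
        (fun _ _ y _ => (m - 1) / m * y) (fun _ _ _ _ => -(1 / m))}
  | row3 (ε : ℝ) (E : Equation) (hε : IsSign ε)
      (h₁ : EqOn E.f₁ Real.exp E.dom) (h₂ : EqOn E.f₂ (fun _ => ε) E.dom) :
      Canonical 3 E {ofCoords (fun _ _ _ _ => 0) (fun _ _ _ _ => 0)
        (fun _ _ y _ => y) (fun _ _ _ _ => 1)}
  | row4 (E : Equation)
      (h₁ : EqOn E.f₁ Real.exp E.dom) (h₂ : EqOn E.f₂ (fun _ => 0) E.dom) :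
      Canonical 4 E {dilation, ofCoords (fun _ _ _ _ => 0) (fun _ _ _ _ => 0)
        (fun _ _ y _ => y) (fun _ _ _ _ => 1)}
  | row5 (m ε : ℝ) (E : Equation) (hm₁ : m ≠ 1) (hε : IsSign ε) (hd : E.dom ⊆ Ioi 0)
      (h₁ : EqOn E.f₁ Real.log E.dom) (h₂ : EqOn E.f₂ (fun u => ε * u ^ m) E.dom) :
      Canonical 5 E {ofCoords (fun t _ _ _ => t) (fun _ x _ _ => x / 2)
        (fun t _ y _ => y - t / (m - 1)) (fun _ _ _ u => -(u / (m - 1)))}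
  | row6 (ε : ℝ) (E : Equation) (hε : IsSign ε) (hd : E.dom ⊆ Ioi 0)
      (h₁ : EqOn E.f₁ Real.log E.dom) (h₂ : EqOn E.f₂ (fun u => ε * (u * Real.log u)) E.dom) :
      Canonical 6 E {ofCoords (fun _ _ _ _ => 0) (fun _ _ _ _ => 0)
        (fun t _ _ _ => Real.exp (ε * t)) (fun t _ _ u => Real.exp (ε * t) * (ε * u))}
  | row7 (E : Equation) (hd : E.dom ⊆ Ioi 0)
      (h₁ : EqOn E.f₁ Real.log E.dom) (h₂ : EqOn E.f₂ (fun _ => 0) E.dom) :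
      Canonical 7 E {dilation, ofCoords (fun _ _ _ _ => 0) (fun _ _ _ _ => 0)
        (fun t _ _ _ => t) (fun _ _ _ u => u)}
  | row8 (m n ε : ℝ) (E : Equation) (hm₀ : m ≠ 0) (hm₁ : m ≠ 1) (hn : n ≠ m + 1) (hε : IsSign ε)
      (hdm : PowerDomain E.dom m) (hdn : PowerDomain E.dom n)
      (h₁ : EqOn E.f₁ (fun u => u ^ m) E.dom) (h₂ : EqOn E.f₂ (fun u => ε * u ^ n) E.dom) :
      Canonical 8 E {ofCoords (fun t _ _ _ => (n - 1) * t) (fun _ x _ _ => (n - 1) / 2 * x)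
        (fun _ _ y _ => (n - m - 1) * y) (fun _ _ _ u => -u)}
  | row9 (m : ℝ) (E : Equation) (hm₀ : m ≠ 0) (hm₁ : m ≠ 1) (hdm : PowerDomain E.dom m)
      (h₁ : EqOn E.f₁ (fun u => u ^ m) E.dom) (h₂ : EqOn E.f₂ (fun _ => 0) E.dom) :
      Canonical 9 E {dilation, ofCoords (fun _ _ _ _ => 0) (fun _ _ _ _ => 0)
        (fun _ _ y _ => y) (fun _ _ _ u => 1 / m * u)}
  | row10 (ε : ℝ) (E : Equation) (hε : IsSign ε)
      (h₁ : EqOn E.f₁ (fun u => u) E.dom) (h₂ : EqOn E.f₂ (fun u => ε * Real.exp u) E.dom) :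
      Canonical 10 E {ofCoords (fun t _ _ _ => t) (fun _ x _ _ => x / 2)
        (fun t _ y _ => y - t) (fun _ _ _ _ => -1)}
  | row11 (m ε : ℝ) (E : Equation) (hm₀ : m ≠ 0) (hm₁ : m ≠ 1) (hm₂ : m ≠ 2) (hε : IsSign ε)
      (hdm : PowerDomain E.dom m)
      (h₁ : EqOn E.f₁ (fun u => u) E.dom) (h₂ : EqOn E.f₂ (fun u => ε * u ^ m) E.dom) :
      Canonical 11 E {ofCoords (fun t _ _ _ => t) (fun _ x _ _ => x / 2)
        (fun _ _ y _ => (m - 2) / (m - 1) * y) (fun _ _ _ u => -(u / (m - 1)))}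
  | row12 (E : Equation)
      (h₁ : EqOn E.f₁ (fun u => u) E.dom) (h₂ : EqOn E.f₂ (fun u => u ^ 2 + 1) E.dom) :
      Canonical 12 E {
        ofCoords (fun _ _ _ _ => 0) (fun _ _ _ _ => 0) (fun t _ y _ => Real.exp y * Real.sin t)
          (fun t _ y u => Real.exp y * (Real.cos t + u * Real.sin t)),
        ofCoords (fun _ _ _ _ => 0) (fun _ _ _ _ => 0) (fun t _ y _ => Real.exp y * Real.cos t)
          (fun t _ y u => -(Real.exp y * (Real.sin t - u * Real.cos t)))}
  | row13 (ε : ℝ) (E : Equation) (hε : IsSign ε)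
      (h₁ : EqOn E.f₁ (fun u => u) E.dom) (h₂ : EqOn E.f₂ (fun u => ε * u) E.dom) :
      Canonical 13 E {
        ofCoords (fun _ _ _ _ => 0) (fun _ _ _ _ => 0) (fun _ _ y _ => y) (fun _ _ _ u => u),
        ofCoords (fun _ _ _ _ => 0) (fun _ _ _ _ => 0) (fun t _ _ _ => Real.exp (ε * t))
          (fun t _ _ _ => Real.exp (ε * t) * ε)}
  | row14 (E : Equation)
      (h₁ : EqOn E.f₁ (fun u => u) E.dom) (h₂ : EqOn E.f₂ (fun _ => 0) E.dom) :
      Canonical 14 E {dilation,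
        ofCoords (fun _ _ _ _ => 0) (fun _ _ _ _ => 0) (fun t _ _ _ => t) (fun _ _ _ _ => 1),
        ofCoords (fun _ _ _ _ => 0) (fun _ _ _ _ => 0) (fun _ _ y _ => y) (fun _ _ _ u => u)}

end Kolmogorov

namespace Kolmogorov

/-! ### Directional derivatives -/

section Calculus

variable {V : Type*} [NormedAddCommGroup V] [NormedSpace ℝ V]

/-! Everything is reduced to identities between finitely many jet coordinates. Lie's criterion at a
point sees only the 2-jet of the test function, and quadratic polynomials realise every 2-jet. Once
the equation has been solved for u_t, the coordinates u_x, u_y, u_xx, u_tx, u_xy are free, so the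
criterion is a polynomial identity in them and splits into coefficients. The outcome
(`Equation.isSymmetry_iff`) is that a symmetry has the form (ct + c₀)∂_t + (cx/2 + c₂)∂_x +
ψ(t,y)∂_y + (α(t,y)u + β(t,y))∂_u, subject to (A) (c - ψ_y) f₁ - ψ_t + (αu + β) f₁' = 0, (B) α_t u +
β_t + (α - c) f₂ + f₁ (α_y u + β_y) - (αu + β) f₂' = 0.

Reduction to canonical forms. If (α, β) is nonzero at some point, then (A) is a linear first-order
ODE for f₁ with affine leading coefficient, so f₁ is e^u, ln u or a power up to G^equiv
(`Equation.not_isGeneric_of_relation`). For every other f₁ only c can survive, and (B) forces f₂ =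
0. For special f₁, linear independence splits (A) and expresses ψ through α, β and c, and (B)
becomes an ODE for f₂. If α and β are constant, this ODE is homogeneous and gives an exponential or
a power. If they vary, comparing points of the base puts f₂ into a small family: b e^u + C, u(b ln u
+ C), b u^(m+1) + C u, or, for f₁ = u, the quadratic polynomials (`exists_quadratic_of_relations`).
Scalings and shifts from G^equiv, and then the additional transformations, normalise the remaining
constants.

The maximal algebras come from the same splitting with f₂ explicit, after which the resulting system
for ψ, α, β is integrated.

Inequivalence. A point transformation is tested on images of graphs. The source equation does not
contain u_tt and u_yy, so these can be varied freely. This forces the transformation to carry the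
direction ∂_x̄ back to ∂_x (`Transforms.graphFirst_ex_eq_zero`), and further splitting makes it
affine in u (`Transforms.exists_affineLink`), with analogues of (A) and (B). The analogue of (A) is
an affine substitution in f₁, so f₁''/f₁' transforms in a controlled way and the kind of f₁ is an
invariant (`AffineLink.shape`, `AffineLink.same_kind`). Within one kind, the analogue of (B)
together with equality of mixed derivatives rules out the match of f₂. For u² + 1 against a linear
f₂ the obstruction is the sign of a discriminant (`AffineLink.id_quadratic_linear_discr`). -/

theorem eventually_differentiableAt {F : V → ℝ} {z : V} (hF : ContDiffAt ℝ ∞ F z) :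
    ∀ᶠ y in 𝓝 z, DifferentiableAt ℝ F y := by
  have h1 : ContDiffAt ℝ 1 F z := hF.of_le (by exact_mod_cast le_top)
  filter_upwards [h1.eventually (by simp)] with y hy
  exact hy.differentiableAt (by simp)

theorem smooth_fderiv_apply {F : V → ℝ} {z : V} (hF : ContDiffAt ℝ ∞ F z) (a : V) :
    ContDiffAt ℝ ∞ (fun y => fderiv ℝ F y a) z :=
  (hF.fderiv_right (m := ∞) (by simp)).clm_apply contDiffAt_const

theorem _root_.ContDiffAt.diff {F : V → ℝ} {z : V} (hF : ContDiffAt ℝ ∞ F z) : DifferentiableAt ℝ F z :=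
  hF.differentiableAt (by simp)

theorem fderiv_fderiv_comm {F : V → ℝ} {z : V} (hF : ContDiffAt ℝ ∞ F z) (a b : V) :
    fderiv ℝ (fun y => fderiv ℝ F y a) z b = fderiv ℝ (fun y => fderiv ℝ F y b) z a := by
  have hd : DifferentiableAt ℝ (fderiv ℝ F) z :=
    (hF.fderiv_right (m := ∞) (by simp)).differentiableAt (by simp)
  have key : ∀ c, fderiv ℝ (fun y => fderiv ℝ F y c) z = (fderiv ℝ (fderiv ℝ F) z).flip c := by
    intro c
    rw [fderiv_clm_apply hd (differentiableAt_const c)]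
    simp
  rw [key, key]
  have h2 : (2 : WithTop ℕ∞) ≤ ∞ := WithTop.coe_le_coe.2 (le_top : (2 : ℕ∞) ≤ ⊤)
  have := hF.isSymmSndFDerivAt (by simpa using h2)
  exact this b a

theorem smoothOn_fderiv_apply {F : V → ℝ} {s : Set V} (hs : IsOpen s) (hF : ContDiffOn ℝ ∞ F s)
    (a : V) : ContDiffOn ℝ ∞ (fun y => fderiv ℝ F y a) s := fun _ hz =>
  (smooth_fderiv_apply (hF.contDiffAt (hs.mem_nhds hz)) a).contDiffWithinAt

theorem fderiv_eq_zero_of_eqOn {F : V → ℝ} {s : Set V} (hs : IsOpen s) {c : ℝ}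
    (h : ∀ y ∈ s, F y = c)
    {z : V} (hz : z ∈ s) : fderiv ℝ F z = 0 := by
  have : F =ᶠ[𝓝 z] fun _ => c := by
    filter_upwards [hs.mem_nhds hz] with y hy using h y hy
  rw [this.fderiv_eq]
  simp

end Calculus

theorem fderiv_base (w : Base → ℝ) (p : Base) (a b c : ℝ) :
    fderiv ℝ w p (a, b, c) = a * Dt w p + b * Dx w p + c * Dy w p := by
  have : ((a, b, c) : Base) = a • (1, 0, 0) + b • (0, 1, 0) + c • (0, 0, 1) := by simp
  rw [this, map_add, map_add, map_smul, map_smul, map_smul]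
  simp [Dt, Dx, Dy]

theorem fderiv_base' (w : Base → ℝ) (p a : Base) :
    fderiv ℝ w p a = a.1 * Dt w p + a.2.1 * Dx w p + a.2.2 * Dy w p :=
  fderiv_base w p a.1 a.2.1 a.2.2

/-- The derivative of a function on the total space in a direction of the base. -/
noncomputable def dB (a : Base) (h : Total → ℝ) (z : Total) : ℝ := fderiv ℝ h z (a, 0)

/-- The derivative of a function on the total space in the direction of `u`. -/
noncomputable def dU (h : Total → ℝ) (z : Total) : ℝ := fderiv ℝ h z (0, 1)

theorem fderiv_total (h : Total → ℝ) (z : Total) (a : Base) (s : ℝ) :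
    fderiv ℝ h z (a, s) = dB a h z + s * dU h z := by
  have : ((a, s) : Total) = (a, 0) + s • (0, 1) := by simp
  rw [this, map_add, map_smul]
  simp [dB, dU]

theorem dB_base (h : Total → ℝ) (z : Total) (a b c : ℝ) :
    dB (a, b, c) h z = a * dB (1, 0, 0) h z + b * dB (0, 1, 0) h z + c * dB (0, 0, 1) h z := by
  have : (((a, b, c), 0) : Total)
      = a • ((1, 0, 0), 0) + b • ((0, 1, 0), 0) + c • ((0, 0, 1), 0) := by simp
  unfold dB
  rw [this, map_add, map_add, map_smul, map_smul, map_smul]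
  simp

theorem smooth_dB {h : Total → ℝ} {z : Total} (hh : ContDiffAt ℝ ∞ h z) (a : Base) :
    ContDiffAt ℝ ∞ (dB a h) z := smooth_fderiv_apply hh _

theorem smooth_dU {h : Total → ℝ} {z : Total} (hh : ContDiffAt ℝ ∞ h z) :
    ContDiffAt ℝ ∞ (dU h) z := smooth_fderiv_apply hh _

theorem smoothOn_dU {h : Total → ℝ} {s : Set Total} (hs : IsOpen s) (hh : ContDiffOn ℝ ∞ h s) :
    ContDiffOn ℝ ∞ (dU h) s := smoothOn_fderiv_apply hs hh _

theorem dU_dB {h : Total → ℝ} {z : Total} (hh : ContDiffAt ℝ ∞ h z) (a : Base) :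
    dU (dB a h) z = dB a (dU h) z := fderiv_fderiv_comm hh _ _

theorem smooth_graph {h : Total → ℝ} {φ : Base → ℝ} {p : Base}
    (hh : ContDiffAt ℝ ∞ h (p, φ p)) (hφ : ContDiffAt ℝ ∞ φ p) :
    ContDiffAt ℝ ∞ (fun q => h (q, φ q)) p :=
  ContDiffAt.comp p (f := fun q => (q, φ q)) hh (contDiffAt_id.prodMk hφ)

theorem fderiv_graph {h : Total → ℝ} {φ : Base → ℝ} {p : Base}
    (hh : DifferentiableAt ℝ h (p, φ p)) (hφ : DifferentiableAt ℝ φ p) (a : Base) :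
    fderiv ℝ (fun q => h (q, φ q)) p a
      = dB a h (p, φ p) + fderiv ℝ φ p a * dU h (p, φ p) := by
  have h1 : HasFDerivAt (fun q => (q, φ q)) ((ContinuousLinearMap.id ℝ Base).prod (fderiv ℝ φ p)) p :=
    (hasFDerivAt_id p).prodMk hφ.hasFDerivAt
  have h2 := HasFDerivAt.comp p (f := fun q => (q, φ q)) hh.hasFDerivAt h1
  have h3 : fderiv ℝ (fun q => h (q, φ q)) p = _ := h2.fderiv
  rw [h3]
  exact fderiv_total h (p, φ p) a (fderiv ℝ φ p a)

theorem tendsto_graph {φ : Base → ℝ} {p : Base} (hφ : ContinuousAt φ p) :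
    Tendsto (fun q => ((q, φ q) : Total)) (𝓝 p) (𝓝 (p, φ p)) :=
  (continuousAt_id.prodMk hφ)

theorem fderiv_graph_eventually {h : Total → ℝ} {φ : Base → ℝ} {p : Base}
    (hh : ContDiffAt ℝ ∞ h (p, φ p)) (hφ : ContDiffAt ℝ ∞ φ p) (a : Base) :
    (fun q => fderiv ℝ (fun q => h (q, φ q)) q a)
      =ᶠ[𝓝 p] fun q => dB a h (q, φ q) + fderiv ℝ φ q a * dU h (q, φ q) := by
  have h1 := (tendsto_graph hφ.continuousAt).eventually (eventually_differentiableAt hh)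
  filter_upwards [h1, eventually_differentiableAt hφ] with q hq hq'
  exact fderiv_graph hq hq' a

/-- The second derivative along the graph of `φ` in the direction `a`, where `s` and `r` stand for the
first and second derivatives of `φ`. -/
noncomputable def graphSecond (a : Base) (h : Total → ℝ) (z : Total) (s r : ℝ) : ℝ :=
  dB a (dB a h) z + 2 * s * dB a (dU h) z + s ^ 2 * dU (dU h) z + r * dU h z

/-- The chain rule is applied twice; the factor 2 of the cross term in `graphSecond` comes from the
commutation `dU_dB`. -/
theorem fderiv_fderiv_graph {h : Total → ℝ} {φ : Base → ℝ} {p : Base}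
    (hh : ContDiffAt ℝ ∞ h (p, φ p)) (hφ : ContDiffAt ℝ ∞ φ p) (a : Base) :
    fderiv ℝ (fun q => fderiv ℝ (fun q => h (q, φ q)) q a) p a
      = graphSecond a h (p, φ p) (fderiv ℝ φ p a) (fderiv ℝ (fun q => fderiv ℝ φ q a) p a) := by
  rw [(fderiv_graph_eventually hh hφ a).fderiv_eq]
  have h1 := (smooth_graph (smooth_dB hh a) hφ).diff
  have h2 := (smooth_graph (smooth_dU hh) hφ).diff
  have h3 := (smooth_fderiv_apply hφ a).diff
  rw [fderiv_fun_add h1 (h3.fun_mul h2), fderiv_fun_mul h3 h2]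
  simp only [add_apply, smul_apply, smul_eq_mul]
  rw [fderiv_graph (smooth_dB hh a).diff hφ.diff, fderiv_graph (smooth_dU hh).diff hφ.diff, dU_dB hh]
  unfold graphSecond
  ring

/-! ### Functions that are affine in `u` -/

theorem fderiv_affine {α β : Base → ℝ} {p : Base} (hα : DifferentiableAt ℝ α p)
    (hβ : DifferentiableAt ℝ β p) (u s : ℝ) (a : Base) :
    fderiv ℝ (fun z : Total => α z.1 * z.2 + β z.1) (p, u) (a, s)
      = fderiv ℝ α p a * u + fderiv ℝ β p a + s * α p := by
  have h1 : HasFDerivAt (fun z : Total => α z.1) ((fderiv ℝ α p).comp (ContinuousLinearMap.fst ℝ Base ℝ))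
      (p, u) := HasFDerivAt.comp (p, u) (f := Prod.fst) hα.hasFDerivAt hasFDerivAt_fst
  have h2 : HasFDerivAt (fun z : Total => β z.1) ((fderiv ℝ β p).comp (ContinuousLinearMap.fst ℝ Base ℝ))
      (p, u) := HasFDerivAt.comp (p, u) (f := Prod.fst) hβ.hasFDerivAt hasFDerivAt_fst
  have h3 : HasFDerivAt (fun z : Total => z.2) (ContinuousLinearMap.snd ℝ Base ℝ) (p, u) := hasFDerivAt_snd
  have h4 : fderiv ℝ (fun z : Total => α z.1 * z.2 + β z.1) (p, u) = _ := ((h1.mul h3).add h2).fderiv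
  rw [h4]
  simp
  ring

theorem dB_affine {h : Total → ℝ} {B : Set Base} {I : Set ℝ} (hB : IsOpen B) (hI : IsOpen I)
    {α β : Base → ℝ} (hα : ContDiffOn ℝ ∞ α B) (hβ : ContDiffOn ℝ ∞ β B)
    (hh : ∀ p ∈ B, ∀ u ∈ I, h (p, u) = α p * u + β p) (a : Base) :
    ∀ p ∈ B, ∀ u ∈ I, dB a h (p, u) = fderiv ℝ α p a * u + fderiv ℝ β p a := by
  intro p hp u hu
  have : h =ᶠ[𝓝 (p, u)] fun z : Total => α z.1 * z.2 + β z.1 := by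
    filter_upwards [(hB.prod hI).mem_nhds ⟨hp, hu⟩] with z hz using hh z.1 hz.1 z.2 hz.2
  unfold dB
  rw [this.fderiv_eq, fderiv_affine (hα.contDiffAt (hB.mem_nhds hp)).diff
    (hβ.contDiffAt (hB.mem_nhds hp)).diff]
  ring

theorem dU_affine {h : Total → ℝ} {B : Set Base} {I : Set ℝ} (hB : IsOpen B) (hI : IsOpen I)
    {α β : Base → ℝ} (hα : ContDiffOn ℝ ∞ α B) (hβ : ContDiffOn ℝ ∞ β B)
    (hh : ∀ p ∈ B, ∀ u ∈ I, h (p, u) = α p * u + β p) :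
    ∀ p ∈ B, ∀ u ∈ I, dU h (p, u) = α p := by
  intro p hp u hu
  have : h =ᶠ[𝓝 (p, u)] fun z : Total => α z.1 * z.2 + β z.1 := by
    filter_upwards [(hB.prod hI).mem_nhds ⟨hp, hu⟩] with z hz using hh z.1 hz.1 z.2 hz.2
  unfold dU
  rw [this.fderiv_eq, fderiv_affine (hα.contDiffAt (hB.mem_nhds hp)).diff
    (hβ.contDiffAt (hB.mem_nhds hp)).diff]
  simp

theorem graphSecond_affine {h : Total → ℝ} {B : Set Base} {I : Set ℝ} (hB : IsOpen B) (hI : IsOpen I)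
    {α β : Base → ℝ} (hα : ContDiffOn ℝ ∞ α B) (hβ : ContDiffOn ℝ ∞ β B)
    (hh : ∀ p ∈ B, ∀ u ∈ I, h (p, u) = α p * u + β p) (a : Base) (s r : ℝ) :
    ∀ p ∈ B, ∀ u ∈ I, graphSecond a h (p, u) s r
      = fderiv ℝ (fun q => fderiv ℝ α q a) p a * u + fderiv ℝ (fun q => fderiv ℝ β q a) p a
        + 2 * s * fderiv ℝ α p a + r * α p := by
  intro p hp u hu
  have h1 := dB_affine hB hI hα hβ hh a
  have h2 := dU_affine hB hI hα hβ hh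
  have hα' := smoothOn_fderiv_apply hB hα a
  have hβ' := smoothOn_fderiv_apply hB hβ a
  have h3 := dB_affine hB hI hα' hβ' h1 a p hp u hu
  have h2' : ∀ p ∈ B, ∀ u ∈ I, dU h (p, u) = (fun _ => (0 : ℝ)) p * u + α p := by
    intro p hp u hu; rw [h2 p hp u hu]; ring
  have h4 := dB_affine hB hI contDiffOn_const hα h2' a p hp u hu
  have h5 := dU_affine hB hI contDiffOn_const hα h2' p hp u hu
  unfold graphSecond
  rw [h3, h4, h5, h2 p hp u hu]
  simp

/-- A function with `∂h/∂u = 0` does not depend on `u`. -/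
theorem eq_of_dU_eq_zero {h : Total → ℝ} {B : Set Base} {I : Set ℝ} (hB : IsOpen B) (hI : IsOpen I)
    (hI' : I.OrdConnected) (hh : ContDiffOn ℝ ∞ h (B ×ˢ I))
    (h0 : ∀ p ∈ B, ∀ u ∈ I, dU h (p, u) = 0) {p : Base} (hp : p ∈ B) {u u' : ℝ} (hu : u ∈ I)
    (hu' : u' ∈ I) : h (p, u) = h (p, u') := by
  have hd : ∀ s ∈ I, HasDerivAt (fun s => h (p, s)) 0 s := by
    intro s hs
    have h1 : DifferentiableAt ℝ h (p, s) := 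
      (hh.contDiffAt ((hB.prod hI).mem_nhds (x := (p, s)) ⟨hp, hs⟩)).diff
    have h2 : HasDerivAt (fun s : ℝ => ((p, s) : Total)) (0, 1) s :=
      (hasDerivAt_const s p).prodMk (hasDerivAt_id s)
    have h3 := h1.hasFDerivAt.comp_hasDerivAt s h2
    have h4 : fderiv ℝ h (p, s) (0, 1) = 0 := h0 p hp s hs
    rw [h4] at h3
    exact h3
  have hc : IsPreconnected I := hI'.isPreconnected
  obtain ⟨c, hc⟩ := hI.exists_is_const_of_deriv_eq_zero hc
    (fun s hs => (hd s hs).differentiableAt.differentiableWithinAt) (fun s hs => (hd s hs).deriv)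
  rw [hc u hu, hc u' hu']

/-- A function on a connected open set is constant if its gradient vanishes. -/
theorem exists_eq_const {B : Set Base} (hB : IsOpen B) (hB' : IsPreconnected B) {f : Base → ℝ}
    (hf : ContDiffOn ℝ ∞ f B) (ht : ∀ p ∈ B, Dt f p = 0) (hx : ∀ p ∈ B, Dx f p = 0)
    (hy : ∀ p ∈ B, Dy f p = 0) : ∃ c, ∀ p ∈ B, f p = c := by
  refine hB.exists_is_const_of_fderiv_eq_zero hB' (hf.differentiableOn (by simp)) fun p hp => ?_
  refine ContinuousLinearMap.ext fun a => ?_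
  rw [fderiv_base', ht p hp, hx p hp, hy p hp]
  simp

/-! ### Polynomials with a prescribed 2-jet -/

/-- The quadratic polynomial on the base with a prescribed 2-jet at `p`. -/
noncomputable def quadPoly (p : Base) (u₀ st sx sy tt xx yy tx xy ty : ℝ) (q : Base) : ℝ :=
  u₀ + st * (q.1 - p.1) + sx * (q.2.1 - p.2.1) + sy * (q.2.2 - p.2.2)
    + tt / 2 * (q.1 - p.1) ^ 2 + xx / 2 * (q.2.1 - p.2.1) ^ 2 + yy / 2 * (q.2.2 - p.2.2) ^ 2
    + tx * ((q.1 - p.1) * (q.2.1 - p.2.1)) + xy * ((q.2.1 - p.2.1) * (q.2.2 - p.2.2))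
    + ty * ((q.1 - p.1) * (q.2.2 - p.2.2))

theorem contDiff_quadPoly (p : Base) (u₀ st sx sy tt xx yy tx xy ty : ℝ) :
    ContDiff ℝ ∞ (quadPoly p u₀ st sx sy tt xx yy tx xy ty) := by
  unfold quadPoly
  fun_prop

theorem fderiv_quadPoly (p : Base) (u₀ st sx sy tt xx yy tx xy ty : ℝ) (q a : Base) :
    fderiv ℝ (quadPoly p u₀ st sx sy tt xx yy tx xy ty) q a
      = quadPoly p (st * a.1 + sx * a.2.1 + sy * a.2.2)
        (tt * a.1 + tx * a.2.1 + ty * a.2.2) (tx * a.1 + xx * a.2.1 + xy * a.2.2)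
        (ty * a.1 + xy * a.2.1 + yy * a.2.2) 0 0 0 0 0 0 q := by
  have h1 : HasFDerivAt (fun q : Base => q.1 - p.1) (ContinuousLinearMap.fst ℝ ℝ (ℝ × ℝ)) q :=
    hasFDerivAt_fst.sub_const _
  have h2 : HasFDerivAt (fun q : Base => q.2.1 - p.2.1)
      ((ContinuousLinearMap.fst ℝ ℝ ℝ).comp (ContinuousLinearMap.snd ℝ ℝ (ℝ × ℝ))) q :=
    (HasFDerivAt.comp q (f := Prod.snd) hasFDerivAt_fst hasFDerivAt_snd).sub_const _
  have h3 : HasFDerivAt (fun q : Base => q.2.2 - p.2.2)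
      ((ContinuousLinearMap.snd ℝ ℝ ℝ).comp (ContinuousLinearMap.snd ℝ ℝ (ℝ × ℝ))) q :=
    (HasFDerivAt.comp q (f := Prod.snd) hasFDerivAt_snd hasFDerivAt_snd).sub_const _
  have h := (((((((((hasFDerivAt_const u₀ q).add (h1.const_mul st)).add (h2.const_mul sx)).add
    (h3.const_mul sy)).add ((h1.pow 2).const_mul (tt / 2))).add
    ((h2.pow 2).const_mul (xx / 2))).add ((h3.pow 2).const_mul (yy / 2))).add
    ((h1.mul h2).const_mul tx)).add ((h2.mul h3).const_mul xy)).add ((h1.mul h3).const_mul ty)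
  have h' : fderiv ℝ (quadPoly p u₀ st sx sy tt xx yy tx xy ty) q = _ := h.fderiv
  rw [h']
  simp [quadPoly]
  ring

theorem quadPoly_self (p : Base) (u₀ st sx sy tt xx yy tx xy ty : ℝ) :
    quadPoly p u₀ st sx sy tt xx yy tx xy ty p = u₀ := by
  simp [quadPoly]

theorem fderiv_fderiv_quadPoly (p : Base) (u₀ st sx sy tt xx yy tx xy ty : ℝ) (a b : Base) :
    fderiv ℝ (fun q => fderiv ℝ (quadPoly p u₀ st sx sy tt xx yy tx xy ty) q a) p b
      = (tt * a.1 + tx * a.2.1 + ty * a.2.2) * b.1 + (tx * a.1 + xx * a.2.1 + xy * a.2.2) * b.2.1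
        + (ty * a.1 + xy * a.2.1 + yy * a.2.2) * b.2.2 := by
  have : (fun q => fderiv ℝ (quadPoly p u₀ st sx sy tt xx yy tx xy ty) q a) = _ :=
    funext fun q => fderiv_quadPoly p u₀ st sx sy tt xx yy tx xy ty q a
  rw [this, fderiv_quadPoly, quadPoly_self]

/-! ### The prolongation formula -/

/-- Product rule for D_x ζ^x. Mixed derivatives of φ are put in the order D_t D_x, D_y D_x in which
`zetaXX` subtracts them again, so that these terms add up with a factor 2. -/
theorem Dx_zetaX_aux {η X₀ X₁ X₂ φ : Base → ℝ} {p : Base} (hη : ContDiffAt ℝ ∞ η p)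
    (h₀ : ContDiffAt ℝ ∞ X₀ p) (h₁ : ContDiffAt ℝ ∞ X₁ p) (h₂ : ContDiffAt ℝ ∞ X₂ p)
    (hφ : ContDiffAt ℝ ∞ φ p) :
    Dx (fun q => Dx η q - Dt φ q * Dx X₀ q - Dx φ q * Dx X₁ q - Dy φ q * Dx X₂ q) p
      = Dx (Dx η) p - (Dt (Dx φ) p * Dx X₀ p + Dt φ p * Dx (Dx X₀) p)
        - (Dx (Dx φ) p * Dx X₁ p + Dx φ p * Dx (Dx X₁) p)
        - (Dy (Dx φ) p * Dx X₂ p + Dy φ p * Dx (Dx X₂) p) := by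
  have e0 : DifferentiableAt ℝ (Dx η) p := (smooth_fderiv_apply hη _).diff
  have e1 : DifferentiableAt ℝ (Dx X₀) p := (smooth_fderiv_apply h₀ _).diff
  have e2 : DifferentiableAt ℝ (Dx X₁) p := (smooth_fderiv_apply h₁ _).diff
  have e3 : DifferentiableAt ℝ (Dx X₂) p := (smooth_fderiv_apply h₂ _).diff
  have f1 : DifferentiableAt ℝ (Dt φ) p := (smooth_fderiv_apply hφ _).diff
  have f2 : DifferentiableAt ℝ (Dx φ) p := (smooth_fderiv_apply hφ _).diff
  have f3 : DifferentiableAt ℝ (Dy φ) p := (smooth_fderiv_apply hφ _).diff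
  have c1 : Dt (Dx φ) p = Dx (Dt φ) p := fderiv_fderiv_comm hφ _ _
  have c2 : Dy (Dx φ) p = Dx (Dy φ) p := fderiv_fderiv_comm hφ _ _
  rw [c1, c2]
  have h := ((e0.hasFDerivAt.sub (f1.hasFDerivAt.mul e1.hasFDerivAt)).sub
    (f2.hasFDerivAt.mul e2.hasFDerivAt)).sub (f3.hasFDerivAt.mul e3.hasFDerivAt)
  have h' : fderiv ℝ (fun q => Dx η q - Dt φ q * Dx X₀ q - Dx φ q * Dx X₁ q - Dy φ q * Dx X₂ q) p = _ :=
    h.fderiv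
  change fderiv ℝ (fun q => Dx η q - Dt φ q * Dx X₀ q - Dx φ q * Dx X₁ q - Dy φ q * Dx X₂ q) p _ = _
  rw [h']
  simp only [sub_apply, add_apply, smul_apply, smul_eq_mul]
  change Dx (Dx η) p - (Dt φ p * Dx (Dx X₀) p + Dx X₀ p * Dx (Dt φ) p)
    - (Dx φ p * Dx (Dx X₁) p + Dx X₁ p * Dx (Dx φ) p)
    - (Dy φ p * Dx (Dx X₂) p + Dx X₂ p * Dx (Dy φ) p) = _
  ring

/-- The components of a vector field. -/
def comp0 (v : Total → Total) (z : Total) : ℝ := (v z).1.1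
/-- The components of a vector field. -/
def comp1 (v : Total → Total) (z : Total) : ℝ := (v z).1.2.1
/-- The components of a vector field. -/
def comp2 (v : Total → Total) (z : Total) : ℝ := (v z).1.2.2
/-- The components of a vector field. -/
def comp3 (v : Total → Total) (z : Total) : ℝ := (v z).2

/-- The unit vectors of the base. -/
abbrev et : Base := (1, 0, 0)
/-- The unit vectors of the base. -/
abbrev ex : Base := (0, 1, 0)
/-- The unit vectors of the base. -/
abbrev ey : Base := (0, 0, 1)

theorem smoothAt_comp {v : Total → Total} {z : Total} (hv : ContDiffAt ℝ ∞ v z) :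
    ContDiffAt ℝ ∞ (comp0 v) z ∧ ContDiffAt ℝ ∞ (comp1 v) z ∧ ContDiffAt ℝ ∞ (comp2 v) z ∧
      ContDiffAt ℝ ∞ (comp3 v) z :=
  ⟨hv.fst.fst, hv.fst.snd.fst, hv.fst.snd.snd, hv.snd⟩

theorem smoothOn_comp {v : Total → Total} {s : Set Total} (hv : ContDiffOn ℝ ∞ v s) :
    ContDiffOn ℝ ∞ (comp0 v) s ∧ ContDiffOn ℝ ∞ (comp1 v) s ∧ ContDiffOn ℝ ∞ (comp2 v) s ∧
      ContDiffOn ℝ ∞ (comp3 v) s :=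
  ⟨hv.fst.fst, hv.fst.snd.fst, hv.fst.snd.snd, hv.snd⟩

/-- The derivative along a graph with slope `s` in the direction `a`. -/
noncomputable def graphFirst (a : Base) (h : Total → ℝ) (z : Total) (s : ℝ) : ℝ :=
  dB a h z + s * dU h z

/-- The prolongation depends on φ only through seven jet coordinates. The derivatives u_tt, u_yy and
u_ty do not occur, and u_tx, u_xy occur only multiplied by x-derivatives of ξ⁰ and ξ² along the
graph. -/
theorem prolonged_eq (E : Equation) {v : Total → Total} {φ : Base → ℝ} {p : Base}
    (hv : ContDiffAt ℝ ∞ v (p, φ p)) (hφ : ContDiffAt ℝ ∞ φ p) {u st sx sy xx tx xy : ℝ}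
    (hu : φ p = u) (ht : Dt φ p = st) (hx : Dx φ p = sx) (hy : Dy φ p = sy)
    (hxx : Dx (Dx φ) p = xx) (htx : Dt (Dx φ) p = tx) (hxy : Dy (Dx φ) p = xy) :
    E.prolonged v φ p =
      graphFirst et (comp3 v) (p, u) st - st * graphFirst et (comp0 v) (p, u) st
        - sx * graphFirst et (comp1 v) (p, u) st - sy * graphFirst et (comp2 v) (p, u) st
      - (graphSecond ex (comp3 v) (p, u) sx xx - st * graphSecond ex (comp0 v) (p, u) sx xx
        - sx * graphSecond ex (comp1 v) (p, u) sx xx - sy * graphSecond ex (comp2 v) (p, u) sx xx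
        - 2 * tx * graphFirst ex (comp0 v) (p, u) sx - 2 * xx * graphFirst ex (comp1 v) (p, u) sx
        - 2 * xy * graphFirst ex (comp2 v) (p, u) sx)
      + E.f₁ u * (graphFirst ey (comp3 v) (p, u) sy - st * graphFirst ey (comp0 v) (p, u) sy
        - sx * graphFirst ey (comp1 v) (p, u) sy - sy * graphFirst ey (comp2 v) (p, u) sy)
      + comp3 v (p, u) * (deriv E.f₁ u * sy - deriv E.f₂ u) := by
  obtain ⟨h0, h1, h2, h3⟩ := smoothAt_comp hv
  have key : ∀ h : Total → ℝ, ContDiffAt ℝ ∞ h (p, φ p) →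
      Dt (fun q => h (q, φ q)) p = graphFirst et h (p, u) st ∧
      Dx (fun q => h (q, φ q)) p = graphFirst ex h (p, u) sx ∧
      Dy (fun q => h (q, φ q)) p = graphFirst ey h (p, u) sy ∧
      Dx (Dx (fun q => h (q, φ q))) p = graphSecond ex h (p, u) sx xx := by
    intro h hh
    subst hu ht hx hy hxx
    exact ⟨fderiv_graph hh.diff hφ.diff _, fderiv_graph hh.diff hφ.diff _,
      fderiv_graph hh.diff hφ.diff _, fderiv_fderiv_graph hh hφ _⟩
  obtain ⟨t0, x0, y0, xx0⟩ := key _ h0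
  obtain ⟨t1, x1, y1, xx1⟩ := key _ h1
  obtain ⟨t2, x2, y2, xx2⟩ := key _ h2
  obtain ⟨t3, x3, y3, xx3⟩ := key _ h3
  have hz := Dx_zetaX_aux (smooth_graph h3 hφ) (smooth_graph h0 hφ) (smooth_graph h1 hφ)
    (smooth_graph h2 hφ) hφ
  unfold Equation.prolonged zetaXX zetaT zetaY
  have hz' : Dx (zetaX v φ) p = _ := hz
  change (Dt (fun q => comp3 v (q, φ q)) p - Dt φ p * Dt (fun q => comp0 v (q, φ q)) p
      - Dx φ p * Dt (fun q => comp1 v (q, φ q)) p - Dy φ p * Dt (fun q => comp2 v (q, φ q)) p)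
      - (Dx (zetaX v φ) p - Dt (Dx φ) p * Dx (fun q => comp0 v (q, φ q)) p
        - Dx (Dx φ) p * Dx (fun q => comp1 v (q, φ q)) p
        - Dy (Dx φ) p * Dx (fun q => comp2 v (q, φ q)) p)
      + E.f₁ (φ p) * (Dy (fun q => comp3 v (q, φ q)) p - Dt φ p * Dy (fun q => comp0 v (q, φ q)) p
        - Dx φ p * Dy (fun q => comp1 v (q, φ q)) p - Dy φ p * Dy (fun q => comp2 v (q, φ q)) p)
      + comp3 v (p, φ p) * (deriv E.f₁ (φ p) * Dy φ p - deriv E.f₂ (φ p)) = _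
  rw [hz', t0, t1, t2, t3, x0, x1, x2, y0, y1, y2, y3, xx0, xx1, xx2, xx3, ht, hx, hy, hxx, htx, hxy,
    hu]
  ring

/-- The infinitesimal invariance criterion in terms of the partial derivatives of the field. -/
theorem Equation.IsSymmetry.identity {E : Equation} {B : Set Base} (hB : IsOpen B) {v : Total → Total}
    (hv : E.IsSymmetry B v) {p : Base} (hp : p ∈ B) {u : ℝ} (hu : u ∈ E.dom) (sx sy xx tx xy st : ℝ)
    (hst : st = xx - E.f₁ u * sy + E.f₂ u) :
      graphFirst et (comp3 v) (p, u) st - st * graphFirst et (comp0 v) (p, u) st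
        - sx * graphFirst et (comp1 v) (p, u) st - sy * graphFirst et (comp2 v) (p, u) st
      - (graphSecond ex (comp3 v) (p, u) sx xx - st * graphSecond ex (comp0 v) (p, u) sx xx
        - sx * graphSecond ex (comp1 v) (p, u) sx xx - sy * graphSecond ex (comp2 v) (p, u) sx xx
        - 2 * tx * graphFirst ex (comp0 v) (p, u) sx - 2 * xx * graphFirst ex (comp1 v) (p, u) sx
        - 2 * xy * graphFirst ex (comp2 v) (p, u) sx)
      + E.f₁ u * (graphFirst ey (comp3 v) (p, u) sy - st * graphFirst ey (comp0 v) (p, u) sy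
        - sx * graphFirst ey (comp1 v) (p, u) sy - sy * graphFirst ey (comp2 v) (p, u) sy)
      + comp3 v (p, u) * (deriv E.f₁ u * sy - deriv E.f₂ u) = 0 := by
  -- The derivatives absent from the prolongation formula are set to 0; `hst` makes the polynomial
  -- satisfy the equation at `p`.
  set φ := quadPoly p u st sx sy 0 xx 0 tx xy 0 with hφ
  have hs : ContDiff ℝ ∞ φ := contDiff_quadPoly ..
  have e0 : φ p = u := quadPoly_self ..
  have e1 : Dt φ p = st := by
    rw [hφ]; unfold Dt; rw [fderiv_quadPoly, quadPoly_self]; simp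
  have e2 : Dx φ p = sx := by
    rw [hφ]; unfold Dx; rw [fderiv_quadPoly, quadPoly_self]; simp
  have e3 : Dy φ p = sy := by
    rw [hφ]; unfold Dy; rw [fderiv_quadPoly, quadPoly_self]; simp
  have e4 : Dx (Dx φ) p = xx :=
    (fderiv_fderiv_quadPoly p u st sx sy 0 xx 0 tx xy 0 _ _).trans (by simp)
  have e5 : Dt (Dx φ) p = tx :=
    (fderiv_fderiv_quadPoly p u st sx sy 0 xx 0 tx xy 0 _ _).trans (by simp)
  have e6 : Dy (Dx φ) p = xy :=
    (fderiv_fderiv_quadPoly p u st sx sy 0 xx 0 tx xy 0 _ _).trans (by simp)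
  have hvz : ContDiffAt ℝ ∞ v (p, φ p) := by
    rw [e0]
    exact hv.1.contDiffAt ((hB.prod E.isOpen_dom).mem_nhds ⟨hp, hu⟩)
  rw [← prolonged_eq E hvz hs.contDiffAt e0 e1 e2 e3 e4 e5 e6]
  refine hv.2 φ hs p hp (by rwa [e0]) ?_
  unfold Equation.HoldsAt
  rw [e1, e4, e3, e0, hst]
  ring

/-! ### The determining equations -/

theorem graphFirst_affine {h : Total → ℝ} {B : Set Base} {I : Set ℝ} (hB : IsOpen B) (hI : IsOpen I)
    {α β : Base → ℝ} (hα : ContDiffOn ℝ ∞ α B) (hβ : ContDiffOn ℝ ∞ β B)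
    (hh : ∀ p ∈ B, ∀ u ∈ I, h (p, u) = α p * u + β p) (a : Base) (s : ℝ) {p : Base} (hp : p ∈ B)
    {u : ℝ} (hu : u ∈ I) :
    graphFirst a h (p, u) s = fderiv ℝ α p a * u + fderiv ℝ β p a + s * α p := by
  unfold graphFirst
  rw [dB_affine hB hI hα hβ hh a p hp u hu, dU_affine hB hI hα hβ hh p hp u hu]

theorem graphFirst_base {h : Total → ℝ} {B : Set Base} {I : Set ℝ} (hB : IsOpen B) (hI : IsOpen I)
    {β : Base → ℝ} (hβ : ContDiffOn ℝ ∞ β B)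
    (hh : ∀ p ∈ B, ∀ u ∈ I, h (p, u) = β p) (a : Base) (s : ℝ) {p : Base} (hp : p ∈ B)
    {u : ℝ} (hu : u ∈ I) :
    graphFirst a h (p, u) s = fderiv ℝ β p a := by
  rw [graphFirst_affine hB hI (contDiffOn_const (c := (0 : ℝ))) hβ (by simpa using hh) a s hp hu]
  simp

theorem graphSecond_base {h : Total → ℝ} {B : Set Base} {I : Set ℝ} (hB : IsOpen B) (hI : IsOpen I)
    {β : Base → ℝ} (hβ : ContDiffOn ℝ ∞ β B)
    (hh : ∀ p ∈ B, ∀ u ∈ I, h (p, u) = β p) (a : Base) (s r : ℝ) {p : Base} (hp : p ∈ B)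
    {u : ℝ} (hu : u ∈ I) :
    graphSecond a h (p, u) s r = fderiv ℝ (fun q => fderiv ℝ β q a) p a := by
  rw [graphSecond_affine hB hI (contDiffOn_const (c := (0 : ℝ))) hβ (by simpa using hh) a s r p hp u hu]
  simp

/-- The determining equations for the coefficients of a symmetry
`(c t + c₀)∂_t + (½c x + c₂)∂_x + ψ∂_y + (α u + β)∂_u`. -/
structure DeterminingSystem (E : Equation) (B : Set Base) (c : ℝ) (ψ α β : Base → ℝ) : Prop where
  smooth_ψ : ContDiffOn ℝ ∞ ψ B
  smooth_α : ContDiffOn ℝ ∞ α B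
  smooth_β : ContDiffOn ℝ ∞ β B
  dx_ψ : ∀ p ∈ B, Dx ψ p = 0
  dx_α : ∀ p ∈ B, Dx α p = 0
  dx_β : ∀ p ∈ B, Dx β p = 0
  eqA : ∀ p ∈ B, ∀ u ∈ E.dom,
    (c - Dy ψ p) * E.f₁ u - Dt ψ p + (α p * u + β p) * deriv E.f₁ u = 0
  eqB : ∀ p ∈ B, ∀ u ∈ E.dom, Dt α p * u + Dt β p + (α p - c) * E.f₂ u
    + E.f₁ u * (Dy α p * u + Dy β p) - (α p * u + β p) * deriv E.f₂ u = 0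

/-- The field `(c t + c₀)∂_t + (½c x + c₂)∂_x + ψ∂_y + (α u + β)∂_u`. -/
noncomputable def affineField (c₀ c c₂ : ℝ) (ψ α β : Base → ℝ) (z : Total) : Total :=
  ((c * z.1.1 + c₀, c / 2 * z.1.2.1 + c₂, ψ z.1), α z.1 * z.2 + β z.1)

theorem smooth_affineField {B : Set Base} {I : Set ℝ} {ψ α β : Base → ℝ} (hψ : ContDiffOn ℝ ∞ ψ B)
    (hα : ContDiffOn ℝ ∞ α B) (hβ : ContDiffOn ℝ ∞ β B) (c₀ c c₂ : ℝ) :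
    ContDiffOn ℝ ∞ (affineField c₀ c c₂ ψ α β) (B ×ˢ I) := by
  have h1 : ∀ {f : Base → ℝ}, ContDiffOn ℝ ∞ f B → ContDiffOn ℝ ∞ (fun z : Total => f z.1) (B ×ˢ I) :=
    fun hf => ContDiffOn.comp (f := Prod.fst) hf contDiffOn_fst fun z hz => hz.1
  have h2 : ContDiffOn ℝ ∞ (fun z : Total => c * z.1.1 + c₀) (B ×ˢ I) := by fun_prop
  have h3 : ContDiffOn ℝ ∞ (fun z : Total => c / 2 * z.1.2.1 + c₂) (B ×ˢ I) := by fun_prop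
  exact (h2.prodMk (h3.prodMk (h1 hψ))).prodMk (((h1 hα).mul contDiffOn_snd).add (h1 hβ))

/-- For coefficients of this shape the prolonged equation, taken modulo the equation itself, is u_y
times (A) plus (B). -/
theorem DeterminingSystem.isSymmetry {E : Equation} {B : Set Base} (hB : IsOpen B) {c : ℝ}
    {ψ α β : Base → ℝ} (h : DeterminingSystem E B c ψ α β) (c₀ c₂ : ℝ) {v : Total → Total}
    (hv : EqOn v (affineField c₀ c c₂ ψ α β) (B ×ˢ E.dom)) : E.IsSymmetry B v := by
  have hsm : ContDiffOn ℝ ∞ v (B ×ˢ E.dom) :=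
    (smooth_affineField h.smooth_ψ h.smooth_α h.smooth_β c₀ c c₂).congr hv
  refine ⟨hsm, fun φ hφ p hp hu hold => ?_⟩
  rw [prolonged_eq E (hsm.contDiffAt ((hB.prod E.isOpen_dom).mem_nhds ⟨hp, hu⟩)) hφ.contDiffAt
    rfl rfl rfl rfl rfl rfl rfl]
  -- Writing ξ⁰ and ξ¹ as values of `quadPoly` makes their derivatives available from
  -- `fderiv_quadPoly`.
  have v0 : ∀ p ∈ B, ∀ u ∈ E.dom, comp0 v (p, u) = quadPoly 0 c₀ c 0 0 0 0 0 0 0 0 p := by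
    intro p hp u hu
    unfold comp0; rw [hv ⟨hp, hu⟩]; simp [affineField, quadPoly]; ring
  have v1 : ∀ p ∈ B, ∀ u ∈ E.dom, comp1 v (p, u) = quadPoly 0 c₂ 0 (c / 2) 0 0 0 0 0 0 0 p := by
    intro p hp u hu
    unfold comp1; rw [hv ⟨hp, hu⟩]; simp [affineField, quadPoly]; ring
  have v2 : ∀ p ∈ B, ∀ u ∈ E.dom, comp2 v (p, u) = ψ p := by
    intro p hp u hu
    unfold comp2; rw [hv ⟨hp, hu⟩]; simp [affineField]
  have v3 : ∀ p ∈ B, ∀ u ∈ E.dom, comp3 v (p, u) = α p * u + β p := by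
    intro p hp u hu
    unfold comp3; rw [hv ⟨hp, hu⟩]; simp [affineField]
  have s0 := (contDiff_quadPoly 0 c₀ c 0 0 0 0 0 0 0 0).contDiffOn (s := B)
  have s1 := (contDiff_quadPoly 0 c₂ 0 (c / 2) 0 0 0 0 0 0 0).contDiffOn (s := B)
  have hI := E.isOpen_dom
  have z1 : ∀ f : Base → ℝ, (∀ p ∈ B, Dx f p = 0) → fderiv ℝ f p ex = 0 := fun f hf => hf p hp
  have z2 : ∀ f : Base → ℝ, (∀ p ∈ B, Dx f p = 0) →
      fderiv ℝ (fun q => fderiv ℝ f q ex) p ex = 0 := by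
    intro f hf
    rw [fderiv_eq_zero_of_eqOn hB (F := fun q => fderiv ℝ f q ex) hf hp]; rfl
  rw [graphSecond_affine hB hI h.smooth_α h.smooth_β v3 _ _ _ p hp _ hu,
    graphSecond_base hB hI s0 v0 _ _ _ hp hu, graphSecond_base hB hI s1 v1 _ _ _ hp hu,
    graphSecond_base hB hI h.smooth_ψ v2 _ _ _ hp hu]
  simp only [graphFirst_affine hB hI h.smooth_α h.smooth_β v3 _ _ hp hu,
    graphFirst_base hB hI s0 v0 _ _ hp hu, graphFirst_base hB hI s1 v1 _ _ hp hu,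
    graphFirst_base hB hI h.smooth_ψ v2 _ _ hp hu, z1 _ h.dx_ψ, z1 _ h.dx_α,
    z2 _ h.dx_ψ, z2 _ h.dx_α, z2 _ h.dx_β, fderiv_quadPoly, v3 p hp _ hu]
  have hA := h.eqA p hp _ hu
  have hB' := h.eqB p hp _ hu
  unfold Equation.HoldsAt at hold
  -- Here u_xx is eliminated by the equation; the other direction, `identity`, eliminates u_t.
  have hxx : Dx (Dx φ) p = Dt φ p + E.f₁ (φ p) * Dy φ p - E.f₂ (φ p) := by linarith
  rw [hxx]
  simp [quadPoly]
  change Dt α p * φ p + Dt β p + _ - _ - _ * Dt ψ p - _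
    + _ * (Dy α p * φ p + Dy β p + _ - _ * Dy ψ p) + _ = 0
  linear_combination Dy φ p * hA + hB'

theorem Equation.differentiableAt_f₁ (E : Equation) {u : ℝ} (hu : u ∈ E.dom) :
    DifferentiableAt ℝ E.f₁ u :=
  (E.smooth_f₁.contDiffAt (E.isOpen_dom.mem_nhds hu)).diff

theorem Equation.differentiableAt_f₂ (E : Equation) {u : ℝ} (hu : u ∈ E.dom) :
    DifferentiableAt ℝ E.f₂ u :=
  (E.smooth_f₂.contDiffAt (E.isOpen_dom.mem_nhds hu)).diff

/-- Nonconstancy of f₁ is linear independence of 1 and f₁. This allows splitting with respect to f₁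
before anything else is known about it. -/
theorem Equation.coeff_eq_zero (E : Equation) {A B : ℝ} (h : ∀ u ∈ E.dom, A + B * E.f₁ u = 0) :
    A = 0 ∧ B = 0 := by
  obtain ⟨a, ha, b, hb, hab⟩ := E.nonconst_f₁
  have h1 := h a ha
  have h2 := h b hb
  have h3 : B * (E.f₁ a - E.f₁ b) = 0 := by linarith
  have h4 : B = 0 := (mul_eq_zero.1 h3).resolve_right (sub_ne_zero.2 hab)
  subst h4
  exact ⟨by linarith, rfl⟩

theorem Equation.exists_deriv_ne_zero (E : Equation) : ∃ u ∈ E.dom, deriv E.f₁ u ≠ 0 := by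
  by_contra! hc
  obtain ⟨c, h⟩ := E.isOpen_dom.exists_is_const_of_deriv_eq_zero E.ordConnected_dom.isPreconnected
    (fun u hu => (E.differentiableAt_f₁ hu).differentiableWithinAt) hc
  obtain ⟨a, ha, b, hb, hab⟩ := E.nonconst_f₁
  exact hab ((h a ha).trans (h b hb).symm)

theorem Equation.continuousAt_deriv_f₁ (E : Equation) {u : ℝ} (hu : u ∈ E.dom) :
    ContinuousAt (deriv E.f₁) u := by
  have h := (E.smooth_f₁.contDiffAt (E.isOpen_dom.mem_nhds hu))
  have h2 := (smooth_fderiv_apply h (1 : ℝ)).continuousAt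
  exact h2

/-- Near a point with f₁' ≠ 0 the affine factor vanishes on a neighbourhood, hence identically. -/
theorem Equation.affine_mul_deriv_eq_zero (E : Equation) {A B : ℝ}
    (h : ∀ u ∈ E.dom, (A * u + B) * deriv E.f₁ u = 0) : A = 0 ∧ B = 0 := by
  obtain ⟨u, hu, hne⟩ := E.exists_deriv_ne_zero
  have ev : ∀ᶠ s in 𝓝 u, A * s + B = 0 := by
    filter_upwards [(E.continuousAt_deriv_f₁ hu).eventually_ne hne, E.isOpen_dom.mem_nhds hu]
      with s hs hs'
    exact (mul_eq_zero.1 (h s hs')).resolve_right hs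
  have ev2 : (fun s => A * s + B) =ᶠ[𝓝 u] fun _ => 0 := ev
  have hA : A = 0 := by
    have hd : HasDerivAt (fun s => A * s + B) (A * 1) u := ((hasDerivAt_id u).const_mul A).add_const B
    have := hd.deriv.symm.trans ev2.deriv_eq
    simpa using this
  subst hA
  exact ⟨rfl, by simpa using ev2.self_of_nhds⟩

theorem fderiv_eq_mul_of_eqOn {B : Set Base} (hB : IsOpen B) {f g : Base → ℝ} {k : ℝ}
    (hg : ContDiffOn ℝ ∞ g B) (h : ∀ q ∈ B, f q = k * g q) {p : Base} (hp : p ∈ B) (a : Base) :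
    fderiv ℝ f p a = k * fderiv ℝ g p a := by
  have e : f =ᶠ[𝓝 p] fun q => k * g q := by
    filter_upwards [hB.mem_nhds hp] with q hq using h q hq
  rw [e.fderiv_eq, fderiv_const_mul (hg.contDiffAt (hB.mem_nhds hp)).diff]
  rfl

/-- A function without dependence on `u` descends to the base. -/
theorem exists_base_function {B : Set Base} {I : Set ℝ} (hB : IsOpen B) (hI : IsOpen I)
    (hI' : I.OrdConnected) (hne : I.Nonempty) {h : Total → ℝ} (hh : ContDiffOn ℝ ∞ h (B ×ˢ I))
    (h0 : ∀ p ∈ B, ∀ u ∈ I, dU h (p, u) = 0) :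
    ∃ f : Base → ℝ, ContDiffOn ℝ ∞ f B ∧ ∀ p ∈ B, ∀ u ∈ I, h (p, u) = f p := by
  obtain ⟨u₀, hu₀⟩ := hne
  refine ⟨fun p => h (p, u₀), ?_, fun p hp u hu => eq_of_dU_eq_zero hB hI hI' hh h0 hp hu hu₀⟩
  exact hh.comp (f := fun p => (p, u₀)) (contDiffOn_id.prodMk contDiffOn_const) fun p hp => ⟨hp, hu₀⟩

/-- A function with vanishing second `u`-derivative is affine in `u`. -/
theorem exists_affine_function {B : Set Base} {I : Set ℝ} (hB : IsOpen B) (hI : IsOpen I)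
    (hI' : I.OrdConnected) (hne : I.Nonempty) {h : Total → ℝ} (hh : ContDiffOn ℝ ∞ h (B ×ˢ I))
    (h0 : ∀ p ∈ B, ∀ u ∈ I, dU (dU h) (p, u) = 0) :
    ∃ α β : Base → ℝ, ContDiffOn ℝ ∞ α B ∧ ContDiffOn ℝ ∞ β B ∧
      ∀ p ∈ B, ∀ u ∈ I, h (p, u) = α p * u + β p := by
  obtain ⟨α, hα, hα'⟩ := exists_base_function hB hI hI' hne (smoothOn_dU (hB.prod hI) hh) h0
  have hα2 : ContDiffOn ℝ ∞ (fun z : Total => α z.1) (B ×ˢ I) :=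
    ContDiffOn.comp (f := Prod.fst) hα contDiffOn_fst fun z hz => hz.1
  have hk : ContDiffOn ℝ ∞ (fun z : Total => h z - α z.1 * z.2) (B ×ˢ I) :=
    hh.sub (hα2.mul contDiffOn_snd)
  obtain ⟨β, hβ, hβ'⟩ := exists_base_function hB hI hI' hne hk (by
    intro p hp u hu
    have hz : ((p, u) : Total) ∈ B ×ˢ I := ⟨hp, hu⟩
    have hαz := (hα.contDiffAt (hB.mem_nhds hp)).diff
    have e1 : DifferentiableAt ℝ h (p, u) := (hh.contDiffAt ((hB.prod hI).mem_nhds hz)).diff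
    have e2 : DifferentiableAt ℝ (fun z : Total => α z.1 * z.2) (p, u) :=
      ((hα2.mul contDiffOn_snd).contDiffAt ((hB.prod hI).mem_nhds hz)).diff
    have e3 := fderiv_affine hαz (differentiableAt_const (0 : ℝ)) u 1 0
    have e4 : fderiv ℝ (fun z : Total => h z - α z.1 * z.2) (p, u) = _ := fderiv_fun_sub e1 e2
    have e5 : fderiv ℝ h (p, u) (0, 1) = α p := hα' p hp u hu
    unfold dU
    rw [e4, sub_apply, e5]
    simp at e3
    rw [e3]
    simp)
  exact ⟨α, β, hα, hβ, fun p hp u hu => by have := hβ' p hp u hu; linarith⟩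

/-- The criterion is split with respect to the free jet coordinates, each coefficient being isolated
by finite differences at small integer values. Connectedness of the base is needed only to integrate
ξ⁰ and ξ¹ with global constants. -/
theorem Equation.IsSymmetry.exists_determiningSystem {E : Equation} {B : Set Base} (hB : IsOpen B)
    (hB' : IsPreconnected B) {v : Total → Total} (hv : E.IsSymmetry B v) :
    ∃ (c₀ c c₂ : ℝ) (ψ α β : Base → ℝ), DeterminingSystem E B c ψ α β ∧
      EqOn v (affineField c₀ c c₂ ψ α β) (B ×ˢ E.dom) := by
  have hI := E.isOpen_dom
  have hI' := E.ordConnected_dom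
  have hne := E.nonempty_dom
  obtain ⟨h0, h1, h2, h3⟩ := smoothOn_comp hv.1
  have key := fun p hp u hu => hv.identity hB (p := p) hp (u := u) hu
  -- the coefficients of `u_tx` and `u_xy`
  have x0 : ∀ p ∈ B, ∀ u ∈ E.dom, dB ex (comp0 v) (p, u) = 0 ∧ dU (comp0 v) (p, u) = 0 := by
    intro p hp u hu
    -- Only 2 u_tx (ξ⁰_x + u_x ξ⁰_u) depends on u_tx; its values for u_x = 0 and u_x = 1 separate
    -- ξ⁰_x from ξ⁰_u.
    have k := fun sx tx => key p hp u hu sx 0 0 tx 0 _ rfl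
    have a0 := k 0 0; have a1 := k 0 1; have a2 := k 1 0; have a3 := k 1 1
    have b1 : graphFirst ex (comp0 v) (p, u) 0 = 0 := by linarith
    have b2 : graphFirst ex (comp0 v) (p, u) 1 = 0 := by linarith
    unfold graphFirst at b1 b2
    constructor <;> linarith
  have x2 : ∀ p ∈ B, ∀ u ∈ E.dom, dB ex (comp2 v) (p, u) = 0 ∧ dU (comp2 v) (p, u) = 0 := by
    intro p hp u hu
    have k := fun sx xy => key p hp u hu sx 0 0 0 xy _ rfl
    have a0 := k 0 0; have a1 := k 0 1; have a2 := k 1 0; have a3 := k 1 1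
    have b1 : graphFirst ex (comp2 v) (p, u) 0 = 0 := by linarith
    have b2 : graphFirst ex (comp2 v) (p, u) 1 = 0 := by linarith
    unfold graphFirst at b1 b2
    constructor <;> linarith
  obtain ⟨a₀, ha₀, e0⟩ := exists_base_function hB hI hI' hne h0 fun p hp u hu => (x0 p hp u hu).2
  obtain ⟨ψ, hψ, e2⟩ := exists_base_function hB hI hI' hne h2 fun p hp u hu => (x2 p hp u hu).2
  -- the coefficient of `u_x u_xx`
  have u1 : ∀ p ∈ B, ∀ u ∈ E.dom, dU (comp1 v) (p, u) = 0 := by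
    intro p hp u hu
    -- The mixed difference in u_x and u_xx equals 2 ξ¹_u: all other terms depend on at most one of
    -- the two.
    have k := fun sx xx => key p hp u hu sx 0 xx 0 0 _ rfl
    simp only [graphFirst_base hB hI ha₀ e0 _ _ hp hu, graphFirst_base hB hI hψ e2 _ _ hp hu,
      graphSecond_base hB hI ha₀ e0 _ _ _ hp hu, graphSecond_base hB hI hψ e2 _ _ _ hp hu] at k
    have a0 := k 0 0; have a1 := k 1 0; have a2 := k 0 1; have a3 := k 1 1
    simp only [graphFirst, graphSecond] at a0 a1 a2 a3
    linarith
  obtain ⟨a₁, ha₁, e1⟩ := exists_base_function hB hI hI' hne h1 u1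
  -- the coefficient of `u_x²`
  have u3 : ∀ p ∈ B, ∀ u ∈ E.dom, dU (dU (comp3 v)) (p, u) = 0 := by
    intro p hp u hu
    have k := fun sx => key p hp u hu sx 0 0 0 0 _ rfl
    simp only [graphFirst_base hB hI ha₀ e0 _ _ hp hu, graphFirst_base hB hI hψ e2 _ _ hp hu,
      graphSecond_base hB hI ha₀ e0 _ _ _ hp hu, graphSecond_base hB hI hψ e2 _ _ _ hp hu,
      graphFirst_base hB hI ha₁ e1 _ _ hp hu, graphSecond_base hB hI ha₁ e1 _ _ _ hp hu] at k
    -- The second difference in u_x leaves only the η_uu term.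
    have a0 := k 0; have a1 := k 1; have a2 := k (-1)
    simp only [graphFirst, graphSecond] at a0 a1 a2
    linarith
  obtain ⟨α, β, hα, hβ, e3⟩ := exists_affine_function hB hI hI' hne h3 u3
  have k' : ∀ p ∈ B, ∀ u ∈ E.dom, ∀ sx sy xx st : ℝ, st = xx - E.f₁ u * sy + E.f₂ u →
      Dt α p * u + Dt β p + st * α p - st * Dt a₀ p - sx * Dt a₁ p - sy * Dt ψ p
      - (Dx (Dx α) p * u + Dx (Dx β) p + 2 * sx * Dx α p + xx * α p - st * Dx (Dx a₀) p
        - sx * Dx (Dx a₁) p - sy * Dx (Dx ψ) p - 2 * xx * Dx a₁ p)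
      + E.f₁ u * (Dy α p * u + Dy β p + sy * α p - st * Dy a₀ p - sx * Dy a₁ p - sy * Dy ψ p)
      + (α p * u + β p) * (deriv E.f₁ u * sy - deriv E.f₂ u) = 0 := by
    intro p hp u hu sx sy xx st hst
    have k := key p hp u hu sx sy xx 0 0 st hst
    rw [graphSecond_affine hB hI hα hβ e3 _ _ _ p hp _ hu,
      graphSecond_base hB hI ha₀ e0 _ _ _ hp hu, graphSecond_base hB hI hψ e2 _ _ _ hp hu,
      graphSecond_base hB hI ha₁ e1 _ _ _ hp hu] at k
    simp only [graphFirst_affine hB hI hα hβ e3 _ _ hp hu,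
      graphFirst_base hB hI ha₀ e0 _ _ hp hu, graphFirst_base hB hI hψ e2 _ _ hp hu,
      graphFirst_base hB hI ha₁ e1 _ _ hp hu, e3 p hp u hu] at k
    simp only [mul_zero, zero_mul, sub_zero] at k
    exact k
  have xa0 : ∀ p ∈ B, Dx a₀ p = 0 := by
    intro p hp
    obtain ⟨u, hu⟩ := hne
    have := (x0 p hp u hu).1
    rwa [dB_affine hB hI (contDiffOn_const (c := (0 : ℝ))) ha₀ (by simpa using e0) ex p hp u hu,
      fderiv_const_apply, zero_apply, zero_mul, zero_add] at this
  have xψ : ∀ p ∈ B, Dx ψ p = 0 := by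
    intro p hp
    obtain ⟨u, hu⟩ := hne
    have := (x2 p hp u hu).1
    rwa [dB_affine hB hI (contDiffOn_const (c := (0 : ℝ))) hψ (by simpa using e2) ex p hp u hu,
      fderiv_const_apply, zero_apply, zero_mul, zero_add] at this
  have dz : ∀ f : Base → ℝ, (∀ p ∈ B, f p = 0) → ∀ p ∈ B, Dx f p = 0 ∧ Dt f p = 0 ∧ Dy f p = 0 := by
    intro f hf p hp
    have := fderiv_eq_zero_of_eqOn hB hf hp
    simp [Dx, Dt, Dy, this]
  -- the coefficient of `u_xx`
  have c1 : ∀ p ∈ B, 2 * Dx a₁ p = Dt a₀ p ∧ Dy a₀ p = 0 := by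
    intro p hp
    have := E.coeff_eq_zero (A := 2 * Dx a₁ p - Dt a₀ p) (B := - Dy a₀ p) (by
      intro u hu
      have a0 := k' p hp u hu 0 0 0 _ rfl
      have a1 := k' p hp u hu 0 0 1 _ rfl
      rw [(dz _ xa0 p hp).1] at a0 a1
      linarith)
    constructor <;> linarith [this.1, this.2]
  -- the coefficient of `u_y`
  have c2 : ∀ p ∈ B, ∀ u ∈ E.dom,
      (Dt a₀ p - Dy ψ p) * E.f₁ u - Dt ψ p + (α p * u + β p) * deriv E.f₁ u = 0 := by
    intro p hp u hu
    have a0 := k' p hp u hu 0 0 0 _ rfl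
    have a1 := k' p hp u hu 0 1 0 _ rfl
    rw [(dz _ xa0 p hp).1, (c1 p hp).2] at a0 a1
    rw [(dz _ xψ p hp).1] at a1
    linarith
  have comm : ∀ {f : Base → ℝ}, ContDiffOn ℝ ∞ f B → ∀ p ∈ B, ∀ a b,
      fderiv ℝ (fun q => fderiv ℝ f q a) p b = fderiv ℝ (fun q => fderiv ℝ f q b) p a :=
    fun hf p hp a b => fderiv_fderiv_comm (hf.contDiffAt (hB.mem_nhds hp)) a b
  have xt0 : ∀ p ∈ B, Dx (Dt a₀) p = 0 := fun p hp =>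
    (comm ha₀ p hp et ex).trans (dz _ xa0 p hp).2.1
  have yt0 : ∀ p ∈ B, Dy (Dt a₀) p = 0 := fun p hp =>
    (comm ha₀ p hp et ey).trans (dz _ (fun p hp => (c1 p hp).2) p hp).2.1
  have xx1 : ∀ p ∈ B, Dx (Dx a₁) p = 0 := by
    intro p hp
    have : Dx (Dx a₁) p = (1 / 2) * Dx (Dt a₀) p :=
      fderiv_eq_mul_of_eqOn hB (smoothOn_fderiv_apply hB ha₀ et)
        (fun q hq => by change Dx a₁ q = 1 / 2 * Dt a₀ q; linarith [(c1 q hq).1]) hp ex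
    rw [this, xt0 p hp, mul_zero]
  -- the `x`-derivative of the `u_y` coefficient
  have xη : ∀ p ∈ B, Dx α p = 0 ∧ Dx β p = 0 := by
    intro p hp
    apply E.affine_mul_deriv_eq_zero
    intro u hu
    have hd : ∀ {f : Base → ℝ}, ContDiffOn ℝ ∞ f B → HasFDerivAt f (fderiv ℝ f p) p := fun hf =>
      (hf.contDiffAt (hB.mem_nhds hp)).diff.hasFDerivAt
    have d := ((((hd (smoothOn_fderiv_apply hB ha₀ et)).sub
      (hd (smoothOn_fderiv_apply hB hψ ey))).mul_const (E.f₁ u)).sub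
      (hd (smoothOn_fderiv_apply hB hψ et))).add
      ((((hd hα).mul_const u).add (hd hβ)).mul_const (deriv E.f₁ u))
    have d2 := d.fderiv.symm.trans
      (fderiv_eq_zero_of_eqOn hB (c := 0) (fun q hq => c2 q hq u hu) hp)
    have d3 := DFunLike.congr_fun d2 ex
    simp only [sub_apply, add_apply, smul_apply, smul_eq_mul, zero_apply] at d3
    have t1 : fderiv ℝ (fun q => fderiv ℝ ψ q ey) p ex = 0 :=
      (comm hψ p hp ey ex).trans (dz _ xψ p hp).2.2
    have t2 : fderiv ℝ (fun q => fderiv ℝ ψ q et) p ex = 0 :=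
      (comm hψ p hp et ex).trans (dz _ xψ p hp).2.1
    have t3 : fderiv ℝ (fun q => fderiv ℝ a₀ q et) p ex = 0 := xt0 p hp
    rw [t1, t2, t3] at d3
    change _ + deriv E.f₁ u * (u * Dx α p + Dx β p) = 0 at d3
    linear_combination d3
  -- the coefficient of `u_x`
  have c3 : ∀ p ∈ B, Dt a₁ p = 0 ∧ Dy a₁ p = 0 := by
    intro p hp
    apply E.coeff_eq_zero
    intro u hu
    have a0 := k' p hp u hu 0 0 0 _ rfl
    have a1 := k' p hp u hu 1 0 0 _ rfl
    rw [(xη p hp).1, xx1 p hp] at a1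
    linarith
  -- From ξ⁰_t = 2 ξ¹_x and ξ¹_t = 0; together with `xt0` and `yt0` this makes ξ⁰_t a constant,
  -- which is `c`.
  have tt0 : ∀ p ∈ B, Dt (Dt a₀) p = 0 := by
    intro p hp
    have h1 : Dt (Dt a₀) p = 2 * Dt (Dx a₁) p :=
      fderiv_eq_mul_of_eqOn hB (smoothOn_fderiv_apply hB ha₁ ex)
        (fun q hq => by change Dt a₀ q = 2 * Dx a₁ q; linarith [(c1 q hq).1]) hp et
    have h2 : Dt (Dx a₁) p = 0 := (comm ha₁ p hp ex et).trans
      (dz _ (fun p hp => (c3 p hp).1) p hp).1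
    rw [h1, h2, mul_zero]
  obtain ⟨c, hc⟩ := exists_eq_const hB hB' (smoothOn_fderiv_apply hB ha₀ et) tt0 xt0 yt0
  have hc' : ∀ p ∈ B, Dt a₀ p = c := hc
  have lin : ∀ {f : Base → ℝ} (k l : ℝ), ContDiffOn ℝ ∞ f B → (∀ p ∈ B, Dt f p = k) →
      (∀ p ∈ B, Dx f p = l) → (∀ p ∈ B, Dy f p = 0) → ∃ d, ∀ p ∈ B, f p = k * p.1 + l * p.2.1 + d := by
    intro f k l hf ht hx hy
    have hq := contDiff_quadPoly 0 0 k l 0 0 0 0 0 0 0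
    have hfd : ∀ p ∈ B, ∀ a, fderiv ℝ (fun q => f q - quadPoly 0 0 k l 0 0 0 0 0 0 0 q) p a
        = fderiv ℝ f p a - (k * a.1 + l * a.2.1) := by
      intro p hp a
      rw [fderiv_fun_sub (hf.contDiffAt (hB.mem_nhds hp)).diff hq.contDiffAt.diff, sub_apply,
        fderiv_quadPoly]
      simp [quadPoly]
    obtain ⟨d, hd⟩ := exists_eq_const hB hB'
      (hf.sub hq.contDiffOn)
      (fun p hp => (hfd p hp _).trans (by
        change Dt f p - _ = 0; rw [ht p hp]; simp))
      (fun p hp => (hfd p hp _).trans (by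
        change Dx f p - _ = 0; rw [hx p hp]; simp))
      (fun p hp => (hfd p hp _).trans (by
        change Dy f p - _ = 0; rw [hy p hp]; simp))
    refine ⟨d, fun p hp => ?_⟩
    have := hd p hp
    simp [quadPoly] at this
    linarith
  obtain ⟨c₀, hc₀⟩ := lin c 0 ha₀ hc' xa0 fun p hp => (c1 p hp).2
  obtain ⟨c₂, hc₂⟩ := lin 0 (c / 2) ha₁ (fun p hp => (c3 p hp).1)
    (fun p hp => by linarith [(c1 p hp).1, hc' p hp]) fun p hp => (c3 p hp).2
  refine ⟨c₀, c, c₂, ψ, α, β, ⟨hψ, hα, hβ, xψ, fun p hp => (xη p hp).1, fun p hp => (xη p hp).2,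
    fun p hp u hu => ?_, fun p hp u hu => ?_⟩, ?_⟩
  · rw [← hc' p hp]; exact c2 p hp u hu
  · have a0 := k' p hp u hu 0 0 0 _ rfl
    rw [(dz _ (fun p hp => (xη p hp).1) p hp).1, (dz _ (fun p hp => (xη p hp).2) p hp).1,
      (dz _ xa0 p hp).1, (c1 p hp).2, hc' p hp] at a0
    linarith
  · rintro ⟨p, u⟩ ⟨hp, hu⟩
    have h0' := e0 p hp u hu
    have h1' := e1 p hp u hu
    have h2' := e2 p hp u hu
    have h3' := e3 p hp u hu
    rw [hc₀ p hp] at h0'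
    rw [hc₂ p hp] at h1'
    simp only [comp0, comp1, comp2, comp3] at h0' h1' h2' h3'
    refine Prod.ext (Prod.ext ?_ (Prod.ext ?_ ?_)) ?_ <;> simp only [affineField] <;> linarith

theorem Equation.isSymmetry_iff {E : Equation} {B : Set Base} (hB : IsOpen B)
    (hB' : IsPreconnected B) {v : Total → Total} : E.IsSymmetry B v ↔
    ∃ (c₀ c c₂ : ℝ) (ψ α β : Base → ℝ), DeterminingSystem E B c ψ α β ∧
      EqOn v (affineField c₀ c c₂ ψ α β) (B ×ˢ E.dom) :=
  ⟨fun h => h.exists_determiningSystem hB hB', fun ⟨c₀, _, c₂, _, _, _, h, h'⟩ =>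
    h.isSymmetry hB c₀ c₂ h'⟩

/-! ### Chain rules for a change of the independent variables -/

theorem fderiv_base_comp {w g₀ g₁ g₂ : Base → ℝ} {p : Base}
    (hw : DifferentiableAt ℝ w (g₀ p, g₁ p, g₂ p)) (h₀ : DifferentiableAt ℝ g₀ p)
    (h₁ : DifferentiableAt ℝ g₁ p) (h₂ : DifferentiableAt ℝ g₂ p) (a : Base) :
    fderiv ℝ (fun q => w (g₀ q, g₁ q, g₂ q)) p a
      = fderiv ℝ g₀ p a * Dt w (g₀ p, g₁ p, g₂ p) + fderiv ℝ g₁ p a * Dx w (g₀ p, g₁ p, g₂ p)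
        + fderiv ℝ g₂ p a * Dy w (g₀ p, g₁ p, g₂ p) := by
  have h := HasFDerivAt.comp p (f := fun q => (g₀ q, g₁ q, g₂ q)) hw.hasFDerivAt
    (h₀.hasFDerivAt.prodMk (h₁.hasFDerivAt.prodMk h₂.hasFDerivAt))
  have h' : fderiv ℝ (fun q => w (g₀ q, g₁ q, g₂ q)) p = _ := h.fderiv
  rw [h']
  exact fderiv_base w _ _ _ _

theorem smooth_base_comp {w g₀ g₁ g₂ : Base → ℝ} {p : Base}
    (hw : ContDiffAt ℝ ∞ w (g₀ p, g₁ p, g₂ p)) (h₀ : ContDiffAt ℝ ∞ g₀ p)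
    (h₁ : ContDiffAt ℝ ∞ g₁ p) (h₂ : ContDiffAt ℝ ∞ g₂ p) :
    ContDiffAt ℝ ∞ (fun q => w (g₀ q, g₁ q, g₂ q)) p :=
  ContDiffAt.comp p (f := fun q => (g₀ q, g₁ q, g₂ q)) hw (h₀.prodMk (h₁.prodMk h₂))

/-- The direction `a` moves only the second coordinate to first order, so of the second derivatives
of w only w_xx enters. This is the only second derivative that the equations contain. -/
theorem fderiv_fderiv_base_comp {w g₀ g₁ g₂ : Base → ℝ} {p : Base}
    (hw : ContDiffAt ℝ ∞ w (g₀ p, g₁ p, g₂ p)) (h₀ : ContDiffAt ℝ ∞ g₀ p)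
    (h₁ : ContDiffAt ℝ ∞ g₁ p) (h₂ : ContDiffAt ℝ ∞ g₂ p) (a : Base)
    (z₀ : fderiv ℝ g₀ p a = 0) (z₂ : fderiv ℝ g₂ p a = 0) :
    fderiv ℝ (fun q => fderiv ℝ (fun q => w (g₀ q, g₁ q, g₂ q)) q a) p a
      = Dx (Dx w) (g₀ p, g₁ p, g₂ p) * (fderiv ℝ g₁ p a) ^ 2
        + fderiv ℝ (fun q => fderiv ℝ g₀ q a) p a * Dt w (g₀ p, g₁ p, g₂ p)
        + fderiv ℝ (fun q => fderiv ℝ g₁ q a) p a * Dx w (g₀ p, g₁ p, g₂ p)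
        + fderiv ℝ (fun q => fderiv ℝ g₂ q a) p a * Dy w (g₀ p, g₁ p, g₂ p) := by
  have hc : ContinuousAt (fun q => ((g₀ q, g₁ q, g₂ q) : Base)) p :=
    h₀.continuousAt.prodMk (h₁.continuousAt.prodMk h₂.continuousAt)
  have ev : (fun q => fderiv ℝ (fun q => w (g₀ q, g₁ q, g₂ q)) q a) =ᶠ[𝓝 p] fun q =>
      fderiv ℝ g₀ q a * Dt w (g₀ q, g₁ q, g₂ q) + fderiv ℝ g₁ q a * Dx w (g₀ q, g₁ q, g₂ q)
        + fderiv ℝ g₂ q a * Dy w (g₀ q, g₁ q, g₂ q) := by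
    filter_upwards [hc.eventually (eventually_differentiableAt hw), eventually_differentiableAt h₀,
      eventually_differentiableAt h₁, eventually_differentiableAt h₂] with q e e₀ e₁ e₂
    exact fderiv_base_comp e e₀ e₁ e₂ a
  have sw : ∀ b : Base, ContDiffAt ℝ ∞ (fun y => fderiv ℝ w y b) (g₀ p, g₁ p, g₂ p) :=
    fun b => smooth_fderiv_apply hw b
  have d : ∀ b : Base, DifferentiableAt ℝ (fun q => fderiv ℝ w (g₀ q, g₁ q, g₂ q) b) p :=
    fun b => (smooth_base_comp (sw b) h₀ h₁ h₂).diff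
  have k₀ := (smooth_fderiv_apply h₀ a).diff
  have k₁ := (smooth_fderiv_apply h₁ a).diff
  have k₂ := (smooth_fderiv_apply h₂ a).diff
  have h := ((k₀.hasFDerivAt.mul (d et).hasFDerivAt).add (k₁.hasFDerivAt.mul (d ex).hasFDerivAt)).add
    (k₂.hasFDerivAt.mul (d ey).hasFDerivAt)
  have h' : fderiv ℝ (fun q => fderiv ℝ g₀ q a * Dt w (g₀ q, g₁ q, g₂ q)
      + fderiv ℝ g₁ q a * Dx w (g₀ q, g₁ q, g₂ q) + fderiv ℝ g₂ q a * Dy w (g₀ q, g₁ q, g₂ q)) p = _ :=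
    h.fderiv
  rw [ev.fderiv_eq, h']
  simp only [add_apply, smul_apply, smul_eq_mul]
  have dx := fderiv_base_comp (sw ex).diff h₀.diff h₁.diff h₂.diff a
  rw [z₀, z₂] at dx ⊢
  rw [dx]
  have e : Dx (fun y => fderiv ℝ w y ex) = Dx (Dx w) := rfl
  rw [e]
  change _ + Dt w _ * _ + (_ + Dx w _ * _) + (_ + Dy w _ * _) = _
  ring

/-! ### Point transformations that are affine in `u` -/

/-- A sufficient condition for a map to be a point transformation between two equations. -/
theorem transforms_of_affine {E E' : Equation} {κ c₀ c₂ : ℝ} (hκ : κ ≠ 0) {Y α β : Base → ℝ}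
    (hY : ContDiff ℝ ∞ Y) (hα : ContDiff ℝ ∞ α) (hβ : ContDiff ℝ ∞ β)
    (xY : ∀ p, Dx Y p = 0) (xα : ∀ p, Dx α p = 0) (xβ : ∀ p, Dx β p = 0)
    (yY : ∀ p, Dy Y p ≠ 0) (α0 : ∀ p, α p ≠ 0)
    (hinj : ∀ p q : Base, p.1 = q.1 → Y p = Y q → p.2.2 = q.2.2)
    (hdom : ∀ p, ∀ u ∈ E.dom, α p * u + β p ∈ E'.dom)
    (hA : ∀ p, ∀ u ∈ E.dom, κ ^ 2 * E'.f₁ (α p * u + β p) = Dy Y p * E.f₁ u + Dt Y p)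
    (hB : ∀ p, ∀ u ∈ E.dom, κ ^ 2 * E'.f₂ (α p * u + β p)
      = α p * E.f₂ u + Dt α p * u + Dt β p + E.f₁ u * (Dy α p * u + Dy β p))
    {Φ : Total → Total}
    (hΦ : ∀ z, Φ z = ((κ ^ 2 * z.1.1 + c₀, κ * z.1.2.1 + c₂, Y z.1), α z.1 * z.2 + β z.1)) :
    Transforms Φ univ E E' := by
  have hΦ' : Φ = fun z => ((κ ^ 2 * z.1.1 + c₀, κ * z.1.2.1 + c₂, Y z.1), α z.1 * z.2 + β z.1) :=
    funext hΦ
  have c1 : ∀ {f : Base → ℝ}, ContDiff ℝ ∞ f → ContDiff ℝ ∞ (fun z : Total => f z.1) :=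
    fun hf => hf.comp contDiff_fst
  have st : ContDiff ℝ ∞ (fun p : Base => κ ^ 2 * p.1 + c₀) := by fun_prop
  have sx : ContDiff ℝ ∞ (fun p : Base => κ * p.2.1 + c₂) := by fun_prop
  have su : ContDiff ℝ ∞ (fun z : Total => α z.1 * z.2 + β z.1) :=
    ((c1 hα).mul contDiff_snd).add (c1 hβ)
  have hsm : ContDiff ℝ ∞ Φ := by
    rw [hΦ']
    exact ((c1 st).prodMk ((c1 sx).prodMk (c1 hY))).prodMk su
  have ft : ∀ p a, fderiv ℝ (fun p : Base => κ ^ 2 * p.1 + c₀) p a = κ ^ 2 * a.1 := by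
    intro p a
    have : HasFDerivAt (fun p : Base => κ ^ 2 * p.1 + c₀) (κ ^ 2 • ContinuousLinearMap.fst ℝ ℝ (ℝ × ℝ)) p :=
      (hasFDerivAt_fst.const_mul _).add_const _
    rw [this.fderiv]; simp
  have fx : ∀ p a, fderiv ℝ (fun p : Base => κ * p.2.1 + c₂) p a = κ * a.2.1 := by
    intro p a
    have : HasFDerivAt (fun p : Base => κ * p.2.1 + c₂)
        (κ • (ContinuousLinearMap.fst ℝ ℝ ℝ).comp (ContinuousLinearMap.snd ℝ ℝ (ℝ × ℝ))) p :=
      ((HasFDerivAt.comp p (f := Prod.snd) hasFDerivAt_fst hasFDerivAt_snd).const_mul _).add_const _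
    rw [this.fderiv]; simp
  refine ⟨hsm.contDiffOn, ?_, ?_, ?_, ?_⟩
  · rintro ⟨p, u⟩ - ⟨q, s⟩ - h
    simp only [hΦ, Prod.mk.injEq] at h
    obtain ⟨⟨h1, h2, h3⟩, h4⟩ := h
    have e1 : p.1 = q.1 := mul_left_cancel₀ (pow_ne_zero 2 hκ) (add_right_cancel h1)
    have e2 : p.2.1 = q.2.1 := mul_left_cancel₀ hκ (add_right_cancel h2)
    have e3 : p = q := Prod.ext e1 (Prod.ext e2 (hinj p q e1 h3))
    subst e3
    exact Prod.ext rfl (mul_left_cancel₀ (α0 p) (add_right_cancel h4))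
  · rintro ⟨p, u⟩ - hdet
    have hbase : ∀ {f : Base → ℝ}, ContDiff ℝ ∞ f → ∀ a s,
        fderiv ℝ (fun z : Total => f z.1) (p, u) (a, s) = fderiv ℝ f p a := by
      intro f hf a s
      have := HasFDerivAt.comp (p, u) (f := Prod.fst) (hf.differentiable (by simp) p).hasFDerivAt
        (hasFDerivAt_fst (𝕜 := ℝ) (E := Base) (F := ℝ))
      have h : fderiv ℝ (fun z : Total => f z.1) (p, u) = _ := this.fderiv
      rw [h]; rfl
    have dif : ∀ {f : Total → ℝ}, ContDiff ℝ ∞ f → HasFDerivAt f (fderiv ℝ f (p, u)) (p, u) :=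
      fun hf => (hf.differentiable (by simp) _).hasFDerivAt
    have hfd := ((dif (c1 st)).prodMk ((dif (c1 sx)).prodMk (dif (c1 hY)))).prodMk (dif su)
    rw [← hΦ'] at hfd
    -- The Jacobian is triangular with diagonal κ², κ, Y_y, α.
    have hker : LinearMap.ker (fderiv ℝ Φ (p, u) : Total →ₗ[ℝ] Total) = ⊥ := by
      rw [LinearMap.ker_eq_bot']
      rintro ⟨a, s⟩ ha
      rw [hfd.fderiv] at ha
      have ha' : ((fderiv ℝ (fun z : Total => κ ^ 2 * z.1.1 + c₀) (p, u) (a, s),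
        fderiv ℝ (fun z : Total => κ * z.1.2.1 + c₂) (p, u) (a, s),
        fderiv ℝ (fun z : Total => Y z.1) (p, u) (a, s)),
        fderiv ℝ (fun z : Total => α z.1 * z.2 + β z.1) (p, u) (a, s)) = (0 : Total) := ha
      rw [hbase st, hbase sx, hbase hY, fderiv_affine (hα.differentiable (by simp) p)
        (hβ.differentiable (by simp) p), ft, fx, fderiv_base'] at ha'
      simp only [Prod.mk_eq_zero] at ha'
      obtain ⟨⟨h1, h2, h3⟩, h4⟩ := ha'
      have e1 : a.1 = 0 := (mul_eq_zero.1 h1).resolve_left (pow_ne_zero 2 hκ)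
      have e2 : a.2.1 = 0 := (mul_eq_zero.1 h2).resolve_left hκ
      rw [e1, e2] at h3
      have e3 : a.2.2 = 0 := by
        have : a.2.2 * Dy Y p = 0 := by linarith
        exact (mul_eq_zero.1 this).resolve_right (yY p)
      have e4 : a = 0 := Prod.ext e1 (Prod.ext e2 e3)
      subst e4
      have : s * α p = 0 := by simpa using h4
      rw [(mul_eq_zero.1 this).resolve_right (α0 p)]
      rfl
    have := LinearMap.isUnit_iff_ker_eq_bot (fderiv ℝ Φ (p, u) : Total →ₗ[ℝ] Total) |>.2 hker
    exact (LinearMap.isUnit_iff_isUnit_det _).1 this |>.ne_zero hdet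
  · rintro ⟨p, u⟩ ⟨-, hu⟩
    rw [hΦ]
    exact hdom p u hu
  · intro u w p _ hu hus hws hev
    simp only [hΦ] at hws hev ⊢
    have hsu := su.contDiffAt (x := (p, u p))
    have haff : ∀ p ∈ univ, ∀ s ∈ univ, (fun z : Total => α z.1 * z.2 + β z.1) (p, s) = α p * s + β p :=
      fun _ _ _ _ => rfl
    have first : ∀ a, fderiv ℝ (fun q => w (κ ^ 2 * q.1 + c₀, κ * q.2.1 + c₂, Y q)) p a
        = graphFirst a (fun z : Total => α z.1 * z.2 + β z.1) (p, u p) (fderiv ℝ u p a) := by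
      intro a
      rw [Filter.EventuallyEq.fderiv_eq hev]
      exact fderiv_graph (h := fun z : Total => α z.1 * z.2 + β z.1) hsu.diff hus.diff a
    have second : fderiv ℝ (fun q => fderiv ℝ (fun q =>
        w (κ ^ 2 * q.1 + c₀, κ * q.2.1 + c₂, Y q)) q ex) p ex
        = graphSecond ex (fun z : Total => α z.1 * z.2 + β z.1) (p, u p) (Dx u p) (Dx (Dx u) p) := by
      have : (fun q => fderiv ℝ (fun q => w (κ ^ 2 * q.1 + c₀, κ * q.2.1 + c₂, Y q)) q ex)
          =ᶠ[𝓝 p] fun q => fderiv ℝ (fun q => α q * u q + β q) q ex := by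
        have hev' : (fun q => w (κ ^ 2 * q.1 + c₀, κ * q.2.1 + c₂, Y q)) =ᶠ[𝓝 p]
          fun q => α q * u q + β q := hev
        filter_upwards [hev'.fderiv (𝕜 := ℝ)] with q hq
        rw [hq]
      rw [this.fderiv_eq]
      exact fderiv_fderiv_graph (h := fun z : Total => α z.1 * z.2 + β z.1) hsu hus ex
    rw [fderiv_fderiv_base_comp (g₀ := fun p : Base => κ ^ 2 * p.1 + c₀)
      (g₁ := fun p : Base => κ * p.2.1 + c₂) hws st.contDiffAt sx.contDiffAt hY.contDiffAt ex
      ((ft _ _).trans (by simp)) (xY p), graphSecond_affine isOpen_univ isOpen_univ hα.contDiffOn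
      hβ.contDiffOn haff _ _ _ p trivial _ trivial] at second
    have first' := fun a => (fderiv_base_comp (g₀ := fun p : Base => κ ^ 2 * p.1 + c₀)
      (g₁ := fun p : Base => κ * p.2.1 + c₂) hws.diff st.contDiffAt.diff sx.contDiffAt.diff
      hY.contDiffAt.diff a).symm.trans (first a)
    have gf := fun a s => graphFirst_affine (h := fun z : Total => α z.1 * z.2 + β z.1) isOpen_univ
      isOpen_univ hα.contDiffOn hβ.contDiffOn haff a s (mem_univ p) (mem_univ (u p))
    simp only [gf, ft, fx] at first'
    have zz : ∀ {f : Base → ℝ}, (∀ p, Dx f p = 0) →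
        fderiv ℝ (fun q => fderiv ℝ f q ex) p ex = 0 := by
      intro f hf
      rw [fderiv_eq_zero_of_eqOn isOpen_univ (F := fun q => fderiv ℝ f q ex) (fun q _ => hf q)
        (mem_univ p)]; rfl
    have z2 : fderiv ℝ (fun q => κ * (ex : Base).2.1) p ex = 0 := by simp
    have z3 : fderiv ℝ (fun q => κ ^ 2 * (ex : Base).1) p ex = 0 := by simp
    simp only [ft, fx, zz xY, zz xα, zz xβ, z2, z3] at second
    have e1 := first' et
    have e2 := first' ey
    have xα' : fderiv ℝ α p ex = 0 := xα p
    rw [xα'] at second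
    change κ ^ 2 * 1 * _ + κ * 0 * _ + Dt Y p * _ = Dt α p * u p + Dt β p + Dt u p * α p at e1
    change κ ^ 2 * 0 * _ + κ * 0 * _ + Dy Y p * _ = Dy α p * u p + Dy β p + Dy u p * α p at e2
    have hA' := hA p (u p) hu
    have hB' := hB p (u p) hu
    have hw := hev.self_of_nhds
    unfold Equation.HoldsAt
    rw [hw]
    set P : Base := (κ ^ 2 * p.1 + c₀, κ * p.2.1 + c₂, Y p)
    -- The defects of the two equations are proportional with nonzero factors, so they vanish
    -- together.
    have main : κ ^ 2 * (Dt w P - Dx (Dx w) P + E'.f₁ (α p * u p + β p) * Dy w P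
        - E'.f₂ (α p * u p + β p)) =
        α p * (Dt u p - Dx (Dx u) p + E.f₁ (u p) * Dy u p - E.f₂ (u p)) := by
      have second' : Dx (Dx w) P * κ ^ 2 = Dx (Dx u) p * α p := by
        linear_combination second
      linear_combination e1 + E.f₁ (u p) * e2 - second' + Dy w P * hA' - hB'
    constructor
    · intro h
      rw [h, sub_self, mul_zero, mul_eq_zero] at main
      linarith [main.resolve_left (pow_ne_zero 2 hκ)]
    · intro h
      rw [h, sub_self, mul_zero, eq_comm, mul_eq_zero] at main
      linarith [main.resolve_left (α0 p)]

/-! ### The image of a graph under a point transformation -/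

/-- The hypothesis `hinj` says that the base part of Φ along the graph of φ is a local
diffeomorphism, so the image of the graph is locally the graph of a function w; the numbers are the
derivatives of w at the image point. The last clause is restricted to directions that are mapped to
multiples of ∂_x̄, where only w_xx appears. -/
theorem exists_image_jet {Φ : Total → Total} {B : Set Base} {E E' : Equation} (hB : IsOpen B)
    (h : Transforms Φ B E E') {p : Base} (hp : p ∈ B) {φ : Base → ℝ} (hφ : ContDiff ℝ ∞ φ)
    (hu : φ p ∈ E.dom)
    (hinj : ∀ a, graphFirst a (comp0 Φ) (p, φ p) (fderiv ℝ φ p a) = 0 →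
      graphFirst a (comp1 Φ) (p, φ p) (fderiv ℝ φ p a) = 0 →
      graphFirst a (comp2 Φ) (p, φ p) (fderiv ℝ φ p a) = 0 → a = 0) :
    ∃ wt wx wy wxx : ℝ,
      (E.HoldsAt φ p ↔ wt - wxx + E'.f₁ (comp3 Φ (p, φ p)) * wy = E'.f₂ (comp3 Φ (p, φ p))) ∧
      (∀ a s, fderiv ℝ φ p a = s → graphFirst a (comp3 Φ) (p, φ p) s
        = graphFirst a (comp0 Φ) (p, φ p) s * wt + graphFirst a (comp1 Φ) (p, φ p) s * wx
          + graphFirst a (comp2 Φ) (p, φ p) s * wy) ∧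
      (∀ a s r, fderiv ℝ φ p a = s → fderiv ℝ (fun q => fderiv ℝ φ q a) p a = r →
        graphFirst a (comp0 Φ) (p, φ p) s = 0 → graphFirst a (comp2 Φ) (p, φ p) s = 0 →
        graphSecond a (comp3 Φ) (p, φ p) s r = wxx * graphFirst a (comp1 Φ) (p, φ p) s ^ 2
          + graphSecond a (comp0 Φ) (p, φ p) s r * wt + graphSecond a (comp1 Φ) (p, φ p) s r * wx
          + graphSecond a (comp2 Φ) (p, φ p) s r * wy) := by
  have hΦ : ContDiffAt ℝ ∞ Φ (p, φ p) :=
    h.1.contDiffAt ((hB.prod E.isOpen_dom).mem_nhds ⟨hp, hu⟩)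
  obtain ⟨h0, h1, h2, h3⟩ := smoothAt_comp hΦ
  have hφp : ContDiffAt ℝ ∞ φ p := hφ.contDiffAt
  set G : Base → Base := fun q => (Φ (q, φ q)).1 with hGdef
  have s0 := smooth_graph h0 hφp
  have s1 := smooth_graph h1 hφp
  have s2 := smooth_graph h2 hφp
  have hG : ContDiffAt ℝ ∞ G p := s0.prodMk (s1.prodMk s2)
  have hGf : fderiv ℝ G p = _ :=
    (s0.diff.hasFDerivAt.prodMk (s1.diff.hasFDerivAt.prodMk s2.diff.hasFDerivAt)).fderiv
  have g0 := fun a => fderiv_graph h0.diff hφp.diff a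
  have g1 := fun a => fderiv_graph h1.diff hφp.diff a
  have g2 := fun a => fderiv_graph h2.diff hφp.diff a
  have g3 := fun a => fderiv_graph h3.diff hφp.diff a
  have inj : Function.Injective (fderiv ℝ G p : Base →ₗ[ℝ] Base) := by
    rw [← LinearMap.ker_eq_bot, LinearMap.ker_eq_bot']
    intro a ha
    rw [hGf] at ha
    have ha' : (fderiv ℝ (fun q => comp0 Φ (q, φ q)) p a, fderiv ℝ (fun q => comp1 Φ (q, φ q)) p a,
      fderiv ℝ (fun q => comp2 Φ (q, φ q)) p a) = (0 : Base) := ha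
    rw [g0, g1, g2] at ha'
    simp only [Prod.mk_eq_zero] at ha'
    exact hinj a ha'.1 ha'.2.1 ha'.2.2
  -- An injective endomorphism in finite dimension is invertible, so the inverse function theorem
  -- gives `g`, and w is the last component of Φ along the graph composed with `g`.
  set e : Base ≃L[ℝ] Base := (LinearEquiv.ofInjectiveEndo _ inj).toContinuousLinearEquiv
  have hGe : HasFDerivAt G (e : Base →L[ℝ] Base) p := by
    have h' := (hG.differentiableAt (by simp)).hasFDerivAt
    have : (e : Base →L[ℝ] Base) = fderiv ℝ G p :=
      ContinuousLinearMap.ext fun a => rfl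
    rwa [this]
  have hn : (∞ : WithTop ℕ∞) ≠ 0 := by simp
  set g : Base → Base := hG.localInverse hGe hn
  have hg : ContDiffAt ℝ ∞ g (G p) := hG.to_localInverse hGe hn
  have hgG : ∀ᶠ q in 𝓝 p, g (G q) = q :=
    (hG.hasStrictFDerivAt' hGe hn).eventually_left_inverse
  have hgp : g (G p) = p := hgG.self_of_nhds
  set w : Base → ℝ := fun P => comp3 Φ (g P, φ (g P)) with hwdef
  have hw : ContDiffAt ℝ ∞ w (G p) := by
    have h4 : ContDiffAt ℝ ∞ (fun q => comp3 Φ (q, φ q)) (g (G p)) := by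
      rw [hgp]; exact smooth_graph h3 hφp
    exact ContDiffAt.comp (G p) (f := g) h4 hg
  have hev : ∀ᶠ q in 𝓝 p, w (Φ (q, φ q)).1 = (Φ (q, φ q)).2 := by
    filter_upwards [hgG] with q hq
    change comp3 Φ (g (G q), φ (g (G q))) = _
    rw [hq]; rfl
  have hev' : (fun q => w (comp0 Φ (q, φ q), comp1 Φ (q, φ q), comp2 Φ (q, φ q)))
      =ᶠ[𝓝 p] fun q => comp3 Φ (q, φ q) := hev
  have hold := h.2.2.2.2 φ w p hp hu hφp hw hev
  have hval : w (Φ (p, φ p)).1 = comp3 Φ (p, φ p) := hev.self_of_nhds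
  refine ⟨Dt w (G p), Dx w (G p), Dy w (G p), Dx (Dx w) (G p), ?_, ?_, ?_⟩
  · rw [hold]
    unfold Equation.HoldsAt
    rw [hval]
  · rintro a s rfl
    have e1 := fderiv_base_comp (w := w) (g₀ := fun q => comp0 Φ (q, φ q))
      (g₁ := fun q => comp1 Φ (q, φ q)) (g₂ := fun q => comp2 Φ (q, φ q)) hw.diff s0.diff s1.diff
      s2.diff a
    rw [hev'.fderiv_eq, g0, g1, g2, g3] at e1
    exact e1
  · rintro a s r rfl rfl z0 z2
    have e1 := fderiv_fderiv_base_comp (w := w) (g₀ := fun q => comp0 Φ (q, φ q))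
      (g₁ := fun q => comp1 Φ (q, φ q)) (g₂ := fun q => comp2 Φ (q, φ q)) hw s0 s1
      s2 a ((g0 a).trans z0) ((g2 a).trans z2)
    have ev2 : (fun q => fderiv ℝ
        (fun q => w (comp0 Φ (q, φ q), comp1 Φ (q, φ q), comp2 Φ (q, φ q))) q a)
        =ᶠ[𝓝 p] fun q => fderiv ℝ (fun q => comp3 Φ (q, φ q)) q a := by
      filter_upwards [hev'.fderiv (𝕜 := ℝ)] with q hq
      rw [hq]
    rw [ev2.fderiv_eq, fderiv_fderiv_graph h3 hφp, fderiv_fderiv_graph h0 hφp,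
      fderiv_fderiv_graph h1 hφp, fderiv_fderiv_graph h2 hφp, g1] at e1
    exact e1

/-- The linear form on the base with coefficients `σ`. -/
def slope (σ a : Base) : ℝ := σ.1 * a.1 + σ.2.1 * a.2.1 + σ.2.2 * a.2.2

/-- A graph with slope `σ` through `z` is mapped to a graph. -/
def Transversal (Φ : Total → Total) (z : Total) (σ : Base) : Prop :=
  ∀ a, graphFirst a (comp0 Φ) z (slope σ a) = 0 → graphFirst a (comp1 Φ) z (slope σ a) = 0 →
    graphFirst a (comp2 Φ) z (slope σ a) = 0 → a = 0

theorem graphFirst_add (a b : Base) (h : Total → ℝ) (z : Total) (s r : ℝ) :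
    graphFirst (a + b) h z (s + r) = graphFirst a h z s + graphFirst b h z r := by
  unfold graphFirst
  rw [← fderiv_total, ← fderiv_total, ← fderiv_total, ← map_add]
  rfl

theorem graphFirst_smul (c : ℝ) (a : Base) (h : Total → ℝ) (z : Total) (s : ℝ) :
    graphFirst (c • a) h z (c * s) = c * graphFirst a h z s := by
  unfold graphFirst
  have e : ((c • a, c * s) : Total) = c • (a, s) := rfl
  rw [← fderiv_total, ← fderiv_total, e, map_smul, smul_eq_mul]

theorem graphFirst_zero_one (h : Total → ℝ) (z : Total) : graphFirst 0 h z 1 = dU h z := by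
  unfold graphFirst
  rw [← fderiv_total]
  rfl

theorem slope_smul (σ : Base) (c : ℝ) (a : Base) : slope σ (c • a) = c * slope σ a := by
  simp [slope]; ring

theorem slope_add (σ a b : Base) : slope σ (a + b) = slope σ a + slope σ b := by
  simp [slope]; ring

/-! ### Point transformations preserve the x-direction -/

section PointTransformation

variable {Φ : Total → Total} {B : Set Base} {E E' : Equation}

theorem fderiv_components {z : Total} (hΦ : ContDiffAt ℝ ∞ Φ z) (a : Base) (s : ℝ) :
    fderiv ℝ Φ z (a, s) = ((graphFirst a (comp0 Φ) z s, graphFirst a (comp1 Φ) z s,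
      graphFirst a (comp2 Φ) z s), graphFirst a (comp3 Φ) z s) := by
  obtain ⟨h0, h1, h2, h3⟩ := smoothAt_comp hΦ
  have h : HasFDerivAt Φ _ z := (h0.diff.hasFDerivAt.prodMk (h1.diff.hasFDerivAt.prodMk
    h2.diff.hasFDerivAt)).prodMk h3.diff.hasFDerivAt
  rw [h.fderiv]
  unfold graphFirst
  rw [← fderiv_total, ← fderiv_total, ← fderiv_total, ← fderiv_total]
  rfl

/-- The derivative of a point transformation is injective, in terms of the components. -/
theorem Transforms.injective_jet (hB : IsOpen B) (h : Transforms Φ B E E') {z : Total}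
    (hz : z ∈ B ×ˢ E.dom) (a : Base) (s : ℝ) (e0 : graphFirst a (comp0 Φ) z s = 0)
    (e1 : graphFirst a (comp1 Φ) z s = 0) (e2 : graphFirst a (comp2 Φ) z s = 0)
    (e3 : graphFirst a (comp3 Φ) z s = 0) : a = 0 ∧ s = 0 := by
  have hΦ : ContDiffAt ℝ ∞ Φ z := h.1.contDiffAt ((hB.prod E.isOpen_dom).mem_nhds hz)
  have hd : LinearMap.det (fderiv ℝ Φ z : Total →ₗ[ℝ] Total) ≠ 0 := h.2.2.1 z hz
  have hk := (LinearMap.isUnit_iff_ker_eq_bot _).1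
    ((LinearMap.isUnit_iff_isUnit_det _).2 (isUnit_iff_ne_zero.2 hd))
  have := (LinearMap.ker_eq_bot'.1 hk) (a, s) (by
    change fderiv ℝ Φ z (a, s) = 0
    rw [fderiv_components hΦ, e0, e1, e2, e3]; rfl)
  simpa using this

/-- The vector (n, r) is the preimage of ∂_ū under the derivative of Φ. It is the one direction that
a tangent space must avoid for the image of the graph to be a graph. -/
theorem Transforms.exists_vertical (hB : IsOpen B) (h : Transforms Φ B E E') {z : Total}
    (hz : z ∈ B ×ˢ E.dom) : ∃ (n : Base) (r : ℝ), graphFirst n (comp0 Φ) z r = 0 ∧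
      graphFirst n (comp1 Φ) z r = 0 ∧ graphFirst n (comp2 Φ) z r = 0 ∧
      graphFirst n (comp3 Φ) z r = 1 := by
  have hΦ : ContDiffAt ℝ ∞ Φ z := h.1.contDiffAt ((hB.prod E.isOpen_dom).mem_nhds hz)
  have hd : LinearMap.det (fderiv ℝ Φ z : Total →ₗ[ℝ] Total) ≠ 0 := h.2.2.1 z hz
  have hk := (LinearMap.isUnit_iff_range_eq_top _).1
    ((LinearMap.isUnit_iff_isUnit_det _).2 (isUnit_iff_ne_zero.2 hd))
  obtain ⟨⟨n, r⟩, hnr⟩ := LinearMap.range_eq_top.1 hk (0, 1)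
  have hnr' : fderiv ℝ Φ z (n, r) = (0, 1) := hnr
  rw [fderiv_components hΦ] at hnr'
  simp only [Prod.mk.injEq, Prod.mk_eq_zero] at hnr'
  exact ⟨n, r, hnr'.1.1, hnr'.1.2.1, hnr'.1.2.2, hnr'.2⟩

/-- A tangent vector whose image has zero base part is mapped to a multiple of ∂_ū, hence is that
multiple of (n, r); since (n, r) is not tangent to the graph, the multiple is 0. -/
theorem Transforms.transversal_of_ne (hB : IsOpen B) (h : Transforms Φ B E E') {z : Total}
    (hz : z ∈ B ×ˢ E.dom) {n : Base} {r : ℝ} (n0 : graphFirst n (comp0 Φ) z r = 0)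
    (n1 : graphFirst n (comp1 Φ) z r = 0) (n2 : graphFirst n (comp2 Φ) z r = 0)
    (n3 : graphFirst n (comp3 Φ) z r = 1) {σ : Base} (hσ : slope σ n ≠ r) : Transversal Φ z σ := by
  intro a a0 a1 a2
  set l := graphFirst a (comp3 Φ) z (slope σ a)
  have key : ∀ g : Total → ℝ, graphFirst (a + (-l) • n) g z (slope σ a + (-l) * r)
      = graphFirst a g z (slope σ a) - l * graphFirst n g z r := by
    intro g
    rw [graphFirst_add, graphFirst_smul]; ring
  obtain ⟨k1, k2⟩ := h.injective_jet hB hz (a + (-l) • n) (slope σ a + (-l) * r)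
    (by rw [key, a0, n0]; ring) (by rw [key, a1, n1]; ring) (by rw [key, a2, n2]; ring)
    (by rw [key, n3]; ring)
  have k3 : slope σ a + (-l) * slope σ n = 0 := by
    rw [← slope_smul, ← slope_add, k1]; simp [slope]
  have hl : l * (slope σ n - r) = 0 := by linear_combination k2 - k3
  have hl0 : l = 0 := (mul_eq_zero.1 hl).resolve_right (sub_ne_zero.2 hσ)
  simpa [hl0] using k1

/-- Transversality excludes only the slopes with σ·n = r, an affine hyperplane or the empty set. Two
admissible values of u_x are what is needed to separate the x-derivative from the u-derivative
later. -/
theorem Transforms.exists_transversal_pair (hB : IsOpen B) (h : Transforms Φ B E E') {z : Total}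
    (hz : z ∈ B ×ˢ E.dom) : ∃ σ σ' : Base, Transversal Φ z σ ∧ Transversal Φ z σ' ∧
      σ.2.1 ≠ σ'.2.1 := by
  obtain ⟨n, r, n0, n1, n2, n3⟩ := h.exists_vertical hB hz
  have tr : ∀ {σ : Base}, slope σ n ≠ r → Transversal Φ z σ :=
    fun hσ => h.transversal_of_ne hB hz n0 n1 n2 n3 hσ
  by_cases ht : n.1 = 0
  · by_cases hy : n.2.2 = 0
    · by_cases hx : n.2.1 = 0
      -- For n = 0 the preimage of ∂_ū is a nonzero multiple of ∂_u, and every slope is transversal.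
      · have hr : r ≠ 0 := by
          rintro rfl
          have hn : n = 0 := Prod.ext ht (Prod.ext hx hy)
          subst hn
          have : graphFirst 0 (comp3 Φ) z 0 = 0 := by
            simpa using graphFirst_smul 0 0 (comp3 Φ) z 0
          rw [this] at n3
          exact zero_ne_one n3
        exact ⟨(0, 0, 0), (0, 1, 0), tr (by simp [slope, hx, hr.symm]), tr (by simp [slope, hx, hr.symm]),
          by simp⟩
      · refine ⟨(0, (r + 1) / n.2.1, 0), (0, (r + 2) / n.2.1, 0), tr ?_, tr ?_, ?_⟩
        · simp only [slope]; field_simp; simp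
        · simp only [slope]; field_simp; simp
        · intro e
          have e : (r + 1) / n.2.1 = (r + 2) / n.2.1 := e
          field_simp at e
          linarith
    · refine ⟨(0, 0, (r + 1) / n.2.2), (0, 1, (r + 1 - n.2.1) / n.2.2), tr ?_, tr ?_, by simp⟩
      · simp only [slope]; field_simp; simp
      · simp only [slope]; field_simp; intro e; linarith
  · refine ⟨((r + 1) / n.1, 0, 0), ((r + 1 - n.2.1) / n.1, 1, 0), tr ?_, tr ?_, by simp⟩
    · simp only [slope]; field_simp; simp
    · simp only [slope]; field_simp; intro e; linarith

/-- The images of the graphs of quadratic polynomials. -/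
theorem Transforms.exists_jet (hB : IsOpen B) (h : Transforms Φ B E E') {p : Base} {u : ℝ} (hp : p ∈ B)
    (hu : u ∈ E.dom) {σ : Base} (hσ : Transversal Φ (p, u) σ) (tt yy xx : ℝ)
    (hE : σ.1 - xx + E.f₁ u * σ.2.2 = E.f₂ u) :
    ∃ wt wx wy wxx : ℝ,
      wt - wxx + E'.f₁ (comp3 Φ (p, u)) * wy = E'.f₂ (comp3 Φ (p, u)) ∧
      (∀ a, graphFirst a (comp3 Φ) (p, u) (slope σ a)
        = graphFirst a (comp0 Φ) (p, u) (slope σ a) * wt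
          + graphFirst a (comp1 Φ) (p, u) (slope σ a) * wx
          + graphFirst a (comp2 Φ) (p, u) (slope σ a) * wy) ∧
      (∀ a r, r = tt * a.1 ^ 2 + xx * a.2.1 ^ 2 + yy * a.2.2 ^ 2 →
        graphFirst a (comp0 Φ) (p, u) (slope σ a) = 0 →
        graphFirst a (comp2 Φ) (p, u) (slope σ a) = 0 →
        graphSecond a (comp3 Φ) (p, u) (slope σ a) r
          = wxx * graphFirst a (comp1 Φ) (p, u) (slope σ a) ^ 2
          + graphSecond a (comp0 Φ) (p, u) (slope σ a) r * wt
          + graphSecond a (comp1 Φ) (p, u) (slope σ a) r * wx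
          + graphSecond a (comp2 Φ) (p, u) (slope σ a) r * wy) := by
  set φ := quadPoly p u σ.1 σ.2.1 σ.2.2 tt xx yy 0 0 0 with hφ
  have e0 : φ p = u := quadPoly_self ..
  have e1 : ∀ a, fderiv ℝ φ p a = slope σ a := by
    intro a; rw [hφ, fderiv_quadPoly, quadPoly_self]; rfl
  have e2 : ∀ a, fderiv ℝ (fun q => fderiv ℝ φ q a) p a
      = tt * a.1 ^ 2 + xx * a.2.1 ^ 2 + yy * a.2.2 ^ 2 := by
    intro a; rw [hφ, fderiv_fderiv_quadPoly]; ring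
  obtain ⟨wt, wx, wy, wxx, k1, k2, k3⟩ := exists_image_jet hB h hp (contDiff_quadPoly ..)
    (φ := φ) (by rwa [e0]) (by
      intro a
      rw [e0, e1]
      exact hσ a)
  rw [e0] at k1 k2 k3
  refine ⟨wt, wx, wy, wxx, k1.1 ?_, fun a => k2 a _ (e1 a), fun a r hr => k3 a _ r (e1 a) (hr ▸ e2 a)⟩
  unfold Equation.HoldsAt
  have f1 : Dt φ p = σ.1 := (e1 et).trans (by simp [slope])
  have f2 : Dy φ p = σ.2.2 := (e1 ey).trans (by simp [slope])
  have f3 : Dx (Dx φ) p = xx := (e2 ex).trans (by simp)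
  rw [f1, f2, f3, e0]
  exact hE

theorem Transversal.exists_preimage {z : Total} {σ : Base} (hσ : Transversal Φ z σ) (b : Base) :
    ∃ a, graphFirst a (comp0 Φ) z (slope σ a) = b.1 ∧ graphFirst a (comp1 Φ) z (slope σ a) = b.2.1 ∧
      graphFirst a (comp2 Φ) z (slope σ a) = b.2.2 := by
  let G : Base →ₗ[ℝ] Base :=
    { toFun := fun a => (graphFirst a (comp0 Φ) z (slope σ a), graphFirst a (comp1 Φ) z (slope σ a),
        graphFirst a (comp2 Φ) z (slope σ a))
      map_add' := by intro a b; simp only [slope_add, graphFirst_add]; rfl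
      map_smul' := by intro c a; simp only [slope_smul, graphFirst_smul]; rfl }
  have hG : Function.Injective G := by
    rw [← LinearMap.ker_eq_bot, LinearMap.ker_eq_bot']
    intro a ha
    have ha' : (graphFirst a (comp0 Φ) z (slope σ a), graphFirst a (comp1 Φ) z (slope σ a),
        graphFirst a (comp2 Φ) z (slope σ a)) = (0 : Base) := ha
    simp only [Prod.mk_eq_zero] at ha'
    exact hσ a ha'.1 ha'.2.1 ha'.2.2
  obtain ⟨a, rfl⟩ := LinearMap.injective_iff_surjective.1 hG b
  exact ⟨a, rfl, rfl, rfl⟩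

/-- Two graphs with the same 1-jet and u_xx but different u_tt and u_yy both satisfy E. Their images
have the same first derivatives, hence by E' the same w_xx. Comparing second derivatives along the
preimage `a` of ∂_x̄ gives u_tt a_t² + u_yy a_y² = 0 for arbitrary u_tt, u_yy, so `a` is a multiple
of ∂_x. -/
theorem Transforms.graphFirst_ex_eq_zero (hB : IsOpen B) (h : Transforms Φ B E E') {p : Base} {u : ℝ}
    (hp : p ∈ B) (hu : u ∈ E.dom) {σ : Base} (hσ : Transversal Φ (p, u) σ) :
    graphFirst ex (comp0 Φ) (p, u) σ.2.1 = 0 ∧ graphFirst ex (comp2 Φ) (p, u) σ.2.1 = 0 := by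
  obtain ⟨a, a0, a1, a2⟩ := hσ.exists_preimage (0, 1, 0)
  obtain ⟨b, b0, b1, b2⟩ := hσ.exists_preimage (1, 0, 0)
  obtain ⟨c, c0, c1, c2⟩ := hσ.exists_preimage (0, 0, 1)
  obtain ⟨m, m0, m1, m2⟩ := hσ.exists_preimage
    (dU (comp0 Φ) (p, u), dU (comp1 Φ) (p, u), dU (comp2 Φ) (p, u))
  simp only at a0 a1 a2 b0 b1 b2 c0 c1 c2 m0 m1 m2
  -- two graphs whose second derivatives differ by a multiple of `dt²` and `dy²`
  have main : ∀ tt yy : ℝ, tt * a.1 ^ 2 + yy * a.2.2 ^ 2 = 0 := by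
    intro tt yy
    obtain ⟨wt, wx, wy, wxx, k1, k2, k3⟩ := h.exists_jet hB hp hu hσ 0 0
      (σ.1 + E.f₁ u * σ.2.2 - E.f₂ u) (by ring)
    obtain ⟨wt', wx', wy', wxx', k1', k2', k3'⟩ := h.exists_jet hB hp hu hσ tt yy
      (σ.1 + E.f₁ u * σ.2.2 - E.f₂ u) (by ring)
    have ea := k2 a; have ea' := k2' a; have eb := k2 b; have eb' := k2' b
    have ec := k2 c; have ec' := k2' c; have em := k2 m
    rw [a0, a1, a2] at ea ea'
    rw [b0, b1, b2] at eb eb'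
    rw [c0, c1, c2] at ec ec'
    rw [m0, m1, m2] at em
    have hx : wx = wx' := by linarith
    have ht : wt = wt' := by linarith
    have hy : wy = wy' := by linarith
    subst hx ht hy
    have hxx : wxx = wxx' := by linarith
    subst hxx
    have s := k3 a _ rfl a0 a2
    have s' := k3' a _ rfl a0 a2
    simp only [graphSecond] at s s'
    have hprod : (tt * a.1 ^ 2 + yy * a.2.2 ^ 2) * (dU (comp3 Φ) (p, u)
        - (dU (comp0 Φ) (p, u) * wt + dU (comp1 Φ) (p, u) * wx + dU (comp2 Φ) (p, u) * wy)) = 0 := by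
      linear_combination s' - s
    -- If the second factor were 0, the tangent vector over `m` and the vector ∂_u would have the
    -- same image under the derivative of Φ, so ∂_u would be tangent to the graph.
    refine (mul_eq_zero.1 hprod).resolve_right fun hU => ?_
    have key : ∀ g : Total → ℝ, graphFirst (m + (-1 : ℝ) • 0) g (p, u) (slope σ m + (-1) * 1)
        = graphFirst m g (p, u) (slope σ m) - dU g (p, u) := by
      intro g
      rw [graphFirst_add, graphFirst_smul, graphFirst_zero_one]; ring
    obtain ⟨k4, k5⟩ := h.injective_jet hB ⟨hp, hu⟩ (m + (-1 : ℝ) • 0) (slope σ m + (-1) * 1)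
      (by rw [key, m0]; ring) (by rw [key, m1]; ring) (by rw [key, m2]; ring)
      (by rw [key, em]; linarith)
    have k6 : m = 0 := by simpa using k4
    rw [k6] at k5
    simp [slope] at k5
  have ha1 : a.1 = 0 := by simpa using main 1 0
  have ha2 : a.2.2 = 0 := by simpa using main 0 1
  have ha : a = a.2.1 • ex := Prod.ext (by simp [ha1]) (Prod.ext (by simp) (by simp [ha2]))
  have hne : a.2.1 ≠ 0 := by
    intro h0
    rw [h0, zero_smul] at ha
    rw [ha] at a1
    have : graphFirst 0 (comp1 Φ) (p, u) (slope σ 0) = 0 := by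
      simpa [slope] using graphFirst_smul 0 0 (comp1 Φ) (p, u) 0
    rw [this] at a1
    exact zero_ne_one a1
  have hs : slope σ a = a.2.1 * σ.2.1 := by simp [slope, ha1, ha2]; ring
  have e : ∀ g : Total → ℝ, graphFirst a g (p, u) (slope σ a)
      = a.2.1 * graphFirst ex g (p, u) σ.2.1 := by
    intro g
    rw [hs, ← graphFirst_smul, ← ha]
  rw [e] at a0 a2
  exact ⟨(mul_eq_zero.1 a0).resolve_left hne, (mul_eq_zero.1 a2).resolve_left hne⟩

/-- The previous relation is affine in u_x and holds for two different values of u_x. -/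
theorem Transforms.time_components (hB : IsOpen B) (h : Transforms Φ B E E') {p : Base} {u : ℝ}
    (hp : p ∈ B) (hu : u ∈ E.dom) :
    (dB ex (comp0 Φ) (p, u) = 0 ∧ dU (comp0 Φ) (p, u) = 0) ∧
      (dB ex (comp2 Φ) (p, u) = 0 ∧ dU (comp2 Φ) (p, u) = 0) := by
  obtain ⟨σ, σ', h1, h2, hne⟩ := h.exists_transversal_pair hB (z := (p, u)) ⟨hp, hu⟩
  obtain ⟨a1, a2⟩ := h.graphFirst_ex_eq_zero hB hp hu h1
  obtain ⟨b1, b2⟩ := h.graphFirst_ex_eq_zero hB hp hu h2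
  unfold graphFirst at a1 a2 b1 b2
  have aux : ∀ A D : ℝ, A + σ.2.1 * D = 0 → A + σ'.2.1 * D = 0 → A = 0 ∧ D = 0 := by
    intro A D e e'
    have : (σ.2.1 - σ'.2.1) * D = 0 := by linarith
    have hD := (mul_eq_zero.1 this).resolve_left (sub_ne_zero.2 hne)
    subst hD
    exact ⟨by linarith, rfl⟩
  exact ⟨aux _ _ a1 b1, aux _ _ a2 b2⟩

end PointTransformation

/-- The data of a point transformation
`(t, x, y, u) ↦ (k t + c, √k x + c', Y(t, y), α(t, y) u + β(t, y))` between two equations. -/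
structure AffineLink (E E' : Equation) (B : Set Base) (k : ℝ) (Y α β : Base → ℝ) : Prop where
  pos : 0 < k
  smooth_Y : ContDiffOn ℝ ∞ Y B
  smooth_α : ContDiffOn ℝ ∞ α B
  smooth_β : ContDiffOn ℝ ∞ β B
  dy_ne : ∀ p ∈ B, Dy Y p ≠ 0
  α_ne : ∀ p ∈ B, α p ≠ 0
  maps : ∀ p ∈ B, ∀ u ∈ E.dom, α p * u + β p ∈ E'.dom
  eqA : ∀ p ∈ B, ∀ u ∈ E.dom, k * E'.f₁ (α p * u + β p) = Dy Y p * E.f₁ u + Dt Y p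
  eqB : ∀ p ∈ B, ∀ u ∈ E.dom, k * E'.f₂ (α p * u + β p)
      = α p * E.f₂ u + Dt α p * u + Dt β p + E.f₁ u * (Dy α p * u + Dy β p)

theorem affine_eq_zero_of_eventually {A B u : ℝ} (ev : ∀ᶠ s in 𝓝 u, A * s + B = 0) :
    A = 0 ∧ B = 0 := by
  have ev2 : (fun s => A * s + B) =ᶠ[𝓝 u] fun _ => 0 := ev
  have hA : A = 0 := by
    have hd : HasDerivAt (fun s => A * s + B) (A * 1) u := ((hasDerivAt_id u).const_mul A).add_const B
    have := hd.deriv.symm.trans ev2.deriv_eq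
    simpa using this
  subst hA
  exact ⟨rfl, by simpa using ev2.self_of_nhds⟩

theorem exists_mem_affine_ne_zero {I : Set ℝ} (hI : IsOpen I) (hne : I.Nonempty) {a b : ℝ}
    (ha : a ≠ 0) : ∃ u ∈ I, a * u + b ≠ 0 := by
  by_contra! hc
  obtain ⟨u, hu⟩ := hne
  exact ha (affine_eq_zero_of_eventually (u := u) (by
    filter_upwards [hI.mem_nhds hu] with s hs using hc s hs)).1

/-- The single excluded point allows for powers: their derivative can vanish, but only where the
argument au + b is 0. -/
theorem affine_eq_zero_of_mul {I : Set ℝ} (hI : IsOpen I) (hne : I.Nonempty) {a b A B : ℝ}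
    (ha : a ≠ 0) (h : ∀ u ∈ I, a * u + b ≠ 0 → A * u + B = 0) : A = 0 ∧ B = 0 := by
  obtain ⟨u, hu, hu'⟩ := exists_mem_affine_ne_zero hI hne (b := b) ha
  refine affine_eq_zero_of_eventually (u := u) ?_
  have hc : ContinuousAt (fun s => a * s + b) u := by fun_prop
  filter_upwards [hI.mem_nhds hu, hc.eventually_ne hu'] with s hs hs' using h s hs hs'

/-- The derivative of the relation between the functions `f₁` along the base. -/
theorem fderiv_link {E E' : Equation} {B : Set Base} (hB : IsOpen B) {k Y α β : Base → ℝ}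
    (hk : ContDiffOn ℝ ∞ k B) (hY : ContDiffOn ℝ ∞ Y B) (hα : ContDiffOn ℝ ∞ α B)
    (hβ : ContDiffOn ℝ ∞ β B)
    (maps : ∀ p ∈ B, ∀ u ∈ E.dom, α p * u + β p ∈ E'.dom)
    (eqA : ∀ p ∈ B, ∀ u ∈ E.dom, k p * E'.f₁ (α p * u + β p) = Dy Y p * E.f₁ u + Dt Y p)
    {p : Base} (hp : p ∈ B) {u : ℝ} (hu : u ∈ E.dom) (a : Base) (hka : fderiv ℝ k p a = 0) :
    k p * (deriv E'.f₁ (α p * u + β p) * (fderiv ℝ α p a * u + fderiv ℝ β p a))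
      = fderiv ℝ (Dy Y) p a * E.f₁ u + fderiv ℝ (Dt Y) p a := by
  have dif : ∀ {f : Base → ℝ}, ContDiffOn ℝ ∞ f B → HasFDerivAt f (fderiv ℝ f p) p := fun hf =>
    (hf.contDiffAt (hB.mem_nhds hp)).diff.hasFDerivAt
  have hin := ((dif hα).mul_const u).add (dif hβ)
  have hf := (E'.differentiableAt_f₁ (maps p hp u hu)).hasDerivAt.comp_hasFDerivAt p hin
  have hl := (dif hk).mul hf
  have hr := ((dif (smoothOn_fderiv_apply hB hY ey)).mul_const (E.f₁ u)).add
    (dif (smoothOn_fderiv_apply hB hY et))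
  have ev : (fun q => k q * E'.f₁ (α q * u + β q)) =ᶠ[𝓝 p] fun q => Dy Y q * E.f₁ u + Dt Y q := by
    filter_upwards [hB.mem_nhds hp] with q hq using eqA q hq u hu
  have e := hl.fderiv.symm.trans (ev.fderiv_eq.trans hr.fderiv)
  have e' := DFunLike.congr_fun e a
  simp only [add_apply, smul_apply, smul_eq_mul, hka] at e'
  change k p * (deriv E'.f₁ (α p * u + β p) * (u * fderiv ℝ α p a + fderiv ℝ β p a)) + _
    = E.f₁ u * fderiv ℝ (Dy Y) p a + fderiv ℝ (Dt Y) p a at e'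
  linear_combination e'

/-! ### Point transformations are affine in u -/

section PointTransformation

variable {Φ : Total → Total} {B : Set Base} {E E' : Equation}

theorem graphFirst_et (h : Total → ℝ) (z : Total) (σ : Base) :
    graphFirst et h z (slope σ et) = dB et h z + σ.1 * dU h z := by simp [graphFirst, slope]

theorem graphFirst_ex (h : Total → ℝ) (z : Total) (σ : Base) :
    graphFirst ex h z (slope σ ex) = dB ex h z + σ.2.1 * dU h z := by simp [graphFirst, slope]

theorem graphFirst_ey (h : Total → ℝ) (z : Total) (σ : Base) :
    graphFirst ey h z (slope σ ey) = dB ey h z + σ.2.2 * dU h z := by simp [graphFirst, slope]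

theorem graphFirst_coord (h : Total → ℝ) (z : Total) (a : Base) (s : ℝ) :
    graphFirst a h z s = a.1 * dB et h z + a.2.1 * dB ex h z + a.2.2 * dB ey h z + s * dU h z := by
  have := dB_base h z a.1 a.2.1 a.2.2
  unfold graphFirst
  rw [← this]

/-- A point transformation between two equations is affine in `u`, and its parts depend on the
independent variables in a restricted way. -/
theorem Transforms.exists_affineLink (hB : IsOpen B) (hBc : IsPreconnected B)
    (hBne : B.Nonempty) (h : Transforms Φ B E E')
    (hE' : ∀ u ∈ E'.dom, u ≠ 0 → deriv E'.f₁ u ≠ 0) :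
    ∃ (k : ℝ) (Y α β : Base → ℝ), AffineLink E E' B k Y α β := by
  have hI := E.isOpen_dom
  have hI' := E.ordConnected_dom
  have hne := E.nonempty_dom
  obtain ⟨h0, h1, h2, h3⟩ := smoothOn_comp h.1
  obtain ⟨T, hT, eT⟩ := exists_base_function hB hI hI' hne h0
    fun p hp u hu => (h.time_components hB hp hu).1.2
  obtain ⟨Y, hY, eY⟩ := exists_base_function hB hI hI' hne h2
    fun p hp u hu => (h.time_components hB hp hu).2.2
  have dbase : ∀ {g : Total → ℝ} {f : Base → ℝ}, ContDiffOn ℝ ∞ f B →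
      (∀ p ∈ B, ∀ u ∈ E.dom, g (p, u) = f p) → ∀ p ∈ B, ∀ u ∈ E.dom, ∀ a,
      dB a g (p, u) = fderiv ℝ f p a ∧ dU g (p, u) = 0 := by
    intro g f hf hg p hp u hu a
    have e1 := graphFirst_base hB hI hf hg a 0 hp hu
    have e2 := graphFirst_base hB hI hf hg a 1 hp hu
    unfold graphFirst at e1 e2
    constructor <;> linarith
  have xT : ∀ p ∈ B, Dx T p = 0 := by
    intro p hp
    obtain ⟨u, hu⟩ := hne
    exact ((dbase hT eT p hp u hu ex).1).symm.trans (h.time_components hB hp hu).1.1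
  have xY : ∀ p ∈ B, Dx Y p = 0 := by
    intro p hp
    obtain ⟨u, hu⟩ := hne
    exact ((dbase hY eY p hp u hu ex).1).symm.trans (h.time_components hB hp hu).2.1
  have gT : ∀ p ∈ B, ∀ u ∈ E.dom, ∀ a s, graphFirst a (comp0 Φ) (p, u) s
      = a.1 * Dt T p + a.2.2 * Dy T p := by
    intro p hp u hu a s
    rw [graphFirst_base hB hI hT eT a s hp hu, fderiv_base', xT p hp]; ring
  have gY : ∀ p ∈ B, ∀ u ∈ E.dom, ∀ a s, graphFirst a (comp2 Φ) (p, u) s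
      = a.1 * Dt Y p + a.2.2 * Dy Y p := by
    intro p hp u hu a s
    rw [graphFirst_base hB hI hY eY a s hp hu, fderiv_base', xY p hp]; ring
  have secT : ∀ p ∈ B, ∀ u ∈ E.dom, ∀ s r, graphSecond ex (comp0 Φ) (p, u) s r = 0 := by
    intro p hp u hu s r
    rw [graphSecond_base hB hI hT eT _ s r hp hu]
    rw [fderiv_eq_zero_of_eqOn hB (F := fun q => fderiv ℝ T q ex) xT hp]; rfl
  have secY : ∀ p ∈ B, ∀ u ∈ E.dom, ∀ s r, graphSecond ex (comp2 Φ) (p, u) s r = 0 := by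
    intro p hp u hu s r
    rw [graphSecond_base hB hI hY eY _ s r hp hu]
    rw [fderiv_eq_zero_of_eqOn hB (F := fun q => fderiv ℝ Y q ex) xY hp]; rfl
  -- the two minors of the Jacobian
  have minorXU : ∀ p ∈ B, ∀ u ∈ E.dom, dB ex (comp1 Φ) (p, u) * dU (comp3 Φ) (p, u)
      - dU (comp1 Φ) (p, u) * dB ex (comp3 Φ) (p, u) ≠ 0 := by
    intro p hp u hu h0
    have key : ∀ l s : ℝ, l * dB ex (comp1 Φ) (p, u) + s * dU (comp1 Φ) (p, u) = 0 →
        l * dB ex (comp3 Φ) (p, u) + s * dU (comp3 Φ) (p, u) = 0 → l = 0 ∧ s = 0 := by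
      intro l s e1 e3
      obtain ⟨k1, k2⟩ := h.injective_jet hB (z := (p, u)) ⟨hp, hu⟩ (0, l, 0) s
        (by rw [gT p hp u hu]; simp) (by rw [graphFirst_coord]; simpa using e1)
        (by rw [gY p hp u hu]; simp) (by rw [graphFirst_coord]; simpa using e3)
      exact ⟨by simpa using k1, k2⟩
    obtain ⟨a1, a2⟩ := key (dU (comp1 Φ) (p, u)) (-dB ex (comp1 Φ) (p, u)) (by ring) (by linarith)
    obtain ⟨b1, b2⟩ := key (dU (comp3 Φ) (p, u)) (-dB ex (comp3 Φ) (p, u))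
      (by linear_combination h0)
      (by ring)
    have := (key 1 0 (by linarith) (by linarith)).1
    exact one_ne_zero this
  have minorTY : ∀ p ∈ B, Dt T p * Dy Y p - Dy T p * Dt Y p ≠ 0 := by
    intro p hp h0
    obtain ⟨u, hu⟩ := hne
    have hm := minorXU p hp u hu
    have key : ∀ a b : ℝ, a * Dt T p + b * Dy T p = 0 → a * Dt Y p + b * Dy Y p = 0 →
        a = 0 ∧ b = 0 := by
      intro a b e1 e3
      set m := dB ex (comp1 Φ) (p, u) * dU (comp3 Φ) (p, u)
        - dU (comp1 Φ) (p, u) * dB ex (comp3 Φ) (p, u)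
      set P := a * dB et (comp1 Φ) (p, u) + b * dB ey (comp1 Φ) (p, u)
      set Q := a * dB et (comp3 Φ) (p, u) + b * dB ey (comp3 Φ) (p, u)
      -- A kernel vector of the (t, y)-block is completed to one of the whole Jacobian: its x- and
      -- u-components are obtained by Cramer's rule from the nonzero minor `m`.
      obtain ⟨k1, k2⟩ := h.injective_jet hB (z := (p, u)) ⟨hp, hu⟩
        (a, (dU (comp1 Φ) (p, u) * Q - dU (comp3 Φ) (p, u) * P) / m, b)
        ((dB ex (comp3 Φ) (p, u) * P - dB ex (comp1 Φ) (p, u) * Q) / m)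
        (by rw [gT p hp u hu]; exact e1)
        (by rw [graphFirst_coord]; simp only [P, Q]; field_simp; simp only [m]; ring)
        (by rw [gY p hp u hu]; exact e3)
        (by rw [graphFirst_coord]; simp only [P, Q]; field_simp; simp only [m]; ring)
      simp only [Prod.mk_eq_zero] at k1
      exact ⟨k1.1, k1.2.2⟩
    obtain ⟨a1, a2⟩ := key (Dy T p) (-Dt T p) (by ring) (by linarith)
    obtain ⟨b1, b2⟩ := key (Dy Y p) (-Dt Y p) (by linear_combination h0) (by ring)
    exact one_ne_zero (key 1 0 (by linarith) (by linarith)).1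
  -- the master identity
  have master : ∀ p ∈ B, ∀ u ∈ E.dom, ∀ st sx sy xx : ℝ, st = xx - E.f₁ u * sy + E.f₂ u →
      dB ex (comp1 Φ) (p, u) + sx * dU (comp1 Φ) (p, u) ≠ 0 → ∃ wx wxx : ℝ,
      dB ex (comp3 Φ) (p, u) + sx * dU (comp3 Φ) (p, u)
        = (dB ex (comp1 Φ) (p, u) + sx * dU (comp1 Φ) (p, u)) * wx ∧
      graphSecond ex (comp3 Φ) (p, u) sx xx
        = wxx * (dB ex (comp1 Φ) (p, u) + sx * dU (comp1 Φ) (p, u)) ^ 2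
          + graphSecond ex (comp1 Φ) (p, u) sx xx * wx ∧
      (Dy Y p - E'.f₁ (comp3 Φ (p, u)) * Dy T p) * (dB et (comp3 Φ) (p, u) + st * dU (comp3 Φ) (p, u)
          - (dB et (comp1 Φ) (p, u) + st * dU (comp1 Φ) (p, u)) * wx)
        + (E'.f₁ (comp3 Φ (p, u)) * Dt T p - Dt Y p) * (dB ey (comp3 Φ) (p, u)
          + sy * dU (comp3 Φ) (p, u) - (dB ey (comp1 Φ) (p, u) + sy * dU (comp1 Φ) (p, u)) * wx)
        = (Dt T p * Dy Y p - Dy T p * Dt Y p) * (E'.f₂ (comp3 Φ (p, u)) + wxx) := by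
    intro p hp u hu st sx sy xx hst hD
    have tr : Transversal Φ (p, u) (st, sx, sy) := by
      intro a a0 a1 a2
      rw [gT p hp u hu] at a0
      rw [gY p hp u hu] at a2
      have hm := minorTY p hp
      have z1 : a.1 = 0 := by
        have : a.1 * (Dt T p * Dy Y p - Dy T p * Dt Y p) = 0 := by
          linear_combination Dy Y p * a0 - Dy T p * a2
        exact (mul_eq_zero.1 this).resolve_right hm
      have z2 : a.2.2 = 0 := by
        have : a.2.2 * (Dt T p * Dy Y p - Dy T p * Dt Y p) = 0 := by
          linear_combination Dt T p * a2 - Dt Y p * a0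
        exact (mul_eq_zero.1 this).resolve_right hm
      rw [graphFirst_coord] at a1
      simp only [slope, z1, z2] at a1
      have z3 : a.2.1 = 0 := by
        have : a.2.1 * (dB ex (comp1 Φ) (p, u) + sx * dU (comp1 Φ) (p, u)) = 0 := by
          linear_combination a1
        exact (mul_eq_zero.1 this).resolve_right hD
      exact Prod.ext z1 (Prod.ext z3 z2)
    obtain ⟨wt, wx, wy, wxx, k1, k2, k3⟩ := h.exists_jet hB hp hu tr 0 0 xx (by rw [hst]; ring)
    have et' := k2 et
    have ex' := k2 ex
    have ey' := k2 ey
    rw [gT p hp u hu, gY p hp u hu, graphFirst_et, graphFirst_et] at et'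
    rw [gT p hp u hu, gY p hp u hu, graphFirst_ey, graphFirst_ey] at ey'
    rw [gT p hp u hu, gY p hp u hu, graphFirst_ex, graphFirst_ex] at ex'
    have exx := k3 ex xx (by simp) (by rw [gT p hp u hu]; simp) (by rw [gY p hp u hu]; simp)
    have sl : slope (st, sx, sy) ex = sx := by simp [slope]
    rw [graphFirst_ex, sl, secT p hp u hu, secY p hp u hu] at exx
    simp only at et' ex' ey' exx
    refine ⟨wx, wxx, by linear_combination ex', by linear_combination exx, ?_⟩
    -- The weights are chosen so that w_t and w_y appear only as the Jacobian times w_t + f₁ w_y,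
    -- with the f₁ of E', which that equation replaces by f₂ + w_xx.
    linear_combination (Dy Y p - E'.f₁ (comp3 Φ (p, u)) * Dy T p) * et'
      + (E'.f₁ (comp3 Φ (p, u)) * Dt T p - Dt Y p) * ey'
      + (Dt T p * Dy Y p - Dy T p * Dt Y p) * k1
  -- the coefficient of `u_xx`
  have cxx : ∀ p ∈ B, ∀ u ∈ E.dom, ∀ sx : ℝ,
      dB ex (comp1 Φ) (p, u) + sx * dU (comp1 Φ) (p, u) ≠ 0 →
      (Dy Y p - E'.f₁ (comp3 Φ (p, u)) * Dy T p)
        * (dB ex (comp1 Φ) (p, u) + sx * dU (comp1 Φ) (p, u)) ^ 2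
        = Dt T p * Dy Y p - Dy T p * Dt Y p := by
    intro p hp u hu sx hD
    obtain ⟨wx, w0, a1, a2, a3⟩ := master p hp u hu _ sx 0 0 rfl hD
    obtain ⟨wx', w1, b1, b2, b3⟩ := master p hp u hu _ sx 0 1 rfl hD
    have hw : wx' = wx := mul_left_cancel₀ hD (b1.symm.trans a1)
    subst hw
    set D := dB ex (comp1 Φ) (p, u) + sx * dU (comp1 Φ) (p, u)
    have hK : (dU (comp3 Φ) (p, u) - dU (comp1 Φ) (p, u) * wx') ≠ 0 := by
      intro hK
      apply minorXU p hp u hu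
      simp only [D] at b1
      linear_combination (dB ex (comp1 Φ) (p, u) + sx * dU (comp1 Φ) (p, u)) * hK
        - dU (comp1 Φ) (p, u) * b1
    have d2 : (w1 - w0) * D ^ 2 = dU (comp3 Φ) (p, u) - dU (comp1 Φ) (p, u) * wx' := by
      simp only [graphSecond] at a2 b2
      linear_combination a2 - b2
    have d3 : (Dy Y p - E'.f₁ (comp3 Φ (p, u)) * Dy T p)
        * (dU (comp3 Φ) (p, u) - dU (comp1 Φ) (p, u) * wx')
        = (Dt T p * Dy Y p - Dy T p * Dt Y p) * (w1 - w0) := by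
      linear_combination b3 - a3
    apply mul_right_cancel₀ hK
    linear_combination D ^ 2 * d3 + (Dt T p * Dy Y p - Dy T p * Dt Y p) * d2
  have uX : ∀ p ∈ B, ∀ u ∈ E.dom, dU (comp1 Φ) (p, u) = 0 := by
    intro p hp u hu
    by_contra hX
    -- If X depended on u, the slope could be chosen so that D_x X is 1 or 2. Then `cxx` would give
    -- S = J and 4S = J, hence J = 0 for the Jacobian J of (T, Y).
    have c1 := cxx p hp u hu ((1 - dB ex (comp1 Φ) (p, u)) / dU (comp1 Φ) (p, u))
    have c2 := cxx p hp u hu ((2 - dB ex (comp1 Φ) (p, u)) / dU (comp1 Φ) (p, u))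
    rw [div_mul_cancel₀ _ hX] at c1 c2
    have e1 := c1 (by norm_num)
    have e2 := c2 (by norm_num)
    apply minorTY p hp
    linear_combination (1 / 3 : ℝ) * e2 - (4 / 3 : ℝ) * e1
  obtain ⟨X, hX, eX⟩ := exists_base_function hB hI hI' hne h1 uX
  have dX : ∀ p ∈ B, ∀ u ∈ E.dom, ∀ a, dB a (comp1 Φ) (p, u) = fderiv ℝ X p a :=
    fun p hp u hu a => (dbase hX eX p hp u hu a).1
  have secX : ∀ p ∈ B, ∀ u ∈ E.dom, ∀ s r, graphSecond ex (comp1 Φ) (p, u) s r = Dx (Dx X) p :=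
    fun p hp u hu s r => graphSecond_base hB hI hX eX _ s r hp hu
  have hX0 : ∀ p ∈ B, Dx X p ≠ 0 := by
    intro p hp hx
    obtain ⟨u, hu⟩ := hne
    apply minorXU p hp u hu
    rw [uX p hp u hu, dX p hp u hu, show fderiv ℝ X p ex = 0 from hx]; ring
  have hU0 : ∀ p ∈ B, ∀ u ∈ E.dom, dU (comp3 Φ) (p, u) ≠ 0 := by
    intro p hp u hu hx
    apply minorXU p hp u hu
    rw [uX p hp u hu, hx]; ring
  have master' : ∀ p ∈ B, ∀ u ∈ E.dom, ∀ sx sy : ℝ, ∃ wx wxx : ℝ,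
      dB ex (comp3 Φ) (p, u) + sx * dU (comp3 Φ) (p, u) = Dx X p * wx ∧
      graphSecond ex (comp3 Φ) (p, u) sx 0 = wxx * Dx X p ^ 2 + Dx (Dx X) p * wx ∧
      (Dy Y p - E'.f₁ (comp3 Φ (p, u)) * Dy T p) * (dB et (comp3 Φ) (p, u)
          + (- E.f₁ u * sy + E.f₂ u) * dU (comp3 Φ) (p, u) - Dt X p * wx)
        + (E'.f₁ (comp3 Φ (p, u)) * Dt T p - Dt Y p) * (dB ey (comp3 Φ) (p, u)
          + sy * dU (comp3 Φ) (p, u) - Dy X p * wx)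
        = (Dt T p * Dy Y p - Dy T p * Dt Y p) * (E'.f₂ (comp3 Φ (p, u)) + wxx) := by
    intro p hp u hu sx sy
    have hx : dB ex (comp1 Φ) (p, u) = Dx X p := dX p hp u hu ex
    have ht : dB et (comp1 Φ) (p, u) = Dt X p := dX p hp u hu et
    have hy : dB ey (comp1 Φ) (p, u) = Dy X p := dX p hp u hu ey
    obtain ⟨wx, wxx, a1, a2, a3⟩ := master p hp u hu (- E.f₁ u * sy + E.f₂ u) sx sy 0 (by ring)
      (by rw [uX p hp u hu, hx]; simpa using hX0 p hp)
    rw [uX p hp u hu, hx] at a1 a2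
    rw [uX p hp u hu, ht, hy] at a3
    rw [secX p hp u hu] at a2
    simp only [mul_zero, add_zero] at a1 a2 a3
    exact ⟨wx, wxx, a1, a2, a3⟩
  have cX : ∀ p ∈ B, ∀ u ∈ E.dom, (Dy Y p - E'.f₁ (comp3 Φ (p, u)) * Dy T p) * Dx X p ^ 2
        = Dt T p * Dy Y p - Dy T p * Dt Y p := by
    intro p hp u hu
    have := cxx p hp u hu 0
    rw [uX p hp u hu, show dB ex (comp1 Φ) (p, u) = Dx X p from dX p hp u hu ex] at this
    simpa using this (by simpa using hX0 p hp)
  -- the coefficient of `u_y`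
  have cy : ∀ p ∈ B, ∀ u ∈ E.dom, E'.f₁ (comp3 Φ (p, u)) * Dt T p - Dt Y p
      = E.f₁ u * (Dy Y p - E'.f₁ (comp3 Φ (p, u)) * Dy T p) := by
    intro p hp u hu
    obtain ⟨wx, w0, a1, a2, a3⟩ := master' p hp u hu 0 0
    obtain ⟨wx', w1, b1, b2, b3⟩ := master' p hp u hu 0 1
    have hw : wx' = wx := mul_left_cancel₀ (hX0 p hp) (b1.symm.trans a1)
    subst hw
    have hw2 : w1 = w0 := by
      apply mul_right_cancel₀ (pow_ne_zero 2 (hX0 p hp))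
      linear_combination a2 - b2
    subst hw2
    apply mul_right_cancel₀ (hU0 p hp u hu)
    linear_combination b3 - a3
  have hS : ∀ p ∈ B, ∀ u ∈ E.dom, Dy Y p - E'.f₁ (comp3 Φ (p, u)) * Dy T p ≠ 0 := by
    intro p hp u hu hS
    apply minorTY p hp
    rw [← cX p hp u hu, hS, zero_mul]
  -- division by the common factor
  have master'' : ∀ p ∈ B, ∀ u ∈ E.dom, ∀ sx : ℝ, ∃ wx wxx : ℝ,
      dB ex (comp3 Φ) (p, u) + sx * dU (comp3 Φ) (p, u) = Dx X p * wx ∧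
      graphSecond ex (comp3 Φ) (p, u) sx 0 = wxx * Dx X p ^ 2 + Dx (Dx X) p * wx ∧
      dB et (comp3 Φ) (p, u) + E.f₂ u * dU (comp3 Φ) (p, u) - Dt X p * wx
        + E.f₁ u * (dB ey (comp3 Φ) (p, u) - Dy X p * wx)
        = Dx X p ^ 2 * (E'.f₂ (comp3 Φ (p, u)) + wxx) := by
    intro p hp u hu sx
    obtain ⟨wx, wxx, a1, a2, a3⟩ := master' p hp u hu sx 0
    refine ⟨wx, wxx, a1, a2, mul_left_cancel₀ (hS p hp u hu) ?_⟩
    rw [cy p hp u hu, ← cX p hp u hu] at a3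
    linear_combination a3
  have uU : ∀ p ∈ B, ∀ u ∈ E.dom, dU (dU (comp3 Φ)) (p, u) = 0 := by
    intro p hp u hu
    -- Second difference in u_x: w_x is affine in u_x, and therefore so is w_xx, while the second
    -- x-derivative of U along the graph contributes 2 U_uu.
    obtain ⟨wx0, w0, a1, a2, a3⟩ := master'' p hp u hu 0
    obtain ⟨wx1, w1, b1, b2, b3⟩ := master'' p hp u hu 1
    obtain ⟨wx2, w2, c1, c2, c3⟩ := master'' p hp u hu (-1)
    simp only [graphSecond] at a2 b2 c2
    have hw : wx1 + wx2 = 2 * wx0 := by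
      apply mul_left_cancel₀ (hX0 p hp)
      linear_combination 2 * a1 - b1 - c1
    have hwx : (w1 + w2 - 2 * w0) * Dx X p ^ 2 = 0 := by
      linear_combination 2 * a3 - b3 - c3 - (Dt X p + E.f₁ u * Dy X p) * hw
    linear_combination (1 / 2 : ℝ) * (b2 + c2 - 2 * a2) + (1 / 2 : ℝ) * hwx
      + (1 / 2 : ℝ) * Dx (Dx X) p * hw
  obtain ⟨α, β, hα, hβ, eU⟩ := exists_affine_function hB hI hI' hne h3 uU
  have dUα : ∀ p ∈ B, ∀ u ∈ E.dom, dU (comp3 Φ) (p, u) = α p := dU_affine hB hI hα hβ eU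
  have dBα := fun a => dB_affine hB hI hα hβ eU a
  have hα0 : ∀ p ∈ B, α p ≠ 0 := by
    intro p hp
    obtain ⟨u, hu⟩ := hne
    rw [← dUα p hp u hu]
    exact hU0 p hp u hu
  have hmaps : ∀ p ∈ B, ∀ u ∈ E.dom, α p * u + β p ∈ E'.dom := by
    intro p hp u hu
    rw [← eU p hp u hu]
    exact h.2.2.2.1 (p, u) ⟨hp, hu⟩
  -- `T` depends on `t` only
  have yT : ∀ p ∈ B, Dy T p = 0 := by
    intro p hp
    -- The relation `cX` is differentiated in u at a point whose image is nonzero, where `hE'`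
    -- guarantees f₁' ≠ 0 for the target; only the T_y term depends on u.
    obtain ⟨u, hu, hu'⟩ := exists_mem_affine_ne_zero hI hne (b := β p) (hα0 p hp)
    have hd : HasDerivAt (fun s => (Dy Y p - E'.f₁ (α p * s + β p) * Dy T p) * Dx X p ^ 2)
        ((0 - deriv E'.f₁ (α p * u + β p) * (α p * 1) * Dy T p) * Dx X p ^ 2) u :=
      (((hasDerivAt_const u (Dy Y p)).sub (((E'.differentiableAt_f₁ (hmaps p hp u hu)).hasDerivAt.comp
        u (((hasDerivAt_id u).const_mul (α p)).add_const (β p))).mul_const (Dy T p))).mul_const _)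
    have ev : (fun s => (Dy Y p - E'.f₁ (α p * s + β p) * Dy T p) * Dx X p ^ 2) =ᶠ[𝓝 u]
        fun _ => Dt T p * Dy Y p - Dy T p * Dt Y p := by
      filter_upwards [hI.mem_nhds hu] with s hs
      rw [← cX p hp s hs, eU p hp s hs]
    have e := hd.deriv.symm.trans ev.deriv_eq
    have e' : deriv E'.f₁ (α p * u + β p) * α p * Dx X p ^ 2 * Dy T p = 0 := by
      rw [deriv_const] at e
      linear_combination -e
    exact (mul_eq_zero.1 e').resolve_left (mul_ne_zero (mul_ne_zero (hE' _ (hmaps p hp u hu) hu')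
      (hα0 p hp)) (pow_ne_zero 2 (hX0 p hp)))
  have hY0 : ∀ p ∈ B, Dy Y p ≠ 0 := by
    intro p hp hy
    apply minorTY p hp
    rw [hy, yT p hp]; ring
  have tX : ∀ p ∈ B, Dx X p ^ 2 = Dt T p := by
    intro p hp
    obtain ⟨u, hu⟩ := hne
    have := cX p hp u hu
    rw [yT p hp] at this
    apply mul_left_cancel₀ (hY0 p hp)
    linear_combination this
  have dz : ∀ f : Base → ℝ, (∀ p ∈ B, f p = 0) → ∀ p ∈ B, ∀ a, fderiv ℝ f p a = 0 := by
    intro f hf p hp a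
    rw [fderiv_eq_zero_of_eqOn hB hf hp]; rfl
  have comm : ∀ {f : Base → ℝ}, ContDiffOn ℝ ∞ f B → ∀ p ∈ B, ∀ a b,
      fderiv ℝ (fun q => fderiv ℝ f q a) p b = fderiv ℝ (fun q => fderiv ℝ f q b) p a :=
    fun hf p hp a b => fderiv_fderiv_comm (hf.contDiffAt (hB.mem_nhds hp)) a b
  have xtT : ∀ p ∈ B, Dx (Dt T) p = 0 := fun p hp => (comm hT p hp et ex).trans (dz _ xT p hp et)
  have ytT : ∀ p ∈ B, Dy (Dt T) p = 0 := fun p hp => (comm hT p hp et ey).trans (dz _ yT p hp et)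
  have hTt : ContDiffOn ℝ ∞ (Dt T) B := smoothOn_fderiv_apply hB hT et
  have hXx : ContDiffOn ℝ ∞ (Dx X) B := smoothOn_fderiv_apply hB hX ex
  have sq : ∀ p ∈ B, ∀ a, 2 * Dx X p * fderiv ℝ (Dx X) p a = fderiv ℝ (Dt T) p a := by
    intro p hp a
    have hd := ((hXx.contDiffAt (hB.mem_nhds hp)).diff.hasFDerivAt).pow 2
    have ev : (Dx X ^ 2) =ᶠ[𝓝 p] Dt T := by
      filter_upwards [hB.mem_nhds hp] with q hq using tX q hq
    have e := hd.fderiv.symm.trans ev.fderiv_eq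
    rw [← e]
    simp
  have xxX : ∀ p ∈ B, Dx (Dx X) p = 0 := by
    intro p hp
    have e := sq p hp ex
    rw [show fderiv ℝ (Dt T) p ex = 0 from xtT p hp] at e
    exact (mul_eq_zero.1 e).resolve_left (mul_ne_zero two_ne_zero (hX0 p hp))
  have eqA : ∀ p ∈ B, ∀ u ∈ E.dom,
      Dt T p * E'.f₁ (α p * u + β p) = Dy Y p * E.f₁ u + Dt Y p := by
    intro p hp u hu
    have := cy p hp u hu
    rw [yT p hp, eU p hp u hu] at this
    linear_combination this
  have hTt0 : ∀ p ∈ B, 0 < Dt T p := fun p hp => by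
    rw [← tX p hp]; exact (sq_nonneg _).lt_of_ne' (pow_ne_zero 2 (hX0 p hp))
  have xU : ∀ p ∈ B, Dx α p = 0 ∧ Dx β p = 0 := by
    intro p hp
    -- In the x-derivative of `eqA` the right side vanishes because Y does not depend on x, which
    -- leaves T_t f₁' (α_x u + β_x) = 0.
    refine affine_eq_zero_of_mul hI hne (hα0 p hp) (b := β p) fun u hu hne0 => ?_
    have e := fderiv_link hB hTt hY hα hβ hmaps eqA hp hu ex (xtT p hp)
    rw [show fderiv ℝ (Dy Y) p ex = 0 from (comm hY p hp ey ex).trans (dz _ xY p hp ey),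
      show fderiv ℝ (Dt Y) p ex = 0 from (comm hY p hp et ex).trans (dz _ xY p hp et)] at e
    have e2 : (Dt T p * deriv E'.f₁ (α p * u + β p)) * (Dx α p * u + Dx β p) = 0 := by
      change _ * (fderiv ℝ α p ex * u + fderiv ℝ β p ex) = 0
      linear_combination e
    exact (mul_eq_zero.1 e2).resolve_left (mul_ne_zero (hTt0 p hp).ne' (hE' _ (hmaps p hp u hu) hne0))
  have dxα : ∀ p ∈ B, Dx α p = 0 := fun p hp => (xU p hp).1
  have dxβ : ∀ p ∈ B, Dx β p = 0 := fun p hp => (xU p hp).2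
  have fin : ∀ p ∈ B, ∀ u ∈ E.dom, ∀ sx : ℝ, Dt α p * u + Dt β p + E.f₂ u * α p
      + E.f₁ u * (Dy α p * u + Dy β p) - (Dt X p + E.f₁ u * Dy X p) * (sx * α p / Dx X p)
      = Dt T p * E'.f₂ (α p * u + β p) := by
    intro p hp u hu sx
    obtain ⟨wx, wxx, a1, a2, a3⟩ := master'' p hp u hu sx
    rw [graphSecond_affine hB hI hα hβ eU _ _ _ p hp u hu,
      show fderiv ℝ (fun q => fderiv ℝ α q ex) p ex = 0 from dz _ dxα p hp ex,
      show fderiv ℝ (fun q => fderiv ℝ β q ex) p ex = 0 from dz _ dxβ p hp ex,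
      show fderiv ℝ α p ex = 0 from dxα p hp, xxX p hp] at a2
    rw [dUα p hp u hu, dBα ex p hp u hu, show fderiv ℝ α p ex = 0 from dxα p hp,
      show fderiv ℝ β p ex = 0 from dxβ p hp] at a1
    rw [dUα p hp u hu, dBα et p hp u hu, dBα ey p hp u hu, eU p hp u hu] at a3
    have hwx : wx = sx * α p / Dx X p := by
      rw [eq_div_iff (hX0 p hp)]; linear_combination -a1
    have hwxx : wxx * Dx X p ^ 2 = 0 := by linear_combination -a2
    rw [← hwx, ← tX p hp]
    change Dt α p * u + Dt β p + _ - _ + _ * (Dy α p * u + Dy β p - _) = _ at a3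
    linear_combination a3 + hwxx
  have cX2 : ∀ p ∈ B, Dt X p = 0 ∧ Dy X p = 0 := by
    intro p hp
    apply E.coeff_eq_zero
    intro u hu
    -- Comparing u_x = 0 and u_x = 1 isolates the coefficient X_t + f₁ X_y of u_x.
    have e0 := fin p hp u hu 0
    have e1 := fin p hp u hu 1
    have : (Dt X p + Dy X p * E.f₁ u) * (1 * α p / Dx X p) = 0 := by linear_combination e0 - e1
    exact (mul_eq_zero.1 this).resolve_right
      (div_ne_zero (mul_ne_zero one_ne_zero (hα0 p hp)) (hX0 p hp))
  have ttT : ∀ p ∈ B, Dt (Dt T) p = 0 := by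
    intro p hp
    have e := sq p hp et
    rw [show fderiv ℝ (Dx X) p et = 0 from (comm hX p hp ex et).trans
      (dz _ (fun p hp => (cX2 p hp).1) p hp ex), mul_zero] at e
    exact e.symm
  obtain ⟨k, hk⟩ := exists_eq_const hB hBc hTt ttT xtT ytT
  obtain ⟨p₀, hp₀⟩ := hBne
  refine ⟨k, Y, α, β, hk p₀ hp₀ ▸ hTt0 p₀ hp₀, hY, hα, hβ, hY0, hα0, hmaps,
    fun p hp u hu => hk p hp ▸ eqA p hp u hu, fun p hp u hu => ?_⟩
  have := fin p hp u hu 0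
  rw [hk p hp] at this
  linear_combination -this

end PointTransformation

/-! ### Functions of one variable -/

section OneVariable

variable {I : Set ℝ}

theorem hasDerivAt_eq_zero_of_eqOn (hI : IsOpen I) {F : ℝ → ℝ} (h : ∀ u ∈ I, F u = 0) {u d : ℝ}
    (hu : u ∈ I) (hd : HasDerivAt F d u) : d = 0 := by
  have ev : F =ᶠ[𝓝 u] fun _ => 0 := by filter_upwards [hI.mem_nhds hu] with s hs using h s hs
  have := hd.deriv.symm.trans ev.deriv_eq
  simpa using this

theorem exists_eq_of_deriv_eq_zero (hI : IsOpen I) (hI' : I.OrdConnected) {f : ℝ → ℝ}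
    (hf : ∀ u ∈ I, HasDerivAt f 0 u) : ∃ C, ∀ u ∈ I, f u = C :=
  hI.exists_is_const_of_deriv_eq_zero hI'.isPreconnected
    (fun u hu => (hf u hu).differentiableAt.differentiableWithinAt) (fun u hu => (hf u hu).deriv)

theorem smoothOn_deriv (hI : IsOpen I) {f : ℝ → ℝ} (hf : ContDiffOn ℝ ∞ f I) :
    ContDiffOn ℝ ∞ (deriv f) I := smoothOn_fderiv_apply hI hf (1 : ℝ)

theorem hasDerivAt_of_smooth (hI : IsOpen I) {f : ℝ → ℝ} (hf : ContDiffOn ℝ ∞ f I) {u : ℝ}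
    (hu : u ∈ I) : HasDerivAt f (deriv f u) u :=
  (hf.contDiffAt (hI.mem_nhds hu)).diff.hasDerivAt

theorem deriv_eq_of_eqOn (hI : IsOpen I) {f g : ℝ → ℝ} (h : EqOn f g I) {u : ℝ} (hu : u ∈ I) :
    deriv f u = deriv g u := by
  have ev : f =ᶠ[𝓝 u] g := by filter_upwards [hI.mem_nhds hu] with s hs using h hs
  exact ev.deriv_eq

/-- The solutions of `f' = k f`. -/
theorem exists_eq_exp (hI : IsOpen I) (hI' : I.OrdConnected) {f : ℝ → ℝ} {k : ℝ}
    (hf : ∀ u ∈ I, HasDerivAt f (k * f u) u) : ∃ C, ∀ u ∈ I, f u = C * Real.exp (k * u) := by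
  obtain ⟨C, hC⟩ := exists_eq_of_deriv_eq_zero hI hI' (f := fun u => f u * Real.exp (-(k * u))) (by
    intro u hu
    have h1 : HasDerivAt (fun u => Real.exp (-(k * u))) (Real.exp (-(k * u)) * -(k * 1)) u :=
      (((hasDerivAt_id u).const_mul k).neg).exp
    refine ((hf u hu).mul h1).congr_deriv ?_
    ring)
  refine ⟨C, fun u hu => ?_⟩
  rw [← hC u hu, mul_assoc, ← Real.exp_add]
  simp

/-- The solutions of `u f' = a f` for positive `u`. -/
theorem exists_eq_rpow_of_pos (hI : IsOpen I) (hI' : I.OrdConnected) (hpos : I ⊆ Ioi 0) {f : ℝ → ℝ}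
    {a : ℝ} (hf : ContDiffOn ℝ ∞ f I) (h : ∀ u ∈ I, u * deriv f u = a * f u) :
    ∃ C, ∀ u ∈ I, f u = C * u ^ a := by
  obtain ⟨C, hC⟩ := exists_eq_of_deriv_eq_zero hI hI' (f := fun u => f u * u ^ (-a)) (by
    intro u hu
    have hu0 : 0 < u := hpos hu
    refine ((hasDerivAt_of_smooth hI hf hu).mul
      (Real.hasDerivAt_rpow_const (p := -a) (Or.inl hu0.ne'))).congr_deriv ?_
    have e : u ^ (-a) = u * u ^ (-a - 1) := by
      rw [Real.rpow_sub_one hu0.ne']; field_simp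
    rw [e]
    linear_combination (u ^ (-a - 1)) * h u hu)
  refine ⟨C, fun u hu => ?_⟩
  have hu0 : 0 < u := hpos hu
  rw [← hC u hu, mul_assoc, ← Real.rpow_add hu0]
  simp

/-- Since u (f²)' = 2a f² ≤ 0, the function f² decreases away from 0 on both sides; the equation at
u = 0 gives f(0) = 0. -/
theorem eq_zero_of_neg_exponent (hI : IsOpen I) (hI' : I.OrdConnected) (h0 : (0 : ℝ) ∈ I) {f : ℝ → ℝ}
    {a : ℝ} (ha : a < 0) (hf : ContDiffOn ℝ ∞ f I) (h : ∀ u ∈ I, u * deriv f u = a * f u) :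
    ∀ u ∈ I, f u = 0 := by
  have f0 : f 0 = 0 := by
    have := h 0 h0
    rw [zero_mul] at this
    exact (mul_eq_zero.1 this.symm).resolve_left ha.ne
  have hsq : ∀ u ∈ I, HasDerivAt (fun u => f u ^ 2) (2 * f u * deriv f u) u := by
    intro u hu
    refine ((hasDerivAt_of_smooth hI hf hu).pow 2).congr_deriv ?_
    simp
  have hsign : ∀ u ∈ I, u * (2 * f u * deriv f u) ≤ 0 := by
    intro u hu
    have : u * (2 * f u * deriv f u) = 2 * a * f u ^ 2 := by linear_combination 2 * f u * h u hu
    rw [this]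
    nlinarith [sq_nonneg (f u)]
  intro u hu
  have key : f u ^ 2 ≤ 0 := by
    rcases le_total 0 u with hu0 | hu0
    · have hsub : Icc 0 u ⊆ I := hI'.out h0 hu
      have hanti : AntitoneOn (fun u => f u ^ 2) (Icc 0 u) := by
        apply antitoneOn_of_deriv_nonpos (convex_Icc 0 u)
        · exact fun s hs => (hsq s (hsub hs)).continuousAt.continuousWithinAt
        · exact fun s hs => (hsq s (hsub (interior_subset hs))).differentiableAt.differentiableWithinAt
        · intro s hs
          rw [interior_Icc] at hs
          rw [(hsq s (hsub (Ioo_subset_Icc_self hs))).deriv]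
          exact nonpos_of_mul_nonpos_right (hsign s (hsub (Ioo_subset_Icc_self hs))) hs.1
      have := hanti (left_mem_Icc.2 hu0) (right_mem_Icc.2 hu0) hu0
      simpa [f0] using this
    · have hsub : Icc u 0 ⊆ I := hI'.out hu h0
      have hmono : MonotoneOn (fun u => f u ^ 2) (Icc u 0) := by
        apply monotoneOn_of_deriv_nonneg (convex_Icc u 0)
        · exact fun s hs => (hsq s (hsub hs)).continuousAt.continuousWithinAt
        · exact fun s hs => (hsq s (hsub (interior_subset hs))).differentiableAt.differentiableWithinAt
        · intro s hs
          rw [interior_Icc] at hs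
          rw [(hsq s (hsub (Ioo_subset_Icc_self hs))).deriv]
          have h1 := hsign s (hsub (Ioo_subset_Icc_self hs))
          by_contra! hneg
          nlinarith [mul_pos_of_neg_of_neg hs.2 hneg]
      have := hmono (left_mem_Icc.2 hu0) (right_mem_Icc.2 hu0) hu0
      simpa [f0] using this
  exact pow_eq_zero_iff (two_ne_zero) |>.1 (le_antisymm key (sq_nonneg _))

/-- The smooth solutions of `u f' = a f` across `u = 0` are monomials. -/
theorem exists_eq_pow_of_zero_mem (hI : IsOpen I) (hI' : I.OrdConnected) (h0 : (0 : ℝ) ∈ I) (k : ℕ) :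
    ∀ {f : ℝ → ℝ} {a : ℝ}, a < k → ContDiffOn ℝ ∞ f I → (∀ u ∈ I, u * deriv f u = a * f u) →
      (∃ (n : ℕ) (C : ℝ), a = n ∧ ∀ u ∈ I, f u = C * u ^ n) ∨ ∀ u ∈ I, f u = 0 := by
  -- Differentiating the equation replaces (f, a) by (f', a - 1), so finitely many steps lead to a
  -- negative exponent; f is recovered as u f'/a, or as a constant when a = 0.
  induction k with
  | zero =>
    intro f a ha hf h
    exact Or.inr (eq_zero_of_neg_exponent hI hI' h0 (by simpa using ha) hf h)
  | succ k ih =>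
    intro f a ha hf h
    have hf' := smoothOn_deriv hI hf
    have h' : ∀ u ∈ I, u * deriv (deriv f) u = (a - 1) * deriv f u := by
      intro u hu
      have hd := ((hasDerivAt_id u).mul (hasDerivAt_of_smooth hI hf' hu)).sub
        ((hasDerivAt_of_smooth hI hf hu).const_mul a)
      have := hasDerivAt_eq_zero_of_eqOn hI (fun s hs => by
        change s * deriv f s - a * f s = 0
        linarith [h s hs]) hu hd
      simp only [id] at this
      linear_combination this
    have ha' : a - 1 < k := by push_cast at ha; linarith
    by_cases ha0 : a = 0
    · subst ha0
      rcases ih ha' hf' h' with ⟨n, C, hn, -⟩ | hz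
      · exfalso
        have : (0 : ℝ) ≤ n := n.cast_nonneg
        linarith
      · left
        obtain ⟨C, hC⟩ := exists_eq_of_deriv_eq_zero hI hI' (f := f) (fun u hu => by
          have := hasDerivAt_of_smooth hI hf hu
          rwa [hz u hu] at this)
        exact ⟨0, C, by simp, fun u hu => by simpa using hC u hu⟩
    · have hfu : ∀ u ∈ I, f u = u * deriv f u / a := by
        intro u hu
        rw [h u hu]; field_simp
      rcases ih ha' hf' h' with ⟨n, C, hn, hC⟩ | hz
      · left
        refine ⟨n + 1, C / a, by push_cast; linarith, fun u hu => ?_⟩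
        rw [hfu u hu, hC u hu]; ring
      · right
        intro u hu
        rw [hfu u hu, hz u hu]; simp

/-- The smooth solutions of `u f' = a f` on an interval that is positive or contains `0`. -/
theorem exists_eq_rpow (hI : IsOpen I) (hI' : I.OrdConnected) (hpos : I ⊆ Ioi 0 ∨ (0 : ℝ) ∈ I)
    {f : ℝ → ℝ} {a : ℝ} (hf : ContDiffOn ℝ ∞ f I) (h : ∀ u ∈ I, u * deriv f u = a * f u) :
    ∃ C : ℝ, (∀ u ∈ I, f u = C * u ^ a) ∧ (C = 0 ∨ PowerDomain I a) := by
  rcases hpos with hpos | h0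
  · obtain ⟨C, hC⟩ := exists_eq_rpow_of_pos hI hI' hpos hf h
    exact ⟨C, hC, Or.inr (Or.inl hpos)⟩
  · obtain ⟨k, hk⟩ := exists_nat_gt a
    rcases exists_eq_pow_of_zero_mem hI hI' h0 k hk hf h with ⟨n, C, rfl, hC⟩ | hz
    · exact ⟨C, fun u hu => by rw [hC u hu, Real.rpow_natCast], Or.inr (Or.inr ⟨n, rfl⟩)⟩
    · exact ⟨0, fun u hu => by rw [hz u hu]; simp, Or.inl rfl⟩

theorem subset_pos_or_neg_or_zero_mem (hI' : I.OrdConnected) :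
    I ⊆ Ioi 0 ∨ I ⊆ Iio 0 ∨ (0 : ℝ) ∈ I := by
  by_cases h0 : (0 : ℝ) ∈ I
  · exact Or.inr (Or.inr h0)
  by_cases hp : ∃ u ∈ I, 0 < u
  · obtain ⟨u, hu, hu0⟩ := hp
    left
    intro s hs
    by_contra hs0
    exact h0 (hI'.out hs hu ⟨not_lt.1 hs0, hu0.le⟩)
  · right; left
    intro s hs
    push Not at hp
    exact lt_of_le_of_ne (hp s hs) fun h => h0 (h ▸ hs)

/-! ### Powers on their domain -/

/-- The derivative is described by u d = m u^m rather than by u^(m - 1), so the formula is uniform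
for real exponents on the half-line and natural exponents across 0. -/
theorem PowerDomain.hasDerivAt {m : ℝ} (hm : PowerDomain I m) {u : ℝ} (hu : u ∈ I) :
    ∃ d, HasDerivAt (fun s : ℝ => s ^ m) d u ∧ u * d = m * u ^ m := by
  rcases hm with hpos | ⟨k, rfl⟩
  · have hu0 : 0 < u := hpos hu
    refine ⟨_, Real.hasDerivAt_rpow_const (Or.inl hu0.ne'), ?_⟩
    rw [Real.rpow_sub_one hu0.ne']; field_simp
  · simp only [Real.rpow_natCast]
    refine ⟨_, hasDerivAt_pow k u, ?_⟩
    rcases k with _ | k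
    · simp
    · simp; ring

theorem PowerDomain.mul_deriv {m : ℝ} (hm : PowerDomain I m) {u : ℝ} (hu : u ∈ I) :
    u * deriv (fun s : ℝ => s ^ m) u = m * u ^ m := by
  obtain ⟨d, hd, e⟩ := hm.hasDerivAt hu
  rw [hd.deriv, e]

theorem PowerDomain.rpow_add_one {m : ℝ} (hm : PowerDomain I m) {u : ℝ} (hu : u ∈ I) :
    u ^ (m + 1) = u ^ m * u := by
  rcases hm with hpos | ⟨k, rfl⟩
  · have hu0 : 0 < u := hpos hu
    exact Real.rpow_add_one hu0.ne' m
  · rw [← Nat.cast_add_one, Real.rpow_natCast, Real.rpow_natCast, pow_succ]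

theorem PowerDomain.smooth {m : ℝ} (hm : PowerDomain I m) :
    ContDiffOn ℝ ∞ (fun s : ℝ => s ^ m) I := by
  rcases hm with hpos | ⟨k, rfl⟩
  · exact fun u hu => (Real.contDiffAt_rpow_const_of_ne (ne_of_gt (hpos hu))).contDiffWithinAt
  · simp only [Real.rpow_natCast]
    exact (contDiff_id.pow k).contDiffOn

theorem PowerDomain.mono {m : ℝ} (hm : PowerDomain I m) {J : Set ℝ} (hJ : J ⊆ I) : PowerDomain J m :=
  hm.imp (fun h => hJ.trans h) id

theorem PowerDomain.add_one {m : ℝ} (hm : PowerDomain I m) : PowerDomain I (m + 1) :=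
  hm.imp id fun ⟨k, hk⟩ => ⟨k + 1, by rw [hk]; simp⟩

theorem PowerDomain.sub_one {m : ℝ} (hm : PowerDomain I m) (h0 : m ≠ 0) : PowerDomain I (m - 1) :=
  hm.imp id fun ⟨k, hk⟩ => by
    rcases k with _ | k
    · simp [hk] at h0
    · exact ⟨k, by rw [hk]; simp⟩

theorem PowerDomain.zero : PowerDomain I 0 := Or.inr ⟨0, by simp⟩
theorem PowerDomain.one : PowerDomain I 1 := Or.inr ⟨1, by simp⟩
theorem PowerDomain.two : PowerDomain I 2 := Or.inr ⟨2, by simp⟩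

/-! ### Linear independence -/

/-- The Euler operator u d/du - e_j kills the j-th power and multiplies each other coefficient by
the nonzero number e_i - e_j; this shortens the sum. -/
theorem rpow_coeff_eq_zero_of_pos {ι : Type*} (s : Finset ι) {e : ι → ℝ} (he : InjOn e s)
    (hI : IsOpen I) (hne : I.Nonempty) (hpos : I ⊆ Ioi 0) :
    ∀ c : ι → ℝ, (∀ u ∈ I, ∑ i ∈ s, c i * u ^ e i = 0) → ∀ i ∈ s, c i = 0 := by
  classical
  induction s using Finset.induction_on with
  | empty => simp
  | insert j s hj ih =>
    intro c h
    have hs : ∀ i ∈ s, c i = 0 := by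
      have hsub : InjOn e s := he.mono (by simp)
      have := ih hsub (fun i => c i * (e i - e j)) (by
        intro u hu
        have hu0 : 0 < u := hpos hu
        have hd : HasDerivAt (fun u => ∑ i ∈ insert j s, c i * u ^ e i)
            (∑ i ∈ insert j s, c i * (e i * u ^ (e i - 1))) u :=
          HasDerivAt.fun_sum fun i _ => (Real.hasDerivAt_rpow_const (Or.inl hu0.ne')).const_mul _
        have h1 := hasDerivAt_eq_zero_of_eqOn hI h hu hd
        have h2 : u * ∑ i ∈ insert j s, c i * (e i * u ^ (e i - 1))
            = ∑ i ∈ insert j s, c i * e i * u ^ e i := by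
          rw [Finset.mul_sum]
          refine Finset.sum_congr rfl fun i _ => ?_
          rw [Real.rpow_sub_one hu0.ne']; field_simp
        rw [h1, mul_zero] at h2
        have h3 := h u hu
        rw [Finset.sum_insert hj] at h2 h3
        have h4 : ∑ i ∈ s, c i * (e i - e j) * u ^ e i
            = ∑ i ∈ s, c i * e i * u ^ e i - e j * ∑ i ∈ s, c i * u ^ e i := by
          rw [Finset.mul_sum, ← Finset.sum_sub_distrib]
          exact Finset.sum_congr rfl fun i _ => by ring
        rw [h4]
        linear_combination -h2 - e j * h3)
      intro i hi
      refine (mul_eq_zero.1 (this i hi)).resolve_right (sub_ne_zero.2 fun hij => hj ?_)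
      exact he (by simp [hi]) (by simp) hij ▸ hi
    intro i hi
    rcases Finset.mem_insert.1 hi with rfl | hi
    · obtain ⟨u, hu⟩ := hne
      have hu0 : 0 < u := hpos hu
      have h3 := h u hu
      rw [Finset.sum_insert hj, Finset.sum_eq_zero (fun k hk => by rw [hs k hk, zero_mul]),
        add_zero] at h3
      exact (mul_eq_zero.1 h3).resolve_right (Real.rpow_pos_of_pos hu0 _).ne'
    · exact hs i hi

/-- Powers with distinct exponents are linearly independent on their domain. -/
theorem rpow_coeff_eq_zero {ι : Type*} (s : Finset ι) {e : ι → ℝ} (he : InjOn e s)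
    (hI : IsOpen I) (hne : I.Nonempty) (hd : ∀ i ∈ s, PowerDomain I (e i)) (c : ι → ℝ)
    (h : ∀ u ∈ I, u ≠ 0 → ∑ i ∈ s, c i * u ^ e i = 0) : ∀ i ∈ s, c i = 0 := by
  obtain ⟨u, hu, hu0⟩ := exists_mem_affine_ne_zero hI hne (a := 1) (b := 0) one_ne_zero
  rw [one_mul, add_zero] at hu0
  rcases lt_or_gt_of_ne hu0 with hneg | hp
  · have hk : ∀ i ∈ s, ∃ k : ℕ, e i = k := by
      intro i hi
      rcases hd i hi with hpos | hk
      · exact absurd (hpos hu) (not_lt.2 hneg.le)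
      · exact hk
    choose! k hk using hk
    -- The interval contains a negative point, so all exponents are natural numbers, and reflecting
    -- u only multiplies the coefficients by signs.
    have hJ : IsOpen ((fun s : ℝ => -s) ⁻¹' I ∩ Ioi 0) :=
      (hI.preimage continuous_neg).inter isOpen_Ioi
    have := rpow_coeff_eq_zero_of_pos s he hJ ⟨-u, by simpa using hu, by simpa using hneg⟩
      inter_subset_right (fun i => c i * (-1) ^ (k i)) (by
        rintro v ⟨hv, hv0⟩
        have hv0' : 0 < v := hv0
        rw [← h (-v) hv (by linarith)]
        refine Finset.sum_congr rfl fun i hi => ?_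
        rw [hk i hi, Real.rpow_natCast, Real.rpow_natCast, neg_pow v]; ring)
    intro i hi
    exact (mul_eq_zero.1 (this i hi)).resolve_right (pow_ne_zero _ (by norm_num))
  · refine rpow_coeff_eq_zero_of_pos s he (hI.inter isOpen_Ioi) ⟨u, hu, hp⟩ inter_subset_right c ?_
    rintro v ⟨hv, hv0⟩
    exact h v hv (ne_of_gt hv0)

theorem rpow_coeff_two (hI : IsOpen I) (hne : I.Nonempty) {r₁ r₂ A₁ A₂ : ℝ}
    (d₁ : PowerDomain I r₁) (d₂ : PowerDomain I r₂) (h₁₂ : r₁ ≠ r₂)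
    (h : ∀ u ∈ I, u ≠ 0 → A₁ * u ^ r₁ + A₂ * u ^ r₂ = 0) : A₁ = 0 ∧ A₂ = 0 := by
  have := rpow_coeff_eq_zero Finset.univ (e := ![r₁, r₂]) (by
    intro i _ j _ hij
    fin_cases i <;> fin_cases j <;> simp_all) hI hne (by
    intro i _
    fin_cases i <;> simpa) ![A₁, A₂] (by simpa [Fin.sum_univ_two] using h)
  exact ⟨this 0 (Finset.mem_univ _), this 1 (Finset.mem_univ _)⟩

theorem rpow_coeff_three (hI : IsOpen I) (hne : I.Nonempty) {r₁ r₂ r₃ A₁ A₂ A₃ : ℝ}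
    (d₁ : PowerDomain I r₁) (d₂ : PowerDomain I r₂) (d₃ : PowerDomain I r₃) (h₁₂ : r₁ ≠ r₂)
    (h₁₃ : r₁ ≠ r₃) (h₂₃ : r₂ ≠ r₃)
    (h : ∀ u ∈ I, u ≠ 0 → A₁ * u ^ r₁ + A₂ * u ^ r₂ + A₃ * u ^ r₃ = 0) :
    A₁ = 0 ∧ A₂ = 0 ∧ A₃ = 0 := by
  have := rpow_coeff_eq_zero Finset.univ (e := ![r₁, r₂, r₃]) (by
    intro i _ j _ hij
    fin_cases i <;> fin_cases j <;> simp_all) hI hne (by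
    intro i _
    fin_cases i <;> simpa) ![A₁, A₂, A₃] (by simpa [Fin.sum_univ_three] using h)
  exact ⟨this 0 (Finset.mem_univ _), this 1 (Finset.mem_univ _), this 2 (Finset.mem_univ _)⟩

theorem quadratic_coeff (hI : IsOpen I) (hne : I.Nonempty) {A₀ A₁ A₂ : ℝ}
    (h : ∀ u ∈ I, A₀ + A₁ * u + A₂ * u ^ 2 = 0) : A₀ = 0 ∧ A₁ = 0 ∧ A₂ = 0 := by
  refine rpow_coeff_three hI hne (r₁ := 0) (r₂ := 1) (r₃ := 2) PowerDomain.zero PowerDomain.one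
    PowerDomain.two (by norm_num) (by norm_num) (by norm_num) fun u hu _ => ?_
  have := h u hu
  rw [Real.rpow_zero, Real.rpow_one, Real.rpow_two]
  linarith

/-- Applying u d/du removes the constant and turns the logarithm into 1, leaving the powers with
exponents 0 and r ≠ 0. -/
theorem log_coeff (hI : IsOpen I) (hne : I.Nonempty) (hpos : I ⊆ Ioi 0) {A B C r : ℝ} (hr : r ≠ 0)
    (h : ∀ u ∈ I, A * Real.log u + B + C * u ^ r = 0) : A = 0 ∧ B = 0 ∧ C = 0 := by
  have h1 : ∀ u ∈ I, u ≠ 0 → A * u ^ (0 : ℝ) + r * C * u ^ r = 0 := by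
    intro u hu hu0
    have hd := (((Real.hasDerivAt_log hu0).const_mul A).add_const B).add
      ((Real.hasDerivAt_rpow_const (p := r) (Or.inl hu0)).const_mul C)
    have := hasDerivAt_eq_zero_of_eqOn hI h hu hd
    rw [Real.rpow_sub_one hu0] at this
    rw [Real.rpow_zero]
    field_simp at this
    linear_combination this
  obtain ⟨hA, hC⟩ := rpow_coeff_two hI hne PowerDomain.zero (Or.inl hpos) hr.symm h1
  have hC' : C = 0 := (mul_eq_zero.1 hC).resolve_left hr
  obtain ⟨u, hu⟩ := hne
  have := h u hu
  rw [hA, hC'] at this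
  exact ⟨hA, by linarith, hC'⟩

/-- The substitution u = ln x turns independence of exponentials into independence of powers on a
positive set. -/
theorem exp_preimage (hI : IsOpen I) (hne : I.Nonempty) :
    IsOpen {x : ℝ | 0 < x ∧ Real.log x ∈ I} ∧ {x : ℝ | 0 < x ∧ Real.log x ∈ I}.Nonempty := by
  constructor
  · have hc : ContinuousOn Real.log (Ioi 0) :=
      Real.continuousOn_log.mono fun x hx => ne_of_gt hx
    exact hc.isOpen_inter_preimage isOpen_Ioi hI
  · obtain ⟨u, hu⟩ := hne
    exact ⟨Real.exp u, Real.exp_pos u, by simpa using hu⟩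

theorem exp_coeff (hI : IsOpen I) (hne : I.Nonempty) {r₁ r₂ r₃ A₁ A₂ A₃ : ℝ} (h₁₂ : r₁ ≠ r₂)
    (h₁₃ : r₁ ≠ r₃) (h₂₃ : r₂ ≠ r₃)
    (h : ∀ u ∈ I, A₁ * Real.exp (r₁ * u) + A₂ * Real.exp (r₂ * u) + A₃ * Real.exp (r₃ * u) = 0) :
    A₁ = 0 ∧ A₂ = 0 ∧ A₃ = 0 := by
  obtain ⟨hJ, hJne⟩ := exp_preimage hI hne
  have hpos : {x : ℝ | 0 < x ∧ Real.log x ∈ I} ⊆ Ioi 0 := fun x hx => hx.1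
  refine rpow_coeff_three hJ hJne (Or.inl hpos) (Or.inl hpos) (Or.inl hpos) h₁₂ h₁₃ h₂₃ ?_
  rintro x ⟨hx, hxI⟩ -
  have := h _ hxI
  rw [Real.rpow_def_of_pos hx, Real.rpow_def_of_pos hx, Real.rpow_def_of_pos hx, mul_comm _ r₁,
    mul_comm _ r₂, mul_comm _ r₃]
  exact this

/-- After u = ln x and division by x this is the case r = -1 of `log_coeff`. -/
theorem linear_exp_coeff (hI : IsOpen I) (hne : I.Nonempty) {A B C : ℝ}
    (h : ∀ u ∈ I, (A * u + B) * Real.exp u + C = 0) : A = 0 ∧ B = 0 ∧ C = 0 := by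
  obtain ⟨hJ, hJne⟩ := exp_preimage hI hne
  have hpos : {x : ℝ | 0 < x ∧ Real.log x ∈ I} ⊆ Ioi 0 := fun x hx => hx.1
  refine log_coeff hJ hJne hpos (r := -1) (by norm_num) ?_
  rintro x ⟨hx, hxI⟩
  have := h _ hxI
  rw [Real.exp_log hx] at this
  rw [Real.rpow_neg_one]
  field_simp
  linear_combination this

/-- Two differentiations reduce the quadratic part to a constant without changing the form of the
exponential part; the exponential part then vanishes, and the quadratic part with it. -/
theorem quadratic_add_linear_exp_coeff (hI : IsOpen I) (hne : I.Nonempty) {A₀ A₁ A₂ A B : ℝ}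
    (h : ∀ u ∈ I, A₀ + A₁ * u + A₂ * u ^ 2 + (A * u + B) * Real.exp u = 0) :
    A₀ = 0 ∧ A₁ = 0 ∧ A₂ = 0 ∧ A = 0 ∧ B = 0 := by
  have hE : ∀ (A B u : ℝ), HasDerivAt (fun u => (A * u + B) * Real.exp u)
      ((A * u + (B + A)) * Real.exp u) u := by
    intro A B u
    refine ((((hasDerivAt_id u).const_mul A).add_const B).mul (Real.hasDerivAt_exp u)).congr_deriv ?_
    simp only [id]; ring
  have h1 : ∀ u ∈ I, A₁ + 2 * A₂ * u + (A * u + (B + A)) * Real.exp u = 0 := by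
    intro u hu
    have hd := ((((hasDerivAt_id u).const_mul A₁).const_add A₀).add
      (((hasDerivAt_id u).pow 2).const_mul A₂)).add (hE A B u)
    have := hasDerivAt_eq_zero_of_eqOn hI h hu hd
    simp at this
    linear_combination this
  have h2 : ∀ u ∈ I, 2 * A₂ + (A * u + (B + A + A)) * Real.exp u = 0 := by
    intro u hu
    have hd := (((hasDerivAt_id u).const_mul (2 * A₂)).const_add A₁).add (hE A (B + A) u)
    have := hasDerivAt_eq_zero_of_eqOn hI h1 hu hd
    simp at this
    linear_combination this
  obtain ⟨e1, e2, e3⟩ := linear_exp_coeff hI hne (A := A) (B := B + A + A) (C := 2 * A₂)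
    fun u hu => by linear_combination h2 u hu
  have hB : B = 0 := by linarith
  obtain ⟨f0, f1, f2⟩ := quadratic_coeff hI hne (A₀ := A₀) (A₁ := A₁) (A₂ := A₂) fun u hu => by
    have := h u hu
    rw [e1, hB] at this
    linear_combination this
  exact ⟨f0, f1, f2, e1, hB⟩

end OneVariable

/-! ### The space of solutions of the determining equations -/

section LinearStructure

variable {E : Equation} {B : Set Base} {c c' : ℝ} {ψ α β ψ' α' β' : Base → ℝ}

theorem fderiv_add_apply_of_mem (hB : IsOpen B) {f g : Base → ℝ} (hf : ContDiffOn ℝ ∞ f B)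
    (hg : ContDiffOn ℝ ∞ g B) {p : Base} (hp : p ∈ B) (a : Base) :
    fderiv ℝ (f + g) p a = fderiv ℝ f p a + fderiv ℝ g p a := by
  rw [fderiv_add (hf.contDiffAt (hB.mem_nhds hp)).diff (hg.contDiffAt (hB.mem_nhds hp)).diff]
  rfl

theorem fderiv_smul_apply_of_mem (hB : IsOpen B) {f : Base → ℝ} (hf : ContDiffOn ℝ ∞ f B)
    {p : Base} (hp : p ∈ B) (r : ℝ) (a : Base) :
    fderiv ℝ (r • f) p a = r * fderiv ℝ f p a := by
  rw [fderiv_const_smul (hf.contDiffAt (hB.mem_nhds hp)).diff]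
  rfl

theorem DeterminingSystem.zero (E : Equation) (B : Set Base) : DeterminingSystem E B 0 0 0 0 := by
  have h : ∀ p a : Base, fderiv ℝ (0 : Base → ℝ) p a = 0 := fun p a => by simp
  exact ⟨contDiffOn_const, contDiffOn_const, contDiffOn_const, fun p _ => h p _, fun p _ => h p _,
    fun p _ => h p _, fun p _ u _ => by simp [Dt, Dy], fun p _ u _ => by simp [Dt, Dy]⟩

theorem DeterminingSystem.add (hB : IsOpen B) (h : DeterminingSystem E B c ψ α β)
    (h' : DeterminingSystem E B c' ψ' α' β') :
    DeterminingSystem E B (c + c') (ψ + ψ') (α + α') (β + β') := by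
  refine ⟨h.smooth_ψ.add h'.smooth_ψ, h.smooth_α.add h'.smooth_α, h.smooth_β.add h'.smooth_β,
    fun p hp => ?_, fun p hp => ?_, fun p hp => ?_, fun p hp u hu => ?_, fun p hp u hu => ?_⟩
  · exact (fderiv_add_apply_of_mem hB h.smooth_ψ h'.smooth_ψ hp _).trans (by
      rw [show fderiv ℝ ψ p _ = 0 from h.dx_ψ p hp, show fderiv ℝ ψ' p _ = 0 from h'.dx_ψ p hp]; simp)
  · exact (fderiv_add_apply_of_mem hB h.smooth_α h'.smooth_α hp _).trans (by
      rw [show fderiv ℝ α p _ = 0 from h.dx_α p hp, show fderiv ℝ α' p _ = 0 from h'.dx_α p hp]; simp)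
  · exact (fderiv_add_apply_of_mem hB h.smooth_β h'.smooth_β hp _).trans (by
      rw [show fderiv ℝ β p _ = 0 from h.dx_β p hp, show fderiv ℝ β' p _ = 0 from h'.dx_β p hp]; simp)
  · have e1 := h.eqA p hp u hu
    have e2 := h'.eqA p hp u hu
    simp only [Dt, Dy, fderiv_add_apply_of_mem hB h.smooth_ψ h'.smooth_ψ hp, Pi.add_apply] at *
    linear_combination e1 + e2
  · have e1 := h.eqB p hp u hu
    have e2 := h'.eqB p hp u hu
    simp only [Dt, Dy, fderiv_add_apply_of_mem hB h.smooth_α h'.smooth_α hp,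
      fderiv_add_apply_of_mem hB h.smooth_β h'.smooth_β hp, Pi.add_apply] at *
    linear_combination e1 + e2

theorem DeterminingSystem.smul (hB : IsOpen B) (r : ℝ) (h : DeterminingSystem E B c ψ α β) :
    DeterminingSystem E B (r * c) (r • ψ) (r • α) (r • β) := by
  refine ⟨h.smooth_ψ.const_smul r, h.smooth_α.const_smul r, h.smooth_β.const_smul r,
    fun p hp => ?_, fun p hp => ?_, fun p hp => ?_, fun p hp u hu => ?_, fun p hp u hu => ?_⟩
  · exact (fderiv_smul_apply_of_mem hB h.smooth_ψ hp _ _).trans (by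
      rw [show fderiv ℝ ψ p _ = 0 from h.dx_ψ p hp]; simp)
  · exact (fderiv_smul_apply_of_mem hB h.smooth_α hp _ _).trans (by
      rw [show fderiv ℝ α p _ = 0 from h.dx_α p hp]; simp)
  · exact (fderiv_smul_apply_of_mem hB h.smooth_β hp _ _).trans (by
      rw [show fderiv ℝ β p _ = 0 from h.dx_β p hp]; simp)
  · have e1 := h.eqA p hp u hu
    simp only [Dt, Dy, fderiv_smul_apply_of_mem hB h.smooth_ψ hp, Pi.smul_apply, smul_eq_mul] at *
    linear_combination r * e1
  · have e1 := h.eqB p hp u hu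
    simp only [Dt, Dy, fderiv_smul_apply_of_mem hB h.smooth_α hp,
      fderiv_smul_apply_of_mem hB h.smooth_β hp, Pi.smul_apply, smul_eq_mul] at *
    linear_combination r * e1

theorem affineField_add (c₀ c₂ c₀' c₂' : ℝ) (z : Total) :
    affineField c₀ c c₂ ψ α β z + affineField c₀' c' c₂' ψ' α' β' z
      = affineField (c₀ + c₀') (c + c') (c₂ + c₂') (ψ + ψ') (α + α') (β + β') z := by
  refine Prod.ext (Prod.ext ?_ (Prod.ext ?_ ?_)) ?_ <;> simp [affineField] <;> ring

theorem affineField_smul (c₀ c₂ r : ℝ) (z : Total) :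
    r • affineField c₀ c c₂ ψ α β z
      = affineField (r * c₀) (r * c) (r * c₂) (r • ψ) (r • α) (r • β) z := by
  refine Prod.ext (Prod.ext ?_ (Prod.ext ?_ ?_)) ?_ <;> simp [affineField] <;> ring

end LinearStructure

theorem mem_span_kernelFields {w : Total → Total} : w ∈ Submodule.span ℝ kernelFields ↔
    ∃ a b d : ℝ, w = fun _ => ((a, b, d), 0) := by
  unfold kernelFields
  rw [Submodule.mem_span_triple]
  constructor
  · rintro ⟨a, b, d, rfl⟩
    refine ⟨a, b, d, funext fun z => ?_⟩
    simp [ofCoords]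
  · rintro ⟨a, b, d, rfl⟩
    refine ⟨a, b, d, funext fun z => ?_⟩
    simp [ofCoords]

/-- A description of the algebra of symmetries by generators. -/
theorem isSymmetry_iff_spannedOn {E : Equation} {B : Set Base} (hB : IsOpen B)
    (hB' : IsPreconnected B) {S : Set (Total → Total)}
    (h : ∀ c ψ α β, DeterminingSystem E B c ψ α β → ∃ s ∈ Submodule.span ℝ S, ∃ d : ℝ,
      ∀ p ∈ B, ∀ u, affineField 0 c 0 ψ α β (p, u) = s (p, u) + ((0, 0, d), 0))
    (h' : ∀ X ∈ S, ∃ c ψ α β, DeterminingSystem E B c ψ α β ∧ X = affineField 0 c 0 ψ α β)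
    (v : Total → Total) :
    E.IsSymmetry B v ↔ SpannedOn (kernelFields ∪ S) (B ×ˢ E.dom) v := by
  rw [Equation.isSymmetry_iff hB hB']
  constructor
  · rintro ⟨c₀, c, c₂, ψ, α, β, hD, hv⟩
    obtain ⟨s, hs, d, hsd⟩ := h c ψ α β hD
    refine ⟨(fun _ => ((c₀, c₂, d), 0)) + s, ?_, fun z hz => ?_⟩
    · rw [Submodule.span_union]
      exact Submodule.add_mem_sup (mem_span_kernelFields.2 ⟨_, _, _, rfl⟩) hs
    · have e := hsd z.1 hz.1 z.2
      rw [hv hz]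
      have : affineField c₀ c c₂ ψ α β z = affineField 0 c 0 ψ α β (z.1, z.2) + ((c₀, c₂, 0), 0) := by
        refine Prod.ext (Prod.ext ?_ (Prod.ext ?_ ?_)) ?_ <;> simp [affineField]
      rw [this, e]
      refine Prod.ext (Prod.ext ?_ (Prod.ext ?_ ?_)) ?_ <;> simp <;> ring
  · rintro ⟨w, hw, hv⟩
    suffices hw' : ∃ c₀ c c₂ ψ α β, DeterminingSystem E B c ψ α β ∧ w = affineField c₀ c c₂ ψ α β by
      obtain ⟨c₀, c, c₂, ψ, α, β, hD, rfl⟩ := hw'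
      exact ⟨c₀, c, c₂, ψ, α, β, hD, hv⟩
    clear hv
    induction hw using Submodule.span_induction with
    | mem x hx =>
      rcases hx with hx | hx
      · obtain ⟨a, b, d, rfl⟩ := mem_span_kernelFields.1 (Submodule.subset_span hx)
        refine ⟨a, 0, b, fun _ => d, 0, 0, ?_, ?_⟩
        · have z := DeterminingSystem.zero E B
          exact ⟨contDiffOn_const, z.smooth_α, z.smooth_β, fun p _ => by simp [Dx], z.dx_α, z.dx_β,
            fun p _ u _ => by simp [Dt, Dy], z.eqB⟩
        · funext z; simp [affineField]
      · obtain ⟨c, ψ, α, β, hD, rfl⟩ := h' x hx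
        exact ⟨0, c, 0, ψ, α, β, hD, rfl⟩
    | zero =>
      refine ⟨0, 0, 0, 0, 0, 0, .zero E B, ?_⟩
      funext z; simp [affineField]; rfl
    | add x y _ _ hx hy =>
      obtain ⟨c₀, c, c₂, ψ, α, β, hD, rfl⟩ := hx
      obtain ⟨c₀', c', c₂', ψ', α', β', hD', rfl⟩ := hy
      exact ⟨_, _, _, _, _, _, hD.add hB hD', funext fun z => affineField_add _ _ _ _ _⟩
    | smul r x _ hx =>
      obtain ⟨c₀, c, c₂, ψ, α, β, hD, rfl⟩ := hx
      exact ⟨_, _, _, _, _, _, hD.smul hB r, funext fun z => affineField_smul _ _ _ _⟩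

/-! ### Functions of `t` and `y` -/

theorem hasFDerivAt_mul_base {g h : ℝ → ℝ} {g' h' : ℝ} {p : Base} (hg : HasDerivAt g g' p.1)
    (hh : HasDerivAt h h' p.2.2) : ∃ L : Base →L[ℝ] ℝ,
      HasFDerivAt (fun q : Base => g q.1 * h q.2.2) L p ∧
        ∀ a, L a = g' * h p.2.2 * a.1 + g p.1 * h' * a.2.2 := by
  have h1 := hg.comp_hasFDerivAt p (hasFDerivAt_fst (𝕜 := ℝ) (E := ℝ) (F := ℝ × ℝ))
  have h2 : HasFDerivAt (fun q : Base => q.2.2)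
    ((ContinuousLinearMap.snd ℝ ℝ ℝ).comp (ContinuousLinearMap.snd ℝ ℝ (ℝ × ℝ))) p :=
    ((ContinuousLinearMap.snd ℝ ℝ ℝ).comp (ContinuousLinearMap.snd ℝ ℝ (ℝ × ℝ))).hasFDerivAt
  have h3 := hh.comp_hasFDerivAt p h2
  refine ⟨_, h1.mul h3, fun a => ?_⟩
  simp
  ring

theorem Dt_mul_base {g h : ℝ → ℝ} {g' h' : ℝ} {p : Base} (hg : HasDerivAt g g' p.1)
    (hh : HasDerivAt h h' p.2.2) : Dt (fun q : Base => g q.1 * h q.2.2) p = g' * h p.2.2 := by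
  obtain ⟨L, hL, e⟩ := hasFDerivAt_mul_base hg hh
  simp [Dt, hL.fderiv, e]

theorem Dx_mul_base {g h : ℝ → ℝ} {g' h' : ℝ} {p : Base} (hg : HasDerivAt g g' p.1)
    (hh : HasDerivAt h h' p.2.2) : Dx (fun q : Base => g q.1 * h q.2.2) p = 0 := by
  obtain ⟨L, hL, e⟩ := hasFDerivAt_mul_base hg hh
  simp [Dx, hL.fderiv, e]

theorem Dy_mul_base {g h : ℝ → ℝ} {g' h' : ℝ} {p : Base} (hg : HasDerivAt g g' p.1)
    (hh : HasDerivAt h h' p.2.2) : Dy (fun q : Base => g q.1 * h q.2.2) p = g p.1 * h' := by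
  obtain ⟨L, hL, e⟩ := hasFDerivAt_mul_base hg hh
  simp [Dy, hL.fderiv, e]

theorem hasFDerivAt_affine_base (k l d : ℝ) (p : Base) : ∃ L : Base →L[ℝ] ℝ,
      HasFDerivAt (fun q : Base => k * q.2.2 + l * q.1 + d) L p ∧ ∀ a, L a = k * a.2.2 + l * a.1 := by
  have h2 : HasFDerivAt (fun q : Base => q.2.2)
    ((ContinuousLinearMap.snd ℝ ℝ ℝ).comp (ContinuousLinearMap.snd ℝ ℝ (ℝ × ℝ))) p :=
    ((ContinuousLinearMap.snd ℝ ℝ ℝ).comp (ContinuousLinearMap.snd ℝ ℝ (ℝ × ℝ))).hasFDerivAt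
  refine ⟨_, ((h2.const_mul k).add ((hasFDerivAt_fst (𝕜 := ℝ) (E := ℝ) (F := ℝ × ℝ)).const_mul l)).add_const
    d, fun a => ?_⟩
  simp

theorem Dt_affine_base (k l d : ℝ) (p : Base) : Dt (fun q => k * q.2.2 + l * q.1 + d) p = l := by
  obtain ⟨L, hL, e⟩ := hasFDerivAt_affine_base k l d p
  simp [Dt, hL.fderiv, e]

theorem Dx_affine_base (k l d : ℝ) (p : Base) : Dx (fun q => k * q.2.2 + l * q.1 + d) p = 0 := by
  obtain ⟨L, hL, e⟩ := hasFDerivAt_affine_base k l d p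
  simp [Dx, hL.fderiv, e]

theorem Dy_affine_base (k l d : ℝ) (p : Base) : Dy (fun q => k * q.2.2 + l * q.1 + d) p = k := by
  obtain ⟨L, hL, e⟩ := hasFDerivAt_affine_base k l d p
  simp [Dy, hL.fderiv, e]

theorem exists_eq_affine {B : Set Base} (hB : IsOpen B) (hB' : IsPreconnected B) {f : Base → ℝ}
    {k l : ℝ} (hf : ContDiffOn ℝ ∞ f B) (ht : ∀ p ∈ B, Dt f p = l) (hx : ∀ p ∈ B, Dx f p = 0)
    (hy : ∀ p ∈ B, Dy f p = k) : ∃ d, ∀ p ∈ B, f p = k * p.2.2 + l * p.1 + d := by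
  have hfd : ∀ p ∈ B, ∀ a, fderiv ℝ (fun q : Base => f q - (k * q.2.2 + l * q.1 + 0)) p a
      = fderiv ℝ f p a - (k * a.2.2 + l * a.1) := by
    intro p hp a
    obtain ⟨L, hL, e⟩ := hasFDerivAt_affine_base k l 0 p
    rw [fderiv_fun_sub (hf.contDiffAt (hB.mem_nhds hp)).diff hL.differentiableAt, sub_apply,
      hL.fderiv, e]
  obtain ⟨d, hd⟩ := exists_eq_const hB hB'
    (hf.sub (g := fun q : Base => k * q.2.2 + l * q.1 + 0) (by fun_prop))
    (fun p hp => (hfd p hp _).trans (by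
      change Dt f p - _ = 0; rw [ht p hp]; simp))
    (fun p hp => (hfd p hp _).trans (by
      change Dx f p - _ = 0; rw [hx p hp]; simp))
    (fun p hp => (hfd p hp _).trans (by
      change Dy f p - _ = 0; rw [hy p hp]; simp))
  exact ⟨d, fun p hp => by linarith [hd p hp]⟩

/-- The determining equations for coefficients `α`, `β` that are constant. -/
theorem DeterminingSystem.of_affine {E : Equation} {B : Set Base} {c k l a b : ℝ}
    (hA : ∀ u ∈ E.dom, (c - k) * E.f₁ u - l + (a * u + b) * deriv E.f₁ u = 0)
    (hB : ∀ u ∈ E.dom, (a - c) * E.f₂ u - (a * u + b) * deriv E.f₂ u = 0) :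
    DeterminingSystem E B c (fun q => k * q.2.2 + l * q.1 + 0) (fun _ => a) fun _ => b := by
  refine ⟨by fun_prop, contDiffOn_const, contDiffOn_const, fun p _ => Dx_affine_base _ _ _ _,
    fun p _ => by simp [Dx], fun p _ => by simp [Dx], fun p _ u hu => ?_, fun p _ u hu => ?_⟩
  · rw [Dt_affine_base, Dy_affine_base]; exact hA u hu
  · have := hB u hu
    simp [Dt, Dy]; linarith

theorem DeterminingSystem.exists_ψ_eq {E : Equation} {B : Set Base} (hB : IsOpen B)
    (hB' : IsPreconnected B) {c : ℝ} {ψ α β : Base → ℝ} (h : DeterminingSystem E B c ψ α β) {k l : ℝ}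
    (ht : ∀ p ∈ B, Dt ψ p = l) (hy : ∀ p ∈ B, Dy ψ p = k) :
    ∃ d, ∀ p ∈ B, ψ p = k * p.2.2 + l * p.1 + d :=
  exists_eq_affine hB hB' h.smooth_ψ ht h.dx_ψ hy

theorem fderiv_congr_of_mem {B : Set Base} (hB : IsOpen B) {f g : Base → ℝ}
    (h : ∀ q ∈ B, f q = g q) {p : Base} (hp : p ∈ B) : fderiv ℝ f p = fderiv ℝ g p := by
  have e : f =ᶠ[𝓝 p] g := by filter_upwards [hB.mem_nhds hp] with q hq using h q hq
  exact e.fderiv_eq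

theorem fderiv_mul_apply_of_mem {B : Set Base} (hB : IsOpen B) {f g : Base → ℝ}
    (hf : ContDiffOn ℝ ∞ f B) (hg : ContDiffOn ℝ ∞ g B) {p : Base} (hp : p ∈ B) (a : Base) :
    fderiv ℝ (fun q => f q * g q) p a = fderiv ℝ f p a * g p + f p * fderiv ℝ g p a := by
  rw [fderiv_fun_mul (hf.contDiffAt (hB.mem_nhds hp)).diff (hg.contDiffAt (hB.mem_nhds hp)).diff]
  simp; ring

theorem Dt_Dy_comm {B : Set Base} (hB : IsOpen B) {f : Base → ℝ} (hf : ContDiffOn ℝ ∞ f B)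
    {p : Base} (hp : p ∈ B) : Dt (Dy f) p = Dy (Dt f) p :=
  fderiv_fderiv_comm (hf.contDiffAt (hB.mem_nhds hp)) ey et

theorem Dt_eq_zero_of_eqOn {B : Set Base} (hB : IsOpen B) {f : Base → ℝ} {k : ℝ}
    (h : ∀ q ∈ B, f q = k) {p : Base} (hp : p ∈ B) : Dt f p = 0 := by
  simp [Dt, fderiv_eq_zero_of_eqOn hB h hp]

theorem Dy_eq_zero_of_eqOn {B : Set Base} (hB : IsOpen B) {f : Base → ℝ} {k : ℝ}
    (h : ∀ q ∈ B, f q = k) {p : Base} (hp : p ∈ B) : Dy f p = 0 := by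
  simp [Dy, fderiv_eq_zero_of_eqOn hB h hp]

theorem Equation.deriv_f₁_eq (E : Equation) {f : ℝ → ℝ} (h : EqOn E.f₁ f E.dom) {u : ℝ}
    (hu : u ∈ E.dom) : deriv E.f₁ u = deriv f u :=
  deriv_eq_of_eqOn E.isOpen_dom h hu

theorem Equation.deriv_f₂_eq (E : Equation) {f : ℝ → ℝ} (h : EqOn E.f₂ f E.dom) {u : ℝ}
    (hu : u ∈ E.dom) : deriv E.f₂ u = deriv f u :=
  deriv_eq_of_eqOn E.isOpen_dom h hu

/-! ### Splitting equation (A) for the special functions f₁ -/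

namespace DeterminingSystem

variable {E : Equation} {B : Set Base} {c : ℝ} {ψ α β : Base → ℝ}

/-- Equation (A) reads (αu + β + c - ψ_y) e^u - ψ_t = 0, and its coefficients vanish separately.
Then β_t = ψ_yt = 0, which leaves (B) as a relation for f₂ with β_y as its only derivative
coefficient. -/
theorem of_exp (hB : IsOpen B) (h : DeterminingSystem E B c ψ α β) (h₁ : EqOn E.f₁ Real.exp E.dom) :
    ∀ p ∈ B, α p = 0 ∧ Dt ψ p = 0 ∧ Dy ψ p = β p + c ∧ Dt β p = 0 ∧
      ∀ u ∈ E.dom, - c * E.f₂ u + Real.exp u * Dy β p - β p * deriv E.f₂ u = 0 := by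
  have key : ∀ p ∈ B, α p = 0 ∧ β p = Dy ψ p - c ∧ Dt ψ p = 0 := by
    intro p hp
    obtain ⟨e1, e2, e3⟩ := linear_exp_coeff E.isOpen_dom E.nonempty_dom (A := α p)
      (B := c - Dy ψ p + β p) (C := -Dt ψ p) fun u hu => by
        have := h.eqA p hp u hu
        rw [E.deriv_f₁_eq h₁ hu, h₁ hu, Real.deriv_exp] at this
        linear_combination this
    exact ⟨e1, by linarith, by linarith⟩
  intro p hp
  have ht : Dt β p = 0 := by
    have e : Dt β p = fderiv ℝ (fun q => Dy ψ q - c) p et := by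
      unfold Dt; rw [fderiv_congr_of_mem hB (fun q hq => (key q hq).2.1) hp]
    rw [e, fderiv_sub_const]
    exact (Dt_Dy_comm hB h.smooth_ψ hp).trans (Dy_eq_zero_of_eqOn hB (fun q hq => (key q hq).2.2) hp)
  refine ⟨(key p hp).1, (key p hp).2.2, by linarith [(key p hp).2.1], ht, fun u hu => ?_⟩
  have := h.eqB p hp u hu
  rw [ht, Dt_eq_zero_of_eqOn hB (fun q hq => (key q hq).1) hp,
    Dy_eq_zero_of_eqOn hB (fun q hq => (key q hq).1) hp, h₁ hu, (key p hp).1] at this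
  linear_combination this

/-- Equation (A) reads (c - ψ_y) ln u + (α - ψ_t) + β/u = 0. Equality of mixed derivatives of ψ
gives α_y = 0, since ψ_y is constant. -/
theorem of_log (hB : IsOpen B) (h : DeterminingSystem E B c ψ α β) (hd : E.dom ⊆ Ioi 0)
    (h₁ : EqOn E.f₁ Real.log E.dom) :
    ∀ p ∈ B, β p = 0 ∧ Dt ψ p = α p ∧ Dy ψ p = c ∧ Dy α p = 0 ∧
      ∀ u ∈ E.dom, Dt α p * u + (α p - c) * E.f₂ u - α p * (u * deriv E.f₂ u) = 0 := by
  have key : ∀ p ∈ B, β p = 0 ∧ Dt ψ p = α p ∧ Dy ψ p = c := by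
    intro p hp
    obtain ⟨e1, e2, e3⟩ := log_coeff E.isOpen_dom E.nonempty_dom hd (r := -1) (by norm_num)
      (A := c - Dy ψ p) (B := α p - Dt ψ p) (C := β p) fun u hu => by
        have := h.eqA p hp u hu
        have hu0 : u ≠ 0 := ne_of_gt (hd hu)
        rw [E.deriv_f₁_eq h₁ hu, h₁ hu, Real.deriv_log] at this
        rw [Real.rpow_neg_one]
        field_simp at this ⊢
        linear_combination this
    exact ⟨e3, by linarith, by linarith⟩
  intro p hp
  have hy : Dy α p = 0 := by
    have e : Dy α p = Dy (Dt ψ) p := by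
      unfold Dy; rw [fderiv_congr_of_mem hB (fun q hq => (key q hq).2.1) hp]
    rw [e, ← Dt_Dy_comm hB h.smooth_ψ hp]
    exact Dt_eq_zero_of_eqOn hB (fun q hq => (key q hq).2.2) hp
  refine ⟨(key p hp).1, (key p hp).2.1, (key p hp).2.2, hy, fun u hu => ?_⟩
  have := h.eqB p hp u hu
  rw [hy, Dt_eq_zero_of_eqOn hB (fun q hq => (key q hq).1) hp,
    Dy_eq_zero_of_eqOn hB (fun q hq => (key q hq).1) hp, (key p hp).1] at this
  linear_combination this

/-- For m ≠ 0, 1 the exponents m, 0, m - 1 are distinct, so (A) splits into three equations and β =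
0. For m = 1 the last two coincide and β survives, which is why f₁ = u is treated separately. -/
theorem of_pow (hB : IsOpen B) (h : DeterminingSystem E B c ψ α β) {m : ℝ} (hm₀ : m ≠ 0)
    (hm₁ : m ≠ 1) (hd : PowerDomain E.dom m) (h₁ : EqOn E.f₁ (fun u => u ^ m) E.dom) :
    ∀ p ∈ B, β p = 0 ∧ Dt ψ p = 0 ∧ Dy ψ p = m * α p + c ∧ Dt α p = 0 ∧
      ∀ u ∈ E.dom, (α p - c) * E.f₂ u + Dy α p * u ^ (m + 1) - α p * (u * deriv E.f₂ u) = 0 := by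
  have key : ∀ p ∈ B, β p = 0 ∧ Dt ψ p = 0 ∧ Dy ψ p = m * α p + c := by
    intro p hp
    obtain ⟨e1, e2, e3⟩ := rpow_coeff_three E.isOpen_dom E.nonempty_dom hd PowerDomain.zero
      (hd.sub_one hm₀) hm₀ (fun e => by linarith) (r₃ := m - 1) (fun e => hm₁ (by linarith))
      (A₁ := c - Dy ψ p + m * α p) (A₂ := -Dt ψ p) (A₃ := m * β p) fun u hu hu0 => by
        have := h.eqA p hp u hu
        rw [E.deriv_f₁_eq h₁ hu, h₁ hu] at this
        have hder := hd.mul_deriv hu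
        have hsub := (hd.sub_one hm₀).rpow_add_one hu
        rw [sub_add_cancel] at hsub
        have hder' : deriv (fun s : ℝ => s ^ m) u = m * u ^ (m - 1) := by
          apply mul_left_cancel₀ hu0
          rw [hder, hsub]; ring
        rw [hder'] at this
        rw [Real.rpow_zero]
        simp only at this
        linear_combination this - m * α p * (-hsub)
    exact ⟨(mul_eq_zero.1 e3).resolve_left hm₀, by linarith, by linarith⟩
  intro p hp
  have ht : Dt α p = 0 := by
    have e : Dt (Dy ψ) p = m * Dt α p := by
      have e : Dt (Dy ψ) p = fderiv ℝ (fun q => m * α q + c) p et := by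
        conv_lhs => unfold Dt
        rw [fderiv_congr_of_mem hB (fun q hq => (key q hq).2.2) hp]
      rw [e, fderiv_add_const, fderiv_const_mul (h.smooth_α.contDiffAt (hB.mem_nhds hp)).diff]
      rfl
    rw [Dt_Dy_comm hB h.smooth_ψ hp, Dy_eq_zero_of_eqOn hB (fun q hq => (key q hq).2.1) hp] at e
    exact (mul_eq_zero.1 e.symm).resolve_left hm₀
  refine ⟨(key p hp).1, (key p hp).2.1, (key p hp).2.2, ht, fun u hu => ?_⟩
  have := h.eqB p hp u hu
  rw [ht, Dt_eq_zero_of_eqOn hB (fun q hq => (key q hq).1) hp,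
    Dy_eq_zero_of_eqOn hB (fun q hq => (key q hq).1) hp, (key p hp).1, h₁ hu] at this
  rw [hd.rpow_add_one hu]
  linear_combination this

/-- Here f₁' = 1, so (A) splits only into coefficients of 1 and u, and both α and β survive. They
are the derivatives of ψ up to the constant c, whence α_t = β_y. -/
theorem of_id (hB : IsOpen B) (h : DeterminingSystem E B c ψ α β)
    (h₁ : EqOn E.f₁ (fun u => u) E.dom) :
    ∀ p ∈ B, Dt ψ p = β p ∧ Dy ψ p = α p + c ∧ Dt α p = Dy β p ∧
      ∀ u ∈ E.dom, Dy α p * u ^ 2 + 2 * Dt α p * u + Dt β p + (α p - c) * E.f₂ u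
        - (α p * u + β p) * deriv E.f₂ u = 0 := by
  have key : ∀ p ∈ B, Dt ψ p = β p ∧ Dy ψ p = α p + c := by
    intro p hp
    obtain ⟨e1, e2, e3⟩ := quadratic_coeff E.isOpen_dom E.nonempty_dom (A₀ := β p - Dt ψ p)
      (A₁ := c - Dy ψ p + α p) (A₂ := 0) fun u hu => by
        have := h.eqA p hp u hu
        rw [E.deriv_f₁_eq h₁ hu, h₁ hu] at this
        simp at this
        linear_combination this
    exact ⟨by linarith, by linarith⟩
  intro p hp
  have ht : Dt α p = Dy β p := by
    have e : Dt (Dy ψ) p = Dt α p := by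
      have e : Dt (Dy ψ) p = fderiv ℝ (fun q => α q + c) p et := by
        conv_lhs => unfold Dt
        rw [fderiv_congr_of_mem hB (fun q hq => (key q hq).2) hp]
      rw [e, fderiv_add_const]
      rfl
    rw [← e, Dt_Dy_comm hB h.smooth_ψ hp]
    unfold Dy
    rw [fderiv_congr_of_mem hB (fun q hq => (key q hq).1) hp]
  refine ⟨(key p hp).1, (key p hp).2, ht, fun u hu => ?_⟩
  have := h.eqB p hp u hu
  rw [h₁ hu, ← ht] at this
  linear_combination this

end DeterminingSystem

theorem IsSign.ne_zero {ε : ℝ} (h : IsSign ε) : ε ≠ 0 := by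
  rcases h with rfl | rfl <;> norm_num

theorem IsSign.mul_self {ε : ℝ} (h : IsSign ε) : ε * ε = 1 := by
  rcases h with rfl | rfl <;> norm_num

theorem deriv_exp_mul (a m u : ℝ) :
    deriv (fun s => a * Real.exp (m * s)) u = a * (m * Real.exp (m * u)) := by
  have := ((((hasDerivAt_id u).const_mul m).exp).const_mul a).deriv
  simp only [id] at this
  rw [this]; ring

theorem mul_deriv_rpow {I : Set ℝ} {m : ℝ} (hm : PowerDomain I m) (a : ℝ) {u : ℝ} (hu : u ∈ I) :
    u * deriv (fun s : ℝ => a * s ^ m) u = a * (m * u ^ m) := by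
  obtain ⟨d, hd, e⟩ := hm.hasDerivAt hu
  rw [(hd.const_mul a).deriv, ← e]; ring

theorem hasDerivAt_exp_mul (k t : ℝ) :
    HasDerivAt (fun t => Real.exp (k * t)) (k * Real.exp (k * t)) t := by
  refine (((hasDerivAt_id t).const_mul k).exp).congr_deriv ?_
  simp; ring

theorem fderiv_exp_fst (k : ℝ) (p a : Base) : fderiv ℝ (fun p : Base => Real.exp (k * p.1)) p a
    = k * Real.exp (k * p.1) * a.1 := by
  have h : HasFDerivAt (fun p : Base => Real.exp (k * p.1)) _ p :=
    (hasDerivAt_exp_mul k p.1).comp_hasFDerivAt p (hasFDerivAt_fst (𝕜 := ℝ) (E := ℝ) (F := ℝ × ℝ))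
  rw [h.fderiv]
  simp

/-! ### Maximal algebras for f₁ = e^u, ln u, u^m with m ≠ 1 -/

section Rows

variable {E : Equation} {B : Set Base}

/-- The algebra of the equation `(e^u, ε e^{mu})`. -/
theorem algebra_exp_exp (hB : IsOpen B) (hB' : IsConnected B) {m ε : ℝ} (hm₀ : m ≠ 0) (hm₁ : m ≠ 1) (hε : IsSign ε)
    (h₁ : EqOn E.f₁ Real.exp E.dom) (h₂ : EqOn E.f₂ (fun u => ε * Real.exp (m * u)) E.dom)
    (v : Total → Total) : E.IsSymmetry B v ↔ SpannedOn (kernelFields ∪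
      {ofCoords (fun t _ _ _ => t) (fun _ x _ _ => x / 2)
        (fun _ _ y _ => (m - 1) / m * y) (fun _ _ _ _ => -(1 / m))}) (B ×ˢ E.dom) v := by
  refine isSymmetry_iff_spannedOn hB hB'.isPreconnected (fun c ψ α β h => ?_) ?_ v
  · have key : ∀ p ∈ B, β p = -(c / m) := by
      intro p hp
      obtain ⟨-, -, -, ht, he⟩ := h.of_exp hB h₁ p hp
      have := (exp_coeff E.isOpen_dom E.nonempty_dom (A₁ := -(c + m * β p) * ε) (A₂ := Dy β p)
        (A₃ := 0) hm₁ hm₀ one_ne_zero fun u hu => by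
          have := he u hu
          rw [E.deriv_f₂_eq h₂ hu, h₂ hu, deriv_exp_mul] at this
          rw [one_mul]
          linear_combination this).1
      have := (mul_eq_zero.1 this).resolve_right hε.ne_zero
      field_simp
      linarith
    obtain ⟨d, hd⟩ := h.exists_ψ_eq hB hB'.isPreconnected (l := 0) (k := (m - 1) / m * c)
      (fun p hp => (h.of_exp hB h₁ p hp).2.1) fun p hp => by
        rw [(h.of_exp hB h₁ p hp).2.2.1, key p hp]; field_simp; ring
    refine ⟨_, Submodule.smul_mem _ c (Submodule.subset_span rfl), d, fun p hp u => ?_⟩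
    refine Prod.ext (Prod.ext ?_ (Prod.ext ?_ ?_)) ?_ <;>
      simp [affineField, ofCoords, hd p hp, key p hp, (h.of_exp hB h₁ p hp).1] <;> ring
  · rintro X rfl
    refine ⟨1, _, _, _, .of_affine (k := (m - 1) / m) (l := 0) (a := 0) (b := -(1 / m)) ?_ ?_,
      funext fun z => ?_⟩
    · intro u hu
      rw [E.deriv_f₁_eq h₁ hu, Real.deriv_exp, h₁ hu]; field_simp; ring
    · intro u hu
      rw [E.deriv_f₂_eq h₂ hu, deriv_exp_mul, h₂ hu]; field_simp; ring
    · refine Prod.ext (Prod.ext ?_ (Prod.ext ?_ ?_)) ?_ <;> simp [affineField, ofCoords] <;> ring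

/-- The algebra of the equation `(e^u, ε)`. -/
theorem algebra_exp_const (hB : IsOpen B) (hB' : IsConnected B) {ε : ℝ} (hε : IsSign ε)
    (h₁ : EqOn E.f₁ Real.exp E.dom) (h₂ : EqOn E.f₂ (fun _ => ε) E.dom)
    (v : Total → Total) : E.IsSymmetry B v ↔ SpannedOn (kernelFields ∪
      {ofCoords (fun _ _ _ _ => 0) (fun _ _ _ _ => 0)
        (fun _ _ y _ => y) (fun _ _ _ _ => 1)}) (B ×ˢ E.dom) v := by
  refine isSymmetry_iff_spannedOn hB hB'.isPreconnected (fun c ψ α β h => ?_) ?_ v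
  · have key : ∀ p ∈ B, Dy β p = 0 ∧ c = 0 := by
      intro p hp
      obtain ⟨-, -, -, ht, he⟩ := h.of_exp hB h₁ p hp
      have := (linear_exp_coeff E.isOpen_dom E.nonempty_dom (A := 0) (B := Dy β p)
        (C := -c * ε) fun u hu => by
          have := he u hu
          rw [E.deriv_f₂_eq h₂ hu, h₂ hu, deriv_const] at this
          linear_combination this).2
      exact ⟨this.1, by have := (mul_eq_zero.1 this.2).resolve_right hε.ne_zero; linarith⟩
    obtain rfl : c = 0 := (key _ hB'.nonempty.some_mem).2
    obtain ⟨b, hb⟩ := exists_eq_const hB hB'.isPreconnected h.smooth_β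
      (fun p hp => (h.of_exp hB h₁ p hp).2.2.2.1) h.dx_β fun p hp => (key p hp).1
    obtain ⟨d, hd⟩ := h.exists_ψ_eq hB hB'.isPreconnected (l := 0) (k := b)
      (fun p hp => (h.of_exp hB h₁ p hp).2.1) fun p hp => by
        rw [(h.of_exp hB h₁ p hp).2.2.1, hb p hp, add_zero]
    refine ⟨_, Submodule.smul_mem _ b (Submodule.subset_span rfl), d, fun p hp u => ?_⟩
    refine Prod.ext (Prod.ext ?_ (Prod.ext ?_ ?_)) ?_ <;>
      simp [affineField, ofCoords, hd p hp, hb p hp, (h.of_exp hB h₁ p hp).1]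
  · rintro X rfl
    refine ⟨0, _, _, _, .of_affine (k := 1) (l := 0) (a := 0) (b := 1) ?_ ?_,
      funext fun z => ?_⟩
    · intro u hu
      rw [E.deriv_f₁_eq h₁ hu, Real.deriv_exp, h₁ hu]; ring
    · intro u hu
      rw [E.deriv_f₂_eq h₂ hu, deriv_const]; ring
    · refine Prod.ext (Prod.ext ?_ (Prod.ext ?_ ?_)) ?_ <;> simp [affineField, ofCoords]

/-- The algebra of the equation `(e^u, 0)`. -/
theorem algebra_exp_zero (hB : IsOpen B) (hB' : IsConnected B) (h₁ : EqOn E.f₁ Real.exp E.dom) (h₂ : EqOn E.f₂ (fun _ => 0) E.dom)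
    (v : Total → Total) : E.IsSymmetry B v ↔ SpannedOn (kernelFields ∪
      {dilation, ofCoords (fun _ _ _ _ => 0) (fun _ _ _ _ => 0)
        (fun _ _ y _ => y) (fun _ _ _ _ => 1)}) (B ×ˢ E.dom) v := by
  refine isSymmetry_iff_spannedOn hB hB'.isPreconnected (fun c ψ α β h => ?_) ?_ v
  · have key : ∀ p ∈ B, Dy β p = 0 := by
      intro p hp
      obtain ⟨-, -, -, ht, he⟩ := h.of_exp hB h₁ p hp
      exact (linear_exp_coeff E.isOpen_dom E.nonempty_dom (A := 0) (B := Dy β p)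
        (C := 0) fun u hu => by
          have := he u hu
          rw [E.deriv_f₂_eq h₂ hu, h₂ hu, deriv_const] at this
          linear_combination this).2.1
    obtain ⟨b, hb⟩ := exists_eq_const hB hB'.isPreconnected h.smooth_β
      (fun p hp => (h.of_exp hB h₁ p hp).2.2.2.1) h.dx_β key
    obtain ⟨d, hd⟩ := h.exists_ψ_eq hB hB'.isPreconnected (l := 0) (k := b + c)
      (fun p hp => (h.of_exp hB h₁ p hp).2.1) fun p hp => by
        rw [(h.of_exp hB h₁ p hp).2.2.1, hb p hp]
    refine ⟨_, Submodule.mem_span_pair.2 ⟨c, b, rfl⟩, d, fun p hp u => ?_⟩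
    refine Prod.ext (Prod.ext ?_ (Prod.ext ?_ ?_)) ?_ <;>
      simp [affineField, ofCoords, dilation, hd p hp, hb p hp, (h.of_exp hB h₁ p hp).1] <;> ring
  · rintro X (rfl | rfl)
    · refine ⟨1, _, _, _, .of_affine (k := 1) (l := 0) (a := 0) (b := 0) ?_ ?_,
        funext fun z => ?_⟩
      · intro u hu; ring
      · intro u hu; rw [h₂ hu]; ring
      · refine Prod.ext (Prod.ext ?_ (Prod.ext ?_ ?_)) ?_ <;>
          simp [affineField, ofCoords, dilation] <;> ring
    · refine ⟨0, _, _, _, .of_affine (k := 1) (l := 0) (a := 0) (b := 1) ?_ ?_,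
        funext fun z => ?_⟩
      · intro u hu
        rw [E.deriv_f₁_eq h₁ hu, Real.deriv_exp, h₁ hu]; ring
      · intro u hu
        rw [E.deriv_f₂_eq h₂ hu, deriv_const]; ring
      · refine Prod.ext (Prod.ext ?_ (Prod.ext ?_ ?_)) ?_ <;> simp [affineField, ofCoords]

/-- The algebra of the equation `(ln u, ε u^m)`. -/
theorem algebra_log_pow (hB : IsOpen B) (hB' : IsConnected B) {m ε : ℝ} (hm₁ : m ≠ 1) (hε : IsSign ε) (hd : E.dom ⊆ Ioi 0)
    (h₁ : EqOn E.f₁ Real.log E.dom) (h₂ : EqOn E.f₂ (fun u => ε * u ^ m) E.dom)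
    (v : Total → Total) : E.IsSymmetry B v ↔ SpannedOn (kernelFields ∪
      {ofCoords (fun t _ _ _ => t) (fun _ x _ _ => x / 2)
        (fun t _ y _ => y - t / (m - 1)) (fun _ _ _ u => -(u / (m - 1)))}) (B ×ˢ E.dom) v := by
  have hm : m - 1 ≠ 0 := sub_ne_zero.2 hm₁
  have hP : PowerDomain E.dom m := Or.inl hd
  refine isSymmetry_iff_spannedOn hB hB'.isPreconnected (fun c ψ α β h => ?_) ?_ v
  · have key : ∀ p ∈ B, α p = -(c / (m - 1)) := by
      intro p hp
      obtain ⟨-, -, -, -, he⟩ := h.of_log hB hd h₁ p hp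
      have := (rpow_coeff_two E.isOpen_dom E.nonempty_dom hP PowerDomain.one hm₁
        (A₁ := (α p - c - m * α p) * ε) (A₂ := Dt α p) fun u hu _ => by
          have := he u hu
          rw [E.deriv_f₂_eq h₂ hu, mul_deriv_rpow hP ε hu, h₂ hu] at this
          rw [Real.rpow_one]
          linear_combination this).1
      have := (mul_eq_zero.1 this).resolve_right hε.ne_zero
      field_simp
      linarith
    obtain ⟨d, hd'⟩ := h.exists_ψ_eq hB hB'.isPreconnected (l := -(c / (m - 1))) (k := c)
      (fun p hp => ((h.of_log hB hd h₁ p hp).2.1).trans (key p hp))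
      fun p hp => (h.of_log hB hd h₁ p hp).2.2.1
    refine ⟨_, Submodule.smul_mem _ c (Submodule.subset_span rfl), d, fun p hp u => ?_⟩
    refine Prod.ext (Prod.ext ?_ (Prod.ext ?_ ?_)) ?_ <;>
      simp [affineField, ofCoords, hd' p hp, key p hp, (h.of_log hB hd h₁ p hp).1] <;> ring
  · rintro X rfl
    refine ⟨1, _, _, _, .of_affine (k := 1) (l := -(1 / (m - 1))) (a := -(1 / (m - 1))) (b := 0) ?_ ?_,
      funext fun z => ?_⟩
    · intro u hu
      have hu0 : u ≠ 0 := ne_of_gt (hd hu)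
      rw [E.deriv_f₁_eq h₁ hu, Real.deriv_log]; field_simp; ring
    · intro u hu
      have := mul_deriv_rpow hP ε hu
      rw [E.deriv_f₂_eq h₂ hu, h₂ hu, add_zero, mul_assoc, this]; field_simp; ring
    · refine Prod.ext (Prod.ext ?_ (Prod.ext ?_ ?_)) ?_ <;> simp [affineField, ofCoords] <;> ring

/-- The algebra of the equation `(ln u, ε u ln u)`. -/
theorem algebra_log_mul_log (hB : IsOpen B) (hB' : IsConnected B) {ε : ℝ} (hε : IsSign ε) (hd : E.dom ⊆ Ioi 0)
    (h₁ : EqOn E.f₁ Real.log E.dom) (h₂ : EqOn E.f₂ (fun u => ε * (u * Real.log u)) E.dom)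
    (v : Total → Total) : E.IsSymmetry B v ↔ SpannedOn (kernelFields ∪
      {ofCoords (fun _ _ _ _ => 0) (fun _ _ _ _ => 0)
        (fun t _ _ _ => Real.exp (ε * t)) (fun t _ _ u => Real.exp (ε * t) * (ε * u))})
      (B ×ˢ E.dom) v := by
  have hder : ∀ u ∈ E.dom, deriv E.f₂ u = ε * (Real.log u + 1) := by
    intro u hu
    have hu0 : u ≠ 0 := ne_of_gt (hd hu)
    have hd : HasDerivAt (fun u => ε * (u * Real.log u)) _ u :=
      ((hasDerivAt_id u).mul (Real.hasDerivAt_log hu0)).const_mul ε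
    rw [E.deriv_f₂_eq h₂ hu, hd.deriv]
    simp only [id]; field_simp
  refine isSymmetry_iff_spannedOn hB hB'.isPreconnected (fun c ψ α β h => ?_) ?_ v
  · have key : ∀ p ∈ B, c = 0 ∧ Dt α p = ε * α p := by
      intro p hp
      obtain ⟨-, -, -, -, he⟩ := h.of_log hB hd h₁ p hp
      obtain ⟨e1, e2, -⟩ := log_coeff E.isOpen_dom E.nonempty_dom hd (r := 1) one_ne_zero
        (A := -c * ε) (B := Dt α p - ε * α p) (C := 0) fun u hu => by
          have := he u hu
          rw [hder u hu, h₂ hu] at this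
          have hu0 : u ≠ 0 := ne_of_gt (hd hu)
          refine mul_left_cancel₀ hu0 ?_
          linear_combination this
      exact ⟨by have := (mul_eq_zero.1 e1).resolve_right hε.ne_zero; linarith, by linarith⟩
    obtain rfl : c = 0 := (key _ hB'.nonempty.some_mem).1
    -- Integrating factor for α_t = ε α.
    have hs : ContDiffOn ℝ ∞ (fun p : Base => Real.exp (-ε * p.1)) B := by fun_prop
    obtain ⟨k, hk⟩ := exists_eq_const hB hB'.isPreconnected (hs.mul h.smooth_α) (fun p hp => by
        refine (fderiv_mul_apply_of_mem hB hs h.smooth_α hp _).trans ?_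
        have := (key p hp).2
        unfold Dt at this
        rw [this, fderiv_exp_fst]; ring) (fun p hp => by
        refine (fderiv_mul_apply_of_mem hB hs h.smooth_α hp _).trans ?_
        have := h.dx_α p hp
        unfold Dx at this
        rw [this, fderiv_exp_fst]; ring) (fun p hp => by
        refine (fderiv_mul_apply_of_mem hB hs h.smooth_α hp _).trans ?_
        have := (h.of_log hB hd h₁ p hp).2.2.2.1
        unfold Dy at this
        rw [this, fderiv_exp_fst]; ring)
    have hα : ∀ p ∈ B, α p = k * Real.exp (ε * p.1) := by
      intro p hp
      have := hk p hp
      rw [← this, mul_right_comm, ← Real.exp_add]; simp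
    -- An antiderivative of ψ_t = α = k e^{εt}; the factor is ε because 1/ε = ε.
    have fd : ∀ p ∈ B, ∀ a, fderiv ℝ (fun q => ψ q - ε * k * Real.exp (ε * q.1)) p a
        = fderiv ℝ ψ p a - ε * k * (ε * Real.exp (ε * p.1) * a.1) := by
      intro p hp a
      rw [fderiv_fun_sub (h.smooth_ψ.contDiffAt (hB.mem_nhds hp)).diff (by fun_prop),
        fderiv_const_mul (by fun_prop)]
      simp [fderiv_exp_fst]
    obtain ⟨d, hd'⟩ := exists_eq_const hB hB'.isPreconnected
      (h.smooth_ψ.sub (g := fun q => ε * k * Real.exp (ε * q.1)) (by fun_prop)) (fun p hp => by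
        refine (fd p hp _).trans ?_
        have := (h.of_log hB hd h₁ p hp).2.1
        unfold Dt at this
        rw [this, hα p hp]
        linear_combination (- k * Real.exp (ε * p.1)) * hε.mul_self) (fun p hp => by
        refine (fd p hp _).trans ?_
        have := h.dx_ψ p hp
        unfold Dx at this
        rw [this]; ring) (fun p hp => by
        refine (fd p hp _).trans ?_
        have := (h.of_log hB hd h₁ p hp).2.2.1
        unfold Dy at this
        rw [this]; ring)
    refine ⟨_, Submodule.smul_mem _ (ε * k) (Submodule.subset_span rfl), d, fun p hp u => ?_⟩
    have e1 : ψ p = d + ε * k * Real.exp (ε * p.1) := by linarith [hd' p hp]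
    refine Prod.ext (Prod.ext ?_ (Prod.ext ?_ ?_)) ?_
    · simp [affineField, ofCoords]
    · simp [affineField, ofCoords]
    · simp [affineField, ofCoords, e1]; ring
    · simp [affineField, ofCoords, hα p hp, (h.of_log hB hd h₁ p hp).1]
      linear_combination (-(k * Real.exp (ε * p.1) * u)) * hε.mul_self
  · rintro X rfl
    have m1 : ∀ k p, HasDerivAt (fun t => k * Real.exp (ε * t)) (k * (ε * Real.exp (ε * p))) p :=
      fun k p => (hasDerivAt_exp_mul ε p).const_mul k
    refine ⟨0, fun p => (1 * Real.exp (ε * p.1)) * 1, fun p => ε * Real.exp (ε * p.1) * 1,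
      fun _ => 0, ⟨by fun_prop, by fun_prop, contDiffOn_const,
      fun p _ => Dx_mul_base (m1 1 p.1) (hasDerivAt_const _ _),
      fun p _ => Dx_mul_base (m1 ε p.1) (hasDerivAt_const _ _), fun p _ => by simp [Dx],
      fun p hp u hu => ?_, fun p hp u hu => ?_⟩, funext fun z => ?_⟩
    · have hu0 : u ≠ 0 := ne_of_gt (hd hu)
      rw [Dt_mul_base (m1 1 p.1) (hasDerivAt_const _ _), Dy_mul_base (m1 1 p.1) (hasDerivAt_const _ _),
        E.deriv_f₁_eq h₁ hu, Real.deriv_log]; field_simp; ring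
    · rw [Dt_mul_base (m1 ε p.1) (hasDerivAt_const _ _), Dy_mul_base (m1 ε p.1) (hasDerivAt_const _ _),
        hder u hu, h₂ hu]; simp [Dt, Dy]; ring
    · refine Prod.ext (Prod.ext ?_ (Prod.ext ?_ ?_)) ?_ <;> simp [affineField, ofCoords] <;> ring

/-- The algebra of the equation `(ln u, 0)`. -/
theorem algebra_log_zero (hB : IsOpen B) (hB' : IsConnected B) (hd : E.dom ⊆ Ioi 0)
    (h₁ : EqOn E.f₁ Real.log E.dom) (h₂ : EqOn E.f₂ (fun _ => 0) E.dom)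
    (v : Total → Total) : E.IsSymmetry B v ↔ SpannedOn (kernelFields ∪
      {dilation, ofCoords (fun _ _ _ _ => 0) (fun _ _ _ _ => 0)
        (fun t _ _ _ => t) (fun _ _ _ u => u)}) (B ×ˢ E.dom) v := by
  refine isSymmetry_iff_spannedOn hB hB'.isPreconnected (fun c ψ α β h => ?_) ?_ v
  · have key : ∀ p ∈ B, Dt α p = 0 := by
      intro p hp
      obtain ⟨-, -, -, -, he⟩ := h.of_log hB hd h₁ p hp
      obtain ⟨u, hu⟩ := E.nonempty_dom
      have := he u hu
      rw [E.deriv_f₂_eq h₂ hu, h₂ hu, deriv_const] at this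
      exact (mul_eq_zero.1 (by linarith : Dt α p * u = 0)).resolve_right (ne_of_gt (hd hu))
    obtain ⟨a, ha⟩ := exists_eq_const hB hB'.isPreconnected h.smooth_α key h.dx_α
      fun p hp => (h.of_log hB hd h₁ p hp).2.2.2.1
    obtain ⟨d, hd'⟩ := h.exists_ψ_eq hB hB'.isPreconnected (l := a) (k := c)
      (fun p hp => ((h.of_log hB hd h₁ p hp).2.1).trans (ha p hp))
      fun p hp => (h.of_log hB hd h₁ p hp).2.2.1
    refine ⟨_, Submodule.mem_span_pair.2 ⟨c, a, rfl⟩, d, fun p hp u => ?_⟩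
    refine Prod.ext (Prod.ext ?_ (Prod.ext ?_ ?_)) ?_ <;>
      simp [affineField, ofCoords, dilation, hd' p hp, ha p hp, (h.of_log hB hd h₁ p hp).1] <;> ring
  · rintro X (rfl | rfl)
    · refine ⟨1, _, _, _, .of_affine (k := 1) (l := 0) (a := 0) (b := 0) ?_ ?_,
        funext fun z => ?_⟩
      · intro u hu; ring
      · intro u hu; rw [h₂ hu]; ring
      · refine Prod.ext (Prod.ext ?_ (Prod.ext ?_ ?_)) ?_ <;>
          simp [affineField, ofCoords, dilation] <;> ring
    · refine ⟨0, _, _, _, .of_affine (k := 0) (l := 1) (a := 1) (b := 0) ?_ ?_,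
        funext fun z => ?_⟩
      · intro u hu
        have hu0 : u ≠ 0 := ne_of_gt (hd hu)
        rw [E.deriv_f₁_eq h₁ hu, Real.deriv_log]; field_simp; ring
      · intro u hu
        rw [E.deriv_f₂_eq h₂ hu, deriv_const, h₂ hu]; ring
      · refine Prod.ext (Prod.ext ?_ (Prod.ext ?_ ?_)) ?_ <;> simp [affineField, ofCoords]

/-- The algebra of the equation `(u^m, ε u^n)`. -/
theorem algebra_pow_pow (hB : IsOpen B) (hB' : IsConnected B) {m n ε : ℝ} (hm₀ : m ≠ 0) (hm₁ : m ≠ 1) (hn : n ≠ m + 1) (hε : IsSign ε)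
    (hdm : PowerDomain E.dom m) (hdn : PowerDomain E.dom n)
    (h₁ : EqOn E.f₁ (fun u => u ^ m) E.dom) (h₂ : EqOn E.f₂ (fun u => ε * u ^ n) E.dom)
    (v : Total → Total) : E.IsSymmetry B v ↔ SpannedOn (kernelFields ∪
      {ofCoords (fun t _ _ _ => (n - 1) * t) (fun _ x _ _ => (n - 1) / 2 * x)
        (fun _ _ y _ => (n - m - 1) * y) (fun _ _ _ u => -u)}) (B ×ˢ E.dom) v := by
  refine isSymmetry_iff_spannedOn hB hB'.isPreconnected (fun c ψ α β h => ?_) ?_ v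
  · have key : ∀ p ∈ B, Dy α p = 0 ∧ c = (1 - n) * α p := by
      intro p hp
      obtain ⟨-, -, -, -, he⟩ := h.of_pow hB hm₀ hm₁ hdm h₁ p hp
      obtain ⟨e1, e2⟩ := rpow_coeff_two E.isOpen_dom E.nonempty_dom hdn hdm.add_one hn
        (A₁ := (α p - c - n * α p) * ε) (A₂ := Dy α p) fun u hu _ => by
          have := he u hu
          rw [E.deriv_f₂_eq h₂ hu, mul_deriv_rpow hdn ε hu, h₂ hu] at this
          linear_combination this
      have := (mul_eq_zero.1 e1).resolve_right hε.ne_zero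
      exact ⟨e2, by linarith⟩
    obtain ⟨a, ha⟩ := exists_eq_const hB hB'.isPreconnected h.smooth_α
      (fun p hp => (h.of_pow hB hm₀ hm₁ hdm h₁ p hp).2.2.2.1) h.dx_α fun p hp => (key p hp).1
    have hc : c = (1 - n) * a := by
      rw [← ha _ hB'.nonempty.some_mem]; exact (key _ hB'.nonempty.some_mem).2
    obtain ⟨d, hd⟩ := h.exists_ψ_eq hB hB'.isPreconnected (l := 0) (k := m * a + c)
      (fun p hp => (h.of_pow hB hm₀ hm₁ hdm h₁ p hp).2.1) fun p hp => by
        rw [(h.of_pow hB hm₀ hm₁ hdm h₁ p hp).2.2.1, ha p hp]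
    refine ⟨_, Submodule.smul_mem _ (-a) (Submodule.subset_span rfl), d, fun p hp u => ?_⟩
    refine Prod.ext (Prod.ext ?_ (Prod.ext ?_ ?_)) ?_ <;>
      simp [affineField, ofCoords, hd p hp, ha p hp, (h.of_pow hB hm₀ hm₁ hdm h₁ p hp).1, hc] <;> ring
  · rintro X rfl
    refine ⟨n - 1, _, _, _, .of_affine (k := n - m - 1) (l := 0) (a := -1) (b := 0) ?_ ?_,
      funext fun z => ?_⟩
    · intro u hu
      have := hdm.mul_deriv hu
      rw [E.deriv_f₁_eq h₁ hu, h₁ hu, add_zero, mul_assoc, this]; ring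
    · intro u hu
      have := mul_deriv_rpow hdn ε hu
      rw [E.deriv_f₂_eq h₂ hu, h₂ hu, add_zero, mul_assoc, this]; ring
    · refine Prod.ext (Prod.ext ?_ (Prod.ext ?_ ?_)) ?_ <;> simp [affineField, ofCoords]

/-- The algebra of the equation `(u^m, 0)`. -/
theorem algebra_pow_zero (hB : IsOpen B) (hB' : IsConnected B) {m : ℝ} (hm₀ : m ≠ 0) (hm₁ : m ≠ 1) (hdm : PowerDomain E.dom m)
    (h₁ : EqOn E.f₁ (fun u => u ^ m) E.dom) (h₂ : EqOn E.f₂ (fun _ => 0) E.dom)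
    (v : Total → Total) : E.IsSymmetry B v ↔ SpannedOn (kernelFields ∪
      {dilation, ofCoords (fun _ _ _ _ => 0) (fun _ _ _ _ => 0)
        (fun _ _ y _ => y) (fun _ _ _ u => 1 / m * u)}) (B ×ˢ E.dom) v := by
  refine isSymmetry_iff_spannedOn hB hB'.isPreconnected (fun c ψ α β h => ?_) ?_ v
  · have key : ∀ p ∈ B, Dy α p = 0 := by
      intro p hp
      obtain ⟨-, -, -, -, he⟩ := h.of_pow hB hm₀ hm₁ hdm h₁ p hp
      exact (rpow_coeff_two E.isOpen_dom E.nonempty_dom hdm hdm.add_one (by simp)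
        (A₁ := 0) (A₂ := Dy α p) fun u hu _ => by
          have := he u hu
          rw [E.deriv_f₂_eq h₂ hu, deriv_const, h₂ hu] at this
          linear_combination this).2
    obtain ⟨a, ha⟩ := exists_eq_const hB hB'.isPreconnected h.smooth_α
      (fun p hp => (h.of_pow hB hm₀ hm₁ hdm h₁ p hp).2.2.2.1) h.dx_α key
    obtain ⟨d, hd⟩ := h.exists_ψ_eq hB hB'.isPreconnected (l := 0) (k := m * a + c)
      (fun p hp => (h.of_pow hB hm₀ hm₁ hdm h₁ p hp).2.1) fun p hp => by
        rw [(h.of_pow hB hm₀ hm₁ hdm h₁ p hp).2.2.1, ha p hp]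
    refine ⟨_, Submodule.mem_span_pair.2 ⟨c, m * a, rfl⟩, d, fun p hp u => ?_⟩
    refine Prod.ext (Prod.ext ?_ (Prod.ext ?_ ?_)) ?_ <;>
      simp [affineField, ofCoords, dilation, hd p hp, ha p hp,
        (h.of_pow hB hm₀ hm₁ hdm h₁ p hp).1] <;> field_simp
    ring
  · rintro X (rfl | rfl)
    · refine ⟨1, _, _, _, .of_affine (k := 1) (l := 0) (a := 0) (b := 0) ?_ ?_,
        funext fun z => ?_⟩
      · intro u hu; ring
      · intro u hu; rw [h₂ hu]; ring
      · refine Prod.ext (Prod.ext ?_ (Prod.ext ?_ ?_)) ?_ <;>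
          simp [affineField, ofCoords, dilation] <;> ring
    · refine ⟨0, _, _, _, .of_affine (k := 1) (l := 0) (a := 1 / m) (b := 0) ?_ ?_,
        funext fun z => ?_⟩
      · intro u hu
        have := hdm.mul_deriv hu
        rw [E.deriv_f₁_eq h₁ hu, h₁ hu, add_zero, mul_assoc, this]; field_simp; ring
      · intro u hu
        rw [E.deriv_f₂_eq h₂ hu, deriv_const, h₂ hu]; ring
      · refine Prod.ext (Prod.ext ?_ (Prod.ext ?_ ?_)) ?_ <;> simp [affineField, ofCoords]

end Rows

/-! ### Maximal algebras for f₁ = u -/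

section LinearRows

variable {E : Equation} {B : Set Base}

/-- The algebra of the equation `(u, ε e^u)`. -/
theorem algebra_id_exp (hB : IsOpen B) (hB' : IsConnected B) {ε : ℝ} (hε : IsSign ε)
    (h₁ : EqOn E.f₁ (fun u => u) E.dom) (h₂ : EqOn E.f₂ (fun u => ε * Real.exp u) E.dom)
    (v : Total → Total) : E.IsSymmetry B v ↔ SpannedOn (kernelFields ∪
      {ofCoords (fun t _ _ _ => t) (fun _ x _ _ => x / 2)
        (fun t _ y _ => y - t) (fun _ _ _ _ => -1)}) (B ×ˢ E.dom) v := by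
  have hder : ∀ u ∈ E.dom, deriv E.f₂ u = ε * Real.exp u := by
    intro u hu
    rw [E.deriv_f₂_eq h₂ hu, ((Real.hasDerivAt_exp u).const_mul ε).deriv]
  refine isSymmetry_iff_spannedOn hB hB'.isPreconnected (fun c ψ α β h => ?_) ?_ v
  · have key : ∀ p ∈ B, α p = 0 ∧ β p = -c := by
      intro p hp
      obtain ⟨-, -, -, he⟩ := h.of_id hB h₁ p hp
      obtain ⟨-, -, -, e4, e5⟩ := quadratic_add_linear_exp_coeff E.isOpen_dom E.nonempty_dom
        (A₀ := Dt β p) (A₁ := 2 * Dt α p) (A₂ := Dy α p) (A := - ε * α p)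
        (B := ε * (α p - c - β p)) fun u hu => by
          have := he u hu
          rw [hder u hu, h₂ hu] at this
          linear_combination this
      have e4' := (mul_eq_zero.1 e4).resolve_left (neg_ne_zero.2 hε.ne_zero)
      have e5' := (mul_eq_zero.1 e5).resolve_left hε.ne_zero
      exact ⟨e4', by linarith⟩
    obtain ⟨d, hd⟩ := h.exists_ψ_eq hB hB'.isPreconnected (l := -c) (k := c)
      (fun p hp => ((h.of_id hB h₁ p hp).1).trans (key p hp).2) fun p hp => by
        rw [(h.of_id hB h₁ p hp).2.1, (key p hp).1, zero_add]
    refine ⟨_, Submodule.smul_mem _ c (Submodule.subset_span rfl), d, fun p hp u => ?_⟩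
    refine Prod.ext (Prod.ext ?_ (Prod.ext ?_ ?_)) ?_ <;>
      simp [affineField, ofCoords, hd p hp, key p hp] <;> ring
  · rintro X rfl
    refine ⟨1, _, _, _, .of_affine (k := 1) (l := -1) (a := 0) (b := -1) ?_ ?_,
      funext fun z => ?_⟩
    · intro u hu
      rw [E.deriv_f₁_eq h₁ hu, h₁ hu]; simp
    · intro u hu
      rw [hder u hu, h₂ hu]; ring
    · refine Prod.ext (Prod.ext ?_ (Prod.ext ?_ ?_)) ?_ <;> simp [affineField, ofCoords] <;> ring

/-- The coefficients of the monomials in the determining equation for `f₂ = ε u^m`. -/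
theorem coeff_of_id_pow {I : Set ℝ} (hI : IsOpen I) (hne : I.Nonempty) {m ε A₂ A₁ A₀ a b c : ℝ}
    (hm₀ : m ≠ 0) (hm₁ : m ≠ 1) (hm₂ : m ≠ 2) (hε : ε ≠ 0) (hm : PowerDomain I m)
    (h : ∀ u ∈ I, A₂ * u ^ 3 + A₁ * u ^ 2 + A₀ * u + (a - c - m * a) * ε * u ^ (m + 1)
      - m * b * ε * u ^ m = 0) : a = c / (1 - m) ∧ (A₂ = 0 → b = 0) := by
  have hm' : 1 - m ≠ 0 := sub_ne_zero.2 hm₁.symm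
  have key : ∀ A₂ C₁ C₂ : ℝ, (m = 3 → A₂ = 0) → (∀ u ∈ I, u ≠ 0 → A₂ * u ^ 3 + A₁ * u ^ 2 + A₀ * u
      + C₁ * u ^ (m + 1) + C₂ * u ^ m = 0) → C₁ = 0 ∧ C₂ = 0 := by
    intro A₂ C₁ C₂ h0 hC
    have hinj : ∀ r, m + 1 ≠ r → m ≠ r → r ≠ 2 → r ≠ 1 →
        InjOn ![m + 1, m, 2, 1, r] ((Finset.univ : Finset (Fin 5)) : Set (Fin 5)) := by
      intro r h1 h2 h3 h4 i _ j _ hij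
      have hm₃ : m + 1 ≠ 2 := fun e => hm₁ (by linarith)
      fin_cases i <;> fin_cases j <;> first
        | rfl
        | (exfalso; simp [hm₀, hm₁, hm₂, hm₃, h1, h2, h3, h4, hm₁.symm, hm₂.symm, hm₃.symm, h1.symm,
            h2.symm, h3.symm, h4.symm] at hij; done)
    have p3 : PowerDomain I 3 := Or.inr ⟨3, by norm_num⟩
    -- With m ≠ 0, 1, 2 the exponents m + 1, m, 3, 2, 1 coincide only for m = 3. In that case u^m
    -- and u³ merge, and the free fifth slot is filled by the exponent 0 with coefficient 0.
    by_cases h3 : m = 3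
    · obtain rfl := h0 h3
      have := rpow_coeff_eq_zero Finset.univ (hinj 0 (by rw [h3]; norm_num) hm₀ (by norm_num)
        (by norm_num)) hI hne (by
        intro i _
        fin_cases i
        exacts [hm.add_one, hm, PowerDomain.two, PowerDomain.one, PowerDomain.zero])
        ![C₁, C₂, A₁, A₀, 0] (by
        intro u hu hu0
        have := hC u hu hu0
        simp only [Fin.sum_univ_five]
        simp
        linear_combination this)
      exact ⟨this 0 (Finset.mem_univ _), this 1 (Finset.mem_univ _)⟩
    · have := rpow_coeff_eq_zero Finset.univ (hinj 3 (fun e => hm₂ (by linarith)) h3 (by norm_num)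
        (by norm_num)) hI hne (by
        intro i _
        fin_cases i
        exacts [hm.add_one, hm, PowerDomain.two, PowerDomain.one, p3]) ![C₁, C₂, A₁, A₀, A₂] (by
        intro u hu hu0
        have := hC u hu hu0
        have e3 : u ^ (3 : ℝ) = u ^ (3 : ℕ) := Real.rpow_natCast u 3
        simp only [Fin.sum_univ_five]
        simp [e3]
        linear_combination this)
      exact ⟨this 0 (Finset.mem_univ _), this 1 (Finset.mem_univ _)⟩
  have e1 : (a - c - m * a) * ε = 0 := by
    -- For m = 3 the monomials A₂ u³ and -m b ε u^m are combined into one; the coefficient of u^(m +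
    -- 1) can still be read off.
    by_cases h3 : m = 3
    · refine (key 0 _ (A₂ - m * b * ε) (fun _ => rfl) fun u hu hu0 => ?_).1
      have := h u hu
      have e3 : u ^ m = u ^ (3 : ℕ) := by rw [h3]; exact Real.rpow_natCast u 3
      rw [e3] at this ⊢
      linear_combination this
    · refine (key A₂ _ (- m * b * ε) (fun e => absurd e h3) fun u hu hu0 => ?_).1
      linear_combination h u hu
  have e2 := (mul_eq_zero.1 e1).resolve_right hε
  refine ⟨by field_simp; linarith, fun h3 => ?_⟩
  have : -m * b * ε = 0 :=
    (key A₂ ((a - c - m * a) * ε) (- m * b * ε) (fun _ => h3)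
      fun u hu hu0 => by linear_combination h u hu).2
  simpa [hε, hm₀] using this

/-- The algebra of the equation `(u, ε u^m)`. -/
theorem algebra_id_pow (hB : IsOpen B) (hB' : IsConnected B) {m ε : ℝ} (hm₀ : m ≠ 0) (hm₁ : m ≠ 1)
    (hm₂ : m ≠ 2) (hε : IsSign ε) (hdm : PowerDomain E.dom m)
    (h₁ : EqOn E.f₁ (fun u => u) E.dom) (h₂ : EqOn E.f₂ (fun u => ε * u ^ m) E.dom)
    (v : Total → Total) : E.IsSymmetry B v ↔ SpannedOn (kernelFields ∪
      {ofCoords (fun t _ _ _ => t) (fun _ x _ _ => x / 2)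
        (fun _ _ y _ => (m - 2) / (m - 1) * y) (fun _ _ _ u => -(u / (m - 1)))}) (B ×ˢ E.dom) v := by
  have hm : m - 1 ≠ 0 := sub_ne_zero.2 hm₁
  have hm' : 1 - m ≠ 0 := sub_ne_zero.2 hm₁.symm
  refine isSymmetry_iff_spannedOn hB hB'.isPreconnected (fun c ψ α β h => ?_) ?_ v
  · have key' : ∀ p ∈ B, α p = c / (1 - m) ∧ (Dy α p = 0 → β p = 0) := by
      intro p hp
      obtain ⟨-, -, -, he⟩ := h.of_id hB h₁ p hp
      refine coeff_of_id_pow E.isOpen_dom E.nonempty_dom hm₀ hm₁ hm₂ hε.ne_zero hdm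
        (A₂ := Dy α p) (A₁ := 2 * Dt α p) (A₀ := Dt β p) fun u hu => ?_
      have := he u hu
      have hder := mul_deriv_rpow hdm ε hu
      rw [E.deriv_f₂_eq h₂ hu, h₂ hu] at this
      -- Multiplication by u replaces the derivative of the power by u d = m u^m.
      have := congrArg (u * ·) this
      simp only [mul_zero] at this
      rw [hdm.rpow_add_one hu]
      linear_combination this + (α p * u + β p) * hder
    -- First α is found to be constant; then α_y = 0 resolves the possible merging at m = 3 and
    -- gives β = 0.
    have key : ∀ p ∈ B, α p = c / (1 - m) ∧ β p = 0 := fun p hp =>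
      ⟨(key' p hp).1, (key' p hp).2 (Dy_eq_zero_of_eqOn hB (fun q hq => (key' q hq).1) hp)⟩
    obtain ⟨d, hd⟩ := h.exists_ψ_eq hB hB'.isPreconnected (l := 0) (k := c / (1 - m) + c)
      (fun p hp => ((h.of_id hB h₁ p hp).1).trans (key p hp).2) fun p hp => by
        rw [(h.of_id hB h₁ p hp).2.1, (key p hp).1]
    have e1 : c / (1 - m) = -(c / (m - 1)) := by field_simp; ring
    refine ⟨_, Submodule.smul_mem _ c (Submodule.subset_span rfl), d, fun p hp u => ?_⟩
    refine Prod.ext (Prod.ext ?_ (Prod.ext ?_ ?_)) ?_ <;>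
      simp [affineField, ofCoords, hd p hp, key p hp, e1] <;> field_simp <;> ring
  · rintro X rfl
    refine ⟨1, _, _, _, .of_affine (k := (m - 2) / (m - 1)) (l := 0) (a := -(1 / (m - 1))) (b := 0)
      ?_ ?_, funext fun z => ?_⟩
    · intro u hu
      rw [E.deriv_f₁_eq h₁ hu, h₁ hu]; simp; field_simp; ring
    · intro u hu
      have := mul_deriv_rpow hdm ε hu
      rw [E.deriv_f₂_eq h₂ hu, h₂ hu, add_zero, mul_assoc, this]; field_simp; ring
    · refine Prod.ext (Prod.ext ?_ (Prod.ext ?_ ?_)) ?_ <;> simp [affineField, ofCoords] <;> ring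

/-- The algebra of the equation `(u, u² + 1)`. -/
theorem algebra_id_sq_add_one (hB : IsOpen B) (hB' : IsConnected B)
    (h₁ : EqOn E.f₁ (fun u => u) E.dom) (h₂ : EqOn E.f₂ (fun u => u ^ 2 + 1) E.dom)
    (v : Total → Total) : E.IsSymmetry B v ↔ SpannedOn (kernelFields ∪ {
        ofCoords (fun _ _ _ _ => 0) (fun _ _ _ _ => 0) (fun t _ y _ => Real.exp y * Real.sin t)
          (fun t _ y u => Real.exp y * (Real.cos t + u * Real.sin t)),
        ofCoords (fun _ _ _ _ => 0) (fun _ _ _ _ => 0) (fun t _ y _ => Real.exp y * Real.cos t)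
          (fun t _ y u => -(Real.exp y * (Real.sin t - u * Real.cos t)))}) (B ×ˢ E.dom) v := by
  have hder : ∀ u ∈ E.dom, deriv E.f₂ u = 2 * u := by
    intro u hu
    rw [E.deriv_f₂_eq h₂ hu]; simp
  have hexp := Real.hasDerivAt_exp
  have hnexp : ∀ y, HasDerivAt (fun y => Real.exp (-y)) (-Real.exp (-y)) y := fun y =>
    ((hasDerivAt_neg y).exp).congr_deriv (by ring)
  refine isSymmetry_iff_spannedOn hB hB'.isPreconnected (fun c ψ α β h => ?_) ?_ v
  · have key : ∀ p ∈ B, Dt β p = c - α p ∧ Dt α p = β p ∧ Dy β p = β p ∧ Dy α p = α p + c := by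
      intro p hp
      obtain ⟨-, -, ht, he⟩ := h.of_id hB h₁ p hp
      obtain ⟨e0, e1, e2⟩ := quadratic_coeff E.isOpen_dom E.nonempty_dom
        (A₀ := Dt β p + α p - c) (A₁ := 2 * Dt α p - 2 * β p) (A₂ := Dy α p - α p - c)
        fun u hu => by
          have := he u hu
          rw [hder u hu, h₂ hu] at this
          linear_combination this
      exact ⟨by linarith, by linarith, by linarith, by linarith⟩
    -- Compatibility of the system: β_yt = β_t = c - α, whereas β_ty = -α_y = -α - c.
    have hc : c = 0 := by
      obtain ⟨p, hp⟩ := hB'.nonempty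
      have e := Dt_Dy_comm hB h.smooth_β hp
      have e1 : Dt (Dy β) p = Dt β p := by
        conv_lhs => unfold Dt
        rw [fderiv_congr_of_mem hB (fun q hq => (key q hq).2.2.1) hp]; rfl
      have e2 : Dy (Dt β) p = - Dy α p := by
        conv_lhs => unfold Dy
        rw [fderiv_congr_of_mem hB (fun q hq => (key q hq).1) hp, fderiv_const_sub]; rfl
      obtain ⟨k1, -, -, k4⟩ := key p hp
      linarith
    subst hc
    have s1 : ContDiffOn ℝ ∞ (fun p : Base => Real.sin p.1 * Real.exp (-p.2.2)) B := by fun_prop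
    have s2 : ContDiffOn ℝ ∞ (fun p : Base => Real.cos p.1 * Real.exp (-p.2.2)) B := by fun_prop
    -- First integrals e^{-y}(f(t) α + g(t) β) with f' = g, g' = -f. The choices (sin, cos) and
    -- (cos, -sin) give two constants, from which α and β are solved by sin² + cos² = 1.
    have combo : ∀ {f g : ℝ → ℝ} {f' g' : ℝ → ℝ}, (∀ t, HasDerivAt f (f' t) t) →
        (∀ t, HasDerivAt g (g' t) t) → ContDiffOn ℝ ∞ (fun p : Base => f p.1 * Real.exp (-p.2.2)) B →
        ContDiffOn ℝ ∞ (fun p : Base => g p.1 * Real.exp (-p.2.2)) B →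
        (∀ t, f' t = g t) → (∀ t, g' t = - f t) →
        ∃ k, ∀ p ∈ B, f p.1 * Real.exp (-p.2.2) * α p + g p.1 * Real.exp (-p.2.2) * β p = k := by
      intro f g f' g' hf hg sf sg e1 e2
      have D : ∀ p ∈ B, ∀ a, fderiv ℝ (fun p : Base => f p.1 * Real.exp (-p.2.2) * α p
          + g p.1 * Real.exp (-p.2.2) * β p) p a
          = fderiv ℝ (fun p : Base => f p.1 * Real.exp (-p.2.2)) p a * α p
          + f p.1 * Real.exp (-p.2.2) * fderiv ℝ α p a
          + (fderiv ℝ (fun p : Base => g p.1 * Real.exp (-p.2.2)) p a * β p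
          + g p.1 * Real.exp (-p.2.2) * fderiv ℝ β p a) := by
        intro p hp a
        rw [← fderiv_mul_apply_of_mem hB sf h.smooth_α hp, ← fderiv_mul_apply_of_mem hB sg h.smooth_β hp]
        exact fderiv_add_apply_of_mem hB (sf.mul h.smooth_α) (sg.mul h.smooth_β) hp a
      refine exists_eq_const hB hB'.isPreconnected ((sf.mul h.smooth_α).add (sg.mul h.smooth_β))
        (fun p hp => (D p hp _).trans ?_) (fun p hp => (D p hp _).trans ?_)
        fun p hp => (D p hp _).trans ?_
      · change Dt _ p * α p + _ * Dt α p + (Dt _ p * β p + _ * Dt β p) = 0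
        rw [Dt_mul_base (hf _) (hnexp _), Dt_mul_base (hg _) (hnexp _), (key p hp).1, (key p hp).2.1,
          e1, e2]; ring
      · change Dx _ p * α p + _ * Dx α p + (Dx _ p * β p + _ * Dx β p) = 0
        rw [Dx_mul_base (hf _) (hnexp _), Dx_mul_base (hg _) (hnexp _), h.dx_α p hp, h.dx_β p hp]; ring
      · change Dy _ p * α p + _ * Dy α p + (Dy _ p * β p + _ * Dy β p) = 0
        rw [Dy_mul_base (hf _) (hnexp _), Dy_mul_base (hg _) (hnexp _), (key p hp).2.2.1,
          (key p hp).2.2.2]; ring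
    obtain ⟨a, ha⟩ := combo Real.hasDerivAt_sin Real.hasDerivAt_cos s1 s2 (fun _ => rfl) fun _ => rfl
    obtain ⟨b, hb⟩ := combo Real.hasDerivAt_cos (fun t => (Real.hasDerivAt_sin t).neg) s2
      (by simpa using s1.neg) (fun _ => rfl) fun _ => rfl
    have hαβ : ∀ p ∈ B, α p = Real.exp p.2.2 * (a * Real.sin p.1 + b * Real.cos p.1) ∧
        β p = Real.exp p.2.2 * (a * Real.cos p.1 - b * Real.sin p.1) := by
      intro p hp
      have hE : Real.exp p.2.2 * Real.exp (-p.2.2) = 1 := by rw [← Real.exp_add]; simp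
      rw [← ha p hp, ← hb p hp]
      simp only [Pi.neg_apply]
      have hs := Real.sin_sq_add_cos_sq p.1
      constructor
      · linear_combination (-α p * (Real.sin p.1 ^ 2 + Real.cos p.1 ^ 2)) * hE - α p * hs
      · linear_combination (-β p * (Real.sin p.1 ^ 2 + Real.cos p.1 ^ 2)) * hE - β p * hs
    -- With c = 0 one has ψ_t = β = α_t and ψ_y = α = α_y, so ψ - α is constant.
    have fd : ∀ p ∈ B, ∀ a, fderiv ℝ (fun q => ψ q - α q) p a
        = fderiv ℝ ψ p a - fderiv ℝ α p a := by
      intro p hp a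
      rw [fderiv_fun_sub (h.smooth_ψ.contDiffAt (hB.mem_nhds hp)).diff
        (h.smooth_α.contDiffAt (hB.mem_nhds hp)).diff]; rfl
    obtain ⟨d, hd⟩ := exists_eq_const hB hB'.isPreconnected (h.smooth_ψ.sub h.smooth_α)
      (fun p hp => (fd p hp _).trans (by
        change Dt ψ p - Dt α p = 0
        rw [(h.of_id hB h₁ p hp).1, (key p hp).2.1, sub_self]))
      (fun p hp => (fd p hp _).trans (by
        change Dx ψ p - Dx α p = 0
        rw [h.dx_ψ p hp, h.dx_α p hp, sub_self]))
      (fun p hp => (fd p hp _).trans (by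
        change Dy ψ p - Dy α p = 0
        rw [(h.of_id hB h₁ p hp).2.1, (key p hp).2.2.2, sub_self]))
    refine ⟨_, Submodule.mem_span_pair.2 ⟨a, b, rfl⟩, d, fun p hp u => ?_⟩
    have hψ : ψ p = α p + d := by linarith [hd p hp]
    refine Prod.ext (Prod.ext ?_ (Prod.ext ?_ ?_)) ?_ <;>
      simp [affineField, ofCoords, hψ, (hαβ p hp).1, (hαβ p hp).2] <;> ring
  · have gen : ∀ f g : ℝ → ℝ, (∀ t, HasDerivAt f (g t) t) → (∀ t, HasDerivAt g (-f t) t) →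
        ContDiff ℝ ∞ f → ContDiff ℝ ∞ g → DeterminingSystem E B 0
          (fun p => f p.1 * Real.exp p.2.2) (fun p => f p.1 * Real.exp p.2.2)
          fun p => g p.1 * Real.exp p.2.2 := by
      intro f g hf hg sf sg
      refine ⟨by fun_prop, by fun_prop, by fun_prop, fun p hp => Dx_mul_base (hf _) (hexp _),
        fun p hp => Dx_mul_base (hf _) (hexp _), fun p hp => Dx_mul_base (hg _) (hexp _),
        fun p hp u hu => ?_, fun p hp u hu => ?_⟩
      · rw [Dt_mul_base (hf _) (hexp _), Dy_mul_base (hf _) (hexp _), E.deriv_f₁_eq h₁ hu, h₁ hu]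
        simp
      · rw [Dt_mul_base (hf _) (hexp _), Dy_mul_base (hf _) (hexp _), Dt_mul_base (hg _) (hexp _),
          Dy_mul_base (hg _) (hexp _), hder u hu, h₂ hu, h₁ hu]
        ring
    rintro X (rfl | rfl)
    · refine ⟨0, _, _, _, gen Real.sin Real.cos Real.hasDerivAt_sin Real.hasDerivAt_cos
        Real.contDiff_sin Real.contDiff_cos, funext fun z => ?_⟩
      refine Prod.ext (Prod.ext ?_ (Prod.ext ?_ ?_)) ?_ <;> simp [affineField, ofCoords] <;> ring
    · refine ⟨0, _, _, _, gen Real.cos (-Real.sin) Real.hasDerivAt_cos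
        (fun t => (Real.hasDerivAt_sin t).neg) Real.contDiff_cos Real.contDiff_sin.neg,
        funext fun z => ?_⟩
      refine Prod.ext (Prod.ext ?_ (Prod.ext ?_ ?_)) ?_ <;> simp [affineField, ofCoords] <;> ring

/-- The algebra of the equation `(u, ε u)`. -/
theorem algebra_id_id (hB : IsOpen B) (hB' : IsConnected B) {ε : ℝ} (hε : IsSign ε)
    (h₁ : EqOn E.f₁ (fun u => u) E.dom) (h₂ : EqOn E.f₂ (fun u => ε * u) E.dom)
    (v : Total → Total) : E.IsSymmetry B v ↔ SpannedOn (kernelFields ∪ {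
        ofCoords (fun _ _ _ _ => 0) (fun _ _ _ _ => 0) (fun _ _ y _ => y) (fun _ _ _ u => u),
        ofCoords (fun _ _ _ _ => 0) (fun _ _ _ _ => 0) (fun t _ _ _ => Real.exp (ε * t))
          (fun t _ _ _ => Real.exp (ε * t) * ε)}) (B ×ˢ E.dom) v := by
  have hder : ∀ u ∈ E.dom, deriv E.f₂ u = ε := by
    intro u hu
    rw [E.deriv_f₂_eq h₂ hu, ((hasDerivAt_id' u).const_mul ε).deriv, mul_one]
  refine isSymmetry_iff_spannedOn hB hB'.isPreconnected (fun c ψ α β h => ?_) ?_ v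
  · have key : ∀ p ∈ B, Dt β p = ε * β p ∧ Dt α p = c * ε / 2 ∧ Dy β p = c * ε / 2 ∧ Dy α p = 0 := by
      intro p hp
      obtain ⟨-, -, ht, he⟩ := h.of_id hB h₁ p hp
      obtain ⟨e0, e1, e2⟩ := quadratic_coeff E.isOpen_dom E.nonempty_dom
        (A₀ := Dt β p - ε * β p) (A₁ := 2 * Dt α p - c * ε) (A₂ := Dy α p)
        fun u hu => by
          have := he u hu
          rw [hder u hu, h₂ hu] at this
          linear_combination this
      exact ⟨by linarith, by linarith, by linarith, by linarith⟩
    -- The derivative β_y is the constant cε/2, so 0 = β_yt = ε β_y = c/2.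
    have hc : c = 0 := by
      obtain ⟨p, hp⟩ := hB'.nonempty
      have e := Dt_Dy_comm hB h.smooth_β hp
      rw [Dt_eq_zero_of_eqOn hB (fun q hq => (key q hq).2.2.1) hp] at e
      have e2 : Dy (Dt β) p = ε * Dy β p :=
        fderiv_eq_mul_of_eqOn hB h.smooth_β (fun q hq => (key q hq).1) hp _
      rw [e2, (key p hp).2.2.1] at e
      have := hε.mul_self
      linear_combination (-2) * e - c * this
    subst hc
    simp only [zero_mul, zero_div] at key
    obtain ⟨a, ha⟩ := exists_eq_const hB hB'.isPreconnected h.smooth_α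
      (fun p hp => (key p hp).2.1) h.dx_α fun p hp => (key p hp).2.2.2
    have hs : ContDiffOn ℝ ∞ (fun p : Base => Real.exp (-ε * p.1)) B := by fun_prop
    obtain ⟨b, hb⟩ := exists_eq_const hB hB'.isPreconnected (hs.mul h.smooth_β) (fun p hp => by
        refine (fderiv_mul_apply_of_mem hB hs h.smooth_β hp _).trans ?_
        have := (key p hp).1
        unfold Dt at this
        rw [this, fderiv_exp_fst]; ring) (fun p hp => by
        refine (fderiv_mul_apply_of_mem hB hs h.smooth_β hp _).trans ?_
        have := h.dx_β p hp
        unfold Dx at this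
        rw [this, fderiv_exp_fst]; ring) (fun p hp => by
        refine (fderiv_mul_apply_of_mem hB hs h.smooth_β hp _).trans ?_
        have := (key p hp).2.2.1
        unfold Dy at this
        rw [this, fderiv_exp_fst]; ring)
    have hβ : ∀ p ∈ B, β p = b * Real.exp (ε * p.1) := by
      intro p hp
      have := hb p hp
      rw [← this, mul_right_comm, ← Real.exp_add]; simp
    -- Since ψ_t = β, β_t = εβ and ε² = 1, the function ψ - εβ does not depend on t; its
    -- y-derivative is the constant a.
    have fd : ∀ p ∈ B, ∀ v, fderiv ℝ (fun q => ψ q - ε * β q) p v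
        = fderiv ℝ ψ p v - ε * fderiv ℝ β p v := by
      intro p hp v
      have dβ := (h.smooth_β.contDiffAt (hB.mem_nhds hp)).diff
      rw [fderiv_fun_sub (h.smooth_ψ.contDiffAt (hB.mem_nhds hp)).diff (dβ.const_mul ε),
        fderiv_const_mul dβ]
      simp
    obtain ⟨d, hd⟩ := exists_eq_affine hB hB'.isPreconnected (k := a) (l := 0)
      (h.smooth_ψ.sub (contDiffOn_const.mul h.smooth_β)) (fun p hp => by
        refine (fd p hp _).trans ?_
        change Dt ψ p - ε * Dt β p = 0
        rw [(key p hp).1, (h.of_id hB h₁ p hp).1]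
        linear_combination (-β p) * hε.mul_self) (fun p hp => by
        refine (fd p hp _).trans ?_
        change Dx ψ p - ε * Dx β p = 0
        rw [h.dx_ψ p hp, h.dx_β p hp]; ring) (fun p hp => by
        refine (fd p hp _).trans ?_
        change Dy ψ p - ε * Dy β p = a
        rw [(key p hp).2.2.1, (h.of_id hB h₁ p hp).2.1, ha p hp]; ring)
    refine ⟨_, Submodule.mem_span_pair.2 ⟨a, ε * b, rfl⟩, d, fun p hp u => ?_⟩
    have hψ : ψ p = a * p.2.2 + d + ε * (b * Real.exp (ε * p.1)) := by
      have := hd p hp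
      rw [← hβ p hp]; linarith
    refine Prod.ext (Prod.ext ?_ (Prod.ext ?_ ?_)) ?_
    · simp [affineField, ofCoords]
    · simp [affineField, ofCoords]
    · simp [affineField, ofCoords, hψ]; ring
    · simp [affineField, ofCoords, ha p hp, hβ p hp]
      linear_combination (-(b * Real.exp (ε * p.1))) * hε.mul_self
  · rintro X (rfl | rfl)
    · refine ⟨0, _, _, _, .of_affine (k := 1) (l := 0) (a := 1) (b := 0) ?_ ?_,
        funext fun z => ?_⟩
      · intro u hu
        rw [E.deriv_f₁_eq h₁ hu, h₁ hu]; simp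
      · intro u hu
        rw [hder u hu, h₂ hu]; ring
      · refine Prod.ext (Prod.ext ?_ (Prod.ext ?_ ?_)) ?_ <;> simp [affineField, ofCoords]
    · have m1 : ∀ k p, HasDerivAt (fun t => k * Real.exp (ε * t)) (k * (ε * Real.exp (ε * p))) p :=
        fun k p => (hasDerivAt_exp_mul ε p).const_mul k
      refine ⟨0, fun p => (1 * Real.exp (ε * p.1)) * 1, fun _ => 0,
        fun p => ε * Real.exp (ε * p.1) * 1, ⟨by fun_prop, contDiffOn_const, by fun_prop,
        fun p _ => Dx_mul_base (m1 1 p.1) (hasDerivAt_const _ _), fun p _ => by simp [Dx],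
        fun p _ => Dx_mul_base (m1 ε p.1) (hasDerivAt_const _ _),
        fun p hp u hu => ?_, fun p hp u hu => ?_⟩, funext fun z => ?_⟩
      · rw [Dt_mul_base (m1 1 p.1) (hasDerivAt_const _ _),
          Dy_mul_base (m1 1 p.1) (hasDerivAt_const _ _), E.deriv_f₁_eq h₁ hu]
        simp
      · rw [Dt_mul_base (m1 ε p.1) (hasDerivAt_const _ _),
          Dy_mul_base (m1 ε p.1) (hasDerivAt_const _ _), hder u hu, h₂ hu]; simp [Dt, Dy]; ring
      · refine Prod.ext (Prod.ext ?_ (Prod.ext ?_ ?_)) ?_ <;> simp [affineField, ofCoords] <;> ring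

/-- The algebra of the equation `(u, 0)`. -/
theorem algebra_id_zero (hB : IsOpen B) (hB' : IsConnected B)
    (h₁ : EqOn E.f₁ (fun u => u) E.dom) (h₂ : EqOn E.f₂ (fun _ => 0) E.dom)
    (v : Total → Total) : E.IsSymmetry B v ↔ SpannedOn (kernelFields ∪ {dilation,
        ofCoords (fun _ _ _ _ => 0) (fun _ _ _ _ => 0) (fun t _ _ _ => t) (fun _ _ _ _ => 1),
        ofCoords (fun _ _ _ _ => 0) (fun _ _ _ _ => 0) (fun _ _ y _ => y) (fun _ _ _ u => u)})
      (B ×ˢ E.dom) v := by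
  have hder : ∀ u ∈ E.dom, deriv E.f₂ u = 0 := by
    intro u hu
    rw [E.deriv_f₂_eq h₂ hu, deriv_const]
  refine isSymmetry_iff_spannedOn hB hB'.isPreconnected (fun c ψ α β h => ?_) ?_ v
  · have key : ∀ p ∈ B, Dt β p = 0 ∧ Dt α p = 0 ∧ Dy β p = 0 ∧ Dy α p = 0 := by
      intro p hp
      obtain ⟨-, -, ht, he⟩ := h.of_id hB h₁ p hp
      obtain ⟨e0, e1, e2⟩ := quadratic_coeff E.isOpen_dom E.nonempty_dom
        (A₀ := Dt β p) (A₁ := 2 * Dt α p) (A₂ := Dy α p)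
        fun u hu => by
          have := he u hu
          rw [hder u hu, h₂ hu] at this
          linear_combination this
      exact ⟨by linarith, by linarith, by linarith, by linarith⟩
    obtain ⟨a, ha⟩ := exists_eq_const hB hB'.isPreconnected h.smooth_α
      (fun p hp => (key p hp).2.1) h.dx_α fun p hp => (key p hp).2.2.2
    obtain ⟨b, hb⟩ := exists_eq_const hB hB'.isPreconnected h.smooth_β
      (fun p hp => (key p hp).1) h.dx_β fun p hp => (key p hp).2.2.1
    obtain ⟨d, hd⟩ := h.exists_ψ_eq hB hB'.isPreconnected (l := b) (k := a + c)
      (fun p hp => ((h.of_id hB h₁ p hp).1).trans (hb p hp)) fun p hp => by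
        rw [(h.of_id hB h₁ p hp).2.1, ha p hp]
    refine ⟨_, Submodule.mem_span_triple.2 ⟨c, b, a, rfl⟩, d, fun p hp u => ?_⟩
    refine Prod.ext (Prod.ext ?_ (Prod.ext ?_ ?_)) ?_ <;>
      simp [affineField, ofCoords, dilation, hd p hp, ha p hp, hb p hp] <;> ring
  · rintro X (rfl | rfl | rfl)
    · refine ⟨1, _, _, _, .of_affine (k := 1) (l := 0) (a := 0) (b := 0) ?_ ?_,
        funext fun z => ?_⟩
      · intro u hu; ring
      · intro u hu; rw [h₂ hu]; ring
      · refine Prod.ext (Prod.ext ?_ (Prod.ext ?_ ?_)) ?_ <;>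
          simp [affineField, ofCoords, dilation] <;> ring
    · refine ⟨0, _, _, _, .of_affine (k := 0) (l := 1) (a := 0) (b := 1) ?_ ?_,
        funext fun z => ?_⟩
      · intro u hu
        rw [E.deriv_f₁_eq h₁ hu]; simp
      · intro u hu
        rw [hder u hu, h₂ hu]; ring
      · refine Prod.ext (Prod.ext ?_ (Prod.ext ?_ ?_)) ?_ <;> simp [affineField, ofCoords]
    · refine ⟨0, _, _, _, .of_affine (k := 1) (l := 0) (a := 1) (b := 0) ?_ ?_,
        funext fun z => ?_⟩
      · intro u hu
        rw [E.deriv_f₁_eq h₁ hu, h₁ hu]; simp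
      · intro u hu
        rw [hder u hu, h₂ hu]; ring
      · refine Prod.ext (Prod.ext ?_ (Prod.ext ?_ ?_)) ?_ <;> simp [affineField, ofCoords]

end LinearRows

/-! ### The equivalence group -/

/-- The identity of `G^equiv`. -/
def EquivTransf.one : EquivTransf := ⟨1, 0, 0, 1, 0, 0, 1, 0, one_ne_zero, one_ne_zero, one_ne_zero⟩

/-- The composition of `g` followed by `h`. -/
def EquivTransf.comp (h g : EquivTransf) : EquivTransf :=
  ⟨h.a₁ * g.a₁, h.a₁ ^ 2 * g.a₂ + h.a₂, h.a₁ * g.a₃ + h.a₃, h.a₄ * g.a₄,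
    h.a₄ * g.a₅ + h.a₅ * g.a₁ ^ 2, h.a₄ * g.a₆ + h.a₅ * g.a₂ + h.a₆, h.a₇ * g.a₇, h.a₇ * g.a₈ + h.a₈,
    mul_ne_zero h.a₁_ne g.a₁_ne, mul_ne_zero h.a₄_ne g.a₄_ne, mul_ne_zero h.a₇_ne g.a₇_ne⟩

theorem EquivTransf.takes_one (E : Equation) : EquivTransf.one.Takes E E := by
  constructor
  · simp [EquivTransf.one]
  · intro u _; simp [EquivTransf.one]

theorem EquivTransf.Takes.comp {g h : EquivTransf} {E E' E'' : Equation} (hg : g.Takes E E')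
    (hh : h.Takes E' E'') : (h.comp g).Takes E E'' := by
  have e : ∀ u, (h.comp g).a₇ * u + (h.comp g).a₈ = h.a₇ * (g.a₇ * u + g.a₈) + h.a₈ := by
    intro u; simp only [EquivTransf.comp]; ring
  have hg1 := g.a₁_ne
  have hh1 := h.a₁_ne
  refine ⟨?_, fun u hu => ?_⟩
  · rw [hh.1, hg.1, image_image]
    simp only [e]
  · have hm : g.a₇ * u + g.a₈ ∈ E'.dom := by rw [hg.1]; exact ⟨u, hu, rfl⟩
    rw [e, (hh.2 _ hm).1, (hh.2 _ hm).2, (hg.2 u hu).1, (hg.2 u hu).2]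
    simp only [EquivTransf.comp]
    constructor
    · field_simp; ring
    · field_simp

theorem EquivTransf.Takes.transforms {g : EquivTransf} {E E' : Equation} (h : g.Takes E E') :
    Transforms g.map univ E E' := by
  have hD : ∀ p, Dt (fun q => g.a₄ * q.2.2 + g.a₅ * q.1 + g.a₆) p = g.a₅ := Dt_affine_base _ _ _
  have hD' : ∀ p, Dy (fun q => g.a₄ * q.2.2 + g.a₅ * q.1 + g.a₆) p = g.a₄ := Dy_affine_base _ _ _
  have h1 := g.a₁_ne
  refine transforms_of_affine (κ := g.a₁) (c₀ := g.a₂) (c₂ := g.a₃) h1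
    (Y := fun q => g.a₄ * q.2.2 + g.a₅ * q.1 + g.a₆) (α := fun _ => g.a₇) (β := fun _ => g.a₈)
    (by fun_prop) contDiff_const contDiff_const (fun p => Dx_affine_base _ _ _ _)
    (fun p => by simp [Dx]) (fun p => by simp [Dx]) (fun p => by rw [hD']; exact g.a₄_ne)
    (fun _ => g.a₇_ne) (fun p q hpq e => ?_) (fun p u hu => ?_) (fun p u hu => ?_)
    (fun p u hu => ?_) fun z => rfl
  · rw [hpq] at e
    exact mul_left_cancel₀ g.a₄_ne (by linarith)
  · rw [h.1]; exact ⟨u, hu, rfl⟩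
  · rw [hD, hD', (h.2 u hu).1]; field_simp
  · rw [(h.2 u hu).2]; simp [Dt, Dy]; field_simp

/-- The equation obtained from `E` by the transformation `g`. -/
noncomputable def Equation.push (E : Equation) (g : EquivTransf) : Equation where
  dom := (fun u => g.a₇ * u + g.a₈) '' E.dom
  f₁ w := g.a₄ / g.a₁ ^ 2 * E.f₁ ((w - g.a₈) / g.a₇) + g.a₅ / g.a₁ ^ 2
  f₂ w := g.a₇ / g.a₁ ^ 2 * E.f₂ ((w - g.a₈) / g.a₇)
  isOpen_dom := by
    have : (fun u => g.a₇ * u + g.a₈) '' E.dom = (fun w => (w - g.a₈) / g.a₇) ⁻¹' E.dom := by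
      have h7 := g.a₇_ne
      refine congrFun (image_eq_preimage_of_inverse (fun u => ?_) fun w => ?_) _ <;> field_simp <;> ring
    rw [this]
    exact E.isOpen_dom.preimage (by fun_prop)
  ordConnected_dom := by
    refine (E.ordConnected_dom.isPreconnected.image _ ?_).ordConnected
    fun_prop
  nonempty_dom := E.nonempty_dom.image _
  smooth_f₁ := by
    refine (contDiffOn_const.mul (E.smooth_f₁.comp (t := E.dom) (by fun_prop) ?_)).add contDiffOn_const
    rintro _ ⟨u, hu, rfl⟩
    have h7 := g.a₇_ne
    have : (g.a₇ * u + g.a₈ - g.a₈) / g.a₇ = u := by field_simp; ring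
    change (g.a₇ * u + g.a₈ - g.a₈) / g.a₇ ∈ E.dom
    rwa [this]
  smooth_f₂ := by
    refine contDiffOn_const.mul (E.smooth_f₂.comp (t := E.dom) (by fun_prop) ?_)
    rintro _ ⟨u, hu, rfl⟩
    have h7 := g.a₇_ne
    have : (g.a₇ * u + g.a₈ - g.a₈) / g.a₇ = u := by field_simp; ring
    change (g.a₇ * u + g.a₈ - g.a₈) / g.a₇ ∈ E.dom
    rwa [this]
  nonconst_f₁ := by
    obtain ⟨a, ha, b, hb, hab⟩ := E.nonconst_f₁
    have h7 := g.a₇_ne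
    have h1 := g.a₁_ne
    have h4 := g.a₄_ne
    have e : ∀ u, (g.a₇ * u + g.a₈ - g.a₈) / g.a₇ = u := fun u => by field_simp; ring
    refine ⟨_, ⟨a, ha, rfl⟩, _, ⟨b, hb, rfl⟩, fun h => hab ?_⟩
    simp only [e] at h
    field_simp at h
    exact mul_left_cancel₀ h4 (by linarith)

theorem EquivTransf.takes_push (g : EquivTransf) (E : Equation) : g.Takes E (E.push g) := by
  refine ⟨rfl, fun u hu => ?_⟩
  have h7 := g.a₇_ne
  have e : (g.a₇ * u + g.a₈ - g.a₈) / g.a₇ = u := by field_simp; ring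
  simp only [Equation.push, e, and_self]

theorem EquivTransf.Takes.deriv_comp {g : EquivTransf} {E E' : Equation} (h : g.Takes E E')
    {f f' : ℝ → ℝ} {k l : ℝ} (e : ∀ u ∈ E.dom, f' (g.a₇ * u + g.a₈) = k * f u + l)
    (df : ∀ u ∈ E.dom, DifferentiableAt ℝ f u) (df' : ∀ u ∈ E'.dom, DifferentiableAt ℝ f' u) :
    ∀ u ∈ E.dom, g.a₇ * deriv f' (g.a₇ * u + g.a₈) = k * deriv f u := by
  intro u hu
  have i1 : HasDerivAt (fun u => g.a₇ * u + g.a₈) (g.a₇ * 1) u :=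
    ((hasDerivAt_id u).const_mul g.a₇).add_const g.a₈
  have hpt : g.a₇ * u + g.a₈ ∈ E'.dom := by rw [h.1]; exact ⟨u, hu, rfl⟩
  have i2 := (df' _ hpt).hasDerivAt.comp u i1
  have i3 := ((df u hu).hasDerivAt.const_mul k).add_const l
  have ev : f' ∘ (fun u => g.a₇ * u + g.a₈) =ᶠ[𝓝 u] fun u => k * f u + l := by
    filter_upwards [E.isOpen_dom.mem_nhds hu] with s hs using e s hs
  have := i2.deriv.symm.trans (ev.deriv_eq.trans i3.deriv)
  linear_combination this

theorem EquivTransf.Takes.deriv_f₁ {g : EquivTransf} {E E' : Equation} (h : g.Takes E E') :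
    ∀ u ∈ E.dom, g.a₇ * deriv E'.f₁ (g.a₇ * u + g.a₈) = g.a₄ / g.a₁ ^ 2 * deriv E.f₁ u :=
  h.deriv_comp (fun u hu => (h.2 u hu).1) (fun _ hu => E.differentiableAt_f₁ hu)
    fun _ hu => E'.differentiableAt_f₁ hu

theorem EquivTransf.Takes.deriv_f₂ {g : EquivTransf} {E E' : Equation} (h : g.Takes E E') :
    ∀ u ∈ E.dom, g.a₇ * deriv E'.f₂ (g.a₇ * u + g.a₈) = g.a₇ / g.a₁ ^ 2 * deriv E.f₂ u :=
  h.deriv_comp (l := 0) (fun u hu => by rw [(h.2 u hu).2, add_zero])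
    (fun _ hu => E.differentiableAt_f₂ hu) fun _ hu => E'.differentiableAt_f₂ hu

/-! ### Equations with an extended algebra -/

/-- The determining equations have a solution that does not correspond to an element of `A^ker`. -/
def Equation.Extended (E : Equation) : Prop :=
  ∃ (B : Set Base) (c : ℝ) (ψ α β : Base → ℝ), IsOpen B ∧ IsConnected B ∧
    DeterminingSystem E B c ψ α β ∧ ¬ (c = 0 ∧ ∀ p ∈ B, α p = 0 ∧ β p = 0)

/-- If c, α and β all vanish, (A) forces ψ to be constant, so the field lies in the kernel algebra.
-/
theorem Equation.HasExtension.extended {E : Equation} {B : Set Base} (hB : IsOpen B)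
    (hB' : IsConnected B) (h : E.HasExtension B) : E.Extended := by
  obtain ⟨v, hv, hn⟩ := h
  obtain ⟨c₀, c, c₂, ψ, α, β, hD, hv'⟩ := (Equation.isSymmetry_iff hB hB'.isPreconnected).1 hv
  refine ⟨B, c, ψ, α, β, hB, hB', hD, ?_⟩
  rintro ⟨rfl, h0⟩
  have key : ∀ p ∈ B, Dt ψ p = 0 ∧ Dy ψ p = 0 := by
    intro p hp
    obtain ⟨e1, e2⟩ := E.coeff_eq_zero (A := -Dt ψ p) (B := -Dy ψ p) fun u hu => by
      have := hD.eqA p hp u hu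
      rw [(h0 p hp).1, (h0 p hp).2] at this
      linear_combination this
    exact ⟨by linarith, by linarith⟩
  obtain ⟨d, hd⟩ := exists_eq_const hB hB'.isPreconnected hD.smooth_ψ (fun p hp => (key p hp).1)
    hD.dx_ψ fun p hp => (key p hp).2
  refine hn ⟨_, mem_span_kernelFields.2 ⟨c₀, c₂, d, rfl⟩, fun z hz => ?_⟩
  rw [hv' hz]
  refine Prod.ext (Prod.ext ?_ (Prod.ext ?_ ?_)) ?_ <;>
    simp [affineField, hd z.1 hz.1, (h0 z.1 hz.1).1, (h0 z.1 hz.1).2]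

/-- The linear change `(t, x, y) ↦ (s t, x, r y + q t)` of the base. -/
noncomputable def shear (s r q : ℝ) (hs : s ≠ 0) (hr : r ≠ 0) : Base ≃L[ℝ] Base :=
  ContinuousLinearEquiv.equivOfInverse
    ((s • ContinuousLinearMap.fst ℝ ℝ (ℝ × ℝ)).prod
      (((ContinuousLinearMap.fst ℝ ℝ ℝ).comp (ContinuousLinearMap.snd ℝ ℝ (ℝ × ℝ))).prod
        (r • ((ContinuousLinearMap.snd ℝ ℝ ℝ).comp (ContinuousLinearMap.snd ℝ ℝ (ℝ × ℝ)))
          + q • ContinuousLinearMap.fst ℝ ℝ (ℝ × ℝ))))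
    ((s⁻¹ • ContinuousLinearMap.fst ℝ ℝ (ℝ × ℝ)).prod
      (((ContinuousLinearMap.fst ℝ ℝ ℝ).comp (ContinuousLinearMap.snd ℝ ℝ (ℝ × ℝ))).prod
        (r⁻¹ • ((ContinuousLinearMap.snd ℝ ℝ ℝ).comp (ContinuousLinearMap.snd ℝ ℝ (ℝ × ℝ)))
          - (r⁻¹ * q * s⁻¹) • ContinuousLinearMap.fst ℝ ℝ (ℝ × ℝ))))
    (fun p => by refine Prod.ext ?_ (Prod.ext ?_ ?_) <;> simp <;> field_simp <;> ring)
    (fun p => by refine Prod.ext ?_ (Prod.ext ?_ ?_) <;> simp <;> field_simp <;> ring)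

theorem shear_apply (s r q : ℝ) (hs : s ≠ 0) (hr : r ≠ 0) (p : Base) :
    shear s r q hs hr p = (s * p.1, p.2.1, r * p.2.2 + q * p.1) := rfl

/-- The field is pushed forward: ψ becomes a₄ψ + a₅ct, β becomes a₇β - a₈α, while α and c are
unchanged, all composed with the inverse of the base map. Translations and the scaling of x are
omitted from `L`, because ψ, α, β do not depend on x and the determining equations have no explicit
t, x, y. -/
theorem EquivTransf.Takes.extended {g : EquivTransf} {E E' : Equation} (h : g.Takes E E')
    (hE : E.Extended) : E'.Extended := by
  obtain ⟨B, c, ψ, α, β, hB, hB', hD, hn⟩ := hE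
  have h1 := g.a₁_ne
  have h4 := g.a₄_ne
  have h7 := g.a₇_ne
  set L := shear (1 / g.a₁ ^ 2) (1 / g.a₄) (-g.a₅ / (g.a₁ ^ 2 * g.a₄)) (by positivity)
    (one_div_ne_zero h4) with hL
  have hcomp : ∀ {f : Base → ℝ}, ContDiffOn ℝ ∞ f B → ContDiffOn ℝ ∞ (fun q => f (L q)) (L ⁻¹' B) :=
    fun hf => hf.comp L.contDiff.contDiffOn fun p hp => hp
  have hfd : ∀ {f : Base → ℝ}, ContDiffOn ℝ ∞ f B → ∀ p ∈ L ⁻¹' B, ∀ a,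
      fderiv ℝ (fun q => f (L q)) p a = fderiv ℝ f (L p) (L a) := by
    intro f hf p hp a
    have : HasFDerivAt (fun q => f (L q)) ((fderiv ℝ f (L p)).comp (L : Base →L[ℝ] Base)) p :=
      HasFDerivAt.comp p (hf.contDiffAt (hB.mem_nhds hp)).diff.hasFDerivAt L.hasFDerivAt
    rw [this.fderiv]; rfl
  have ht : ∀ {f : Base → ℝ}, ContDiffOn ℝ ∞ f B → ∀ p ∈ L ⁻¹' B, Dt (fun q => f (L q)) p
      = 1 / g.a₁ ^ 2 * Dt f (L p) - g.a₅ / (g.a₁ ^ 2 * g.a₄) * Dy f (L p) := by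
    intro f hf p hp
    refine (hfd hf p hp _).trans ?_
    simp only [hL, shear_apply]
    rw [fderiv_base']
    simp; ring
  have hx : ∀ {f : Base → ℝ}, ContDiffOn ℝ ∞ f B → ∀ p ∈ L ⁻¹' B, Dx (fun q => f (L q)) p
      = Dx f (L p) := by
    intro f hf p hp
    refine (hfd hf p hp _).trans ?_
    simp only [hL, shear_apply]
    rw [fderiv_base']
    simp
  have hy : ∀ {f : Base → ℝ}, ContDiffOn ℝ ∞ f B → ∀ p ∈ L ⁻¹' B, Dy (fun q => f (L q)) p
      = 1 / g.a₄ * Dy f (L p) := by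
    intro f hf p hp
    refine (hfd hf p hp _).trans ?_
    simp only [hL, shear_apply]
    rw [fderiv_base']
    simp
  have sψ : ContDiffOn ℝ ∞ (fun q => g.a₄ * ψ q + g.a₅ * c * q.1) B :=
    (contDiffOn_const.mul hD.smooth_ψ).add (by fun_prop)
  have sβ : ContDiffOn ℝ ∞ (fun q => g.a₇ * β q - g.a₈ * α q) B :=
    (contDiffOn_const.mul hD.smooth_β).sub (contDiffOn_const.mul hD.smooth_α)
  have dψ : ∀ p ∈ B, ∀ a, fderiv ℝ (fun q => g.a₄ * ψ q + g.a₅ * c * q.1) p a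
      = g.a₄ * fderiv ℝ ψ p a + g.a₅ * c * a.1 := by
    intro p hp a
    have hd := (hD.smooth_ψ.contDiffAt (hB.mem_nhds hp)).diff
    have : HasFDerivAt (fun q : Base => g.a₄ * ψ q + g.a₅ * c * q.1) _ p :=
      (hd.hasFDerivAt.const_mul g.a₄).add
        ((hasFDerivAt_fst (𝕜 := ℝ) (E := ℝ) (F := ℝ × ℝ) (p := p)).const_mul (g.a₅ * c))
    rw [this.fderiv]; simp
  have dβ : ∀ p ∈ B, ∀ a, fderiv ℝ (fun q => g.a₇ * β q - g.a₈ * α q) p a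
      = g.a₇ * fderiv ℝ β p a - g.a₈ * fderiv ℝ α p a := by
    intro p hp a
    have hd := (hD.smooth_β.contDiffAt (hB.mem_nhds hp)).diff
    have hd' := (hD.smooth_α.contDiffAt (hB.mem_nhds hp)).diff
    have : HasFDerivAt (fun q : Base => g.a₇ * β q - g.a₈ * α q) _ p :=
      (hd.hasFDerivAt.const_mul g.a₇).sub (hd'.hasFDerivAt.const_mul g.a₈)
    rw [this.fderiv]; simp
  have hpt : ∀ u ∈ E.dom, g.a₇ * u + g.a₈ ∈ E'.dom := fun u hu => by rw [h.1]; exact ⟨u, hu, rfl⟩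
  have hder₁ := h.deriv_f₁
  have hder₂ := h.deriv_f₂
  refine ⟨L ⁻¹' B, c, _, fun q => α (L q), _, hB.preimage L.continuous,
    (L.toHomeomorph.isConnected_preimage).2 hB',
    ⟨hcomp sψ, hcomp hD.smooth_α, hcomp sβ, fun p hp => ?_, fun p hp => ?_, fun p hp => ?_,
      fun p hp u hu => ?_, fun p hp u hu => ?_⟩, ?_⟩
  · rw [hx sψ p hp]
    refine (dψ _ hp _).trans ?_
    have := hD.dx_ψ _ hp
    unfold Dx at this
    rw [this]; simp
  · rw [hx hD.smooth_α p hp, hD.dx_α _ hp]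
  · rw [hx sβ p hp]
    refine (dβ _ hp _).trans ?_
    have e1 := hD.dx_α _ hp
    have e2 := hD.dx_β _ hp
    unfold Dx at e1 e2
    rw [e1, e2]; simp
  · rw [h.1] at hu
    obtain ⟨u, hu, rfl⟩ := hu
    have e := hD.eqA _ hp u hu
    have e1 : Dt (fun q => g.a₄ * ψ q + g.a₅ * c * q.1) (L p) = g.a₄ * Dt ψ (L p) + g.a₅ * c := by
      refine (dψ _ hp _).trans ?_; simp [Dt]
    have e2 : Dy (fun q => g.a₄ * ψ q + g.a₅ * c * q.1) (L p) = g.a₄ * Dy ψ (L p) := by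
      refine (dψ _ hp _).trans ?_; simp [Dy]
    have e3 := hder₁ u hu
    simp only [ht sψ p hp, hy sψ p hp, e1, e2, (h.2 u hu).1]
    field_simp at e3 ⊢
    linear_combination g.a₄ * e + (α (L p) * u + β (L p)) * e3
  · rw [h.1] at hu
    obtain ⟨u, hu, rfl⟩ := hu
    have e := hD.eqB _ hp u hu
    have e1 : Dt (fun q => g.a₇ * β q - g.a₈ * α q) (L p) = g.a₇ * Dt β (L p) - g.a₈ * Dt α (L p) :=
      dβ _ hp _
    have e2 : Dy (fun q => g.a₇ * β q - g.a₈ * α q) (L p) = g.a₇ * Dy β (L p) - g.a₈ * Dy α (L p) :=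
      dβ _ hp _
    have e3 := hder₂ u hu
    simp only [ht sβ p hp, hy sβ p hp, ht hD.smooth_α p hp, hy hD.smooth_α p hp, e1, e2,
      (h.2 u hu).1, (h.2 u hu).2]
    field_simp at e3 ⊢
    linear_combination g.a₇ * g.a₄ * e - g.a₇ * g.a₄ * (α (L p) * u + β (L p)) * e3
  · rintro ⟨rfl, h0⟩
    refine hn ⟨rfl, fun p hp => ?_⟩
    obtain ⟨e1, e2⟩ := h0 (L.symm p) (by simpa using hp)
    simp only [ContinuousLinearEquiv.apply_symm_apply] at e1 e2
    rw [e1, mul_zero, sub_zero] at e2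
    exact ⟨e1, (mul_eq_zero.1 e2).resolve_left h7⟩

/-! ### The additional equivalence transformations -/

theorem hasFDerivAt_add_base {g : ℝ → ℝ} {g' : ℝ} {p : Base} (hg : HasDerivAt g g' p.1) :
    ∃ L : Base →L[ℝ] ℝ, HasFDerivAt (fun q : Base => q.2.2 + g q.1) L p ∧
      ∀ a, L a = a.2.2 + g' * a.1 := by
  have h1 := hg.comp_hasFDerivAt p (hasFDerivAt_fst (𝕜 := ℝ) (E := ℝ) (F := ℝ × ℝ))
  have h2 : HasFDerivAt (fun q : Base => q.2.2)
    ((ContinuousLinearMap.snd ℝ ℝ ℝ).comp (ContinuousLinearMap.snd ℝ ℝ (ℝ × ℝ))) p :=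
    ((ContinuousLinearMap.snd ℝ ℝ ℝ).comp (ContinuousLinearMap.snd ℝ ℝ (ℝ × ℝ))).hasFDerivAt
  refine ⟨_, h2.add h1, fun a => ?_⟩
  simp

theorem gradient_add_base {g : ℝ → ℝ} {g' : ℝ} {p : Base} (hg : HasDerivAt g g' p.1) :
    Dt (fun q : Base => q.2.2 + g q.1) p = g' ∧ Dx (fun q : Base => q.2.2 + g q.1) p = 0 ∧
      Dy (fun q : Base => q.2.2 + g q.1) p = 1 := by
  obtain ⟨L, hL, e⟩ := hasFDerivAt_add_base hg
  simp [Dt, Dx, Dy, hL.fderiv, e]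

theorem gradient_const (k : ℝ) (p : Base) : Dt (fun _ => k) p = 0 ∧ Dx (fun _ => k) p = 0 ∧
    Dy (fun _ => k) p = 0 := by
  simp [Dt, Dx, Dy]

theorem gradient_mul_base {g h : ℝ → ℝ} {g' h' : ℝ} {p : Base} (hg : HasDerivAt g g' p.1)
    (hh : HasDerivAt h h' p.2.2) : Dt (fun q : Base => g q.1 * h q.2.2) p = g' * h p.2.2 ∧
      Dx (fun q : Base => g q.1 * h q.2.2) p = 0 ∧
      Dy (fun q : Base => g q.1 * h q.2.2) p = g p.1 * h' :=
  ⟨Dt_mul_base hg hh, Dx_mul_base hg hh, Dy_mul_base hg hh⟩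

theorem hasDerivAt_neg_half_sq (ε t : ℝ) : HasDerivAt (fun t => -(ε / 2 * t ^ 2)) (-(ε * t)) t := by
  refine (((hasDerivAt_pow 2 t).const_mul (ε / 2)).neg).congr_deriv ?_
  simp; ring

theorem PowerDomain.mul_rpow {I : Set ℝ} {m : ℝ} (hm : PowerDomain I m) {a u : ℝ} (ha : 0 < a)
    (hu : u ∈ I) : (a * u) ^ m = a ^ m * u ^ m := by
  rcases hm with hp | ⟨k, rfl⟩
  · exact Real.mul_rpow ha.le (le_of_lt (hp hu))
  · simp only [Real.rpow_natCast]; exact mul_pow a u k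

/-! ### Verification of the six additional transformations -/

section

variable {E E' : Equation}

/-- The target interval is the whole line because u - εy takes all real values as y varies. Trivial
factors and summands such as `1 *` and `0 * p.1 + 0` bring the functions to the product and affine
forms for which gradients are available. -/
theorem transforms_exp {ε δ : ℝ} (hε : IsSign ε) (hd : E'.dom = univ)
    (h₁ : EqOn E.f₁ Real.exp E.dom) (h₂ : EqOn E.f₂ (fun u => ε * Real.exp u + δ) E.dom)
    (h₁' : EqOn E'.f₁ Real.exp E'.dom) (h₂' : EqOn E'.f₂ (fun _ => δ) E'.dom) :
    Transforms (ofCoords (fun t _ _ _ => t) (fun _ x _ _ => x)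
      (fun _ _ y _ => -ε * Real.exp (-ε * y)) (fun _ _ y u => u - ε * y)) univ E E' := by
  have hm : ∀ w, w ∈ E'.dom := fun w => by rw [hd]; trivial
  have D : ∀ p : Base, _ := fun p => gradient_mul_base (hasDerivAt_const p.1 (1 : ℝ))
    ((hasDerivAt_exp_mul (-ε) p.2.2).const_mul (-ε))
  have hεε := hε.mul_self
  refine transforms_of_affine one_ne_zero (c₀ := 0) (c₂ := 0)
    (Y := fun p => 1 * (-ε * Real.exp (-ε * p.2.2))) (α := fun _ => 1)
    (β := fun p => -ε * p.2.2 + 0 * p.1 + 0) (by fun_prop) (by fun_prop) (by fun_prop)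
    (fun p => (D p).2.1) (fun p => (gradient_const _ p).2.1) (fun p => Dx_affine_base _ _ _ p)
    (fun p => ?_) (fun _ => one_ne_zero) (fun p q _ e => ?_) (fun _ _ _ => hm _) (fun p u hu => ?_)
    (fun p u hu => ?_) fun z => ?_
  · rw [(D p).2.2]
    simp [hε.ne_zero]
  · have := hε.ne_zero
    simpa [this] using e
  · rw [(D p).1, (D p).2.2, h₁' (hm _), h₁ hu, show (1 : ℝ) * u + (-ε * p.2.2 + 0 * p.1 + 0)
      = u + -ε * p.2.2 by ring, Real.exp_add]
    linear_combination (-Real.exp u * Real.exp (-ε * p.2.2)) * hεε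
  · rw [h₂' (hm _), h₁ hu, h₂ hu, Dt_affine_base, Dy_affine_base, (gradient_const _ p).1,
      (gradient_const _ p).2.2]
    ring
  · refine Prod.ext (Prod.ext ?_ (Prod.ext ?_ ?_)) ?_ <;> simp [ofCoords]
    ring

/-- Multiplying u by e^{-εt} shifts ln u by -εt, which the change of y compensates; the term α_t u
cancels f₂ = εu. -/
theorem transforms_log {ε : ℝ} (hd : E.dom ⊆ Ioi 0) (hd' : E'.dom = Ioi 0)
    (h₁ : EqOn E.f₁ Real.log E.dom) (h₂ : EqOn E.f₂ (fun u => ε * u) E.dom)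
    (h₁' : EqOn E'.f₁ Real.log E'.dom) (h₂' : EqOn E'.f₂ (fun _ => 0) E'.dom) :
    Transforms (ofCoords (fun t _ _ _ => t) (fun _ x _ _ => x)
        (fun t _ y _ => y - ε / 2 * t ^ 2) (fun t _ _ u => Real.exp (-ε * t) * u)) univ E E' := by
  have hm : ∀ (p : Base), ∀ u ∈ E.dom, Real.exp (-ε * p.1) * 1 * u + 0 ∈ E'.dom := fun p u hu => by
    rw [hd']
    have : 0 < u := hd hu
    change 0 < Real.exp (-ε * p.1) * 1 * u + 0
    positivity
  have D : ∀ p : Base, _ := fun p => gradient_add_base (p := p) (hasDerivAt_neg_half_sq ε p.1)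
  have D' : ∀ p : Base, _ := fun p => gradient_mul_base (hasDerivAt_exp_mul (-ε) p.1)
    (hasDerivAt_const p.2.2 (1 : ℝ))
  refine transforms_of_affine one_ne_zero (c₀ := 0) (c₂ := 0)
    (Y := fun p => p.2.2 + -(ε / 2 * p.1 ^ 2)) (α := fun p => Real.exp (-ε * p.1) * 1)
    (β := fun _ => 0) (by fun_prop) (by fun_prop) (by fun_prop)
    (fun p => (D p).2.1) (fun p => (D' p).2.1) (fun p => (gradient_const _ p).2.1)
    (fun p => ?_) (fun _ => by positivity) (fun p q h e => ?_) hm (fun p u hu => ?_)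
    (fun p u hu => ?_) fun z => ?_
  · rw [(D p).2.2]; exact one_ne_zero
  · rw [h] at e; linarith
  · have hu0 : u ≠ 0 := ne_of_gt (hd hu)
    rw [(D p).1, (D p).2.2, h₁' (hm p u hu), h₁ hu, mul_one, add_zero,
      Real.log_mul (Real.exp_ne_zero _) hu0, Real.log_exp]
    ring
  · rw [h₂' (hm p u hu), h₂ hu, (D' p).1, (D' p).2.2, (gradient_const _ p).1,
      (gradient_const _ p).2.2]
    ring
  · refine Prod.ext (Prod.ext ?_ (Prod.ext ?_ ?_)) ?_ <;> simp [ofCoords]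
    ring

/-- With α = e^{-εy} the term f₁ α_y u cancels εα u^(m + 1). As α takes all positive values, the
target interval must absorb every positive multiple of a source value. -/
theorem transforms_pow {m ε δ : ℝ} (hm₀ : m ≠ 0) (hε : IsSign ε) (hd : PowerDomain E.dom m)
    (hmem : ∀ a > 0, ∀ u ∈ E.dom, a * u ∈ E'.dom)
    (h₁ : EqOn E.f₁ (fun u => u ^ m) E.dom)
    (h₂ : EqOn E.f₂ (fun u => ε * u ^ (m + 1) + δ * u) E.dom)
    (h₁' : EqOn E'.f₁ (fun u => u ^ m) E'.dom) (h₂' : EqOn E'.f₂ (fun u => δ * u) E'.dom) :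
    Transforms (ofCoords (fun t _ _ _ => t) (fun _ x _ _ => x)
      (fun _ _ y _ => -(ε / m) * Real.exp (-ε * m * y)) (fun _ _ y u => Real.exp (-ε * y) * u))
      univ E E' := by
  have hm : ∀ (p : Base), ∀ u ∈ E.dom, 1 * Real.exp (-ε * p.2.2) * u + 0 ∈ E'.dom := fun p u hu => by
    rw [add_zero]
    exact hmem _ (by positivity) u hu
  have D : ∀ p : Base, _ := fun p => gradient_mul_base (hasDerivAt_const p.1 (1 : ℝ))
    ((hasDerivAt_exp_mul (-ε * m) p.2.2).const_mul (-(ε / m)))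
  have D' : ∀ p : Base, _ := fun p => gradient_mul_base (hasDerivAt_const p.1 (1 : ℝ))
    (hasDerivAt_exp_mul (-ε) p.2.2)
  have hεε := hε.mul_self
  have hε0 := hε.ne_zero
  refine transforms_of_affine one_ne_zero (c₀ := 0) (c₂ := 0)
    (Y := fun p => 1 * (-(ε / m) * Real.exp (-ε * m * p.2.2)))
    (α := fun p => 1 * Real.exp (-ε * p.2.2))
    (β := fun _ => 0) (by fun_prop) (by fun_prop) (by fun_prop)
    (fun p => (D p).2.1) (fun p => (D' p).2.1) (fun p => (gradient_const _ p).2.1)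
    (fun p => ?_) (fun _ => by positivity) (fun p q h e => ?_) hm (fun p u hu => ?_)
    (fun p u hu => ?_) fun z => ?_
  · rw [(D p).2.2]
    simp [hε0, hm₀]
  · simpa [hε0, hm₀] using e
  · rw [(D p).1, (D p).2.2, h₁' (hm p u hu), h₁ hu]
    simp only [add_zero, one_mul]
    rw [hd.mul_rpow (Real.exp_pos _) hu, ← Real.exp_mul, show -ε * p.2.2 * m = -ε * m * p.2.2 by ring]
    have hdiv : ε / m * m = ε := div_mul_cancel₀ ε hm₀
    linear_combination (-Real.exp (-ε * m * p.2.2) * u ^ m) * hεε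
      + (-ε * Real.exp (-ε * m * p.2.2) * u ^ m) * hdiv
  · rw [h₂' (hm p u hu), h₂ hu, h₁ hu, (D' p).1, (D' p).2.2, (gradient_const _ p).1,
      (gradient_const _ p).2.2]
    simp only
    rw [hd.rpow_add_one hu]
    ring
  · refine Prod.ext (Prod.ext ?_ (Prod.ext ?_ ?_)) ?_ <;> simp [ofCoords]

theorem transforms_const {ε : ℝ} (hd : E'.dom = univ)
    (h₁ : EqOn E.f₁ (fun u => u) E.dom) (h₂ : EqOn E.f₂ (fun _ => ε) E.dom)
    (h₁' : EqOn E'.f₁ (fun u => u) E'.dom) (h₂' : EqOn E'.f₂ (fun _ => 0) E'.dom) :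
    Transforms (ofCoords (fun t _ _ _ => t) (fun _ x _ _ => x)
        (fun t _ y _ => y - ε / 2 * t ^ 2) (fun t _ _ u => u - ε * t)) univ E E' := by
  have hm : ∀ w, w ∈ E'.dom := fun w => by rw [hd]; trivial
  have D : ∀ p : Base, _ := fun p => gradient_add_base (p := p) (hasDerivAt_neg_half_sq ε p.1)
  refine transforms_of_affine one_ne_zero (c₀ := 0) (c₂ := 0)
    (Y := fun p => p.2.2 + -(ε / 2 * p.1 ^ 2)) (α := fun _ => 1)
    (β := fun p => 0 * p.2.2 + -ε * p.1 + 0) (by fun_prop) (by fun_prop) (by fun_prop)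
    (fun p => (D p).2.1) (fun p => (gradient_const _ p).2.1) (fun p => Dx_affine_base _ _ _ p)
    (fun p => ?_) (fun _ => one_ne_zero) (fun p q h e => ?_) (fun _ _ _ => hm _) (fun p u hu => ?_)
    (fun p u hu => ?_) fun z => ?_
  · rw [(D p).2.2]; exact one_ne_zero
  · rw [h] at e; linarith
  · rw [(D p).1, (D p).2.2, h₁' (hm _), h₁ hu]
    ring
  · rw [h₂' (hm _), h₁ hu, h₂ hu, Dt_affine_base, Dy_affine_base, (gradient_const _ p).1,
      (gradient_const _ p).2.2]
    ring
  · refine Prod.ext (Prod.ext ?_ (Prod.ext ?_ ?_)) ?_ <;> simp [ofCoords] <;> ring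

theorem hasDerivAt_exp_neg (y : ℝ) : HasDerivAt (fun y => Real.exp (-y)) (-Real.exp (-y)) y :=
  ((hasDerivAt_neg y).exp).congr_deriv (by ring)

theorem transforms_sq (hd : E'.dom = univ)
    (h₁ : EqOn E.f₁ (fun u => u) E.dom) (h₂ : EqOn E.f₂ (fun u => u ^ 2) E.dom)
    (h₁' : EqOn E'.f₁ (fun u => u) E'.dom) (h₂' : EqOn E'.f₂ (fun _ => 0) E'.dom) :
    Transforms (ofCoords (fun t _ _ _ => t) (fun _ x _ _ => x)
        (fun _ _ y _ => -Real.exp (-y)) (fun _ _ y u => Real.exp (-y) * u)) univ E E' := by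
  have hm : ∀ w, w ∈ E'.dom := fun w => by rw [hd]; trivial
  have D : ∀ k : ℝ, ∀ p : Base, _ := fun k p => gradient_mul_base (hasDerivAt_const p.1 k)
    (hasDerivAt_exp_neg p.2.2)
  refine transforms_of_affine one_ne_zero (c₀ := 0) (c₂ := 0)
    (Y := fun p => -1 * Real.exp (-p.2.2)) (α := fun p => 1 * Real.exp (-p.2.2))
    (β := fun _ => 0) (by fun_prop) (by fun_prop) (by fun_prop)
    (fun p => (D _ p).2.1) (fun p => (D _ p).2.1) (fun p => (gradient_const _ p).2.1)
    (fun p => ?_) (fun _ => by positivity) (fun p q h e => ?_) (fun _ _ _ => hm _) (fun p u hu => ?_)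
    (fun p u hu => ?_) fun z => ?_
  · rw [(D _ p).2.2]; simp
  · simpa using e
  · rw [(D _ p).1, (D _ p).2.2, h₁' (hm _), h₁ hu]
    ring
  · rw [h₂' (hm _), h₁ hu, h₂ hu, (D _ p).1, (D _ p).2.2, (gradient_const _ p).1,
      (gradient_const _ p).2.2]
    ring
  · refine Prod.ext (Prod.ext ?_ (Prod.ext ?_ ?_)) ?_ <;> simp [ofCoords]

/-- All coefficient functions are multiples of e^{t - y}. For such functions f₁ α_y u cancels u²,
and α_t, β_t, β_y leave 2(αu + β), twice the linear target; hence κ² = 2. -/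
theorem transforms_sqSubOne (hd : E'.dom = univ)
    (h₁ : EqOn E.f₁ (fun u => u) E.dom) (h₂ : EqOn E.f₂ (fun u => u ^ 2 - 1) E.dom)
    (h₁' : EqOn E'.f₁ (fun u => u) E'.dom) (h₂' : EqOn E'.f₂ (fun u => u) E'.dom) :
    Transforms (ofCoords (fun t _ _ _ => 2 * t) (fun _ x _ _ => Real.sqrt 2 * x)
        (fun t _ y _ => -2 * Real.exp (t - y))
        (fun t _ y u => Real.exp (t - y) * u - Real.exp (t - y))) univ E E' := by
  have hm : ∀ w, w ∈ E'.dom := fun w => by rw [hd]; trivial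
  have D : ∀ k : ℝ, ∀ p : Base, _ := fun k p => gradient_mul_base
    ((Real.hasDerivAt_exp p.1).const_mul k) (hasDerivAt_exp_neg p.2.2)
  have h2 : Real.sqrt 2 ^ 2 = 2 := Real.sq_sqrt (by norm_num)
  refine transforms_of_affine (κ := Real.sqrt 2) (by positivity) (c₀ := 0) (c₂ := 0)
    (Y := fun p => -2 * Real.exp p.1 * Real.exp (-p.2.2))
    (α := fun p => 1 * Real.exp p.1 * Real.exp (-p.2.2))
    (β := fun p => -1 * Real.exp p.1 * Real.exp (-p.2.2)) (by fun_prop) (by fun_prop) (by fun_prop)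
    (fun p => (D _ p).2.1) (fun p => (D _ p).2.1) (fun p => (D _ p).2.1)
    (fun p => ?_) (fun _ => by positivity) (fun p q h e => ?_) (fun _ _ _ => hm _) (fun p u hu => ?_)
    (fun p u hu => ?_) fun z => ?_
  · rw [(D _ p).2.2]; simp
  · rw [h] at e; simpa using e
  · rw [(D _ p).1, (D _ p).2.2, h₁' (hm _), h₁ hu, h2]
    ring
  · rw [h₂' (hm _), h₁ hu, h₂ hu, (D _ p).1, (D _ p).2.2, (D _ p).1, (D _ p).2.2, h2]
    ring
  · refine Prod.ext (Prod.ext ?_ (Prod.ext ?_ ?_)) ?_ <;> simp [ofCoords, sub_eq_add_neg, Real.exp_add]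
    ring

end

/-! ### Reduction to canonical equations -/

/-- The equation reduces to a canonical one by a transformation from `G^equiv` and, if necessary, an
additional equivalence transformation. -/
def Equation.Reducible (E : Equation) : Prop :=
  ∃ (g : EquivTransf) (E₁ : Equation), g.Takes E E₁ ∧
    ((∃ i S, Canonical i E₁ S) ∨ ∃ (Ψ : Total → Total) (E₂ : Equation),
      Additional Ψ E₁ E₂ ∧ Transforms Ψ univ E₁ E₂ ∧ ∃ i S, Canonical i E₂ S)

theorem Equation.Reducible.of_push {E : Equation} (g : EquivTransf) (h : (E.push g).Reducible) :
    E.Reducible := by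
  obtain ⟨g', E₁, h1, h2⟩ := h
  exact ⟨_, E₁, (g.takes_push E).comp h1, h2⟩

theorem Equation.Reducible.of_takes {E E' : Equation} {g : EquivTransf} (hg : g.Takes E E')
    (h : E'.Reducible) : E.Reducible := by
  obtain ⟨g', E₁, h1, h2⟩ := h
  exact ⟨_, E₁, hg.comp h1, h2⟩

theorem Canonical.reducible {E : Equation} {i : ℕ} {S : Set (Total → Total)} (h : Canonical i E S) :
    E.Reducible :=
  ⟨_, E, EquivTransf.takes_one E, Or.inl ⟨i, S, h⟩⟩

theorem Additional.reducible {E E' : Equation} {Ψ : Total → Total} (h : Additional Ψ E E')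
    (hΨ : Transforms Ψ univ E E') {i : ℕ} {S : Set (Total → Total)} (hc : Canonical i E' S) :
    E.Reducible :=
  ⟨_, E, EquivTransf.takes_one E, Or.inr ⟨Ψ, E', h, hΨ, i, S, hc⟩⟩

theorem Equation.eqOn_push_f₁ {E : Equation} {g : EquivTransf} {F : ℝ → ℝ}
    (h : ∀ u ∈ E.dom, g.a₄ / g.a₁ ^ 2 * E.f₁ u + g.a₅ / g.a₁ ^ 2 = F (g.a₇ * u + g.a₈)) :
    EqOn (E.push g).f₁ F (E.push g).dom := by
  rintro _ ⟨u, hu, rfl⟩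
  rw [← h u hu]
  exact ((g.takes_push E).2 u hu).1

theorem Equation.eqOn_push_f₂ {E : Equation} {g : EquivTransf} {F : ℝ → ℝ}
    (h : ∀ u ∈ E.dom, g.a₇ / g.a₁ ^ 2 * E.f₂ u = F (g.a₇ * u + g.a₈)) :
    EqOn (E.push g).f₂ F (E.push g).dom := by
  rintro _ ⟨u, hu, rfl⟩
  rw [← h u hu]
  exact ((g.takes_push E).2 u hu).2

theorem exists_sign_mul_pos {b : ℝ} (hb : b ≠ 0) : ∃ ε k, IsSign ε ∧ 0 < k ∧ b = ε * k := by
  rcases lt_or_gt_of_ne hb with h | h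
  · exact ⟨-1, -b, Or.inr rfl, by linarith, by ring⟩
  · exact ⟨1, b, Or.inl rfl, h, by ring⟩

/-- The group rescales t by a square, so a coefficient of f₂ can be normalised in modulus by this
scaling, and its sign remains. -/
theorem exists_sign_mul_sq {C : ℝ} (hC : C ≠ 0) : ∃ δ r, IsSign δ ∧ 0 < r ∧ C = δ * r ^ 2 := by
  obtain ⟨ε, k, hε, hk, h⟩ := exists_sign_mul_pos hC
  exact ⟨ε, Real.sqrt k, hε, Real.sqrt_pos.2 hk, by rw [Real.sq_sqrt hk.le]; exact h⟩

theorem IsSign.isSignOrZero {ε : ℝ} (h : IsSign ε) : IsSignOrZero ε :=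
  h.elim Or.inl fun h => Or.inr (Or.inl h)

theorem exists_signOrZero_mul_sq (C : ℝ) :
    ∃ δ r, (IsSign δ ∨ δ = 0) ∧ IsSignOrZero δ ∧ 0 < r ∧ C = δ * r ^ 2 := by
  by_cases hC : C = 0
  · exact ⟨0, 1, Or.inr rfl, Or.inr (Or.inr rfl), one_pos, by simp [hC]⟩
  · obtain ⟨δ, r, hδ, hr, e⟩ := exists_sign_mul_sq hC
    exact ⟨δ, r, Or.inl hδ, hδ.isSignOrZero, hr, e⟩

/-! ### Normalisation for f₁ = e^u -/

section Reduction

variable {E : Equation}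

theorem reducible_exp_exp (h₁ : EqOn E.f₁ Real.exp E.dom) {m K : ℝ} (hm₀ : m ≠ 0) (hm₁ : m ≠ 1)
    (hK : K ≠ 0) (h₂ : EqOn E.f₂ (fun u => K * Real.exp (m * u)) E.dom) : E.Reducible := by
  obtain ⟨ε, r, hε, hr, rfl⟩ := exists_sign_mul_sq hK
  refine .of_push ⟨r, 0, 0, r ^ 2, 0, 0, 1, 0, hr.ne', by positivity, one_ne_zero⟩
    (Canonical.row2 m ε _ hm₀ hm₁ hε (Equation.eqOn_push_f₁ fun u hu => ?_)
      (Equation.eqOn_push_f₂ fun u hu => ?_)).reducible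
  · rw [h₁ hu]; simp only [one_mul, add_zero, zero_div]; field_simp
  · rw [h₂ hu]; simp only [one_mul, add_zero]; field_simp

/-- The equation `(e^u, δ)` with `u` unrestricted. -/
noncomputable def expEquation (δ : ℝ) : Equation where
  dom := univ
  f₁ := Real.exp
  f₂ _ := δ
  isOpen_dom := isOpen_univ
  ordConnected_dom := ordConnected_univ
  nonempty_dom := univ_nonempty
  smooth_f₁ := Real.contDiff_exp.contDiffOn
  smooth_f₂ := contDiffOn_const
  nonconst_f₁ := ⟨0, trivial, 1, trivial, Real.exp_injective.ne zero_ne_one⟩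

theorem reducible_exp_const (h₁ : EqOn E.f₁ Real.exp E.dom) {δ : ℝ} (hδ : IsSign δ ∨ δ = 0)
    (h₂ : EqOn E.f₂ (fun _ => δ) E.dom) : ∃ i S, Canonical i E S := by
  rcases hδ with hδ | rfl
  · exact ⟨_, _, .row3 δ E hδ h₁ h₂⟩
  · exact ⟨_, _, .row4 E h₁ h₂⟩

/-- The constant C is normalised to δ by scaling t. The coefficient of e^u is then either already 0
or is brought to ±1 and removed by the first additional transformation. -/
theorem reducible_exp_add_const (h₁ : EqOn E.f₁ Real.exp E.dom) {b C : ℝ}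
    (h₂ : EqOn E.f₂ (fun u => b * Real.exp u + C) E.dom) : E.Reducible := by
  obtain ⟨δ, r, hδ', hδ, hr, rfl⟩ := exists_signOrZero_mul_sq C
  by_cases hb : b = 0
  · subst hb
    refine .of_push ⟨r, 0, 0, r ^ 2, 0, 0, 1, 0, hr.ne', by positivity, one_ne_zero⟩ ?_
    obtain ⟨i, S, h⟩ := reducible_exp_const (E := E.push ⟨r, 0, 0, r ^ 2, 0, 0, 1, 0, hr.ne',
      by positivity, one_ne_zero⟩) (Equation.eqOn_push_f₁ fun u hu => by
        rw [h₁ hu]; simp only [one_mul, add_zero, zero_div]; field_simp) hδ' (Equation.eqOn_push_f₂ fun u hu => by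
        rw [h₂ hu]; simp only [zero_mul, zero_add]; field_simp)
    exact h.reducible
  · obtain ⟨ε, k, hε, hk, rfl⟩ := exists_sign_mul_pos hb
    have hs : Real.exp (Real.log (k / r ^ 2)) = k / r ^ 2 := Real.exp_log (by positivity)
    -- Translating u by ln(k/r²) multiplies e^u by k/r². This turns the coefficient εk/r² into ε,
    -- and scaling y by k restores f₁ = e^u.
    set g : EquivTransf := ⟨r, 0, 0, k, 0, 0, 1, Real.log (k / r ^ 2), hr.ne', hk.ne',
      one_ne_zero⟩ with hgdef
    have k₁ : EqOn (E.push g).f₁ Real.exp (E.push g).dom := Equation.eqOn_push_f₁ fun u hu => by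
      rw [h₁ hu]; simp only [hgdef]; rw [one_mul, Real.exp_add, hs]; field_simp; simp
    have k₂ : EqOn (E.push g).f₂ (fun u => ε * Real.exp u + δ) (E.push g).dom :=
      Equation.eqOn_push_f₂ fun u hu => by
        rw [h₂ hu]; simp only [hgdef]; rw [one_mul, Real.exp_add, hs]; field_simp
    obtain ⟨i, S, hc⟩ := reducible_exp_const (E := expEquation δ) (fun _ _ => rfl) hδ' fun _ _ => rfl
    exact .of_push g ((Additional.exp ε δ _ (expEquation δ) hε hδ k₁ k₂ (fun _ _ => rfl)
      fun _ _ => rfl).reducible (transforms_exp hε rfl k₁ k₂ (fun _ _ => rfl) fun _ _ => rfl) hc)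

end Reduction

/-! ### Normalisation for f₁ = ln u, u^m and u -/

section Reduction

variable {E : Equation}

/-- The equation `(ln u, 0)` on the positive half-line. -/
noncomputable def logEquation : Equation where
  dom := Ioi 0
  f₁ := Real.log
  f₂ _ := 0
  isOpen_dom := isOpen_Ioi
  ordConnected_dom := ordConnected_Ioi
  nonempty_dom := ⟨1, mem_Ioi.2 one_pos⟩
  smooth_f₁ := fun u hu => (Real.contDiffAt_log.2 (ne_of_gt hu)).contDiffWithinAt
  smooth_f₂ := contDiffOn_const
  nonconst_f₁ := ⟨1, mem_Ioi.2 one_pos, Real.exp 1, Real.exp_pos 1, by simp⟩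

theorem reducible_log_pow (hd : E.dom ⊆ Ioi 0) (h₁ : EqOn E.f₁ Real.log E.dom) {m K : ℝ}
    (hm₁ : m ≠ 1) (hK : K ≠ 0) (h₂ : EqOn E.f₂ (fun u => K * u ^ m) E.dom) : E.Reducible := by
  obtain ⟨ε, r, hε, hr, rfl⟩ := exists_sign_mul_sq hK
  refine .of_push ⟨r, 0, 0, r ^ 2, 0, 0, 1, 0, hr.ne', by positivity, one_ne_zero⟩
    (Canonical.row5 m ε _ hm₁ hε ?_ (Equation.eqOn_push_f₁ fun u hu => ?_)
      (Equation.eqOn_push_f₂ fun u hu => ?_)).reducible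
  · rintro _ ⟨u, hu, rfl⟩
    simpa using hd hu
  · rw [h₁ hu]; simp only [one_mul, add_zero, zero_div]; field_simp
  · rw [h₂ hu]; simp only [one_mul, add_zero]; field_simp

theorem reducible_log_mul_log (hd : E.dom ⊆ Ioi 0) (h₁ : EqOn E.f₁ Real.log E.dom) {b C : ℝ}
    (h₂ : EqOn E.f₂ (fun u => u * (b * Real.log u + C)) E.dom) : E.Reducible := by
  by_cases hb : b = 0
  · subst hb
    by_cases hC : C = 0
    · subst hC
      exact (Canonical.row7 E hd h₁ fun u hu => by rw [h₂ hu]; simp).reducible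
    · obtain ⟨ε, r, hε, hr, rfl⟩ := exists_sign_mul_sq hC
      set g : EquivTransf := ⟨r, 0, 0, r ^ 2, 0, 0, 1, 0, hr.ne', by positivity, one_ne_zero⟩
      have k₀ : (E.push g).dom ⊆ Ioi 0 := by
        rintro _ ⟨u, hu, rfl⟩
        simpa [g] using hd hu
      have k₁ : EqOn (E.push g).f₁ Real.log (E.push g).dom := Equation.eqOn_push_f₁ fun u hu => by
        rw [h₁ hu]; simp only [g, one_mul, add_zero, zero_div]; field_simp
      have k₂ : EqOn (E.push g).f₂ (fun u => ε * u) (E.push g).dom :=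
        Equation.eqOn_push_f₂ fun u hu => by
          rw [h₂ hu]; simp only [g, one_mul, add_zero, zero_mul, zero_add]; field_simp
      exact .of_push g ((Additional.log ε _ logEquation hε k₀ Subset.rfl k₁ k₂ (fun _ _ => rfl)
        fun _ _ => rfl).reducible (transforms_log k₀ rfl k₁ k₂ (fun _ _ => rfl) fun _ _ => rfl)
        (Canonical.row7 logEquation Subset.rfl (fun _ _ => rfl) fun _ _ => rfl))
  · obtain ⟨ε, r, hε, hr, rfl⟩ := exists_sign_mul_sq hb
    have hε0 := hε.ne_zero
    -- Scaling u by e^s adds s to ln u. This absorbs C into b ln u, and a₅ = r² s compensates the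
    -- shift in f₁.
    set s := C / (ε * r ^ 2) with hs
    have hC : C = s * (ε * r ^ 2) := by rw [hs]; field_simp
    set g : EquivTransf := ⟨r, 0, 0, r ^ 2, r ^ 2 * s, 0, Real.exp s, 0, hr.ne', by positivity,
      (Real.exp_pos s).ne'⟩
    have hlog : ∀ u ∈ E.dom, Real.log (Real.exp s * u + 0) = s + Real.log u := fun u hu => by
      rw [add_zero, Real.log_mul (Real.exp_pos s).ne' (ne_of_gt (hd hu)), Real.log_exp]
    refine .of_push g (Canonical.row6 ε _ hε ?_ (Equation.eqOn_push_f₁ fun u hu => ?_)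
      (Equation.eqOn_push_f₂ fun u hu => ?_)).reducible
    · rintro _ ⟨u, hu, rfl⟩
      have : 0 < u := hd hu
      simp only [g, mem_Ioi]; positivity
    · rw [h₁ hu]; simp only [g]; rw [hlog u hu]; field_simp; ring
    · rw [h₂ hu]; simp only [g]; rw [hlog u hu, add_zero, hC]; field_simp; ring

/-- The equation `(u^m, δ u)` on an interval where the power is defined. -/
noncomputable def powEquation (m δ : ℝ) (J : Set ℝ) (hJ : IsOpen J) (hJ' : J.OrdConnected)
    (hpos : Ioi 0 ⊆ J) (hm : m ≠ 0) (hd : PowerDomain J m) : Equation where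
  dom := J
  f₁ u := u ^ m
  f₂ u := δ * u
  isOpen_dom := hJ
  ordConnected_dom := hJ'
  nonempty_dom := ⟨1, hpos (mem_Ioi.2 one_pos)⟩
  smooth_f₁ := hd.smooth
  smooth_f₂ := by fun_prop
  nonconst_f₁ := by
    refine ⟨1, hpos (mem_Ioi.2 one_pos), 2, hpos (mem_Ioi.2 two_pos), fun h => hm ?_⟩
    simp only [Real.one_rpow] at h
    have := congrArg Real.log h
    rw [Real.log_rpow two_pos, Real.log_one] at this
    exact (mul_eq_zero.1 this.symm).resolve_right (Real.log_pos one_lt_two).ne'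

/-- A linear f₂ is the case n = 1 of the eighth form; n ≠ m + 1 holds because m ≠ 0. -/
theorem canonical_pow_mul {m δ : ℝ} (hm₀ : m ≠ 0) (hm₁ : m ≠ 1) (hd : PowerDomain E.dom m)
    (h₁ : EqOn E.f₁ (fun u => u ^ m) E.dom) (hδ : IsSign δ ∨ δ = 0)
    (h₂ : EqOn E.f₂ (fun u => δ * u) E.dom) : ∃ i S, Canonical i E S := by
  rcases hδ with hδ | rfl
  · exact ⟨_, _, .row8 m 1 δ E hm₀ hm₁ (fun e => hm₀ (by linarith)) hδ hd PowerDomain.one h₁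
      fun u hu => by rw [h₂ hu]; simp⟩
  · exact ⟨_, _, .row9 m E hm₀ hm₁ hd h₁ fun u hu => by rw [h₂ hu]; simp⟩

theorem PowerDomain.push {m : ℝ} {g : EquivTransf} (h7 : 0 < g.a₇) (h8 : g.a₈ = 0)
    (hd : PowerDomain E.dom m) : PowerDomain (E.push g).dom m := by
  rcases hd with hd | hk
  · left
    rintro _ ⟨u, hu, rfl⟩
    have : 0 < u := hd hu
    change 0 < g.a₇ * u + g.a₈
    rw [h8, add_zero]
    exact mul_pos h7 this
  · exact Or.inr hk

theorem reducible_pow_pow {m n K : ℝ} (hm₀ : m ≠ 0) (hm₁ : m ≠ 1) (hn : n ≠ m + 1)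
    (hd : PowerDomain E.dom m) (hdn : PowerDomain E.dom n)
    (h₁ : EqOn E.f₁ (fun u => u ^ m) E.dom) (hK : K ≠ 0)
    (h₂ : EqOn E.f₂ (fun u => K * u ^ n) E.dom) : E.Reducible := by
  obtain ⟨ε, r, hε, hr, rfl⟩ := exists_sign_mul_sq hK
  refine .of_push ⟨r, 0, 0, r ^ 2, 0, 0, 1, 0, hr.ne', by positivity, one_ne_zero⟩
    (Canonical.row8 m n ε _ hm₀ hm₁ hn hε (hd.push one_pos rfl) (hdn.push one_pos rfl)
      (Equation.eqOn_push_f₁ fun u hu => ?_) (Equation.eqOn_push_f₂ fun u hu => ?_)).reducible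
  · rw [h₁ hu]; simp only [one_mul, add_zero, zero_div]; field_simp
  · rw [h₂ hu]; simp only [one_mul, add_zero]; field_simp

theorem reducible_pow_add_mul {m b C : ℝ} (hm₀ : m ≠ 0) (hm₁ : m ≠ 1)
    (hd : PowerDomain E.dom m) (h₁ : EqOn E.f₁ (fun u => u ^ m) E.dom)
    (h₂ : EqOn E.f₂ (fun u => b * u ^ (m + 1) + C * u) E.dom) : E.Reducible := by
  obtain ⟨δ, r, hδ', hδ, hr, rfl⟩ := exists_signOrZero_mul_sq C
  by_cases hb : b = 0
  · subst hb
    set g : EquivTransf := ⟨r, 0, 0, r ^ 2, 0, 0, 1, 0, hr.ne', by positivity, one_ne_zero⟩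
    obtain ⟨i, S, h⟩ := canonical_pow_mul (E := E.push g) hm₀ hm₁ (hd.push one_pos rfl)
      (Equation.eqOn_push_f₁ fun u hu => by
        rw [h₁ hu]; simp only [g, one_mul, add_zero, zero_div]; field_simp) hδ'
      (Equation.eqOn_push_f₂ fun u hu => by
        rw [h₂ hu]; simp only [g, zero_mul, zero_add, one_mul, add_zero]; field_simp)
    exact .of_push g h.reducible
  · obtain ⟨ε, k, hε, hk, rfl⟩ := exists_sign_mul_pos hb
    -- Scaling u by `a` multiplies u^m by k/r², which normalises the coefficient of u^(m + 1), while
    -- scaling y by k keeps f₁.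
    set a := (k / r ^ 2) ^ (1 / m) with ha
    have ha0 : 0 < a := by positivity
    have ham : a ^ m = k / r ^ 2 := by
      rw [ha, ← Real.rpow_mul (by positivity), one_div_mul_cancel hm₀, Real.rpow_one]
    set g : EquivTransf := ⟨r, 0, 0, k, 0, 0, a, 0, hr.ne', hk.ne', ha0.ne'⟩
    have k₀ : PowerDomain (E.push g).dom m := hd.push ha0 rfl
    have k₁ : EqOn (E.push g).f₁ (fun u => u ^ m) (E.push g).dom :=
      Equation.eqOn_push_f₁ fun u hu => by
        rw [h₁ hu]; simp only [g, add_zero, zero_div]; rw [hd.mul_rpow ha0 hu, ham]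
    have k₂ : EqOn (E.push g).f₂ (fun u => ε * u ^ (m + 1) + δ * u) (E.push g).dom :=
      Equation.eqOn_push_f₂ fun u hu => by
        rw [h₂ hu]; simp only [g, add_zero]
        rw [hd.add_one.mul_rpow ha0 hu, Real.rpow_add_one ha0.ne', ham]; field_simp
    -- The target interval has to be stable under positive scaling: the half-line for positive u,
    -- the whole line for natural m.
    obtain ⟨J, hJ, hJ', hpos, hJd, hmem⟩ : ∃ J : Set ℝ, ∃ _ : IsOpen J, ∃ _ : J.OrdConnected,
        ∃ _ : Ioi 0 ⊆ J, ∃ _ : PowerDomain J m, ∀ a > 0, ∀ u ∈ (E.push g).dom, a * u ∈ J := by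
      rcases k₀ with h | h
      · exact ⟨Ioi 0, isOpen_Ioi, ordConnected_Ioi, Subset.rfl, Or.inl Subset.rfl,
          fun a ha u hu => mul_pos ha (h hu)⟩
      · exact ⟨univ, isOpen_univ, ordConnected_univ, subset_univ _, Or.inr h, fun _ _ _ _ => trivial⟩
    obtain ⟨i, S, hc⟩ := canonical_pow_mul (E := powEquation m δ J hJ hJ' hpos hm₀ hJd) hm₀ hm₁ hJd
      (fun _ _ => rfl) hδ' fun _ _ => rfl
    exact .of_push g ((Additional.pow m ε δ _ (powEquation m δ J hJ hJ' hpos hm₀ hJd) hm₀ hm₁ hε hδ k₀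
      hJd k₁ k₂ (fun _ _ => rfl) fun _ _ => rfl).reducible
      (transforms_pow hm₀ hε k₀ hmem k₁ k₂ (fun _ _ => rfl) fun _ _ => rfl) hc)

/-- The equation `(u, a u)` with `u` unrestricted. -/
noncomputable def idEquation (a : ℝ) : Equation where
  dom := univ
  f₁ u := u
  f₂ u := a * u
  isOpen_dom := isOpen_univ
  ordConnected_dom := ordConnected_univ
  nonempty_dom := univ_nonempty
  smooth_f₁ := contDiffOn_id
  smooth_f₂ := by fun_prop
  nonconst_f₁ := ⟨0, trivial, 1, trivial, zero_ne_one⟩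

/-- The transformation with prescribed action on `t` and `u` that preserves `f₁ = u`. -/
def EquivTransf.ofId (a₁ a₇ a₈ : ℝ) (h₁ : a₁ ≠ 0) (h₇ : a₇ ≠ 0) : EquivTransf :=
  ⟨a₁, 0, 0, a₁ ^ 2 * a₇, a₁ ^ 2 * a₈, 0, a₇, a₈, h₁, mul_ne_zero (pow_ne_zero 2 h₁) h₇, h₇⟩

theorem eqOn_push_ofId (h : EqOn E.f₁ (fun u => u) E.dom) {a₁ a₇ a₈ : ℝ} (h₁ : a₁ ≠ 0) (h₇ : a₇ ≠ 0) :
    EqOn (E.push (.ofId a₁ a₇ a₈ h₁ h₇)).f₁ (fun u => u) (E.push (.ofId a₁ a₇ a₈ h₁ h₇)).dom :=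
  Equation.eqOn_push_f₁ fun u hu => by
    rw [h hu]; simp only [EquivTransf.ofId]; field_simp

/-- For A ≠ 0 the square is completed, A(u + h)² + D, and the sign of AD decides: 0 leads to u²,
positive to u² + 1, negative to u² - 1, hence to a linear f₂ by the sixth additional transformation.
For A = 0 and B ≠ 0 the constant is absorbed by shifting u by C/B; for A = B = 0 a nonzero constant
is removed by the fourth. -/
theorem reducible_id_quadratic (h₁ : EqOn E.f₁ (fun u => u) E.dom) {A B C : ℝ}
    (h₂ : EqOn E.f₂ (fun u => A * u ^ 2 + B * u + C) E.dom) : E.Reducible := by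
  by_cases hA : A = 0
  · subst hA
    by_cases hB : B = 0
    · subst hB
      by_cases hC : C = 0
      · subst hC
        exact (Canonical.row14 E h₁ fun u hu => by rw [h₂ hu]; simp).reducible
      · obtain ⟨ε, r, hε, hr, rfl⟩ := exists_sign_mul_sq hC
        have k₁ := eqOn_push_ofId h₁ (a₈ := 0) hr.ne' one_ne_zero
        set g : EquivTransf := .ofId r 1 0 hr.ne' one_ne_zero with hg
        have k₂ : EqOn (E.push g).f₂ (fun _ => ε) (E.push g).dom :=
          Equation.eqOn_push_f₂ fun u hu => by
            rw [h₂ hu]; simp only [hg, EquivTransf.ofId, zero_mul, zero_add]; field_simp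
        have k₂' : EqOn (idEquation 0).f₂ (fun _ => 0) (idEquation 0).dom := fun u _ => zero_mul u
        exact .of_push g ((Additional.const ε _ (idEquation 0) hε k₁ k₂ (fun _ _ => rfl)
          k₂').reducible (transforms_const rfl k₁ k₂ (fun _ _ => rfl) k₂')
          (Canonical.row14 (idEquation 0) (fun _ _ => rfl) k₂'))
    · obtain ⟨ε, r, hε, hr, hB'⟩ := exists_sign_mul_sq hB
      refine .of_push (.ofId r 1 (C / B) hr.ne' one_ne_zero) (Canonical.row13 ε _ hε
        (eqOn_push_ofId h₁ _ _) (Equation.eqOn_push_f₂ fun u hu => ?_)).reducible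
      rw [h₂ hu]; simp only [EquivTransf.ofId, zero_mul, zero_add, one_mul]
      have : ε = B / r ^ 2 := by rw [hB']; field_simp
      rw [this]; field_simp
  · set h := B / (2 * A) with hh
    set D := C - A * h ^ 2 with hD
    have e : ∀ u, A * u ^ 2 + B * u + C = A * (u + h) ^ 2 + D := by
      intro u
      have : B = 2 * A * h := by rw [hh]; field_simp
      rw [hD, this]; ring
    have push₂ : ∀ (r δ : ℝ) (hr : 0 < r), A * D = δ * r ^ 4 →
        EqOn (E.push (.ofId r (A / r ^ 2) (A / r ^ 2 * h) hr.ne' (by positivity))).f₂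
          (fun u => u ^ 2 + δ)
          (E.push (.ofId r (A / r ^ 2) (A / r ^ 2 * h) hr.ne' (by positivity))).dom := by
      intro r δ hr hAD
      refine Equation.eqOn_push_f₂ fun u hu => ?_
      rw [h₂ hu]
      simp only [EquivTransf.ofId]
      rw [e]
      field_simp
      linear_combination hAD
    by_cases hAD : A * D = 0
    · have k₁ := eqOn_push_ofId h₁ (a₁ := 1) (a₇ := A / 1 ^ 2) (a₈ := A / 1 ^ 2 * h) one_ne_zero
        (by positivity)
      have k₂ := push₂ 1 0 one_pos (by rw [hAD]; ring)
      simp only [add_zero] at k₂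
      have k₂' : EqOn (idEquation 0).f₂ (fun _ => 0) (idEquation 0).dom := fun u _ => zero_mul u
      exact .of_push _ ((Additional.sq _ (idEquation 0) k₁ k₂ (fun _ _ => rfl)
          k₂').reducible (transforms_sq rfl k₁ k₂ (fun _ _ => rfl) k₂')
          (Canonical.row14 (idEquation 0) (fun _ _ => rfl) k₂'))
    -- The scaling factor of u is A/r², which makes the quadratic coefficient 1 and turns D into
    -- AD/r⁴; hence a fourth root is taken.
    · obtain ⟨ε, s, hε, hs, hAD'⟩ := exists_sign_mul_sq hAD
      set r := Real.sqrt s with hr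
      have hr0 : 0 < r := Real.sqrt_pos.2 hs
      have hrs : A * D = ε * r ^ 4 := by
        rw [hAD', show r ^ 4 = (r ^ 2) ^ 2 by ring, hr, Real.sq_sqrt hs.le]
      have k₁ := eqOn_push_ofId h₁ (a₁ := r) (a₇ := A / r ^ 2) (a₈ := A / r ^ 2 * h) hr0.ne'
        (by positivity)
      have k₂ := push₂ r ε hr0 hrs
      rcases hε with rfl | rfl
      · exact .of_push _ (Canonical.row12 _ k₁ k₂).reducible
      · simp only [← sub_eq_add_neg] at k₂
        have k₂' : EqOn (idEquation 1).f₂ (fun u => u) (idEquation 1).dom := fun u _ => one_mul u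
        exact .of_push _ ((Additional.sqSubOne _ (idEquation 1) k₁ k₂ (fun _ _ => rfl)
          k₂').reducible (transforms_sqSubOne rfl k₁ k₂ (fun _ _ => rfl) k₂')
          (Canonical.row13 1 (idEquation 1) (Or.inl rfl) (fun _ _ => rfl) fun _ _ => rfl))

/-- Scaling u by k makes the exponent u and multiplies f₂ by k, so the sign that remains is that of
kK. -/
theorem reducible_id_exp (h₁ : EqOn E.f₁ (fun u => u) E.dom) {k K : ℝ}
    (h₂ : EqOn E.f₂ (fun u => K * Real.exp (k * u)) E.dom) : E.Reducible := by
  by_cases hk : k = 0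
  · subst hk
    exact reducible_id_quadratic h₁ (A := 0) (B := 0) (C := K) fun u hu => by rw [h₂ hu]; simp
  by_cases hK : K = 0
  · subst hK
    exact reducible_id_quadratic h₁ (A := 0) (B := 0) (C := 0) fun u hu => by rw [h₂ hu]; simp
  obtain ⟨ε, r, hε, hr, e⟩ := exists_sign_mul_sq (mul_ne_zero hk hK)
  refine .of_push (.ofId r k 0 hr.ne' hk) (Canonical.row10 ε _ hε
    (eqOn_push_ofId h₁ _ _) (Equation.eqOn_push_f₂ fun u hu => ?_)).reducible
  rw [h₂ hu]; simp only [EquivTransf.ofId, add_zero]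
  field_simp
  linear_combination e

theorem reducible_id_pow (h₁ : EqOn E.f₁ (fun u => u) E.dom) {m K : ℝ} (hd : PowerDomain E.dom m)
    (h₂ : EqOn E.f₂ (fun u => K * u ^ m) E.dom) : E.Reducible := by
  by_cases hm₀ : m = 0
  · subst hm₀
    exact reducible_id_quadratic h₁ (A := 0) (B := 0) (C := K) fun u hu => by rw [h₂ hu]; simp
  by_cases hm₁ : m = 1
  · subst hm₁
    exact reducible_id_quadratic h₁ (A := 0) (B := K) (C := 0) fun u hu => by rw [h₂ hu]; simp
  by_cases hm₂ : m = 2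
  · subst hm₂
    exact reducible_id_quadratic h₁ (A := K) (B := 0) (C := 0) fun u hu => by rw [h₂ hu]; simp
  by_cases hK : K = 0
  · subst hK
    exact reducible_id_quadratic h₁ (A := 0) (B := 0) (C := 0) fun u hu => by rw [h₂ hu]; simp
  obtain ⟨ε, r, hε, hr, rfl⟩ := exists_sign_mul_sq hK
  refine .of_push (.ofId r 1 0 hr.ne' one_ne_zero) (Canonical.row11 m ε _ hm₀ hm₁ hm₂ hε
    (hd.push one_pos rfl) (eqOn_push_ofId h₁ _ _) (Equation.eqOn_push_f₂ fun u hu => ?_)).reducible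
  rw [h₂ hu]; simp only [EquivTransf.ofId, one_mul, add_zero]; field_simp

end Reduction

/-! ### Functions `f₁` that satisfy a first-order equation -/

theorem EquivTransf.Takes.not_isGeneric {g : EquivTransf} {E E' : Equation} (h : g.Takes E E')
    (hE' : ¬ E'.IsGeneric) : ¬ E.IsGeneric := by
  unfold Equation.IsGeneric at *
  push Not at *
  obtain ⟨g', E'', h1, h2⟩ := hE'
  exact ⟨_, E'', h.comp h1, h2⟩

theorem Equation.not_isGeneric_of_push {E : Equation} (g : EquivTransf) (h : (E.push g).IsSpecial) :
    ¬ E.IsGeneric :=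
  fun hE => hE ⟨g, E.push g, g.takes_push E, h⟩

namespace Equation

variable {E : Equation}

theorem ne_zero_of_eqOn_mul_add {f : ℝ → ℝ} {K C : ℝ} (h : ∀ u ∈ E.dom, E.f₁ u = K * f u + C) :
    K ≠ 0 := by
  rintro rfl
  obtain ⟨a, ha, b, hb, hab⟩ := E.nonconst_f₁
  exact hab (by rw [h a ha, h b hb]; simp)

/-- Integration of u f₁' = k f₁ + l: for k ≠ 0 the function f₁ + l/k is a multiple of u^k. For k = 0
the function f₁ is a logarithm on positive u; across 0 the equation forces l = 0 and f₁ constant,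
which is excluded. -/
theorem not_isGeneric_of_mul_deriv (hpos : E.dom ⊆ Ioi 0 ∨ (0 : ℝ) ∈ E.dom) {k l : ℝ}
    (h : ∀ u ∈ E.dom, u * deriv E.f₁ u = k * E.f₁ u + l) : ¬ E.IsGeneric := by
  by_cases hk : k = 0
  · subst hk
    rcases hpos with hpos | h0
    · obtain ⟨C, hC⟩ := exists_eq_of_deriv_eq_zero E.isOpen_dom E.ordConnected_dom
        (f := fun u => E.f₁ u - l * Real.log u) fun u hu => by
          have hu0 : u ≠ 0 := ne_of_gt (hpos hu)
          refine ((E.differentiableAt_f₁ hu).hasDerivAt.sub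
            ((Real.hasDerivAt_log hu0).const_mul l)).congr_deriv ?_
          have := h u hu
          field_simp
          linarith
      have hC' : ∀ u ∈ E.dom, E.f₁ u = l * Real.log u + C := fun u hu => by linarith [hC u hu]
      have hl := ne_zero_of_eqOn_mul_add hC'
      refine not_isGeneric_of_push ⟨1, 0, 0, 1 / l, -C / l, 0, 1, 0, one_ne_zero,
        one_div_ne_zero hl, one_ne_zero⟩ (Or.inr (Or.inl ⟨?_, eqOn_push_f₁ fun u hu => ?_⟩))
      · rintro _ ⟨u, hu, rfl⟩
        simpa using hpos hu
      · rw [hC' u hu]; simp only [one_mul, add_zero]; field_simp; ring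
    · exfalso
      have hl : l = 0 := by simpa using (h 0 h0).symm
      obtain ⟨C, hC, -⟩ := exists_eq_rpow E.isOpen_dom E.ordConnected_dom (Or.inr h0) E.smooth_f₁
        (a := 0) fun u hu => by rw [h u hu, hl, add_zero]
      obtain ⟨a, ha, b, hb, hab⟩ := E.nonconst_f₁
      exact hab (by rw [hC a ha, hC b hb]; simp)
  · obtain ⟨C, hC, hd⟩ := exists_eq_rpow E.isOpen_dom E.ordConnected_dom hpos
      (E.smooth_f₁.add (contDiffOn_const (c := l / k))) (a := k) fun u hu => by
        change u * deriv (fun u => E.f₁ u + l / k) u = k * (E.f₁ u + l / k)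
        rw [deriv_add_const, h u hu]; field_simp
    have hC' : ∀ u ∈ E.dom, E.f₁ u = C * u ^ k + -(l / k) := fun u hu => by
      have := hC u hu
      linarith
    have hC0 := ne_zero_of_eqOn_mul_add hC'
    refine not_isGeneric_of_push ⟨1, 0, 0, 1 / C, l / k / C, 0, 1, 0, one_ne_zero,
      one_div_ne_zero hC0, one_ne_zero⟩ (Or.inr (Or.inr ⟨k, hk, (hd.resolve_left hC0).push one_pos rfl,
        eqOn_push_f₁ fun u hu => ?_⟩))
    rw [hC' u hu]; simp only [one_mul, add_zero]; field_simp; ring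

/-- The solutions are affine functions for k = 0, equivalent to the power u¹, and otherwise an
exponential plus a constant. -/
theorem not_isGeneric_of_deriv {k l : ℝ}
    (h : ∀ u ∈ E.dom, deriv E.f₁ u = k * E.f₁ u + l) : ¬ E.IsGeneric := by
  by_cases hk : k = 0
  · subst hk
    obtain ⟨C, hC⟩ := exists_eq_of_deriv_eq_zero E.isOpen_dom E.ordConnected_dom
      (f := fun u => E.f₁ u - l * u) fun u hu => by
        refine ((E.differentiableAt_f₁ hu).hasDerivAt.sub
          ((hasDerivAt_id u).const_mul l)).congr_deriv ?_
        rw [h u hu]; ring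
    have hC' : ∀ u ∈ E.dom, E.f₁ u = l * id u + C := fun u hu => by
      have := hC u hu
      simp only [id]; linarith
    have hl := ne_zero_of_eqOn_mul_add hC'
    refine not_isGeneric_of_push ⟨1, 0, 0, 1 / l, -C / l, 0, 1, 0, one_ne_zero,
      one_div_ne_zero hl, one_ne_zero⟩ (Or.inr (Or.inr ⟨1, one_ne_zero, PowerDomain.one,
        eqOn_push_f₁ fun u hu => ?_⟩))
    rw [hC' u hu]; simp only [one_mul, add_zero, id, Real.rpow_one]; field_simp; ring
  · obtain ⟨C, hC⟩ := exists_eq_exp E.isOpen_dom E.ordConnected_dom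
      (f := fun u => E.f₁ u + l / k) (k := k) fun u hu => by
        refine ((E.differentiableAt_f₁ hu).hasDerivAt.add_const (l / k)).congr_deriv ?_
        rw [h u hu]; field_simp
    have hC' : ∀ u ∈ E.dom, E.f₁ u = C * Real.exp (k * u) + -(l / k) := fun u hu => by
      linarith [hC u hu]
    have hC0 := ne_zero_of_eqOn_mul_add (f := fun u => Real.exp (k * u)) hC'
    refine not_isGeneric_of_push ⟨1, 0, 0, 1 / C, l / k / C, 0, k, 0, one_ne_zero,
      one_div_ne_zero hC0, hk⟩ (Or.inl (eqOn_push_f₁ fun u hu => ?_))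
    rw [hC' u hu]; simp only [add_zero]; field_simp; ring

/-- The translation, followed by a reflection if `σ = -1`. -/
def _root_.Kolmogorov.EquivTransf.shift (σ s : ℝ) (hσ : IsSign σ) : EquivTransf :=
  ⟨1, 0, 0, 1, 0, 0, σ, σ * s, one_ne_zero, one_ne_zero, hσ.ne_zero⟩

/-- After the translation the interval is positive, contains 0, or is negative; in the last case a
reflection makes it positive. -/
theorem exists_shift (E : Equation) (s : ℝ) : ∃ σ, ∃ hσ : IsSign σ,
    (E.push (.shift σ s hσ)).dom ⊆ Ioi 0 ∨ (0 : ℝ) ∈ (E.push (.shift σ s hσ)).dom := by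
  have h1 : IsSign 1 := Or.inl rfl
  rcases subset_pos_or_neg_or_zero_mem (E.push (.shift 1 s h1)).ordConnected_dom with h | h | h
  · exact ⟨1, h1, Or.inl h⟩
  · refine ⟨-1, Or.inr rfl, Or.inl ?_⟩
    rintro _ ⟨u, hu, rfl⟩
    have : 1 * u + 1 * s < 0 := h ⟨u, hu, rfl⟩
    change 0 < -1 * u + -1 * s
    linarith
  · exact ⟨1, h1, Or.inr h⟩

/-- For γ ≠ 0 the zero of γu + δ is moved to the origin, and the relation becomes Euler's equation;
for γ = 0 it has constant coefficients. -/
theorem not_isGeneric_of_relation {γ δ a b : ℝ} (hγδ : ¬ (γ = 0 ∧ δ = 0))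
    (h : ∀ u ∈ E.dom, a * E.f₁ u + b + (γ * u + δ) * deriv E.f₁ u = 0) : ¬ E.IsGeneric := by
  by_cases hγ : γ = 0
  · subst hγ
    have hδ : δ ≠ 0 := fun e => hγδ ⟨rfl, e⟩
    refine not_isGeneric_of_deriv (k := -a / δ) (l := -b / δ) fun u hu => ?_
    have := h u hu
    field_simp
    linarith
  · obtain ⟨σ, hσ, hd⟩ := E.exists_shift (δ / γ)
    have hσ' := hσ.mul_self
    set g : EquivTransf := .shift σ (δ / γ) hσ with hg
    refine (g.takes_push E).not_isGeneric (not_isGeneric_of_mul_deriv hd (k := -a / γ) (l := -b / γ) ?_)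
    rintro _ ⟨u, hu, rfl⟩
    have e1 := (g.takes_push E).deriv_f₁ u hu
    have e2 := ((g.takes_push E).2 u hu).1
    have e3 := h u hu
    simp only [hg, EquivTransf.shift] at e1 e2 ⊢
    rw [e2]
    have e4 : (u + δ / γ) * deriv E.f₁ u = -a / γ * E.f₁ u + -b / γ := by
      field_simp
      linarith
    linear_combination (u + δ / γ) * e1 + e4

end Equation

/-- A nonzero (α, β) at one point would make (A) a first-order relation for f₁ of the kind that only
special functions satisfy. -/
theorem DeterminingSystem.of_generic {E : Equation} {B : Set Base} {c : ℝ} {ψ α β : Base → ℝ}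
    (h : DeterminingSystem E B c ψ α β) (h₁ : E.IsGeneric) :
    ∀ p ∈ B, α p = 0 ∧ β p = 0 ∧ Dt ψ p = 0 ∧ Dy ψ p = c := by
  intro p hp
  have h0 : α p = 0 ∧ β p = 0 := by
    by_contra hn
    exact Equation.not_isGeneric_of_relation hn (a := c - Dy ψ p) (b := -Dt ψ p)
      (fun u hu => by linear_combination h.eqA p hp u hu) h₁
  obtain ⟨e1, e2⟩ := E.coeff_eq_zero (A := -Dt ψ p) (B := c - Dy ψ p) fun u hu => by
    have := h.eqA p hp u hu
    rw [h0.1, h0.2] at this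
    linear_combination this
  exact ⟨h0.1, h0.2, by linarith, by linarith⟩

/-- The algebra of the equation `(f₁, 0)` with `f₁` of general form. -/
theorem algebra_generic_zero {E : Equation} {B : Set Base} (hB : IsOpen B) (hB' : IsConnected B)
    (h₁ : E.IsGeneric) (h₂ : EqOn E.f₂ (fun _ => 0) E.dom) (v : Total → Total) :
    E.IsSymmetry B v ↔ SpannedOn (kernelFields ∪ {dilation}) (B ×ˢ E.dom) v := by
  refine isSymmetry_iff_spannedOn hB hB'.isPreconnected (fun c ψ α β h => ?_) ?_ v
  · have key := h.of_generic h₁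
    obtain ⟨d, hd⟩ := h.exists_ψ_eq hB hB'.isPreconnected (l := 0) (k := c)
      (fun p hp => (key p hp).2.2.1) fun p hp => (key p hp).2.2.2
    refine ⟨_, Submodule.smul_mem _ c (Submodule.subset_span rfl), d, fun p hp u => ?_⟩
    refine Prod.ext (Prod.ext ?_ (Prod.ext ?_ ?_)) ?_ <;>
      simp [affineField, ofCoords, dilation, hd p hp, key p hp] <;> ring
  · rintro X rfl
    refine ⟨1, _, _, _, .of_affine (k := 1) (l := 0) (a := 0) (b := 0) ?_ ?_,
      funext fun z => ?_⟩
    · intro u hu; ring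
    · intro u hu; rw [h₂ hu]; ring
    · refine Prod.ext (Prod.ext ?_ (Prod.ext ?_ ?_)) ?_ <;>
        simp [affineField, ofCoords, dilation] <;> ring

/-! ### Reduction of the equations with an extended algebra -/

section Classification

variable {E : Equation}

/-- If β is constant, f₂ satisfies β f₂' = -c f₂ and is an exponential, or zero when β = 0. If β
varies, the difference of the relations at two points is free of c and gives f₂' = b e^u. -/
theorem Equation.Extended.reducible_exp (h : E.Extended) (h₁ : EqOn E.f₁ Real.exp E.dom) :
    E.Reducible := by
  obtain ⟨B, c, ψ, α, β, hB, hB', hD, hn⟩ := h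
  have key := hD.of_exp hB h₁
  by_cases hc : ∀ p ∈ B, ∀ q ∈ B, β p = β q
  · obtain ⟨p, hp⟩ := hB'.nonempty
    have hy := Dy_eq_zero_of_eqOn hB (fun q hq => hc q hq p hp) hp
    have hE : ∀ u ∈ E.dom, c * E.f₂ u + β p * deriv E.f₂ u = 0 := fun u hu => by
      have := (key p hp).2.2.2.2 u hu
      rw [hy] at this
      linarith
    by_cases hb : β p = 0
    · have hc0 : c ≠ 0 := fun e => hn ⟨e, fun q hq => ⟨(key q hq).1, (hc q hq p hp).trans hb⟩⟩
      refine reducible_exp_add_const h₁ (b := 0) (C := 0) fun u hu => ?_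
      have := hE u hu
      rw [hb, zero_mul, add_zero] at this
      rw [(mul_eq_zero.1 this).resolve_left hc0]; simp
    · obtain ⟨K, hK⟩ := exists_eq_exp E.isOpen_dom E.ordConnected_dom (f := E.f₂) (k := -c / β p)
        fun u hu => by
          refine (E.differentiableAt_f₂ hu).hasDerivAt.congr_deriv ?_
          have := hE u hu
          field_simp
          linarith
      by_cases hK0 : K = 0
      · exact reducible_exp_add_const h₁ (b := 0) (C := 0) fun u hu => by rw [hK u hu, hK0]; simp
      by_cases hm₀ : -c / β p = 0
      · exact reducible_exp_add_const h₁ (b := 0) (C := K) fun u hu => by rw [hK u hu, hm₀]; simp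
      by_cases hm₁ : -c / β p = 1
      · exact reducible_exp_add_const h₁ (b := K) (C := 0) fun u hu => by rw [hK u hu, hm₁]; simp
      exact reducible_exp_exp h₁ hm₀ hm₁ hK0 hK
  · push Not at hc
    obtain ⟨p, hp, q, hq, hpq⟩ := hc
    have hpq' : β p - β q ≠ 0 := sub_ne_zero.2 hpq
    set b := (Dy β p - Dy β q) / (β p - β q) with hb
    obtain ⟨C, hC⟩ := exists_eq_of_deriv_eq_zero E.isOpen_dom E.ordConnected_dom
      (f := fun u => E.f₂ u - b * Real.exp u) fun u hu => by
        refine ((E.differentiableAt_f₂ hu).hasDerivAt.sub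
          ((Real.hasDerivAt_exp u).const_mul b)).congr_deriv ?_
        have e1 := (key p hp).2.2.2.2 u hu
        have e2 := (key q hq).2.2.2.2 u hu
        rw [hb]
        field_simp
        linear_combination e2 - e1
    exact reducible_exp_add_const h₁ (b := b) (C := C) fun u hu => by linarith [hC u hu]

/-- For constant α the relation makes f₂ a power, or zero when α = 0. For varying α the difference
of two relations is u f₂' = f₂ + bu, so (f₂/u)' = b/u. -/
theorem Equation.Extended.reducible_log (h : E.Extended) (hd : E.dom ⊆ Ioi 0)
    (h₁ : EqOn E.f₁ Real.log E.dom) : E.Reducible := by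
  obtain ⟨B, c, ψ, α, β, hB, hB', hD, hn⟩ := h
  have key := hD.of_log hB hd h₁
  by_cases hc : ∀ p ∈ B, ∀ q ∈ B, α p = α q
  · obtain ⟨p, hp⟩ := hB'.nonempty
    have ht := Dt_eq_zero_of_eqOn hB (fun q hq => hc q hq p hp) hp
    have hE : ∀ u ∈ E.dom, (α p - c) * E.f₂ u - α p * (u * deriv E.f₂ u) = 0 := fun u hu => by
      have := (key p hp).2.2.2.2 u hu
      rw [ht] at this
      linarith
    by_cases hb : α p = 0
    · have hc0 : c ≠ 0 := fun e => hn ⟨e, fun q hq => ⟨(hc q hq p hp).trans hb, (key q hq).1⟩⟩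
      refine reducible_log_mul_log hd h₁ (b := 0) (C := 0) fun u hu => ?_
      have := hE u hu
      rw [hb] at this
      simp [hc0] at this
      rw [this]; simp
    · obtain ⟨K, hK⟩ := exists_eq_rpow_of_pos E.isOpen_dom E.ordConnected_dom hd (f := E.f₂)
        (a := (α p - c) / α p) E.smooth_f₂ fun u hu => by
          have := hE u hu
          field_simp
          linarith
      by_cases hK0 : K = 0
      · exact reducible_log_mul_log hd h₁ (b := 0) (C := 0) fun u hu => by rw [hK u hu, hK0]; simp
      by_cases hm₁ : (α p - c) / α p = 1
      · exact reducible_log_mul_log hd h₁ (b := 0) (C := K) fun u hu => by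
          rw [hK u hu, hm₁]; simp [mul_comm]
      exact reducible_log_pow hd h₁ hm₁ hK0 hK
  · push Not at hc
    obtain ⟨p, hp, q, hq, hpq⟩ := hc
    have hpq' : α p - α q ≠ 0 := sub_ne_zero.2 hpq
    set b := (Dt α p - Dt α q) / (α p - α q) with hb
    have hE : ∀ u ∈ E.dom, u * deriv E.f₂ u = E.f₂ u + b * u := by
      intro u hu
      have e1 := (key p hp).2.2.2.2 u hu
      have e2 := (key q hq).2.2.2.2 u hu
      rw [hb]
      field_simp
      linear_combination e2 - e1
    obtain ⟨C, hC⟩ := exists_eq_of_deriv_eq_zero E.isOpen_dom E.ordConnected_dom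
      (f := fun u => E.f₂ u * u⁻¹ - b * Real.log u) fun u hu => by
        have hu0 : u ≠ 0 := ne_of_gt (hd hu)
        refine (((E.differentiableAt_f₂ hu).hasDerivAt.mul (hasDerivAt_inv hu0)).sub
          ((Real.hasDerivAt_log hu0).const_mul b)).congr_deriv ?_
        have := hE u hu
        field_simp
        linarith
    refine reducible_log_mul_log hd h₁ (b := b) (C := C) fun u hu => ?_
    have hu0 : u ≠ 0 := ne_of_gt (hd hu)
    have := hC u hu
    field_simp at this
    linarith

/-- For constant α the relation makes f₂ a power, or zero when α = 0. For varying α the difference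
of two relations is u f₂' = f₂ + b u^(m + 1), with particular solution (b/m) u^(m + 1) and
homogeneous solutions Cu. -/
theorem Equation.Extended.reducible_pow_of_pos (h : E.Extended) {m : ℝ} (hm₀ : m ≠ 0) (hm₁ : m ≠ 1)
    (hd : PowerDomain E.dom m) (hpos : E.dom ⊆ Ioi 0 ∨ (0 : ℝ) ∈ E.dom)
    (h₁ : EqOn E.f₁ (fun u => u ^ m) E.dom) : E.Reducible := by
  obtain ⟨B, c, ψ, α, β, hB, hB', hD, hn⟩ := h
  have key := hD.of_pow hB hm₀ hm₁ hd h₁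
  by_cases hc : ∀ p ∈ B, ∀ q ∈ B, α p = α q
  · obtain ⟨p, hp⟩ := hB'.nonempty
    have hy := Dy_eq_zero_of_eqOn hB (fun q hq => hc q hq p hp) hp
    have hE : ∀ u ∈ E.dom, (α p - c) * E.f₂ u - α p * (u * deriv E.f₂ u) = 0 := fun u hu => by
      have := (key p hp).2.2.2.2 u hu
      rw [hy] at this
      linarith
    by_cases hb : α p = 0
    · have hc0 : c ≠ 0 := fun e => hn ⟨e, fun q hq => ⟨(hc q hq p hp).trans hb, (key q hq).1⟩⟩
      refine reducible_pow_add_mul hm₀ hm₁ hd h₁ (b := 0) (C := 0) fun u hu => ?_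
      have := hE u hu
      rw [hb] at this
      simp [hc0] at this
      rw [this]; simp
    · obtain ⟨K, hK, hdn⟩ := exists_eq_rpow E.isOpen_dom E.ordConnected_dom hpos (f := E.f₂)
        (a := (α p - c) / α p) E.smooth_f₂ fun u hu => by
          have := hE u hu
          field_simp
          linarith
      by_cases hK0 : K = 0
      · exact reducible_pow_add_mul hm₀ hm₁ hd h₁ (b := 0) (C := 0) fun u hu => by
          rw [hK u hu, hK0]; simp
      by_cases hn : (α p - c) / α p = m + 1
      · exact reducible_pow_add_mul hm₀ hm₁ hd h₁ (b := K) (C := 0) fun u hu => by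
          rw [hK u hu, hn]; simp
      exact reducible_pow_pow hm₀ hm₁ hn hd (hdn.resolve_left hK0) h₁ hK0 hK
  · push Not at hc
    obtain ⟨p, hp, q, hq, hpq⟩ := hc
    have hpq' : α p - α q ≠ 0 := sub_ne_zero.2 hpq
    set b := (Dy α p - Dy α q) / (α p - α q) with hb
    have hE : ∀ u ∈ E.dom, u * deriv E.f₂ u = E.f₂ u + b * u ^ (m + 1) := by
      intro u hu
      have e1 := (key p hp).2.2.2.2 u hu
      have e2 := (key q hq).2.2.2.2 u hu
      rw [hb]
      field_simp
      linear_combination e2 - e1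
    obtain ⟨C, hC, -⟩ := exists_eq_rpow E.isOpen_dom E.ordConnected_dom hpos
      (E.smooth_f₂.sub (contDiffOn_const.mul hd.add_one.smooth)) (a := 1)
      (f := fun u => E.f₂ u - b / m * u ^ (m + 1)) fun u hu => by
        obtain ⟨d, hd', e⟩ := hd.add_one.hasDerivAt hu
        have := ((E.differentiableAt_f₂ hu).hasDerivAt.sub (hd'.const_mul (b / m))).deriv
        change u * deriv (fun u => E.f₂ u - b / m * u ^ (m + 1)) u = _ 
        erw [this]
        rw [mul_sub, hE u hu, show u * (b / m * d) = b / m * (u * d) by ring, e]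
        field_simp
        ring
    refine reducible_pow_add_mul hm₀ hm₁ hd h₁ (b := b / m) (C := C) fun u hu => ?_
    have := hC u hu
    rw [Real.rpow_one] at this
    linarith

/-- On negative u the exponent is a natural number k; the reflection of u, together with the factor
(-1)^k on y, preserves f₁ = u^k. -/
theorem Equation.Extended.reducible_pow (h : E.Extended) {m : ℝ} (hm₀ : m ≠ 0) (hm₁ : m ≠ 1)
    (hd : PowerDomain E.dom m) (h₁ : EqOn E.f₁ (fun u => u ^ m) E.dom) : E.Reducible := by
  rcases subset_pos_or_neg_or_zero_mem E.ordConnected_dom with hp | hneg | h0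
  · exact h.reducible_pow_of_pos hm₀ hm₁ hd (Or.inl hp) h₁
  · rcases hd with hp | ⟨k, rfl⟩
    · exact h.reducible_pow_of_pos hm₀ hm₁ (Or.inl hp) (Or.inl hp) h₁
    · have hk : (-1 : ℝ) ^ k ≠ 0 := pow_ne_zero k (by norm_num)
      set g : EquivTransf := ⟨1, 0, 0, (-1) ^ k, 0, 0, -1, 0, one_ne_zero, hk, by norm_num⟩ with hg
      refine .of_push g (((g.takes_push E).extended h).reducible_pow_of_pos hm₀ hm₁ (Or.inr ⟨k, rfl⟩)
        (Or.inl ?_) (eqOn_push_f₁ fun u hu => ?_))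
      · rintro _ ⟨u, hu, rfl⟩
        have : u < 0 := hneg hu
        simp only [hg, mem_Ioi]; linarith
      · rw [h₁ hu]
        simp only [hg, Real.rpow_natCast, add_zero, mul_pow]; ring
  · exact h.reducible_pow_of_pos hm₀ hm₁ hd (Or.inr h0) h₁

/-- A shift of u, with a reflection if necessary, turns this into Euler's equation, so f₂ becomes a
multiple of a power. -/
theorem reducible_id_of_mul_deriv (h₁ : EqOn E.f₁ (fun u => u) E.dom) {k s : ℝ}
    (h : ∀ u ∈ E.dom, (u + s) * deriv E.f₂ u = k * E.f₂ u) : E.Reducible := by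
  obtain ⟨σ, hσ, hpos⟩ := E.exists_shift s
  have hσ' := hσ.mul_self
  have h₁' : EqOn (E.push (.ofId 1 σ (σ * s) one_ne_zero hσ.ne_zero)).f₁ (fun u => u)
    (E.push (.ofId 1 σ (σ * s) one_ne_zero hσ.ne_zero)).dom := eqOn_push_ofId h₁ _ _
  set g : EquivTransf := .ofId 1 σ (σ * s) one_ne_zero hσ.ne_zero with hg
  obtain ⟨C, hC, hd⟩ := exists_eq_rpow (E.push g).isOpen_dom (E.push g).ordConnected_dom hpos
    (E.push g).smooth_f₂ (a := k) (by
      rintro _ ⟨u, hu, rfl⟩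
      have e1 := (g.takes_push E).deriv_f₂ u hu
      have e2 := ((g.takes_push E).2 u hu).2
      have e3 := h u hu
      simp only [hg, EquivTransf.ofId] at e1 e2 ⊢
      rw [e2]
      linear_combination (u + s) * e1 + σ * e3)
  refine .of_push g ?_
  rcases hd with rfl | hd
  · exact reducible_id_quadratic h₁' (A := 0) (B := 0) (C := 0) fun u hu => by rw [hC u hu]; simp
  · exact reducible_id_pow h₁' hd hC

/-- A smooth function with two independent relations of the form
`a u² + b u + d + (γ - c) f - (γ u + δ) f' = 0` is quadratic. -/
theorem exists_quadratic_of_relations {I : Set ℝ} (hI : IsOpen I) (hI' : I.OrdConnected)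
    (hne : I.Nonempty) {ι : Type*} {γ δ a b d : ι → ℝ} {f : ℝ → ℝ} (hf : ContDiffOn ℝ ∞ f I) {c : ℝ}
    (h : ∀ i, ∀ u ∈ I, a i * u ^ 2 + b i * u + d i + (γ i - c) * f u
      - (γ i * u + δ i) * deriv f u = 0)
    (hγ₀ : (∀ i j, γ i = γ j) → ∀ i, a i = 0 ∧ b i = 0)
    (hδ₀ : ∀ s, (∀ i, δ i = s * γ i) → ∀ i, b i = 2 * s * a i ∧ d i = s ^ 2 * a i)
    (hnc : ∃ i j, ¬ (γ i = γ j ∧ δ i = δ j)) :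
    ∃ A B C : ℝ, ∀ u ∈ I, f u = A * u ^ 2 + B * u + C := by
  have dq : ∀ (k₃ k₂ k₁ k₀ u : ℝ), HasDerivAt (fun u => k₃ * u ^ 3 + k₂ * u ^ 2 + k₁ * u + k₀)
      (3 * k₃ * u ^ 2 + 2 * k₂ * u + k₁) u := by
    intro k₃ k₂ k₁ k₀ u
    refine (((((hasDerivAt_pow 3 u).const_mul k₃).add ((hasDerivAt_pow 2 u).const_mul k₂)).add
      ((hasDerivAt_id u).const_mul k₁)).add_const k₀).congr_deriv ?_
    simp; ring
  have df : ∀ u ∈ I, HasDerivAt f (deriv f u) u := fun u hu => hasDerivAt_of_smooth hI hf hu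
  have sf := smoothOn_deriv hI hf
  have ddf : ∀ u ∈ I, HasDerivAt (deriv f) (deriv (deriv f) u) u :=
    fun u hu => hasDerivAt_of_smooth hI sf hu
  have antideriv : ∀ (g : ℝ → ℝ) (k₃ k₂ k₁ : ℝ), (∀ u ∈ I, HasDerivAt g
      (3 * k₃ * u ^ 2 + 2 * k₂ * u + k₁) u) → ∃ C, ∀ u ∈ I, g u = k₃ * u ^ 3 + k₂ * u ^ 2 + k₁ * u + C := by
    intro g k₃ k₂ k₁ hg
    obtain ⟨C, hC⟩ := exists_eq_of_deriv_eq_zero hI hI'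
      (f := fun u => g u - (k₃ * u ^ 3 + k₂ * u ^ 2 + k₁ * u + 0)) fun u hu =>
        ((hg u hu).sub (dq k₃ k₂ k₁ 0 u)).congr_deriv (sub_self _)
    exact ⟨C, fun u hu => by linarith [hC u hu]⟩
  -- With γ constant the terms with a and b are absent, and the difference of two relations makes f'
  -- constant.
  by_cases hγ : ∀ i j, γ i = γ j
  · obtain ⟨i, j, hij⟩ := hnc
    have hδ : δ i - δ j ≠ 0 := sub_ne_zero.2 fun e => hij ⟨hγ i j, e⟩
    obtain ⟨C, hC⟩ := antideriv f 0 0 ((d i - d j) / (δ i - δ j)) fun u hu => by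
      refine (df u hu).congr_deriv ?_
      have e1 := h i u hu
      have e2 := h j u hu
      rw [hγ i j, (hγ₀ hγ i).1, (hγ₀ hγ i).2] at e1
      rw [(hγ₀ hγ j).1, (hγ₀ hγ j).2] at e2
      field_simp
      linear_combination e2 - e1
    exact ⟨0, (d i - d j) / (δ i - δ j), C, fun u hu => by rw [hC u hu]; ring⟩
  push Not at hγ
  obtain ⟨i, j, hij⟩ := hγ
  have hγ' : γ i - γ j ≠ 0 := sub_ne_zero.2 hij
  -- Subtracting two relations with different γ eliminates c; this quotient is the relation that
  -- every other one is compared with.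
  obtain ⟨s, q₂, q₁, q₀, hq⟩ : ∃ s q₂ q₁ q₀ : ℝ, ∀ u ∈ I, (u + s) * deriv f u - f u
      = q₂ * u ^ 2 + q₁ * u + q₀ := by
    refine ⟨(δ i - δ j) / (γ i - γ j), (a i - a j) / (γ i - γ j), (b i - b j) / (γ i - γ j),
      (d i - d j) / (γ i - γ j), fun u hu => ?_⟩
    have e1 := h i u hu
    have e2 := h j u hu
    field_simp
    linear_combination e2 - e1
  have hq' : ∀ u ∈ I, (u + s) * deriv (deriv f) u = 2 * q₂ * u + q₁ := by
    intro u hu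
    have hd := ((((hasDerivAt_id u).add_const s).mul (ddf u hu)).sub (df u hu)).sub (dq 0 q₂ q₁ q₀ u)
    have := hasDerivAt_eq_zero_of_eqOn hI (F := fun u => (u + s) * deriv f u - f u
      - (0 * u ^ 3 + q₂ * u ^ 2 + q₁ * u + q₀)) (fun v hv => by rw [hq v hv]; ring) hu hd
    simp only [id] at this
    linear_combination this
  set k₃ : ι → ℝ := fun l => a l - γ l * q₂ with hk₃
  set k₂ : ι → ℝ := fun l => b l + s * a l - γ l * q₁ - δ l * q₂ with hk₂
  set k₁ : ι → ℝ := fun l => d l + s * b l - γ l * q₀ - δ l * q₁ with hk₁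
  set k₀ : ι → ℝ := fun l => s * d l - δ l * q₀ with hk₀
  -- Eliminating f' between the l-th relation and `hq` makes an affine multiple of f a cubic
  -- polynomial. Two differentiations then relate it to `hq'`.
  have hP : ∀ l, ∀ u ∈ I, (c * u + (c * s + δ l - γ l * s)) * f u
      = k₃ l * u ^ 3 + k₂ l * u ^ 2 + k₁ l * u + k₀ l := by
    intro l u hu
    have e1 := h l u hu
    have e2 := hq u hu
    simp only [hk₃, hk₂, hk₁, hk₀]
    linear_combination (-(u + s)) * e1 - (γ l * u + δ l) * e2
  have hP₁ : ∀ l, ∀ u ∈ I, c * f u + (c * u + (c * s + δ l - γ l * s)) * deriv f u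
      = 3 * k₃ l * u ^ 2 + 2 * k₂ l * u + k₁ l := by
    intro l u hu
    have hd := (((((hasDerivAt_id u).const_mul c).add_const (c * s + δ l - γ l * s)).mul
      (df u hu))).sub (dq (k₃ l) (k₂ l) (k₁ l) (k₀ l) u)
    have := hasDerivAt_eq_zero_of_eqOn hI (F := fun u => (c * u + (c * s + δ l - γ l * s)) * f u
      - (k₃ l * u ^ 3 + k₂ l * u ^ 2 + k₁ l * u + k₀ l)) (fun v hv => by rw [hP l v hv]; ring) hu hd
    simp only [id] at this
    linear_combination this
  have hP₂ : ∀ l, ∀ u ∈ I, 2 * c * deriv f u + (c * u + (c * s + δ l - γ l * s)) * deriv (deriv f) u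
      = 6 * k₃ l * u + 2 * k₂ l := by
    intro l u hu
    have hd := (((df u hu).const_mul c).add
      ((((hasDerivAt_id u).const_mul c).add_const (c * s + δ l - γ l * s)).mul
      (ddf u hu))).sub (dq 0 (3 * k₃ l) (2 * k₂ l) (k₁ l) u)
    have := hasDerivAt_eq_zero_of_eqOn hI (F := fun u => c * f u
      + (c * u + (c * s + δ l - γ l * s)) * deriv f u
      - (0 * u ^ 3 + 3 * k₃ l * u ^ 2 + 2 * k₂ l * u + k₁ l))
      (fun v hv => by rw [hP₁ l v hv]; ring) hu hd
    simp only [id] at this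
    linear_combination this
  by_cases hc : c = 0
  · subst hc
    -- For c = 0 the affine factor is the constant δ - sγ. If it vanishes for every index, `hP` says
    -- nothing about f itself, and the extra information in `hδ₀` is used.
    by_cases hκ : ∀ l, δ l = s * γ l
    · have hl : ∃ l, γ l ≠ 0 := by
        by_contra! hz
        exact hij (by rw [hz i, hz j])
      obtain ⟨l, hl⟩ := hl
      obtain ⟨eb, ed⟩ := hδ₀ s hκ l
      have z₂ : ∀ u ∈ I, 2 * k₂ l + 6 * k₃ l * u + 0 * u ^ 2 = 0 := fun u hu => by
        have := hP₂ l u hu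
        rw [hκ l] at this
        linear_combination -this
      obtain ⟨y₂, y₃, -⟩ := quadratic_coeff hI hne z₂
      have e₃ : q₂ = a l / γ l := by
        have : a l - γ l * q₂ = 0 := by simpa [hk₃] using y₃
        field_simp; linarith
      have e₂ : q₁ = 2 * s * (a l / γ l) := by
        have : b l + s * a l - γ l * q₁ - δ l * q₂ = 0 := by simpa [hk₂] using y₂
        rw [eb, hκ l, e₃] at this
        field_simp at this ⊢; linarith
      have hff : ∀ u ∈ I, deriv (deriv f) u = 2 * (a l / γ l) := by
        intro u hu
        have z : ∀ v ∈ I, (v + s) * (deriv (deriv f) v - 2 * (a l / γ l)) = 0 := fun v hv => by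
          have := hq' v hv
          rw [e₃, e₂] at this
          linear_combination this
        have hd := ((hasDerivAt_id u).add_const s).mul
          ((hasDerivAt_of_smooth hI (smoothOn_deriv hI sf) hu).sub_const (2 * (a l / γ l)))
        have y := hasDerivAt_eq_zero_of_eqOn hI z hu hd
        simp only [id] at y
        -- At the zero of u + s the value is obtained from the derivative of the product, elsewhere
        -- by division.
        by_cases hw : u + s = 0
        · rw [hw] at y; linarith
        · linarith [(mul_eq_zero.1 (z u hu)).resolve_left hw]
      obtain ⟨C, hC⟩ := antideriv (deriv f) 0 0 (2 * (a l / γ l)) fun u hu => by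
        refine (ddf u hu).congr_deriv ?_
        rw [hff u hu]; ring
      obtain ⟨C', hC'⟩ := antideriv f 0 (a l / γ l) C fun u hu => by
        refine (df u hu).congr_deriv ?_
        rw [hC u hu]; ring
      exact ⟨a l / γ l, C, C', fun u hu => by rw [hC' u hu]; ring⟩
    · push Not at hκ
      obtain ⟨l, hl⟩ := hκ
      have hκ' : δ l - γ l * s ≠ 0 := fun e => hl (by linarith)
      -- Now f is a constant multiple of a cubic, and its second derivative times u + s is linear by
      -- `hq'`; so the cubic coefficient is 0.
      have z : ∀ u ∈ I, (2 * s * k₂ l - (δ l - γ l * s) * q₁)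
          + (2 * k₂ l + 6 * s * k₃ l - (δ l - γ l * s) * (2 * q₂)) * u + 6 * k₃ l * u ^ 2 = 0 := by
        intro u hu
        have e1 := hP₂ l u hu
        have e2 := hq' u hu
        linear_combination (-(u + s)) * e1 + (δ l - γ l * s) * e2
      have y := (quadratic_coeff hI hne z).2.2
      refine ⟨k₂ l / (δ l - γ l * s), k₁ l / (δ l - γ l * s), k₀ l / (δ l - γ l * s), fun u hu => ?_⟩
      have := hP l u hu
      field_simp
      linear_combination this + u ^ 3 / 6 * y
  -- Multiplying `hP₂` by u + s and eliminating f'' by `hq'` and f' by `hq` leaves 2cf equal to a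
  -- quadratic polynomial with these coefficients.
  · refine ⟨(6 * k₃ i - 4 * c * q₂) / (2 * c),
      (2 * k₂ i + 6 * s * k₃ i - c * q₁ - 2 * (c * s + δ i - γ i * s) * q₂ - 2 * c * q₁) / (2 * c),
      (2 * s * k₂ i - (c * s + δ i - γ i * s) * q₁ - 2 * c * q₀) / (2 * c), fun u hu => ?_⟩
    have e1 := hP₂ i u hu
    have e2 := hq' u hu
    have e3 := hq u hu
    have e4 : 2 * c * f u = (6 * k₃ i - 4 * c * q₂) * u ^ 2
      + (2 * k₂ i + 6 * s * k₃ i - c * q₁ - 2 * (c * s + δ i - γ i * s) * q₂ - 2 * c * q₁) * u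
      + (2 * s * k₂ i - (c * s + δ i - γ i * s) * q₁ - 2 * c * q₀) := by
      linear_combination (u + s) * e1 - (c * u + (c * s + δ i - γ i * s)) * e2 - 2 * c * e3
    field_simp
    linear_combination e4

/-- For constant α, β the relation has leading coefficient αu + β and gives a shifted power, an
exponential, or zero. Otherwise f₂ is quadratic, with the points of the base serving as indices of
the relations. -/
theorem Equation.Extended.reducible_id (h : E.Extended) (h₁ : EqOn E.f₁ (fun u => u) E.dom) :
    E.Reducible := by
  obtain ⟨B, c, ψ, α, β, hB, hB', hD, hn⟩ := h
  have key := hD.of_id hB h₁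
  by_cases hc : ∀ p ∈ B, ∀ q ∈ B, α p = α q ∧ β p = β q
  · obtain ⟨p, hp⟩ := hB'.nonempty
    have hαy := Dy_eq_zero_of_eqOn hB (fun q hq => (hc q hq p hp).1) hp
    have hαt := Dt_eq_zero_of_eqOn hB (fun q hq => (hc q hq p hp).1) hp
    have hβt := Dt_eq_zero_of_eqOn hB (fun q hq => (hc q hq p hp).2) hp
    have hE : ∀ u ∈ E.dom, (α p - c) * E.f₂ u - (α p * u + β p) * deriv E.f₂ u = 0 := fun u hu => by
      have := (key p hp).2.2.2 u hu
      rw [hαy, hαt, hβt] at this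
      linarith
    by_cases ha : α p = 0
    · rw [ha] at hE
      by_cases hb : β p = 0
      · have hc0 : c ≠ 0 := fun e => hn ⟨e, fun q hq =>
          ⟨(hc q hq p hp).1.trans ha, (hc q hq p hp).2.trans hb⟩⟩
        refine reducible_id_quadratic h₁ (A := 0) (B := 0) (C := 0) fun u hu => ?_
        have := hE u hu
        rw [hb] at this
        simp [hc0] at this
        rw [this]; simp
      · obtain ⟨K, hK⟩ := exists_eq_exp E.isOpen_dom E.ordConnected_dom (f := E.f₂) (k := -c / β p)
          fun u hu => by
            refine (E.differentiableAt_f₂ hu).hasDerivAt.congr_deriv ?_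
            have := hE u hu
            field_simp
            linarith
        exact reducible_id_exp h₁ hK
    · refine reducible_id_of_mul_deriv h₁ (k := (α p - c) / α p) (s := β p / α p) fun u hu => ?_
      have := hE u hu
      field_simp
      linarith
  · push Not at hc
    obtain ⟨p, hp, q, hq, hpq⟩ := hc
    obtain ⟨A, B', C, hABC⟩ := exists_quadratic_of_relations E.isOpen_dom E.ordConnected_dom
      E.nonempty_dom (ι := B) (γ := fun p => α p) (δ := fun p => β p) (a := fun p => Dy α p)
      (b := fun p => 2 * Dt α p) (d := fun p => Dt β p) E.smooth_f₂ (c := c)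
      (fun p u hu => (key p p.2).2.2.2 u hu) (fun hγ p => by
        have e : ∀ q ∈ B, α q = α p := fun q hq => hγ ⟨q, hq⟩ p
        exact ⟨Dy_eq_zero_of_eqOn hB e p.2, by rw [Dt_eq_zero_of_eqOn hB e p.2, mul_zero]⟩)
      -- If β = sα throughout, then α_t = β_y = s α_y and β_t = s α_t = s² α_y.
      (fun s hs p => by
        have e : ∀ q ∈ B, β q = s * α q := fun q hq => hs ⟨q, hq⟩
        have ey : Dy β p = s * Dy α p := fderiv_eq_mul_of_eqOn hB hD.smooth_α e p.2 _
        have et : Dt β p = s * Dt α p := fderiv_eq_mul_of_eqOn hB hD.smooth_α e p.2 _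
        have ht := (key p p.2).2.2.1
        rw [et, ht, ey]
        exact ⟨by ring, by ring⟩)
      ⟨⟨p, hp⟩, ⟨q, hq⟩, fun h => hpq h.1 h.2⟩
    exact reducible_id_quadratic h₁ hABC

/-- For generic f₁ the extension can only come from c ≠ 0, and then (B) is c f₂ = 0. Otherwise f₁ is
first made special by an element of G^equiv, which preserves the extension. -/
theorem Equation.Extended.reducible (h : E.Extended) : E.Reducible := by
  by_cases hg : E.IsGeneric
  · obtain ⟨B, c, ψ, α, β, hB, hB', hD, hn⟩ := h
    have key := hD.of_generic hg
    refine (Canonical.row1 E hg fun u hu => ?_).reducible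
    have hc0 : c ≠ 0 := fun e => hn ⟨e, fun p hp => ⟨(key p hp).1, (key p hp).2.1⟩⟩
    obtain ⟨p, hp⟩ := hB'.nonempty
    have := hD.eqB p hp u hu
    rw [Dt_eq_zero_of_eqOn hB (fun q hq => (key q hq).1) hp,
      Dy_eq_zero_of_eqOn hB (fun q hq => (key q hq).1) hp,
      Dt_eq_zero_of_eqOn hB (fun q hq => (key q hq).2.1) hp,
      Dy_eq_zero_of_eqOn hB (fun q hq => (key q hq).2.1) hp, (key p hp).1, (key p hp).2.1] at this
    simpa [hc0] using this
  · unfold IsGeneric at hg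
    rw [not_not] at hg
    obtain ⟨g, E', hgE, hs⟩ := hg
    refine .of_takes hgE ?_
    have h' := hgE.extended h
    rcases hs with h₁ | ⟨hd, h₁⟩ | ⟨m, hm₀, hd, h₁⟩
    · exact h'.reducible_exp h₁
    · exact h'.reducible_log hd h₁
    · by_cases hm₁ : m = 1
      · subst hm₁
        exact h'.reducible_id fun u hu => by rw [h₁ hu]; simp
      · exact h'.reducible_pow hm₀ hm₁ hd h₁

end Classification

/-! ### Inequivalence of the canonical forms -/

/-- The derivative of `f₁` satisfies a linear equation of first order and vanishes at most at zero. -/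
def Equation.HasShape (E : Equation) (c d e : ℝ) : Prop :=
  (∀ u ∈ E.dom, (c * u + d) * deriv (deriv E.f₁) u = e * deriv E.f₁ u) ∧
    ∀ u ∈ E.dom, u ≠ 0 → deriv E.f₁ u ≠ 0

section Shape

variable {E : Equation}

theorem Equation.HasShape.of_mul_deriv {m l : ℝ}
    (h : ∀ u ∈ E.dom, u * deriv E.f₁ u = m * E.f₁ u + l)
    (h0 : ∀ u ∈ E.dom, u ≠ 0 → m * E.f₁ u + l ≠ 0) : E.HasShape 1 0 (m - 1) := by
  refine ⟨fun u hu => ?_, fun u hu hu0 e => h0 u hu hu0 (by rw [← h u hu, e, mul_zero])⟩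
  have h1 := hasDerivAt_of_smooth E.isOpen_dom E.smooth_f₁ hu
  have h2 := hasDerivAt_of_smooth E.isOpen_dom (smoothOn_deriv E.isOpen_dom E.smooth_f₁) hu
  have := hasDerivAt_eq_zero_of_eqOn E.isOpen_dom
    (F := fun u => u * deriv E.f₁ u - (m * E.f₁ u + l)) (fun s hs => sub_eq_zero.2 (h s hs)) hu
    (((hasDerivAt_id u).mul h2).sub ((h1.const_mul m).add_const l))
  simp only [id] at this
  linear_combination this

theorem hasShape_exp (h : EqOn E.f₁ Real.exp E.dom) : E.HasShape 0 1 1 := by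
  have h1 : EqOn (deriv E.f₁) Real.exp E.dom := fun u hu => by
    rw [E.deriv_f₁_eq h hu, Real.deriv_exp]
  refine ⟨fun u hu => ?_, fun u hu _ => by rw [h1 hu]; exact (Real.exp_pos u).ne'⟩
  rw [deriv_eq_of_eqOn E.isOpen_dom h1 hu, h1 hu, Real.deriv_exp]; ring

theorem hasShape_log (hd : E.dom ⊆ Ioi 0) (h : EqOn E.f₁ Real.log E.dom) :
    E.HasShape 1 0 (0 - 1) :=
  .of_mul_deriv (l := 1) (fun u hu => by
    rw [E.deriv_f₁_eq h hu, Real.deriv_log, mul_inv_cancel₀ (ne_of_gt (hd hu))]; ring)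
    fun u _ _ => by norm_num

theorem PowerDomain.rpow_ne_zero {I : Set ℝ} {m : ℝ} (hm : PowerDomain I m) {u : ℝ} (hu : u ∈ I)
    (hu0 : u ≠ 0) : u ^ m ≠ 0 := by
  rcases hm with hpos | ⟨k, rfl⟩
  · exact (Real.rpow_pos_of_pos (hpos hu) m).ne'
  · rw [Real.rpow_natCast]; exact pow_ne_zero k hu0

theorem hasShape_pow {m : ℝ} (hm₀ : m ≠ 0) (hd : PowerDomain E.dom m)
    (h : EqOn E.f₁ (fun u => u ^ m) E.dom) : E.HasShape 1 0 (m - 1) :=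
  .of_mul_deriv (l := 0) (fun u hu => by
    rw [E.deriv_f₁_eq h hu, hd.mul_deriv hu, h hu]; ring)
    fun u hu hu0 => by
      rw [h hu, add_zero]; exact mul_ne_zero hm₀ (hd.rpow_ne_zero hu hu0)

theorem hasShape_id (h : EqOn E.f₁ (fun u => u) E.dom) : E.HasShape 1 0 (1 - 1) :=
  hasShape_pow one_ne_zero PowerDomain.one (h.trans fun u _ => (Real.rpow_one u).symm)

end Shape

/-- The kinds of the function `f₁` in the canonical forms. -/
theorem Canonical.cases_f₁ {i : ℕ} {E : Equation} {S : Set (Total → Total)} (h : Canonical i E S) :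
    (i = 1 ∧ E.IsGeneric) ∨ (2 ≤ i ∧ i ≤ 4 ∧ EqOn E.f₁ Real.exp E.dom) ∨
      (5 ≤ i ∧ i ≤ 7 ∧ E.dom ⊆ Ioi 0 ∧ EqOn E.f₁ Real.log E.dom) ∨
      (8 ≤ i ∧ i ≤ 9 ∧ ∃ m : ℝ, m ≠ 0 ∧ m ≠ 1 ∧ PowerDomain E.dom m ∧
        EqOn E.f₁ (fun u => u ^ m) E.dom) ∨
      (10 ≤ i ∧ EqOn E.f₁ (fun u => u) E.dom) := by
  cases h <;> simp_all
  · exact ⟨_, ‹_›, ‹_›, ‹_›, ‹_›⟩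
  · exact ⟨_, ‹_›, ‹_›, ‹_›, ‹_›⟩

theorem Canonical.isSpecial {i : ℕ} {E : Equation} {S : Set (Total → Total)} (h : Canonical i E S)
    (hi : i ≠ 1) : E.IsSpecial := by
  rcases h.cases_f₁ with h | h | h | ⟨-, -, m, h0, -, h2, h3⟩ | h
  · exact absurd h.1 hi
  · exact Or.inl h.2.2
  · exact Or.inr (Or.inl h.2.2)
  · exact Or.inr (Or.inr ⟨m, h0, h2, h3⟩)
  · exact Or.inr (Or.inr ⟨1, one_ne_zero, PowerDomain.one,
      h.2.trans fun u _ => (Real.rpow_one u).symm⟩)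

theorem Equation.IsSpecial.exists_hasShape {E : Equation} (h : E.IsSpecial) :
    ∃ c d e, E.HasShape c d e := by
  rcases h with h | h | ⟨m, h0, h1, h2⟩
  · exact ⟨_, _, _, hasShape_exp h⟩
  · exact ⟨_, _, _, hasShape_log h.1 h.2⟩
  · exact ⟨_, _, _, hasShape_pow h0 h1 h2⟩

theorem Equation.IsSpecial.mono {E E' : Equation} (h : E'.IsSpecial) (hd : E.dom ⊆ E'.dom)
    (hf : EqOn E.f₁ E'.f₁ E.dom) : E.IsSpecial := by
  rcases h with h | h | ⟨m, h0, h1, h2⟩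
  · exact Or.inl (hf.trans (h.mono hd))
  · exact Or.inr (Or.inl ⟨hd.trans h.1, hf.trans (h.2.mono hd)⟩)
  · exact Or.inr (Or.inr ⟨m, h0, h1.mono hd, hf.trans (h2.mono hd)⟩)

namespace AffineLink

variable {E E' : Equation} {B : Set Base} {k : ℝ} {Y α β : Base → ℝ} {p : Base}

theorem deriv_f₁ (L : AffineLink E E' B k Y α β) (hp : p ∈ B) {u : ℝ} (hu : u ∈ E.dom) :
    k * α p * deriv E'.f₁ (α p * u + β p) = Dy Y p * deriv E.f₁ u := by
  have hl := ((E'.differentiableAt_f₁ (L.maps p hp u hu)).hasDerivAt.comp u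
    (((hasDerivAt_id u).const_mul (α p)).add_const (β p))).const_mul k
  have hr := ((E.differentiableAt_f₁ hu).hasDerivAt.const_mul (Dy Y p)).add_const (Dt Y p)
  have := hasDerivAt_eq_zero_of_eqOn E.isOpen_dom
    (F := fun u => k * E'.f₁ (α p * u + β p) - (Dy Y p * E.f₁ u + Dt Y p))
    (fun s hs => sub_eq_zero.2 (L.eqA p hp s hs)) hu (hl.sub hr)
  linear_combination this

theorem deriv_deriv_f₁ (L : AffineLink E E' B k Y α β) (hp : p ∈ B) {u : ℝ} (hu : u ∈ E.dom) :
    k * α p ^ 2 * deriv (deriv E'.f₁) (α p * u + β p) = Dy Y p * deriv (deriv E.f₁) u := by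
  have hl := ((hasDerivAt_of_smooth E'.isOpen_dom (smoothOn_deriv E'.isOpen_dom E'.smooth_f₁)
    (L.maps p hp u hu)).comp u
    (((hasDerivAt_id u).const_mul (α p)).add_const (β p))).const_mul (k * α p)
  have hr := (hasDerivAt_of_smooth E.isOpen_dom (smoothOn_deriv E.isOpen_dom E.smooth_f₁)
    hu).const_mul (Dy Y p)
  have := hasDerivAt_eq_zero_of_eqOn E.isOpen_dom
    (F := fun u => k * α p * deriv E'.f₁ (α p * u + β p) - Dy Y p * deriv E.f₁ u)
    (fun s hs => sub_eq_zero.2 (L.deriv_f₁ hp hs)) hu (hl.sub hr)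
  linear_combination this

/-- Under the affine substitution of `eqA` the ratio f₁''/f₁' = e/(cu + d) must agree on both sides.
Cross-multiplying and cancelling f₁' away from u = 0 gives an identity between affine functions of
u. -/
theorem shape (L : AffineLink E E' B k Y α β) (hp : p ∈ B) {c d e c' d' e' : ℝ}
    (h : E.HasShape c d e) (h' : E'.HasShape c' d' e') :
    α p * e' * c = e * c' * α p ∧ α p * e' * d = e * (c' * β p + d') := by
  have key := affine_eq_zero_of_mul E.isOpen_dom E.nonempty_dom (a := 1) (b := 0)
    (A := α p * e' * c - e * c' * α p) (B := α p * e' * d - e * (c' * β p + d')) one_ne_zero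
    fun u hu hu0 => by
      rw [one_mul, add_zero] at hu0
      apply mul_right_cancel₀ (mul_ne_zero (L.dy_ne p hp) (h.2 u hu hu0))
      have e1 := h.1 u hu
      have e2 := h'.1 _ (L.maps p hp u hu)
      have e3 := L.deriv_f₁ hp hu
      have e4 := L.deriv_deriv_f₁ hp hu
      linear_combination (-(c' * (α p * u + β p) + d') * Dy Y p) * -e1
        - (c * u + d) * k * α p ^ 2 * e2
        - (c * u + d) * e' * α p * e3 + (c * u + d) * (c' * (α p * u + β p) + d') * e4
  exact ⟨by linarith [key.1], by linarith [key.2]⟩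

/-- At a fixed point of the base, `eqA` is the action on f₁ of an element of G^equiv with a₁ = 1, so
f₁ is equivalent to the restriction of a special function. -/
theorem not_isGeneric (L : AffineLink E E' B k Y α β) (hp : p ∈ B) (h' : E'.IsSpecial) :
    ¬ E.IsGeneric := by
  have hk := L.pos
  refine Equation.not_isGeneric_of_push ⟨1, 0, 0, Dy Y p / k, Dt Y p / k, 0, α p, β p, one_ne_zero,
    div_ne_zero (L.dy_ne p hp) hk.ne', L.α_ne p hp⟩ (h'.mono ?_ (Equation.eqOn_push_f₁ ?_))
  · rintro _ ⟨u, hu, rfl⟩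
    exact L.maps p hp u hu
  · intro u hu
    have := L.eqA p hp u hu
    field_simp
    linear_combination -this

/-- The function `f₁` keeps its kind. -/
theorem same_kind (L : AffineLink E E' B k Y α β) (hB : B.Nonempty) {i j : ℕ}
    {S S' : Set (Total → Total)} (h : Canonical i E S) (h' : Canonical j E' S') (hij : i < j) :
    (2 ≤ i ∧ j ≤ 4 ∧ ∀ p ∈ B, α p = 1) ∨ (5 ≤ i ∧ j ≤ 7 ∧ ∀ p ∈ B, β p = 0) ∨
      (8 ≤ i ∧ j ≤ 9 ∧ ∀ p ∈ B, β p = 0) ∨ 10 ≤ i := by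
  obtain ⟨p, hp⟩ := hB
  have hα := L.α_ne p hp
  -- The logarithm has the shape of the exponent m = 0, which no power has. Equality of exponents
  -- therefore separates ln u, u^m and u, and for m ≠ 1 the singular point u = 0 must be preserved,
  -- that is, β = 0.
  have key : ∀ {m n : ℝ}, m ≠ 1 → E.HasShape 1 0 (m - 1) → E'.HasShape 1 0 (n - 1) →
      ∀ p ∈ B, β p = 0 := by
    intro m n hm h h' p hp
    have := (L.shape hp h h').2
    have e : (m - 1) * β p = 0 := by linear_combination -this
    exact (mul_eq_zero.1 e).resolve_left (sub_ne_zero.2 hm)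
  have eqm : ∀ {m n : ℝ}, E.HasShape 1 0 (m - 1) → E'.HasShape 1 0 (n - 1) → m = n := by
    intro m n h h'
    have := (L.shape hp h h').1
    apply mul_left_cancel₀ hα
    linear_combination -this
  have ne_exp : ∀ {n : ℝ}, E.HasShape 0 1 1 → E'.HasShape 1 0 (n - 1) → False := by
    intro n h h'
    have := (L.shape hp h h').1
    exact hα (by linear_combination -this)
  rcases h.cases_f₁ with ⟨rfl, hg⟩ | ⟨a, b, c⟩ | ⟨a, b, c⟩ | ⟨a, b, m, c⟩ | ⟨a, b⟩
  · exact absurd hg (L.not_isGeneric hp (h'.isSpecial (by omega)))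
  · have hs := hasShape_exp c
    rcases h'.cases_f₁ with ⟨rfl, hg⟩ | ⟨a', b', c'⟩ | ⟨a', b', c'⟩ | ⟨a', b', m', c'⟩ | ⟨a', b'⟩
    · omega
    · exact Or.inl ⟨a, b', fun p hp => by
        have := (L.shape hp hs (hasShape_exp c')).2
        linear_combination this⟩
    · exact (ne_exp hs (hasShape_log c'.1 c'.2)).elim
    · exact (ne_exp hs (hasShape_pow c'.1 c'.2.2.1 c'.2.2.2)).elim
    · exact (ne_exp hs (hasShape_id b')).elim
  · have hs := hasShape_log c.1 c.2
    rcases h'.cases_f₁ with ⟨rfl, hg⟩ | ⟨a', b', c'⟩ | ⟨a', b', c'⟩ | ⟨a', b', m', c'⟩ | ⟨a', b'⟩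
    · omega
    · omega
    · exact Or.inr (Or.inl ⟨a, b', key zero_ne_one hs (hasShape_log c'.1 c'.2)⟩)
    · exact (c'.1 (eqm hs (hasShape_pow c'.1 c'.2.2.1 c'.2.2.2)).symm).elim
    · exact (zero_ne_one (eqm hs (hasShape_id b'))).elim
  · have hs := hasShape_pow c.1 c.2.2.1 c.2.2.2
    rcases h'.cases_f₁ with ⟨rfl, hg⟩ | ⟨a', b', c'⟩ | ⟨a', b', c'⟩ | ⟨a', b', m', c'⟩ | ⟨a', b'⟩
    · omega
    · omega
    · omega
    · exact Or.inr (Or.inr (Or.inl ⟨a, b', key c.2.1 hs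
        (hasShape_pow c'.1 c'.2.2.1 c'.2.2.2)⟩))
    · exact (c.2.1 (eqm hs (hasShape_id b'))).elim
  · exact Or.inr (Or.inr (Or.inr a))

end AffineLink

namespace AffineLink

variable {E E' : Equation} {B : Set Base} {k : ℝ} {Y α β : Base → ℝ} {p : Base}

theorem fderiv_eq (L : AffineLink E E' B k Y α β) (hB : IsOpen B) (hp : p ∈ B) {u : ℝ}
    (hu : u ∈ E.dom) (a : Base) :
    k * (deriv E'.f₁ (α p * u + β p) * (fderiv ℝ α p a * u + fderiv ℝ β p a))
      = fderiv ℝ (Dy Y) p a * E.f₁ u + fderiv ℝ (Dt Y) p a :=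
  fderiv_link hB contDiffOn_const L.smooth_Y L.smooth_α L.smooth_β L.maps L.eqA hp hu a (by simp)

/-! ### Comparison of f₂ for f₁ = e^u -/

section Exp

theorem eqB_exp (L : AffineLink E E' B k Y α β) (hB : IsOpen B) (hα : ∀ p ∈ B, α p = 1)
    (h₁ : EqOn E.f₁ Real.exp E.dom) (hp : p ∈ B) {u : ℝ} (hu : u ∈ E.dom) :
    k * E'.f₂ (α p * u + β p) = E.f₂ u + Dt β p + Dy β p * Real.exp u := by
  rw [L.eqB p hp u hu, h₁ hu, Dt_eq_zero_of_eqOn hB hα hp, Dy_eq_zero_of_eqOn hB hα hp, hα p hp]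
  ring

/-- A transformation can only add multiples of 1 and e^u to f₂, and e^{mu} with m ≠ 0, 1 is
independent of these. -/
theorem exp_exp_ne (L : AffineLink E E' B k Y α β) (hB : IsOpen B) (hα : ∀ p ∈ B, α p = 1)
    (hp : p ∈ B) (h₁ : EqOn E.f₁ Real.exp E.dom) {m ε c : ℝ} (hm₀ : m ≠ 0) (hm₁ : m ≠ 1)
    (hε : ε ≠ 0) (h₂ : EqOn E.f₂ (fun u => ε * Real.exp (m * u)) E.dom)
    (h₂' : EqOn E'.f₂ (fun _ => c) E'.dom) : False := by
  refine hε (exp_coeff E.isOpen_dom E.nonempty_dom (A₂ := Dt β p - k * c) (A₃ := Dy β p) hm₀ hm₁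
    zero_ne_one fun u hu => ?_).1
  have e := L.eqB_exp hB hα h₁ hp hu
  rw [h₂ hu, h₂' (L.maps p hp u hu)] at e
  simp only [zero_mul, Real.exp_zero, one_mul]
  linear_combination -e

/-- A constant source could be removed only by β_t. However, `eqA` gives Y_t = 0, and
differentiating it in t then gives β_t = 0. -/
theorem exp_const_ne (L : AffineLink E E' B k Y α β) (hB : IsOpen B) (hα : ∀ p ∈ B, α p = 1)
    (hp : p ∈ B) (h₁ : EqOn E.f₁ Real.exp E.dom) (h₁' : EqOn E'.f₁ Real.exp E'.dom) {ε : ℝ}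
    (hε : ε ≠ 0) (h₂ : EqOn E.f₂ (fun _ => ε) E.dom)
    (h₂' : EqOn E'.f₂ (fun _ => 0) E'.dom) : False := by
  have hY : ∀ q ∈ B, Dt Y q = 0 := fun q hq => (E.coeff_eq_zero (B := Dy Y q - k * Real.exp (β q))
    fun u hu => by
      have e := L.eqA q hq u hu
      rw [h₁' (L.maps q hq u hu), hα q hq, one_mul, Real.exp_add, h₁ hu] at e
      rw [h₁ hu]
      linear_combination -e).1
  have hβ : Dt β p = 0 := by
    obtain ⟨u, hu⟩ := E.nonempty_dom
    have e := L.fderiv_eq hB hp hu et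
    rw [show fderiv ℝ (Dt Y) p et = 0 from Dt_eq_zero_of_eqOn hB hY hp,
      show fderiv ℝ (Dy Y) p et = 0 from
        (Dt_Dy_comm hB L.smooth_Y hp).trans (Dy_eq_zero_of_eqOn hB hY hp),
      show fderiv ℝ α p et = 0 from Dt_eq_zero_of_eqOn hB hα hp,
      E'.deriv_f₁_eq h₁' (L.maps p hp u hu), Real.deriv_exp] at e
    have e' : (k * Real.exp (α p * u + β p)) * fderiv ℝ β p et = 0 := by linear_combination e
    exact (mul_eq_zero.1 e').resolve_left (mul_ne_zero L.pos.ne' (Real.exp_pos _).ne')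
  refine hε (E.coeff_eq_zero (A := ε) (B := Dy β p) fun u hu => ?_).1
  have e := L.eqB_exp hB hα h₁ hp hu
  rw [h₂ hu, h₂' (L.maps p hp u hu), hβ] at e
  rw [h₁ hu]
  linear_combination -e

end Exp

/-! ### Comparison of f₂ for f₁ = ln u and f₁ = u^m -/

section Homogeneous

theorem eqB_homogeneous (L : AffineLink E E' B k Y α β) (hB : IsOpen B) (hβ : ∀ p ∈ B, β p = 0)
    (hp : p ∈ B) {u : ℝ} (hu : u ∈ E.dom) :
    k * E'.f₂ (α p * u) = α p * E.f₂ u + (Dt α p + Dy α p * E.f₁ u) * u := by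
  have e := L.eqB p hp u hu
  rw [Dt_eq_zero_of_eqOn hB hβ hp, Dy_eq_zero_of_eqOn hB hβ hp, hβ p hp, add_zero] at e
  linear_combination e

theorem maps_homogeneous (L : AffineLink E E' B k Y α β) (hβ : ∀ p ∈ B, β p = 0)
    (hp : p ∈ B) {u : ℝ} (hu : u ∈ E.dom) : α p * u ∈ E'.dom := by
  simpa [hβ p hp] using L.maps p hp u hu

/-- After division by u the power u^(m - 1) would be a combination of 1 and ln u. The value c = 0
covers the target with f₂ = 0. -/
theorem log_pow_ne (L : AffineLink E E' B k Y α β) (hB : IsOpen B) (hβ : ∀ p ∈ B, β p = 0)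
    (hp : p ∈ B) (hd : E.dom ⊆ Ioi 0) (h₁ : EqOn E.f₁ Real.log E.dom)
    {m ε c : ℝ} (hm₁ : m ≠ 1) (hε : ε ≠ 0) (h₂ : EqOn E.f₂ (fun u => ε * u ^ m) E.dom)
    (h₂' : EqOn E'.f₂ (fun u => c * (u * Real.log u)) E'.dom) : False := by
  refine mul_ne_zero (L.α_ne p hp) hε (log_coeff E.isOpen_dom E.nonempty_dom hd
    (A := Dy α p - k * c * α p) (B := Dt α p - k * c * α p * Real.log (α p)) (sub_ne_zero.2 hm₁)
    fun u hu => ?_).2.2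
  have hu0 : u ≠ 0 := ne_of_gt (hd hu)
  have e := L.eqB_homogeneous hB hβ hp hu
  rw [h₂ hu, h₂' (L.maps_homogeneous hβ hp hu), h₁ hu] at e
  simp only [Real.log_mul (L.α_ne p hp) hu0] at e
  rw [Real.rpow_sub_one hu0]
  field_simp
  linear_combination -e

/-- The term εα u ln u could be cancelled only by α_y. However, `eqA` gives Y_y = k, so the
y-derivative of `eqA` gives α_y = 0. -/
theorem log_mul_log_ne (L : AffineLink E E' B k Y α β) (hB : IsOpen B) (hβ : ∀ p ∈ B, β p = 0)
    (hp : p ∈ B) (hd : E.dom ⊆ Ioi 0) (h₁ : EqOn E.f₁ Real.log E.dom)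
    (h₁' : EqOn E'.f₁ Real.log E'.dom) {ε : ℝ} (hε : ε ≠ 0)
    (h₂ : EqOn E.f₂ (fun u => ε * (u * Real.log u)) E.dom)
    (h₂' : EqOn E'.f₂ (fun _ => 0) E'.dom) : False := by
  have hY : ∀ q ∈ B, Dy Y q = k := fun q hq => (sub_eq_zero.1 (E.coeff_eq_zero
    (A := Dt Y q - k * Real.log (α q)) (B := Dy Y q - k) fun u hu => by
      have hu0 : u ≠ 0 := ne_of_gt (hd hu)
      have e := L.eqA q hq u hu
      rw [h₁' (L.maps q hq u hu), hβ q hq, add_zero, Real.log_mul (L.α_ne q hq) hu0, h₁ hu] at e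
      rw [h₁ hu]
      linear_combination -e).2)
  obtain ⟨u, hu⟩ := E.nonempty_dom
  have hα : Dy α p = 0 := by
    have hu0 : u ≠ 0 := ne_of_gt (hd hu)
    have e := L.fderiv_eq hB hp hu ey
    rw [show fderiv ℝ (Dt Y) p ey = 0 from
        (Dt_Dy_comm hB L.smooth_Y hp).symm.trans (Dt_eq_zero_of_eqOn hB hY hp),
      show fderiv ℝ (Dy Y) p ey = 0 from Dy_eq_zero_of_eqOn hB hY hp,
      show fderiv ℝ β p ey = 0 from Dy_eq_zero_of_eqOn hB hβ hp,
      E'.deriv_f₁_eq h₁' (L.maps p hp u hu), Real.deriv_log, hβ p hp] at e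
    have hα := L.α_ne p hp
    have hk := L.pos.ne'
    have e' : fderiv ℝ α p ey = 0 := by simpa [hα, hk, hu0] using e
    exact e'
  refine mul_ne_zero (L.α_ne p hp) hε (E.coeff_eq_zero (A := Dt α p) fun u hu => ?_).2
  have hu0 : u ≠ 0 := ne_of_gt (hd hu)
  have e := L.eqB_homogeneous hB hβ hp hu
  rw [h₂ hu, h₂' (L.maps_homogeneous hβ hp hu), hα] at e
  rw [h₁ hu]
  apply mul_right_cancel₀ hu0
  linear_combination -e

/-- The exponents of f₁ agree, and `eqA` forces Y_t = 0, hence α_t = 0. Then only α_y u^(m + 1)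
could cancel εα u^n, which n ≠ m + 1 excludes. -/
theorem pow_pow_ne (L : AffineLink E E' B k Y α β) (hB : IsOpen B) (hβ : ∀ p ∈ B, β p = 0)
    (hp : p ∈ B) {m n ε m' : ℝ} (hm₀ : m ≠ 0) (hn : n ≠ m + 1) (hε : ε ≠ 0)
    (hdm : PowerDomain E.dom m) (hdn : PowerDomain E.dom n) (hm₀' : m' ≠ 0)
    (hdm' : PowerDomain E'.dom m') (h₁ : EqOn E.f₁ (fun u => u ^ m) E.dom)
    (h₂ : EqOn E.f₂ (fun u => ε * u ^ n) E.dom) (h₁' : EqOn E'.f₁ (fun u => u ^ m') E'.dom)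
    (h₂' : EqOn E'.f₂ (fun _ => 0) E'.dom) : False := by
  have hmm : m' = m := by
    have := (L.shape hp (hasShape_pow hm₀ hdm h₁) (hasShape_pow hm₀' hdm' h₁')).1
    apply mul_left_cancel₀ (L.α_ne p hp)
    linear_combination this
  subst hmm
  have hY : ∀ q ∈ B, Dt Y q = 0 := by
    intro q hq
    obtain ⟨u, hu⟩ := E.nonempty_dom
    have e := L.eqA q hq u hu
    have e1 := L.deriv_f₁ hq hu
    have e2 := hdm.mul_deriv hu
    have e3 := hdm'.mul_deriv (L.maps q hq u hu)
    rw [E.deriv_f₁_eq h₁ hu, E'.deriv_f₁_eq h₁' (L.maps q hq u hu)] at e1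
    rw [h₁ hu, h₁' (L.maps q hq u hu)] at e
    simp only [hβ q hq, add_zero] at e e1 e3
    apply mul_left_cancel₀ hm₀
    -- Euler's operator u d/du - m kills u^m on both sides of `eqA` and leaves m Y_t = 0.
    linear_combination (-m') * e + u * e1 + Dy Y q * e2 - k * e3
  have hα : Dt α p = 0 := by
    obtain ⟨u, hu, hu0⟩ := exists_mem_affine_ne_zero E.isOpen_dom E.nonempty_dom (a := 1) (b := 0)
      one_ne_zero
    rw [one_mul, add_zero] at hu0
    have e := L.fderiv_eq hB hp hu et
    rw [show fderiv ℝ (Dt Y) p et = 0 from Dt_eq_zero_of_eqOn hB hY hp,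
      show fderiv ℝ (Dy Y) p et = 0 from
        (Dt_Dy_comm hB L.smooth_Y hp).trans (Dy_eq_zero_of_eqOn hB hY hp),
      show fderiv ℝ β p et = 0 from Dt_eq_zero_of_eqOn hB hβ hp] at e
    have hne := (hasShape_pow hm₀ hdm' h₁').2 _ (L.maps p hp u hu)
      (by rw [hβ p hp, add_zero]; exact mul_ne_zero (L.α_ne p hp) hu0)
    have hk := L.pos.ne'
    have e' : fderiv ℝ α p et = 0 := by simpa [hne, hk, hu0] using e
    exact e'
  refine mul_ne_zero (L.α_ne p hp) hε (rpow_coeff_two E.isOpen_dom E.nonempty_dom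
    (A₂ := Dy α p) hdn hdm.add_one hn fun u hu _ => ?_).1
  have e := L.eqB_homogeneous hB hβ hp hu
  rw [h₂ hu, h₂' (L.maps_homogeneous hβ hp hu), hα, h₁ hu] at e
  rw [hdm.rpow_add_one hu]
  linear_combination -e

end Homogeneous

/-! ### Comparison of f₂ for f₁ = u -/

section Id

theorem id_relations (L : AffineLink E E' B k Y α β) (h₁ : EqOn E.f₁ (fun u => u) E.dom)
    (h₁' : EqOn E'.f₁ (fun u => u) E'.dom) (hp : p ∈ B) : Dy Y p = k * α p ∧ Dt Y p = k * β p := by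
  obtain ⟨e1, e2⟩ := E.coeff_eq_zero (A := Dt Y p - k * β p) (B := Dy Y p - k * α p) fun u hu => by
    have e := L.eqA p hp u hu
    rw [h₁' (L.maps p hp u hu), h₁ hu] at e
    rw [h₁ hu]
    linear_combination -e
  exact ⟨sub_eq_zero.1 e2, sub_eq_zero.1 e1⟩

theorem Dy_β_eq (L : AffineLink E E' B k Y α β) (hB : IsOpen B) (h₁ : EqOn E.f₁ (fun u => u) E.dom)
    (h₁' : EqOn E'.f₁ (fun u => u) E'.dom) (hp : p ∈ B) : Dy β p = Dt α p := by
  apply mul_left_cancel₀ L.pos.ne'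
  have e1 : Dt (Dy Y) p = k * Dt α p :=
    fderiv_eq_mul_of_eqOn hB L.smooth_α (fun q hq => (L.id_relations h₁ h₁' hq).1) hp et
  have e2 : Dy (Dt Y) p = k * Dy β p :=
    fderiv_eq_mul_of_eqOn hB L.smooth_β (fun q hq => (L.id_relations h₁ h₁' hq).2) hp ey
  rw [← e1, ← e2, Dt_Dy_comm hB L.smooth_Y hp]

theorem eqB_id (L : AffineLink E E' B k Y α β) (hB : IsOpen B) (h₁ : EqOn E.f₁ (fun u => u) E.dom)
    (h₁' : EqOn E'.f₁ (fun u => u) E'.dom) (hp : p ∈ B) {u : ℝ} (hu : u ∈ E.dom) :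
    k * E'.f₂ (α p * u + β p) = α p * E.f₂ u + (Dt β p + 2 * Dt α p * u + Dy α p * u ^ 2) := by
  have e := L.eqB p hp u hu
  rw [L.Dy_β_eq hB h₁ h₁' hp, h₁ hu] at e
  linear_combination e

/-- The operator (αu + β) d/du - mα annihilates the transformed power, keeps quadratic polynomials
quadratic, and produces from εα e^u the term α² ε u e^u, which nothing can cancel. -/
theorem id_exp_pow_ne (L : AffineLink E E' B k Y α β) (hB : IsOpen B) (hp : p ∈ B)
    (h₁ : EqOn E.f₁ (fun u => u) E.dom) (h₁' : EqOn E'.f₁ (fun u => u) E'.dom) {ε m ε' : ℝ}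
    (hε : ε ≠ 0) (h₂ : EqOn E.f₂ (fun u => ε * Real.exp u) E.dom)
    (hdm : PowerDomain E'.dom m) (h₂' : EqOn E'.f₂ (fun u => ε' * u ^ m) E'.dom) : False := by
  have key : ∀ u ∈ E.dom, (2 * Dt α p * β p - m * α p * Dt β p)
      + (2 * Dt α p * α p + 2 * Dy α p * β p - m * α p * (2 * Dt α p)) * u
      + (2 * Dy α p * α p - m * α p * Dy α p) * u ^ 2
      + (α p ^ 2 * ε * u + (β p * α p * ε - m * α p ^ 2 * ε)) * Real.exp u = 0 := by
    intro u hu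
    obtain ⟨d, hd, e⟩ := hdm.hasDerivAt (L.maps p hp u hu)
    have hl := (hd.comp u (((hasDerivAt_id u).const_mul (α p)).add_const (β p))).const_mul (k * ε')
    have hr := ((Real.hasDerivAt_exp u).const_mul (α p * ε)).add
      ((((hasDerivAt_id u).const_mul (2 * Dt α p)).const_add (Dt β p)).add
        (((hasDerivAt_id u).pow 2).const_mul (Dy α p)))
    have rel : ∀ s ∈ E.dom, k * ε' * (α p * s + β p) ^ m - (α p * ε * Real.exp s
        + (Dt β p + 2 * Dt α p * s + Dy α p * s ^ 2)) = 0 := by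
      intro s hs
      have e := L.eqB_id hB h₁ h₁' hp hs
      rw [h₂ hs, h₂' (L.maps p hp s hs)] at e
      linear_combination e
    have e1 := hasDerivAt_eq_zero_of_eqOn E.isOpen_dom rel hu (hl.sub hr)
    have e0 := rel u hu
    simp only [id] at e1
    norm_num at e1
    linear_combination (m * α p) * e0 - (α p * u + β p) * e1 + k * ε' * α p * e
  exact mul_ne_zero (pow_ne_zero 2 (L.α_ne p hp)) hε
    (quadratic_add_linear_exp_coeff E.isOpen_dom E.nonempty_dom key).2.2.2.1

/-- A quadratic target forces a quadratic source, because the substitution is affine in u and the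
added terms are quadratic. This excludes exponentials and the remaining powers on the source side.
-/
theorem id_quadratic_eq (L : AffineLink E E' B k Y α β) (hB : IsOpen B) (hp : p ∈ B)
    (h₁ : EqOn E.f₁ (fun u => u) E.dom) (h₁' : EqOn E'.f₁ (fun u => u) E'.dom) {q₂ q₁ q₀ : ℝ}
    (h₂' : EqOn E'.f₂ (fun u => q₂ * u ^ 2 + q₁ * u + q₀) E'.dom) :
    ∃ c₀ c₁ c₂ : ℝ, ∀ u ∈ E.dom, c₀ + c₁ * u + c₂ * u ^ 2 + α p * E.f₂ u = 0 := by
  refine ⟨Dt β p - k * (q₂ * β p ^ 2 + q₁ * β p + q₀),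
    2 * Dt α p - k * (2 * q₂ * α p * β p + q₁ * α p), Dy α p - k * q₂ * α p ^ 2, fun u hu => ?_⟩
  have e := L.eqB_id hB h₁ h₁' hp hu
  rw [h₂' (L.maps p hp u hu)] at e
  linear_combination -e

theorem id_exp_quadratic_ne (L : AffineLink E E' B k Y α β) (hB : IsOpen B) (hp : p ∈ B)
    (h₁ : EqOn E.f₁ (fun u => u) E.dom) (h₁' : EqOn E'.f₁ (fun u => u) E'.dom) {ε q₂ q₁ q₀ : ℝ}
    (hε : ε ≠ 0) (h₂ : EqOn E.f₂ (fun u => ε * Real.exp u) E.dom)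
    (h₂' : EqOn E'.f₂ (fun u => q₂ * u ^ 2 + q₁ * u + q₀) E'.dom) : False := by
  obtain ⟨c₀, c₁, c₂, h⟩ := L.id_quadratic_eq hB hp h₁ h₁' h₂'
  refine mul_ne_zero (L.α_ne p hp) hε (quadratic_add_linear_exp_coeff E.isOpen_dom E.nonempty_dom
    (A₀ := c₀) (A₁ := c₁) (A₂ := c₂) (A := 0) fun u hu => ?_).2.2.2.2
  have e := h u hu
  rw [h₂ hu] at e
  linear_combination e

theorem id_pow_quadratic_ne (L : AffineLink E E' B k Y α β) (hB : IsOpen B) (hp : p ∈ B)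
    (h₁ : EqOn E.f₁ (fun u => u) E.dom) (h₁' : EqOn E'.f₁ (fun u => u) E'.dom) {m ε q₂ q₁ q₀ : ℝ}
    (hm₀ : m ≠ 0) (hm₁ : m ≠ 1) (hm₂ : m ≠ 2) (hdm : PowerDomain E.dom m)
    (hε : ε ≠ 0) (h₂ : EqOn E.f₂ (fun u => ε * u ^ m) E.dom)
    (h₂' : EqOn E'.f₂ (fun u => q₂ * u ^ 2 + q₁ * u + q₀) E'.dom) : False := by
  obtain ⟨c₀, c₁, c₂, h⟩ := L.id_quadratic_eq hB hp h₁ h₁' h₂'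
  have key : ∀ u ∈ E.dom, u ≠ 0 →
      c₁ * u ^ (1 : ℝ) + 2 * c₂ * u ^ (2 : ℝ) + α p * ε * m * u ^ m = 0 := by
    intro u hu _
    obtain ⟨d, hd, e⟩ := hdm.hasDerivAt hu
    have e1 := hasDerivAt_eq_zero_of_eqOn E.isOpen_dom
      (F := fun u => c₀ + c₁ * u + c₂ * u ^ 2 + α p * ε * u ^ m)
      (fun s hs => by have := h s hs; rw [h₂ hs] at this; linear_combination this) hu
      (((((hasDerivAt_id u).const_mul c₁).const_add c₀).add
        (((hasDerivAt_id u).pow 2).const_mul c₂)).add (hd.const_mul (α p * ε)))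
    simp only [id] at e1
    norm_num at e1
    rw [Real.rpow_one, Real.rpow_two]
    linear_combination u * e1 - α p * ε * e
  exact mul_ne_zero (mul_ne_zero (L.α_ne p hp) hε) hm₀ (rpow_coeff_three E.isOpen_dom
    E.nonempty_dom PowerDomain.one PowerDomain.two hdm (by norm_num) hm₁.symm hm₂.symm key).2.2

theorem id_quadratic_linear (L : AffineLink E E' B k Y α β) (hB : IsOpen B)
    (h₁ : EqOn E.f₁ (fun u => u) E.dom) (h₁' : EqOn E'.f₁ (fun u => u) E'.dom) {q₂ q₁ q₀ c : ℝ}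
    (h₂ : EqOn E.f₂ (fun u => q₂ * u ^ 2 + q₁ * u + q₀) E.dom)
    (h₂' : EqOn E'.f₂ (fun u => c * u) E'.dom) (hp : p ∈ B) :
    Dt β p = k * c * β p - q₀ * α p ∧ Dt α p = (k * c - q₁) / 2 * α p ∧ Dy α p = -q₂ * α p := by
  obtain ⟨e0, e1, e2⟩ := quadratic_coeff E.isOpen_dom E.nonempty_dom
    (A₀ := Dt β p - k * c * β p + q₀ * α p) (A₁ := 2 * Dt α p - k * c * α p + q₁ * α p)
    (A₂ := Dy α p + q₂ * α p) fun u hu => by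
      have e := L.eqB_id hB h₁ h₁' hp hu
      rw [h₂ hu, h₂' (L.maps p hp u hu)] at e
      linear_combination -e
  exact ⟨by linarith, by linarith, by linarith⟩

/-- The compatibility condition of the system in `id_quadratic_linear`. -/
theorem id_quadratic_linear_discr (L : AffineLink E E' B k Y α β) (hB : IsOpen B) (hp : p ∈ B)
    (h₁ : EqOn E.f₁ (fun u => u) E.dom) (h₁' : EqOn E'.f₁ (fun u => u) E'.dom) {q₂ q₁ q₀ c : ℝ}
    (h₂ : EqOn E.f₂ (fun u => q₂ * u ^ 2 + q₁ * u + q₀) E.dom)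
    (h₂' : EqOn E'.f₂ (fun u => c * u) E'.dom) : (k * c) ^ 2 = q₁ ^ 2 - 4 * q₂ * q₀ := by
  have hq := fun q hq => L.id_quadratic_linear hB h₁ h₁' h₂ h₂' (p := q) hq
  -- The derivative β_ty is computed from β_y = α_t and from the formula for β_t; their equality,
  -- divided by α ≠ 0, is the claim.
  have hβ : Dt (Dy β) p = (k * c - q₁) / 2 * Dt α p :=
    fderiv_eq_mul_of_eqOn hB L.smooth_α
      (fun q hq' => (L.Dy_β_eq hB h₁ h₁' hq').trans (hq q hq').2.1) hp et
  have hβ' : Dy (Dt β) p = k * c * Dy β p - q₀ * Dy α p := by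
    have dif : ∀ {f : Base → ℝ}, ContDiffOn ℝ ∞ f B → HasFDerivAt f (fderiv ℝ f p) p := fun hf =>
      (hf.contDiffAt (hB.mem_nhds hp)).diff.hasFDerivAt
    have e := (((dif L.smooth_β).const_mul (k * c)).sub ((dif L.smooth_α).const_mul q₀)).fderiv
    have e' := (fderiv_congr_of_mem hB (fun q hq' => (hq q hq').1) hp).trans e
    exact DFunLike.congr_fun e' ey
  rw [Dt_Dy_comm hB L.smooth_β hp, hβ', L.Dy_β_eq hB h₁ h₁' hp, (hq p hp).2.1, (hq p hp).2.2] at hβ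
  apply mul_right_cancel₀ (L.α_ne p hp)
  linear_combination 4 * hβ

end Id

/-- Equations of two different canonical forms are not related. -/
theorem not_canonical (L : AffineLink E E' B k Y α β) (hB : IsOpen B) (hBne : B.Nonempty)
    {i j : ℕ} {S S' : Set (Total → Total)} (h : Canonical i E S) (h' : Canonical j E' S')
    (hij : i < j) : False := by
  obtain ⟨p, hp⟩ := id hBne
  rcases L.same_kind hBne h h' hij with ⟨a, b, hα⟩ | ⟨a, b, hβ⟩ | ⟨a, b, hβ⟩ | a
  · cases h <;> (try omega) <;> cases h' <;> try omega
    case row2.row3 m ε hm₀ hm₁ hε h₁ h₂ ε' hε' h₁' h₂' =>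
      exact L.exp_exp_ne hB hα hp h₁ hm₀ hm₁ hε.ne_zero h₂ h₂'
    case row2.row4 m ε hm₀ hm₁ hε h₁ h₂ h₁' h₂' =>
      exact L.exp_exp_ne hB hα hp h₁ hm₀ hm₁ hε.ne_zero h₂ h₂'
    case row3.row4 ε hε h₁ h₂ h₁' h₂' =>
      exact L.exp_const_ne hB hα hp h₁ h₁' hε.ne_zero h₂ h₂'
  · cases h <;> (try omega) <;> cases h' <;> try omega
    case row5.row6 m ε hm₁ hε hd h₁ h₂ ε' hε' hd' h₁' h₂' =>
      exact L.log_pow_ne hB hβ hp hd h₁ hm₁ hε.ne_zero h₂ h₂'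
    case row5.row7 m ε hm₁ hε hd h₁ h₂ hd' h₁' h₂' =>
      exact L.log_pow_ne hB hβ hp hd h₁ hm₁ hε.ne_zero h₂
        (h₂'.trans fun u _ => (zero_mul (u * Real.log u)).symm)
    case row6.row7 ε hε hd h₁ h₂ hd' h₁' h₂' =>
      exact L.log_mul_log_ne hB hβ hp hd h₁ h₁' hε.ne_zero h₂ h₂'
  · cases h <;> (try omega) <;> cases h' <;> try omega
    case row8.row9 m n ε hm₀ hm₁ hn hε hdm hdn h₁ h₂ m' hm₀' hm₁' hdm' h₁' h₂' =>
      exact L.pow_pow_ne hB hβ hp hm₀ hn hε.ne_zero hdm hdn hm₀' hdm' h₁ h₂ h₁' h₂'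
  · have sq : ∀ {f : ℝ → ℝ}, EqOn f (fun u => u ^ 2 + 1) E'.dom →
        EqOn f (fun u => 1 * u ^ 2 + 0 * u + 1) E'.dom := fun h => h.trans fun u _ => by ring
    have lin : ∀ {f : ℝ → ℝ} {c : ℝ}, EqOn f (fun u => c * u) E'.dom →
        EqOn f (fun u => 0 * u ^ 2 + c * u + 0) E'.dom := fun h => h.trans fun u _ => by ring
    have zer : ∀ {f : ℝ → ℝ}, EqOn f (fun _ => 0) E'.dom →
        EqOn f (fun u => 0 * u) E'.dom := fun h => h.trans fun u _ => by ring
    cases h <;> (try omega) <;> cases h' <;> try omega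
    case row10.row11 ε hε h₁ h₂ m' ε' hm₀' hm₁' hm₂' hε' hdm' h₁' h₂' =>
      exact L.id_exp_pow_ne hB hp h₁ h₁' hε.ne_zero h₂ hdm' h₂'
    case row10.row12 ε hε h₁ h₂ h₁' h₂' =>
      exact L.id_exp_quadratic_ne hB hp h₁ h₁' hε.ne_zero h₂ (sq h₂')
    case row10.row13 ε hε h₁ h₂ ε' hε' h₁' h₂' =>
      exact L.id_exp_quadratic_ne hB hp h₁ h₁' hε.ne_zero h₂ (lin h₂')
    case row10.row14 ε hε h₁ h₂ h₁' h₂' =>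
      exact L.id_exp_quadratic_ne hB hp h₁ h₁' hε.ne_zero h₂ (lin (zer h₂'))
    case row11.row12 m ε hm₀ hm₁ hm₂ hε hdm h₁ h₂ h₁' h₂' =>
      exact L.id_pow_quadratic_ne hB hp h₁ h₁' hm₀ hm₁ hm₂ hdm hε.ne_zero h₂ (sq h₂')
    case row11.row13 m ε hm₀ hm₁ hm₂ hε hdm h₁ h₂ ε' hε' h₁' h₂' =>
      exact L.id_pow_quadratic_ne hB hp h₁ h₁' hm₀ hm₁ hm₂ hdm hε.ne_zero h₂ (lin h₂')
    case row11.row14 m ε hm₀ hm₁ hm₂ hε hdm h₁ h₂ h₁' h₂' =>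
      exact L.id_pow_quadratic_ne hB hp h₁ h₁' hm₀ hm₁ hm₂ hdm hε.ne_zero h₂ (lin (zer h₂'))
    case row12.row13 h₁ h₂ ε' hε' h₁' h₂' =>
      have := L.id_quadratic_linear_discr hB hp h₁ h₁' (q₂ := 1) (q₁ := 0) (q₀ := 1)
        (h₂.trans fun u _ => by ring) h₂'
      -- The discriminant of u² + 1 is -4, whereas the left side is a square.
      nlinarith [sq_nonneg (k * ε')]
    case row12.row14 h₁ h₂ h₁' h₂' =>
      have := L.id_quadratic_linear_discr hB hp h₁ h₁' (q₂ := 1) (q₁ := 0) (q₀ := 1)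
        (h₂.trans fun u _ => by ring) (zer h₂')
      norm_num at this
    case row13.row14 ε hε h₁ h₂ h₁' h₂' =>
      have := L.id_quadratic_linear_discr hB hp h₁ h₁' (q₂ := 0) (q₁ := ε) (q₀ := 0)
        (h₂.trans fun u _ => by ring) (zer h₂')
      exact pow_ne_zero 2 hε.ne_zero (by linear_combination -this)

end AffineLink

theorem Transforms.mono {Φ : Total → Total} {B B' : Set Base} {E E' : Equation}
    (h : Transforms Φ B E E') (hB : B' ⊆ B) : Transforms Φ B' E E' := by
  obtain ⟨h1, h2, h3, h4, h5⟩ := h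
  have hs : B' ×ˢ E.dom ⊆ B ×ˢ E.dom := prod_mono hB Subset.rfl
  exact ⟨h1.mono hs, h2.mono hs, fun q hq => h3 q (hs hq), fun q hq => h4 q (hs hq),
    fun u w p hp => h5 u w p (hB hp)⟩

/-- Equations of two different canonical forms are not equivalent. -/
theorem Canonical.not_transforms {i j : ℕ} {E E' : Equation} {S S' : Set (Total → Total)}
    (h : Canonical i E S) (h' : Canonical j E' S') (hij : i < j) {Φ : Total → Total} {B : Set Base}
    (hB : IsOpen B) (hBne : B.Nonempty) : ¬ Transforms Φ B E E' := by
  intro hΦ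
  obtain ⟨p, hp⟩ := hBne
  -- The set B need not be connected; a ball suffices, as the obstruction is local.
  obtain ⟨r, hr, hrB⟩ := Metric.isOpen_iff.1 hB p hp
  have hpos : 0 < i := by cases h <;> norm_num
  -- Since 1 ≤ i < j, the target is not of the first form, so its f₁ is special and f₁' vanishes at
  -- most at 0, as `exists_affineLink` requires.
  obtain ⟨c, d, e, hs⟩ := (h'.isSpecial (by omega)).exists_hasShape
  have hne : (Metric.ball p r).Nonempty := Metric.nonempty_ball.2 hr
  obtain ⟨k, Y, α, β, L⟩ := (hΦ.mono hrB).exists_affineLink Metric.isOpen_ball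
    (convex_ball p r).isPreconnected hne hs.2
  exact L.not_canonical Metric.isOpen_ball hne h h' hij

/-- The maximal invariance algebras of the canonical equations. -/
theorem Canonical.isSymmetry_iff {i : ℕ} {E : Equation} {S : Set (Total → Total)}
    (h : Canonical i E S) {B : Set Base} (hB : IsOpen B) (hB' : IsConnected B)
    (v : Total → Total) :
    E.IsSymmetry B v ↔ SpannedOn (kernelFields ∪ S) (B ×ˢ E.dom) v := by
  cases h with
  | row1 _ h₁ h₂ => exact algebra_generic_zero hB hB' h₁ h₂ v
  | row2 m ε _ hm₀ hm₁ hε h₁ h₂ => exact algebra_exp_exp hB hB' hm₀ hm₁ hε h₁ h₂ v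
  | row3 ε _ hε h₁ h₂ => exact algebra_exp_const hB hB' hε h₁ h₂ v
  | row4 _ h₁ h₂ => exact algebra_exp_zero hB hB' h₁ h₂ v
  | row5 m ε _ hm₁ hε hd h₁ h₂ => exact algebra_log_pow hB hB' hm₁ hε hd h₁ h₂ v
  | row6 ε _ hε hd h₁ h₂ => exact algebra_log_mul_log hB hB' hε hd h₁ h₂ v
  | row7 _ hd h₁ h₂ => exact algebra_log_zero hB hB' hd h₁ h₂ v
  | row8 m n ε _ hm₀ hm₁ hn hε hdm hdn h₁ h₂ =>
    exact algebra_pow_pow hB hB' hm₀ hm₁ hn hε hdm hdn h₁ h₂ v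
  | row9 m _ hm₀ hm₁ hdm h₁ h₂ => exact algebra_pow_zero hB hB' hm₀ hm₁ hdm h₁ h₂ v
  | row10 ε _ hε h₁ h₂ => exact algebra_id_exp hB hB' hε h₁ h₂ v
  | row11 m ε _ hm₀ hm₁ hm₂ hε hdm h₁ h₂ => exact algebra_id_pow hB hB' hm₀ hm₁ hm₂ hε hdm h₁ h₂ v
  | row12 _ h₁ h₂ => exact algebra_id_sq_add_one hB hB' h₁ h₂ v
  | row13 ε _ hε h₁ h₂ => exact algebra_id_id hB hB' hε h₁ h₂ v
  | row14 _ h₁ h₂ => exact algebra_id_zero hB hB' h₁ h₂ v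

end Kolmogorov

theorem theorem6 :
    -- every equation with an extended algebra reduces to a canonical one
    (∀ (E : Kolmogorov.Equation) (B : Set Kolmogorov.Base), IsOpen B → IsConnected B →
      E.HasExtension B →
      ∃ (g : Kolmogorov.EquivTransf) (E₁ : Kolmogorov.Equation),
        g.Takes E E₁ ∧ Kolmogorov.Transforms g.map Set.univ E E₁ ∧
        ((∃ i S, Kolmogorov.Canonical i E₁ S) ∨
          ∃ (Ψ : Kolmogorov.Total → Kolmogorov.Total) (E₂ : Kolmogorov.Equation),
            Kolmogorov.Additional Ψ E₁ E₂ ∧ Kolmogorov.Transforms Ψ Set.univ E₁ E₂ ∧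
            ∃ i S, Kolmogorov.Canonical i E₂ S)) ∧
    -- the maximal invariance algebras of the canonical equations
    (∀ i E S, Kolmogorov.Canonical i E S →
      ∀ B : Set Kolmogorov.Base, IsOpen B → IsConnected B →
      ∀ v : Kolmogorov.Total → Kolmogorov.Total, E.IsSymmetry B v ↔
        Kolmogorov.SpannedOn (Kolmogorov.kernelFields ∪ S) (B ×ˢ E.dom) v) ∧
    -- equations of different canonical forms are not equivalent, not even locally
    (∀ i j E E' S S', Kolmogorov.Canonical i E S → Kolmogorov.Canonical j E' S' → i < j →
      ∀ (Φ : Kolmogorov.Total → Kolmogorov.Total) (B : Set Kolmogorov.Base),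
        IsOpen B → B.Nonempty → ¬ Kolmogorov.Transforms Φ B E E') := by
  refine ⟨fun E B hB hB' h => ?_, fun i E S h B hB hB' v => h.isSymmetry_iff hB hB' v,
    fun i j E E' S S' h h' hij Φ B hB hBne => h.not_transforms h' hij hB hBne⟩
  obtain ⟨g, E₁, hg, h⟩ := (h.extended hB hB').reducible
  exact ⟨g, E₁, hg, hg.transforms, h⟩
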